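/- Let $d\ge 1$ and let $H=-\Delta+|x|^2$ be the harmonic oscillator on $\mathbb R^d$, with $L^2(\mathbb R^d)$-normalized Hermite eigenfunctions $\varphi_\alpha$, $\alpha\in\mathbb N^d$, $H\varphi_\alpha=\lambda_\alpha\varphi_\alpha$, $\lambda_\alpha=2|\alpha|+d$. For a tempered distribution $w$ on $\mathbb R^d$ and a function $m$ (bounded on the spectrum), $m(H)w:=\sum_\alpha m(\lambda_\alpha)\langle w,\varphi_\alpha\rangle\varphi_\alpha$ in $\mathscr S'(\mathbb R^d)$; in particular this defines $e^{-tH}w$ for $t\ge 0$. Fix a smooth dyadic partition of unity $(\chi_j)_{j\ge -1}$ of $[0,\infty)$, with values in $[0,1]$, where $\chi_{-1}\in C_0^\infty([-\frac43,\frac43])$ equals $1$ near $0$, $\chi_j=\chi(2^{-j}\cdot)$ for $j\ge 0$ with $\chi\in C_0^\infty([\frac34,\frac83])$, and put $\delta_jw=\chi_j(\sqrt H)w$. For $\sigma\in\mathbb R$ let $$\mathcal B^\sigma=\Big\{w\in\mathscr S'(\mathbb R^d):\ \|w\|_{\mathcal B^\sigma}:=\sup_{j\ge -1}2^{j\sigma}\|\delta_jw\|_{L^\infty(\mathbb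 R^d)}<\infty\Big\}.$$ The product of two distributions is $u\cdot f:=\lim_{N\to\infty}\big(\sum_{j<N}\delta_ju\big)\big(\sum_{j<N}\delta_jf\big)$ in $\mathscr S'(\mathbb R^d)$. For $T>0$, a Banach space $E$ and a continuous $f:[0,T]\to E$ put $$\|f\|_{\overline{\mathcal C}^{\kappa}([0,T];E)}=\sup_{r\ne v}\frac{\|f(v)-f(r)\|_E}{|v-r|^\kappa},\qquad \|f\|_{\mathcal C^\kappa([0,T];E)}=\|f(0)\|_E+\|f\|_{\overline{\mathcal C}^\kappa([0,T];E)}\qquad(\kappa\ge0),$$ and let $\overline{\mathcal C}^\kappa([0,T];E)$, $\mathcal C^\kappa([0,T];E)$ be the sets of continuous paths for which these are finite. **Proposition.** Let $d\ge1$, $T>0$, $0<\lambda,\eta<1$, $\gamma>\lambda$, $\beta>\eta$. Let $f\in\overline{\mathcal C}^{1-\lambda}([0,T];\mathcal B^{-\eta})$ and $u\in\mathcal C^{\gamma}([0,T];\mathcal B^{\beta})$. For $0\le s\le t\le T$ the Riemann sums $$S^{(n)}_{s,t}=\sum_{i=0}^{2^n-1}e^{-(t-t^n_i)H}\big(u_{t^n_i}\cdot(f_{t^n_{i+1}}-f_{t^n_i})\big),\qquad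 t^n_i=s+\frac{i(t-s)}{2^n},$$ belong to $\mathcal B^\mu$ and converge in $\mathcal B^\mu$ as $n\to\infty$, for every $0\le\mu<2-\eta-2\lambda$. The limit, which does not depend on $\mu$, is denoted by $\mathcal I(u\cdot df)_{s,t}=\int_s^te^{-(t-r)H}(u_r\cdot d_rf)$. Moreover: (i) For every $0\le\mu<2-\eta-2\lambda$ there is $\varepsilon_0>0$ such that for every $0<\varepsilon<\varepsilon_0$ there is a constant $C$, independent of $f$, $u$, $s$, $t$, such that for all such $f$, $u$ and all $0\le s<t\le T$ $$\|\mathcal I(u\cdot df)_{s,t}\|_{\mathcal B^\mu}\le C\,|t-s|^{1-\frac{\mu+\eta}2-\lambda-\varepsilon}\,\|u\|_{\mathcal C^\gamma([0,T];\mathcal B^\beta)}\,\|f\|_{\overline{\mathcal C}^{1-\lambda}([0,T];\mathcal B^{-\eta})}.$$ As a consequence, $t\mapsto\int_0^te^{-(t-r)H}(u_r\cdot d_rf)$ belongs to $\mathcal C^{\kappa}([0,T];\mathcal B^\mu)$ for all $0\le\mu<2-\eta-2\lambda$ and $0\le\kappa<\big(1-\frac\eta2-\lambda\big)-\frac\mu2$.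 (ii) Let $f\in\overline{\mathcal C}^1([0,T];L^\infty(\mathbb R^d))$ be a Lipschitz path and $u\in\mathcal C^\gamma([0,T];\mathcal B^\beta)$. Then $f$ has a derivative $f'_r$ in $\mathscr S'(\mathbb R^d)$ at almost every $r\in(0,T)$, and for all $0\le s<t\le T$ the sums $S^{(n)}_{s,t}$ have a limit $\mathcal I(u\cdot df)_{s,t}$ in $\mathscr S'(\mathbb R^d)$, with $$\mathcal I(u\cdot df)_{s,t}=\int_s^te^{-(t-r)H}(u_r\cdot f'_r)\,dr ,$$ where the integral is the Lebesgue integral of $\mathscr S'(\mathbb R^d)$-valued functions: tested against any Schwartz function, the integrand is Lebesgue integrable on $(s,t)$. -/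

import Mathlib

open MeasureTheory Filter Topology SchwartzMap
open scoped ENNReal NNReal ContDiff

noncomputable section
namespace HarmonicYoung

/-- The space `ℝ^d`. -/
abbrev Space (d : ℕ) : Type := EuclideanSpace ℝ (Fin d)

theorem pow_mul_gauss_bounded (m : ℕ) :
    ∃ C : ℝ, ∀ r : ℝ, 0 ≤ r → (1 + r) ^ m * Real.exp (-(r ^ 2 / 2)) ≤ C := by
  -- (1+r)^m ≤ m! exp(1+r), and exp (1 + r - r^2/2) ≤ exp (3/2)
  refine ⟨m.factorial * Real.exp (3 / 2), fun r hr => ?_⟩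
  have h1 : (1 + r) ^ m ≤ m.factorial * Real.exp (1 + r) := by
    have := Real.pow_div_factorial_le_exp (1 + r) (by linarith) m
    rwa [div_le_iff₀' (by positivity)] at this
  calc (1 + r) ^ m * Real.exp (-(r ^ 2 / 2))
      ≤ (m.factorial * Real.exp (1 + r)) * Real.exp (-(r ^ 2 / 2)) := by gcongr
    _ = m.factorial * Real.exp (1 + r + -(r ^ 2 / 2)) := by
        rw [Real.exp_add (1 + r), mul_assoc]
    _ ≤ m.factorial * Real.exp (3 / 2) := by
        gcongr
        nlinarith [sq_nonneg (r - 1)]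

theorem gauss_hasTemperateGrowth (d : ℕ) :
    (fun x : Space d => -(‖x‖ ^ 2 / 2)).HasTemperateGrowth := by
  have h := (Function.hasTemperateGrowth_norm_sq (H := Space d)).mul
    (Function.HasTemperateGrowth.const (-(1 / 2) : ℝ))
  have e : (fun x : Space d => -(‖x‖ ^ 2 / 2)) =
      (fun x : Space d => ‖x‖ ^ 2) * fun _ => (-(1 / 2) : ℝ) := by
    funext x
    change -(‖x‖ ^ 2 / 2) = ‖x‖ ^ 2 * (-(1 / 2))
    ring
  rw [e]
  exact h

/-- The Gaussian `x ↦ exp (-|x|² / 2)` as a real Schwartz function. -/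
def gaussianReal (d : ℕ) : 𝓢(Space d, ℝ) where
  toFun x := Real.exp (-(‖x‖ ^ 2 / 2))
  smooth' := Real.contDiff_exp.comp (gauss_hasTemperateGrowth d).1
  decay' k n := by
    obtain ⟨l, C, hC, hb⟩ := (gauss_hasTemperateGrowth d).norm_iteratedFDeriv_le_uniform n
    obtain ⟨B, hB⟩ := pow_mul_gauss_bounded (k + l * n)
    refine ⟨n.factorial * (1 + C) ^ n * B, fun x => ?_⟩
    set D : ℝ := (1 + C) * (1 + ‖x‖) ^ l with hD
    have hx : (1 : ℝ) ≤ 1 + ‖x‖ := by linarith [norm_nonneg x]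
    have hD1 : 1 ≤ D := one_le_mul_of_one_le_of_one_le (by linarith) (one_le_pow₀ hx)
    have key := norm_iteratedFDeriv_comp_le (𝕜 := ℝ) (g := Real.exp)
      (f := fun x : Space d => -(‖x‖ ^ 2 / 2)) (n := n) (N := ∞)
      (Real.contDiff_exp) (gauss_hasTemperateGrowth d).1 (by exact_mod_cast le_top) x
      (C := Real.exp (-(‖x‖ ^ 2 / 2))) (D := D)
      (fun i _ => by
        rw [norm_iteratedFDeriv_eq_norm_iteratedDeriv, iteratedDeriv_eq_iterate,
          Real.iter_deriv_exp, Real.norm_eq_abs, Real.abs_exp])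
      (fun i hi hin => by
        calc _ ≤ C * (1 + ‖x‖) ^ l := hb i hin x
          _ ≤ D := by rw [hD]; gcongr; linarith
          _ = D ^ 1 := (pow_one D).symm
          _ ≤ D ^ i := pow_le_pow_right₀ hD1 hi)
    calc ‖x‖ ^ k * ‖iteratedFDeriv ℝ n (fun x : Space d => Real.exp (-(‖x‖ ^ 2 / 2))) x‖
        ≤ (1 + ‖x‖) ^ k * (n.factorial * Real.exp (-(‖x‖ ^ 2 / 2)) * D ^ n) := by
          gcongr
          · linarith
          · exact key
      _ = n.factorial * (1 + C) ^ n *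
          ((1 + ‖x‖) ^ (k + l * n) * Real.exp (-(‖x‖ ^ 2 / 2))) := by
          rw [hD, mul_pow, ← pow_mul, pow_add]; ring
      _ ≤ n.factorial * (1 + C) ^ n * B := by
          gcongr
          exact hB _ (norm_nonneg x)

/-- The Gaussian `x ↦ exp (-|x|² / 2)` as a complex-valued Schwartz function. -/
def gaussian (d : ℕ) : 𝓢(Space d, ℂ) := (gaussianReal d).postcompCLM Complex.ofRealCLM

theorem gaussian_apply (d : ℕ) (x : Space d) :
    gaussian d x = (Real.exp (-(‖x‖ ^ 2 / 2)) : ℂ) := rfl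

/-- The `n`-th one-dimensional Hermite polynomial, normalized so that its product with
`exp (-r² / 2)` has norm one in `L²(ℝ)`; `Polynomial.hermite` is the probabilists' one. -/
def hermiteFactor (n : ℕ) (r : ℝ) : ℝ :=
  (Real.sqrt (n.factorial * Real.sqrt Real.pi))⁻¹ *
    Polynomial.aeval (Real.sqrt 2 * r) (Polynomial.hermite n)

theorem aeval_hasTemperateGrowth (p : Polynomial ℤ) {d : ℕ} (i : Fin d) :
    (fun x : Space d => (Polynomial.aeval (Real.sqrt 2 * x i) p : ℝ)).HasTemperateGrowth := by
  have hx : (fun x : Space d => Real.sqrt 2 * x i).HasTemperateGrowth :=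
    (Function.HasTemperateGrowth.const (Real.sqrt 2)).mul
      (EuclideanSpace.proj i : Space d →L[ℝ] ℝ).hasTemperateGrowth
  simp only [Polynomial.aeval_eq_sum_range, zsmul_eq_mul]
  exact Function.HasTemperateGrowth.sum fun k _ =>
    (Function.HasTemperateGrowth.const _).mul (hx.pow k)

theorem prod_hasTemperateGrowth {d : ℕ} (s : Finset (Fin d)) (α : Fin d → ℕ) :
    (fun x : Space d => ∏ i ∈ s, hermiteFactor (α i) (x i)).HasTemperateGrowth := by
  induction s using Finset.induction_on with
  | empty => simp [Function.HasTemperateGrowth.const]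
  | insert i s hi ih =>
    simp only [Finset.prod_insert hi]
    exact ((Function.HasTemperateGrowth.const _).mul (aeval_hasTemperateGrowth _ i)).mul ih

theorem hermitePoly_hasTemperateGrowth (d : ℕ) (α : Fin d → ℕ) :
    (fun x : Space d => ((∏ i, hermiteFactor (α i) (x i) : ℝ) : ℂ)).HasTemperateGrowth :=
  Function.HasTemperateGrowth.comp Function.Complex.hasTemperateGrowth_ofReal (prod_hasTemperateGrowth _ α)

/-- The Hermite function `φ_α(x) = ∏ i, h_{α i}(x_i)`, `α ∈ ℕ^d`. The family `(φ_α)` is the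
orthonormal basis of `L²(ℝ^d)` made of eigenfunctions of `-Δ + |x|²`, see `hermiteFun_apply` and
`harmonicOscillator_hermiteFun`. -/
def hermiteFun {d : ℕ} (α : Fin d → ℕ) : 𝓢(Space d, ℂ) :=
  SchwartzMap.smulLeftCLM ℂ
    (fun x : Space d => ((∏ i, hermiteFactor (α i) (x i) : ℝ) : ℂ)) (gaussian d)

theorem hermiteFun_apply {d : ℕ} (α : Fin d → ℕ) (x : Space d) :
    hermiteFun α x =
      ((∏ i, hermiteFactor (α i) (x i) * Real.exp (-(x i ^ 2 / 2)) : ℝ) : ℂ) := by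
  rw [hermiteFun, SchwartzMap.smulLeftCLM_apply_apply (hermitePoly_hasTemperateGrowth d α), gaussian_apply,
    Finset.prod_mul_distrib, ← Real.exp_sum, smul_eq_mul, Complex.ofReal_mul]
  congr 4
  rw [EuclideanSpace.real_norm_sq_eq, Finset.sum_neg_distrib, Finset.sum_div]

theorem hermite_differential_equation (n : ℕ) :
    Polynomial.derivative (Polynomial.derivative (Polynomial.hermite n)) =
      Polynomial.X * Polynomial.derivative (Polynomial.hermite n) -
        (n : Polynomial ℤ) * Polynomial.hermite n := by
  induction n with
  | zero => simp
  | succ n ih =>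
    have h1 : Polynomial.derivative (Polynomial.hermite (n + 1)) =
        ((n : Polynomial ℤ) + 1) * Polynomial.hermite n := by
      rw [Polynomial.hermite_succ]
      simp only [map_sub, Polynomial.derivative_mul, Polynomial.derivative_X, ih]
      ring
    rw [h1, Polynomial.hermite_succ]
    simp only [Polynomial.derivative_mul, map_add, Polynomial.derivative_natCast,
      Polynomial.derivative_one]
    push_cast
    ring

/-- The one-dimensional Hermite function. -/
def hermiteOne (n : ℕ) (r : ℝ) : ℝ := hermiteFactor n r * Real.exp (-(r ^ 2 / 2))

/-- The derivative of the one-dimensional Hermite function. -/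
def hermiteOneD (n : ℕ) (r : ℝ) : ℝ :=
  (Real.sqrt (n.factorial * Real.sqrt Real.pi))⁻¹ *
    (Real.sqrt 2 * Polynomial.aeval (Real.sqrt 2 * r)
      (Polynomial.derivative (Polynomial.hermite n)) -
     r * Polynomial.aeval (Real.sqrt 2 * r) (Polynomial.hermite n)) * Real.exp (-(r ^ 2 / 2))

theorem hasDerivAt_aeval_sqrt (p : Polynomial ℤ) (r : ℝ) :
    HasDerivAt (fun r : ℝ => (Polynomial.aeval (Real.sqrt 2 * r) p : ℝ))
      (Polynomial.aeval (Real.sqrt 2 * r) (Polynomial.derivative p) * Real.sqrt 2) r := by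
  have h2 : HasDerivAt (fun r : ℝ => Real.sqrt 2 * r) (Real.sqrt 2) r := by
    simpa using (hasDerivAt_id r).const_mul (Real.sqrt 2)
  exact (Polynomial.hasDerivAt_aeval p (Real.sqrt 2 * r)).comp r h2

theorem hasDerivAt_gauss (r : ℝ) :
    HasDerivAt (fun r : ℝ => Real.exp (-(r ^ 2 / 2))) (Real.exp (-(r ^ 2 / 2)) * (-r)) r := by
  have : HasDerivAt (fun r : ℝ => -(r ^ 2 / 2)) (-r) r := by
    have := (((hasDerivAt_id r).pow 2).div_const 2).neg
    exact this.congr_deriv (by simp)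
  exact this.exp

theorem hasDerivAt_hermiteOne (n : ℕ) (r : ℝ) : HasDerivAt (hermiteOne n) (hermiteOneD n r) r := by
  have := ((hasDerivAt_aeval_sqrt (Polynomial.hermite n) r).const_mul
    ((Real.sqrt (n.factorial * Real.sqrt Real.pi))⁻¹)).mul (hasDerivAt_gauss r)
  exact this.congr_deriv (by rw [hermiteOneD]; ring)

theorem hasDerivAt_hermiteOneD' (n : ℕ) (r : ℝ) : HasDerivAt (hermiteOneD n) ((r ^ 2 - (2 * n + 1)) * hermiteOne n r) r := by
  have := ((((hasDerivAt_aeval_sqrt (Polynomial.derivative (Polynomial.hermite n)) r).const_mul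
    (Real.sqrt 2)).sub ((hasDerivAt_id r).mul (hasDerivAt_aeval_sqrt (Polynomial.hermite n) r))).const_mul
      ((Real.sqrt (n.factorial * Real.sqrt Real.pi))⁻¹)).mul (hasDerivAt_gauss r)
  refine this.congr_deriv ?_
  rw [hermite_differential_equation]
  have h2 : Real.sqrt 2 * Real.sqrt 2 = 2 := Real.mul_self_sqrt (by norm_num)
  simp only [hermiteOne, hermiteFactor, map_sub, map_mul, Polynomial.aeval_X, map_natCast, id, Pi.sub_apply, Pi.mul_apply]
  generalize (Polynomial.aeval (Real.sqrt 2 * r)) (Polynomial.hermite n) = p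
  generalize (Polynomial.aeval (Real.sqrt 2 * r)) (Polynomial.derivative (Polynomial.hermite n)) = q
  generalize (Real.sqrt (n.factorial * Real.sqrt Real.pi))⁻¹ = c
  generalize Real.exp (-(r ^ 2 / 2)) = e
  linear_combination (c * e * (r * q * Real.sqrt 2 - n * p)) * h2


theorem lineDeriv_prod {d : ℕ} (f : Fin d → ℝ → ℝ) (j : Fin d) (g : ℝ → ℝ)
    (hf : ∀ r, HasDerivAt (f j) (g r) r) (x : Space d) :
    lineDeriv ℝ (fun y : Space d => ((∏ i, f i (y i) : ℝ) : ℂ)) x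
      (EuclideanSpace.basisFun (Fin d) ℝ j) =
      ((∏ i, Function.update f j g i (x i) : ℝ) : ℂ) := by
  have key : HasDerivAt (fun t : ℝ => ((f j (x j + t) *
      ∏ i ∈ Finset.univ.erase j, f i (x i) : ℝ) : ℂ))
      ((g (x j) * ∏ i ∈ Finset.univ.erase j, f i (x i) : ℝ) : ℂ) 0 := by
    apply HasDerivAt.ofReal_comp
    apply HasDerivAt.mul_const
    have := (hf (x j + 0)).comp_const_add (x j) 0
    simpa using this
  have e1 : ((∏ i, Function.update f j g i (x i) : ℝ) : ℂ) =
      ((g (x j) * ∏ i ∈ Finset.univ.erase j, f i (x i) : ℝ) : ℂ) := by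
    rw [← Finset.mul_prod_erase _ _ (Finset.mem_univ j), Function.update_self]
    congr 2
    refine Finset.prod_congr rfl fun i hi => ?_
    rw [Function.update_of_ne (Finset.ne_of_mem_erase hi)]
  rw [e1, lineDeriv, ← key.deriv]
  congr 1
  funext t
  rw [← Finset.mul_prod_erase _ _ (Finset.mem_univ j)]
  congr 2
  · simp
  · refine Finset.prod_congr rfl fun i hi => ?_
    simp [Finset.ne_of_mem_erase hi]

open scoped LineDeriv Laplacian

/-- The harmonic oscillator `H = -Δ + |x|²` on Schwartz functions. -/
def harmonicOscillator {d : ℕ} (w : 𝓢(Space d, ℂ)) : 𝓢(Space d, ℂ) :=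
  -(Δ w) + SchwartzMap.smulLeftCLM ℂ (fun x : Space d => ((‖x‖ ^ 2 : ℝ) : ℂ)) w

/-- The eigenvalue `λ_α = 2 |α| + d` of `H` at `φ_α`. -/
def eigenvalue {d : ℕ} (α : Fin d → ℕ) : ℝ := 2 * (∑ i, (α i : ℝ)) + d

theorem harmonicOscillator_hermiteFun {d : ℕ} (α : Fin d → ℕ) :
    harmonicOscillator (hermiteFun α) = (eigenvalue α : ℂ) • hermiteFun α := by
  have h2 : ∀ (j : Fin d) (x : Space d),
      (∂_{EuclideanSpace.basisFun (Fin d) ℝ j} (∂_{EuclideanSpace.basisFun (Fin d) ℝ j}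
        (hermiteFun α))) x = (((x j ^ 2 - (2 * α j + 1)) : ℝ) : ℂ) * hermiteFun α x := by
    intro j x
    have e0 : (⇑(hermiteFun α) : Space d → ℂ) =
        fun y => ((∏ i, hermiteOne (α i) (y i) : ℝ) : ℂ) := funext (hermiteFun_apply α)
    have e1 : (⇑(∂_{EuclideanSpace.basisFun (Fin d) ℝ j} (hermiteFun α) : 𝓢(Space d, ℂ)) : Space d → ℂ) =
        fun y => ((∏ i, Function.update (fun i => hermiteOne (α i)) j (hermiteOneD (α j)) i (y i) : ℝ) : ℂ) := by
      funext y
      rw [SchwartzMap.lineDerivOp_apply, e0]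
      exact lineDeriv_prod _ j _ (hasDerivAt_hermiteOne (α j)) y
    rw [SchwartzMap.lineDerivOp_apply, e1,
      lineDeriv_prod _ j (fun r => (r ^ 2 - (2 * α j + 1)) * hermiteOne (α j) r)
        (by rw [Function.update_self]; exact hasDerivAt_hermiteOneD' (α j)) x, e0, ← Complex.ofReal_mul]
    congr 1
    rw [Function.update_idem, ← Finset.mul_prod_erase _ _ (Finset.mem_univ j),
      ← Finset.mul_prod_erase Finset.univ (fun i => hermiteOne (α i) (x i)) (Finset.mem_univ j),
      Function.update_self, mul_assoc]
    congr 2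
    refine Finset.prod_congr rfl fun i hi => ?_
    rw [Function.update_of_ne (Finset.ne_of_mem_erase hi)]
  have hn : (fun x : Space d => ((‖x‖ ^ 2 : ℝ) : ℂ)).HasTemperateGrowth :=
    Function.HasTemperateGrowth.comp Function.Complex.hasTemperateGrowth_ofReal
      (Function.hasTemperateGrowth_norm_sq (Space d))
  ext x
  rw [harmonicOscillator, _root_.add_apply, _root_.neg_apply,
    SchwartzMap.laplacian_eq_sum (EuclideanSpace.basisFun (Fin d) ℝ), _root_.sum_apply,
    SchwartzMap.smulLeftCLM_apply_apply hn, _root_.smul_apply]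
  simp only [h2]
  rw [← Finset.sum_mul, smul_eq_mul, smul_eq_mul, ← neg_mul, ← add_mul]
  congr 1
  rw [← Complex.ofReal_sum, ← Complex.ofReal_neg, ← Complex.ofReal_add, eigenvalue,
    EuclideanSpace.real_norm_sq_eq]
  congr 1
  rw [Finset.sum_sub_distrib, Finset.sum_add_distrib, ← Finset.mul_sum]
  simp

/-- A smooth dyadic partition of unity `(χ_j)_{j ≥ -1}` of `[0, ∞)`: `low` is `χ_{-1}`, and
`χ_j(ξ) = chi (ξ / 2^j)` for `j ≥ 0`. -/
structure DyadicPartition where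
  low : ℝ → ℝ
  chi : ℝ → ℝ
  low_smooth : ContDiff ℝ ∞ low
  chi_smooth : ContDiff ℝ ∞ chi
  low_support : tsupport low ⊆ Set.Icc (-(4 / 3)) (4 / 3)
  chi_support : tsupport chi ⊆ Set.Icc (3 / 4) (8 / 3)
  low_mem : ∀ ξ, low ξ ∈ Set.Icc (0 : ℝ) 1
  chi_mem : ∀ ξ, chi ξ ∈ Set.Icc (0 : ℝ) 1
  low_eq_one : ∀ᶠ ξ in 𝓝 (0 : ℝ), low ξ = 1
  hasSum_one : ∀ ξ : ℝ, 0 ≤ ξ → HasSum (fun j : ℕ => chi (ξ / 2 ^ j)) (1 - low ξ)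

/-- `P.symbol n` is `χ_{n-1}`: the index `j ≥ -1` is written `j = n - 1` with `n : ℕ`. -/
def DyadicPartition.symbol (P : DyadicPartition) : ℕ → ℝ → ℝ
  | 0 => P.low
  | j + 1 => fun ξ => P.chi (ξ / 2 ^ j)

/-- The Littlewood-Paley block `δ_{n-1} w = χ_{n-1}(√H) w` of a tempered distribution `w`. It is
the finite sum of the `χ_{n-1}(√λ_α) ⟨w, φ_α⟩ φ_α`, hence a Schwartz function. -/
def block {d : ℕ} (P : DyadicPartition) (n : ℕ) (w : 𝓢'(Space d, ℂ)) : 𝓢(Space d, ℂ) :=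
  ∑ᶠ α : Fin d → ℕ,
    (((P.symbol n (Real.sqrt (eigenvalue α)) : ℝ) : ℂ) * w (hermiteFun α)) • hermiteFun α

/-- The norm of the harmonic Besov space `B^σ = B^σ_{∞,∞}(ℝ^d)`, with values in `[0, ∞]`:
`sup_{j ≥ -1} 2^{j σ} ‖δ_j w‖_{L^∞}`. The space `B^σ` is the set of all tempered distributions with
finite norm. -/
def besovNorm {d : ℕ} (P : DyadicPartition) (σ : ℝ) (w : 𝓢'(Space d, ℂ)) : ℝ≥0∞ :=
  ⨆ n : ℕ, (2 : ℝ≥0∞) ^ (((n : ℝ) - 1) * σ) * eLpNorm (block P n w) ⊤ volume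

/-- The product of two tempered distributions: the limit in `𝓢'` of the products of the partial
sums of their Littlewood-Paley decompositions. -/
def besovMul {d : ℕ} (P : DyadicPartition) (u f : 𝓢'(Space d, ℂ)) : 𝓢'(Space d, ℂ) :=
  limUnder atTop fun N : ℕ =>
    (SchwartzMap.pairing (ContinuousLinearMap.mul ℂ ℂ) (∑ n ∈ Finset.range N, block P n u)
      (∑ n ∈ Finset.range N, block P n f) : 𝓢'(Space d, ℂ))

/-- The semigroup `e^{-tH} w = ∑_α e^{-t λ_α} ⟨w, φ_α⟩ φ_α`, the series being taken in `𝓢'`. -/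
def heat {d : ℕ} (t : ℝ) (w : 𝓢'(Space d, ℂ)) : 𝓢'(Space d, ℂ) :=
  ∑' α : Fin d → ℕ,
    (((Real.exp (-(t * eigenvalue α)) : ℝ) : ℂ) * w (hermiteFun α)) •
      (hermiteFun α : 𝓢'(Space d, ℂ))

/-- The Hölder seminorm of exponent `κ` on `[0, T]`, with respect to the norm of `B^σ`. -/
def holderSeminorm {d : ℕ} (P : DyadicPartition) (σ κ T : ℝ) (f : ℝ → 𝓢'(Space d, ℂ)) : ℝ≥0∞ :=
  ⨆ r ∈ Set.Icc 0 T, ⨆ v ∈ Set.Icc 0 T, ⨆ _ : r ≠ v,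
    besovNorm P σ (f v - f r) / ENNReal.ofReal (|v - r| ^ κ)

/-- The Hölder norm of exponent `κ` on `[0, T]`, with respect to the norm of `B^σ`. -/
def holderNorm {d : ℕ} (P : DyadicPartition) (σ κ T : ℝ) (f : ℝ → 𝓢'(Space d, ℂ)) : ℝ≥0∞ :=
  besovNorm P σ (f 0) + holderSeminorm P σ κ T f

/-- `f` is a continuous path from `[0, T]` to `B^σ` with finite Hölder seminorm of exponent `κ`.
Since the norm of `f 0` is finite, it is the same to ask for a finite Hölder norm. -/
structure IsHolderPath {d : ℕ} (P : DyadicPartition) (σ κ T : ℝ) (f : ℝ → 𝓢'(Space d, ℂ)) :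
    Prop where
  mem : ∀ r ∈ Set.Icc 0 T, besovNorm P σ (f r) < ⊤
  cont : ∀ r ∈ Set.Icc 0 T,
    Tendsto (fun v => besovNorm P σ (f v - f r)) (𝓝[Set.Icc 0 T] r) (𝓝 0)
  seminorm_lt_top : holderSeminorm P σ κ T f < ⊤

/-- The dyadic point `s + i (t - s) / 2^n`. -/
def dyadicPoint (s t : ℝ) (n i : ℕ) : ℝ := s + i * (t - s) / 2 ^ n

/-- The `n`-th dyadic Riemann sum of the mild integral of `u` against `df` from `s` to `t`. -/
def riemannSum {d : ℕ} (P : DyadicPartition) (u f : ℝ → 𝓢'(Space d, ℂ)) (s t : ℝ) (n : ℕ) :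
    𝓢'(Space d, ℂ) :=
  ∑ i ∈ Finset.range (2 ^ n), heat (t - dyadicPoint s t n i)
    (besovMul P (u (dyadicPoint s t n i))
      (f (dyadicPoint s t n (i + 1)) - f (dyadicPoint s t n i)))

/-- The mild integral of `u` against `df` from `s` to `t`: the limit of the Riemann sums. -/
def mildIntegral {d : ℕ} (P : DyadicPartition) (u f : ℝ → 𝓢'(Space d, ℂ)) (s t : ℝ) :
    𝓢'(Space d, ℂ) :=
  limUnder atTop (riemannSum P u f s t)

/-- `f'` is the time derivative of `f` at almost every time of `(0, T)`, in the sense of `𝓢'`. -/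
def IsTimeDerivative {d : ℕ} (T : ℝ) (f f' : ℝ → 𝓢'(Space d, ℂ)) : Prop :=
  ∀ᵐ r ∂(volume.restrict (Set.Ioo 0 T)), ∀ ψ : 𝓢(Space d, ℂ),
    HasDerivAt (fun v => f v ψ) (f' r ψ) r

end HarmonicYoung

end

open HarmonicYoung

open MeasureTheory Filter Topology SchwartzMap
open scoped ENNReal NNReal ContDiff

noncomputable section
namespace HarmonicYoung

/-! ### One-dimensional Hermite functions -/

/-! The integral is obtained by sewing. Put `p = (μ + η) / 2`, so that passing from `B^{-η}` to
`B^μ` takes `2p` derivatives; the condition on `μ` says that `p + λ < 1`. When an interval `[a, b]`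
of the dyadic partition is cut at its midpoint `c`, with `h = c - a = b - c`, the Riemann sum
changes by `e^{-(t-c)H}((u_c - u_a)·(f_b - f_c)) + (1 - e^{-hH}) e^{-(t-c)H}(u_a·(f_b - f_c))`. In
`B^μ` the first term is at most of order `(t-c)^{-p} h^{γ+1-λ}` and the second `(t-c)^{-p-θ}
h^{θ+1-λ}`, for any `θ` in `(λ, 1 - p)`. One power of `h` turns the sum over the intervals into a
Riemann sum of a convergent integral, and the positive powers `h^{γ-λ}` and `h^{θ-λ}` that remain
make the series of differences geometric (`PathBounds.blockLE_succ_sub`).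

Three estimates are used: products map `B^β × B^{-η}` to `B^{-η}` (`blockLE_besovMul`), `e^{-tH}`
gains `2p` derivatives at the price `t^{-p}` (`BlockLE.heat`), and `1 - e^{-hH}` gains `h^θ` at the
price of `2θ` derivatives (`BlockLE.sub_heat`). They all rest on `L¹` bounds for kernels. Mehler's
formula gives the kernel of `e^{-zH}` at every complex time with positive real part, as a Gaussian
whose `L¹` norm is bounded by a power of `|z| / Re z`; one factor `x_i` or one derivative costs `(Re
z)^{-1/2}`. By Fourier inversion a multiplier `e^{-aλ} g(λ/R)` is a superposition of such kernels,
with bounds uniform in `R` as soon as `R a ≥ 1` (`integral_norm_multKernel_le`).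

A product of Hermite functions does not have its spectrum near the sum of the frequencies, so the
usual support argument for paraproducts is not available. Instead, a block at frequency `2^l` is
written as `H` applied to a smaller function and integrated by parts once, which gains `2^{-l}`
(`norm_prodTerm_le_grad`). Since `η < 1`, one integration by parts is enough.

Time regularity needs `I_{0,v} = e^{-(v-r)H} I_{0,r} + I_{r,v}`, although the dyadic partitions of
the three intervals are not compatible. On each Hermite coefficient the exponential factor comes out
and leaves a scalar sewing problem; additivity holds at division points of rational ratio by
comparing uniform partitions, and then everywhere by continuity (`sewn_additive`).

For a path that is Lipschitz in `L^∞`, separability of `L¹` gives a weak derivative at almost every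
time. The Riemann sums are then integrals of step integrands, and dominated convergence applies
since the semigroup costs only the integrable singularity `(t - r)^{-(1+η)/2}`. -/

theorem derivative_hermite_succ (n : ℕ) :
    Polynomial.derivative (Polynomial.hermite (n + 1)) =
      ((n : Polynomial ℤ) + 1) * Polynomial.hermite n := by
  rw [Polynomial.hermite_succ]
  simp only [map_sub, Polynomial.derivative_mul, Polynomial.derivative_X,
    hermite_differential_equation]
  ring

theorem hermite_add_two (n : ℕ) :
    Polynomial.hermite (n + 2) = Polynomial.X * Polynomial.hermite (n + 1) -
      ((n : Polynomial ℤ) + 1) * Polynomial.hermite n := by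
  rw [Polynomial.hermite_succ, derivative_hermite_succ]

/-- The normalization of the Hermite functions. -/
def hermiteNorm (n : ℕ) : ℝ := (Real.sqrt (n.factorial * Real.sqrt Real.pi))⁻¹

theorem hermiteNorm_succ_mul_sqrt (n : ℕ) :
    hermiteNorm (n + 1) * Real.sqrt (n + 1) = hermiteNorm n := by
  have h : (((n + 1).factorial : ℕ) : ℝ) * Real.sqrt Real.pi =
      (n + 1) * (n.factorial * Real.sqrt Real.pi) := by
    rw [Nat.factorial_succ]; push_cast; ring
  have h0 : Real.sqrt ((n : ℝ) + 1) ≠ 0 := by positivity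
  rw [hermiteNorm, hermiteNorm, h, Real.sqrt_mul (by positivity), mul_inv]
  field_simp

/-- The coefficient `√(n / 2)` of the ladder relations. -/
def ladder (n : ℕ) : ℝ := Real.sqrt (n / 2)

@[simp] theorem ladder_zero : ladder 0 = 0 := by simp [ladder]

theorem ladder_nonneg (n : ℕ) : 0 ≤ ladder n := Real.sqrt_nonneg _

theorem ladder_sq (n : ℕ) : ladder n ^ 2 = n / 2 := Real.sq_sqrt (by positivity)

theorem ladder_succ_pos (n : ℕ) : 0 < ladder (n + 1) := by
  rw [ladder]; positivity

theorem ladder_le (n : ℕ) : ladder n ≤ n + 1 := by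
  rw [ladder, Real.sqrt_le_left (by positivity)]
  have : (0 : ℝ) ≤ n := by positivity
  nlinarith

theorem ladder_mul_sqrt_two (n : ℕ) : ladder n * Real.sqrt 2 = Real.sqrt n := by
  rw [ladder, ← Real.sqrt_mul (by positivity)]
  congr 1; ring

theorem ladder_mul_hermiteNorm_succ (n : ℕ) :
    ladder (n + 1) * hermiteNorm (n + 1) * Real.sqrt 2 = hermiteNorm n := by
  rw [← hermiteNorm_succ_mul_sqrt n, mul_right_comm, ladder_mul_sqrt_two]
  push_cast; ring

theorem ladder_mul_hermiteNorm (n : ℕ) :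
    ladder (n + 1) * hermiteNorm n * Real.sqrt 2 = (n + 1) * hermiteNorm (n + 1) := by
  rw [← hermiteNorm_succ_mul_sqrt n, mul_right_comm, ladder_mul_sqrt_two]
  have : Real.sqrt ((n : ℝ) + 1) * Real.sqrt (n + 1) = n + 1 :=
    Real.mul_self_sqrt (by positivity)
  push_cast
  linear_combination hermiteNorm (n + 1) * this

theorem hermiteOne_eq (n : ℕ) (r : ℝ) : hermiteOne n r =
    hermiteNorm n * Polynomial.aeval (Real.sqrt 2 * r) (Polynomial.hermite n) *
      Real.exp (-(r ^ 2 / 2)) := rfl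

/-- This is the three-term recurrence of the Hermite polynomials after normalization. At `n = 0` the
truncated index `n - 1` does no harm because `ladder 0 = 0`. -/
theorem mul_hermiteOne (n : ℕ) (r : ℝ) : r * hermiteOne n r =
    ladder (n + 1) * hermiteOne (n + 1) r + ladder n * hermiteOne (n - 1) r := by
  have h2 : Real.sqrt 2 ≠ 0 := by positivity
  apply mul_right_cancel₀ h2
  cases n with
  | zero =>
    have h := ladder_mul_hermiteNorm_succ 0
    simp only [hermiteOne_eq, ladder_zero, zero_mul, add_zero, Polynomial.hermite_zero,
      zero_add, Polynomial.hermite_one, Polynomial.aeval_X, map_one] at *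
    linear_combination -(Real.sqrt 2 * r * Real.exp (-(r ^ 2 / 2))) * h
  | succ n =>
    have h := ladder_mul_hermiteNorm_succ (n + 1)
    have h' := ladder_mul_hermiteNorm n
    simp only [hermiteOne_eq, hermite_add_two, map_sub, map_mul, Polynomial.aeval_X, map_add,
      map_natCast, map_one, Nat.add_sub_cancel]
    generalize (Polynomial.aeval (Real.sqrt 2 * r)) (Polynomial.hermite n) = p
    generalize (Polynomial.aeval (Real.sqrt 2 * r)) (Polynomial.hermite (n + 1)) = q
    generalize Real.exp (-(r ^ 2 / 2)) = e
    linear_combination -((Real.sqrt 2 * r * q - (n + 1) * p) * e) * h - p * e * h'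

/-- The annihilation operator `d/dr + r` lowers the index (`key`); subtracting the recurrence for `r
h_n` isolates the derivative. -/
theorem hermiteOneD_eq (n : ℕ) (r : ℝ) : hermiteOneD n r =
    ladder n * hermiteOne (n - 1) r - ladder (n + 1) * hermiteOne (n + 1) r := by
  have h2 : Real.sqrt 2 * Real.sqrt 2 = 2 := Real.mul_self_sqrt (by norm_num)
  have key : hermiteOneD n r + r * hermiteOne n r = 2 * (ladder n * hermiteOne (n - 1) r) := by
    have h2 : Real.sqrt 2 ≠ 0 := by positivity
    apply mul_right_cancel₀ h2
    cases n with
    | zero => simp [hermiteOneD, hermiteOne, hermiteFactor]; ring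
    | succ n =>
      have h' := ladder_mul_hermiteNorm n
      rw [hermiteOneD, derivative_hermite_succ]
      simp only [hermiteOne_eq, map_mul, map_add, map_natCast, map_one, Nat.add_sub_cancel]
      rw [← hermiteNorm]
      generalize (Polynomial.aeval (Real.sqrt 2 * r)) (Polynomial.hermite n) = p
      generalize (Polynomial.aeval (Real.sqrt 2 * r)) (Polynomial.hermite (n + 1)) = q
      generalize Real.exp (-(r ^ 2 / 2)) = e
      have h2 : Real.sqrt 2 * Real.sqrt 2 = 2 := Real.mul_self_sqrt (by norm_num)
      linear_combination hermiteNorm (n + 1) * (n + 1) * p * e * h2 - 2 * p * e * h'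
  have := mul_hermiteOne n r
  linear_combination key - this

/-- Functions of the form `p(r) exp (-b r²)` with a polynomial `p`. -/
def IsPolyGauss (b : ℝ) (f : ℝ → ℝ) : Prop :=
  ∃ p : Polynomial ℝ, ∀ r, f r = p.eval r * Real.exp (-b * r ^ 2)

theorem IsPolyGauss.integrable {b : ℝ} (hb : 0 < b) {f : ℝ → ℝ} (hf : IsPolyGauss b f) :
    Integrable f := by
  obtain ⟨p, hp⟩ := hf
  rw [show f = fun r => ∑ k ∈ Finset.range (p.natDegree + 1),
      p.coeff k * (r ^ (k : ℝ) * Real.exp (-b * r ^ 2)) from ?_]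
  · exact integrable_finsetSum _ fun k _ => (integrable_rpow_mul_exp_neg_mul_sq hb
      (by have : (0 : ℝ) ≤ k := by positivity
          linarith)).const_mul _
  · funext r
    rw [hp, Polynomial.eval_eq_sum_range, Finset.sum_mul]
    simp only [Real.rpow_natCast, mul_assoc]

theorem IsPolyGauss.mul {b c : ℝ} {f g : ℝ → ℝ} (hf : IsPolyGauss b f) (hg : IsPolyGauss c g) :
    IsPolyGauss (b + c) (f * g) := by
  obtain ⟨p, hp⟩ := hf
  obtain ⟨q, hq⟩ := hg
  refine ⟨p * q, fun r => ?_⟩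
  rw [Pi.mul_apply, hp, hq, Polynomial.eval_mul,
    show -(b + c) * r ^ 2 = -b * r ^ 2 + -c * r ^ 2 by ring, Real.exp_add]
  ring

theorem IsPolyGauss.lin {b : ℝ} {f g : ℝ → ℝ} (hf : IsPolyGauss b f) (hg : IsPolyGauss b g)
    (x y : ℝ) : IsPolyGauss b (fun r => x * f r + y * g r) := by
  obtain ⟨p, hp⟩ := hf
  obtain ⟨q, hq⟩ := hg
  refine ⟨Polynomial.C x * p + Polynomial.C y * q, fun r => ?_⟩
  simp only [hp, hq, Polynomial.eval_add, Polynomial.eval_mul, Polynomial.eval_C]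
  ring

theorem isPolyGauss_hermiteOne (n : ℕ) : IsPolyGauss (1 / 2) (hermiteOne n) := by
  refine ⟨Polynomial.C (hermiteNorm n) * ((Polynomial.hermite n).map (Int.castRingHom ℝ)).comp
    (Polynomial.C (Real.sqrt 2) * Polynomial.X), fun r => ?_⟩
  rw [hermiteOne_eq]
  simp only [Polynomial.eval_mul, Polynomial.eval_C, Polynomial.eval_comp, Polynomial.eval_X,
    Polynomial.eval_map]
  rw [show -(1 / 2) * r ^ 2 = -(r ^ 2 / 2) by ring]
  rfl

theorem isPolyGauss_mul_hermiteOne (n : ℕ) :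
    IsPolyGauss (1 / 2) (fun r => r * hermiteOne n r) := by
  simp only [mul_hermiteOne]
  exact (isPolyGauss_hermiteOne _).lin (isPolyGauss_hermiteOne _) _ _

theorem isPolyGauss_hermiteOneD (n : ℕ) : IsPolyGauss (1 / 2) (hermiteOneD n) := by
  have := (isPolyGauss_hermiteOne (n - 1)).lin (isPolyGauss_hermiteOne (n + 1))
    (ladder n) (-ladder (n + 1))
  convert this using 2 with r
  rw [hermiteOneD_eq]; ring

theorem integrable_hermiteOne (n : ℕ) : Integrable (hermiteOne n) :=
  (isPolyGauss_hermiteOne n).integrable (by norm_num)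

theorem integrable_hermiteOne_mul (n m : ℕ) :
    Integrable (fun r => hermiteOne n r * hermiteOne m r) :=
  ((isPolyGauss_hermiteOne n).mul (isPolyGauss_hermiteOne m)).integrable (by norm_num)

theorem integral_hermiteOne_mul_hermiteOneD (n m : ℕ) :
    ∫ r, hermiteOne n r * hermiteOneD m r = -∫ r, hermiteOneD n r * hermiteOne m r :=
  integral_mul_deriv_eq_deriv_mul_of_integrable (fun r _ => hasDerivAt_hermiteOne n r)
    (fun r _ => hasDerivAt_hermiteOne m r)
    (((isPolyGauss_hermiteOne n).mul (isPolyGauss_hermiteOneD m)).integrable (by norm_num))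
    (((isPolyGauss_hermiteOneD n).mul (isPolyGauss_hermiteOne m)).integrable (by norm_num))
    (((isPolyGauss_hermiteOne n).mul (isPolyGauss_hermiteOne m)).integrable (by norm_num))

/-- Creation and annihilation operators are adjoint to each other, by integration by parts. Lowering
both indices in this way yields orthonormality by induction. -/
theorem ladder_mul_integral_hermiteOne (n m : ℕ) :
    ladder (n + 1) * ∫ r, hermiteOne (n + 1) r * hermiteOne m r =
      ladder m * ∫ r, hermiteOne n r * hermiteOne (m - 1) r := by
  have h := integral_hermiteOne_mul_hermiteOneD n m
  have i1 := ((isPolyGauss_hermiteOne n).mul (isPolyGauss_hermiteOneD m)).integrable (by norm_num)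
  have i2 := ((isPolyGauss_hermiteOneD n).mul (isPolyGauss_hermiteOne m)).integrable (by norm_num)
  have h0 : ∫ r, (hermiteOne n r * hermiteOneD m r + hermiteOneD n r * hermiteOne m r) = 0 := by
    rw [show (∫ r, (hermiteOne n r * hermiteOneD m r + hermiteOneD n r * hermiteOne m r)) = _ from
      integral_add i1 i2]
    rw [h]; ring
  have e : ∀ r, hermiteOne n r * hermiteOneD m r + hermiteOneD n r * hermiteOne m r =
      2 * (ladder m * (hermiteOne n r * hermiteOne (m - 1) r) -
        ladder (n + 1) * (hermiteOne (n + 1) r * hermiteOne m r)) := by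
    intro r
    have a1 := mul_hermiteOne n r
    have a2 := mul_hermiteOne m r
    rw [hermiteOneD_eq, hermiteOneD_eq]
    linear_combination hermiteOne n r * a2 - hermiteOne m r * a1
  simp only [e] at h0
  rw [integral_const_mul, integral_sub ((integrable_hermiteOne_mul _ _).const_mul _)
    ((integrable_hermiteOne_mul _ _).const_mul _), integral_const_mul, integral_const_mul] at h0
  linarith

theorem integral_hermiteOne_mul (n m : ℕ) :
    ∫ r, hermiteOne n r * hermiteOne m r = if n = m then 1 else 0 := by
  induction n generalizing m with
  | zero =>
    cases m with
    | zero =>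
      have h := integral_gaussian 1
      have e : ∀ r, hermiteOne 0 r * hermiteOne 0 r =
          (Real.sqrt Real.pi)⁻¹ * Real.exp (-1 * r ^ 2) := by
        intro r
        have : hermiteNorm 0 * hermiteNorm 0 = (Real.sqrt Real.pi)⁻¹ := by
          rw [hermiteNorm, ← mul_inv, Real.mul_self_sqrt (by positivity)]; simp
        rw [hermiteOne_eq, ← this, show -1 * r ^ 2 = -(r ^ 2 / 2) + -(r ^ 2 / 2) by ring,
          Real.exp_add]
        simp
        ring
      simp only [e, integral_const_mul, h, if_true]
      rw [div_one, inv_mul_cancel₀ (by positivity)]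
    | succ m =>
      have := ladder_mul_integral_hermiteOne m 0
      simp only [ladder_zero, zero_mul, mul_eq_zero, (ladder_succ_pos m).ne', false_or] at this
      simp only [mul_comm (hermiteOne 0 _)]
      simpa using this
  | succ n ih =>
    have h := ladder_mul_integral_hermiteOne n m
    have h0 := (ladder_succ_pos n).ne'
    apply mul_left_cancel₀ h0
    rw [h, ih]
    cases m with
    | zero => simp
    | succ m =>
      by_cases hnm : n = m <;> simp [hnm]

/-- Cauchy-Schwarz against the weight `1 + r²`, in the pointwise form `2|h| ≤ (1 + r²)⁻¹ + (1 + r²)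
h²`; the second moment of `h_n²` is `n + 1/2` by the ladder relation. Only polynomial growth in `n`
matters, since it will be multiplied by `e^{-tλ}`. -/
theorem integral_abs_hermiteOne_le (n : ℕ) : ∫ r, |hermiteOne n r| ≤ n + 3 := by
  have i0 := integrable_inv_one_add_sq
  have i1 := integrable_hermiteOne_mul n n
  have i2 : Integrable (fun r => (r * hermiteOne n r) * (r * hermiteOne n r)) :=
    ((isPolyGauss_mul_hermiteOne n).mul (isPolyGauss_mul_hermiteOne n)).integrable (by norm_num)
  have hmom : ∫ r, (r * hermiteOne n r) * (r * hermiteOne n r) = n + 1 / 2 := by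
    have e : ∀ r, (r * hermiteOne n r) * (r * hermiteOne n r) =
        (ladder (n + 1) ^ 2 * (hermiteOne (n + 1) r * hermiteOne (n + 1) r) +
          ladder n ^ 2 * (hermiteOne (n - 1) r * hermiteOne (n - 1) r)) +
        2 * ladder (n + 1) * ladder n * (hermiteOne (n + 1) r * hermiteOne (n - 1) r) := by
      intro r; rw [mul_hermiteOne]; ring
    simp only [e]
    rw [integral_add, integral_add, integral_const_mul, integral_const_mul, integral_const_mul]
    · simp only [integral_hermiteOne_mul, if_true, ladder_sq]
      rw [if_neg (by omega)]
      push_cast; ring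
    all_goals
      first
      | exact (integrable_hermiteOne_mul _ _).const_mul _
      | exact ((integrable_hermiteOne_mul _ _).const_mul _).add
          ((integrable_hermiteOne_mul _ _).const_mul _)
  calc ∫ r, |hermiteOne n r| ≤ ∫ r, (1 / 2) * ((1 + r ^ 2)⁻¹ +
        (hermiteOne n r * hermiteOne n r + (r * hermiteOne n r) * (r * hermiteOne n r))) := by
        refine integral_mono_of_nonneg (Eventually.of_forall fun r => abs_nonneg _)
          ((i0.add (i1.add i2)).const_mul _) (Eventually.of_forall fun r => ?_)
        have hr : 0 < 1 + r ^ 2 := by positivity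
        simp only
        have h1 : (1 + r ^ 2) * (1 + r ^ 2)⁻¹ = 1 := mul_inv_cancel₀ hr.ne'
        have h2 : 0 < (1 + r ^ 2)⁻¹ := by positivity
        set a := |hermiteOne n r| with ha
        have e : hermiteOne n r * hermiteOne n r = a ^ 2 := by rw [ha, sq_abs]; ring
        have : (1 + r ^ 2) * a ^ 2 + (1 + r ^ 2)⁻¹ - 2 * a =
            (1 + r ^ 2)⁻¹ * ((1 + r ^ 2) * a - 1) ^ 2 := by
          linear_combination (-(1 + r ^ 2) * a ^ 2 + 2 * a) * h1
        have h3 : 0 ≤ (1 + r ^ 2)⁻¹ * ((1 + r ^ 2) * a - 1) ^ 2 := by positivity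
        rw [show r * hermiteOne n r * (r * hermiteOne n r) =
          r ^ 2 * (hermiteOne n r * hermiteOne n r) by ring, e]
        linarith
    _ = (1 / 2) * (Real.pi + (1 + (n + 1 / 2))) := by
        have e1 := integral_add i1 i2
        have e0 := integral_add i0 (i1.add i2)
        simp only [Pi.add_apply] at e0 e1
        rw [integral_const_mul, e0, e1, integral_univ_inv_one_add_sq, hmom,
          integral_hermiteOne_mul, if_pos rfl]
    _ ≤ n + 3 := by
        have := Real.pi_lt_four
        have : (0 : ℝ) ≤ n := by positivity
        linarith

/-- Serves both `r h_n` and `h_n'`, whose ladder expansions differ only by signs. -/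
theorem integral_abs_lin_hermiteOne_le {f : ℝ → ℝ} (n : ℕ) (σ τ : ℝ)
    (hσ : |σ| = 1) (hτ : |τ| = 1)
    (hf : ∀ r, f r = σ * (ladder (n + 1) * hermiteOne (n + 1) r) +
      τ * (ladder n * hermiteOne (n - 1) r)) :
    ∫ r, |f r| ≤ 2 * ((n : ℝ) + 4) ^ 2 := by
  have i1 := ((integrable_hermiteOne (n + 1)).abs.const_mul (ladder (n + 1)))
  have i2 := ((integrable_hermiteOne (n - 1)).abs.const_mul (ladder n))
  calc ∫ r, |f r| ≤ ∫ r, (ladder (n + 1) * |hermiteOne (n + 1) r| +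
        ladder n * |hermiteOne (n - 1) r|) := by
        refine integral_mono_of_nonneg (Eventually.of_forall fun r => abs_nonneg _)
          (i1.add i2) (Eventually.of_forall fun r => ?_)
        simp only [hf]
        refine (abs_add_le _ _).trans (le_of_eq ?_)
        rw [abs_mul, abs_mul, abs_mul, abs_mul, hσ, hτ, abs_of_nonneg (ladder_nonneg _),
          abs_of_nonneg (ladder_nonneg _), one_mul, one_mul]
    _ ≤ ((n : ℝ) + 2) * (n + 4) + (n + 1) * (n + 3) := by
        rw [integral_add i1 i2, integral_const_mul, integral_const_mul]
        have h1 := ladder_le (n + 1)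
        have h2 := ladder_le n
        have h3 := integral_abs_hermiteOne_le (n + 1)
        have h4 := integral_abs_hermiteOne_le (n - 1)
        have h5 : ((n - 1 : ℕ) : ℝ) ≤ n := by exact_mod_cast Nat.sub_le _ _
        push_cast at h1 h3
        gcongr
        · linarith
        · linarith
        · linarith
    _ ≤ 2 * ((n : ℝ) + 4) ^ 2 := by
        have : (0 : ℝ) ≤ n := by positivity
        nlinarith

theorem integral_abs_mul_hermiteOne_le (n : ℕ) :
    ∫ r, |r * hermiteOne n r| ≤ 2 * ((n : ℝ) + 4) ^ 2 :=
  integral_abs_lin_hermiteOne_le n 1 1 (by simp) (by simp)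
    fun r => by rw [mul_hermiteOne]; ring

theorem integral_abs_hermiteOneD_le (n : ℕ) :
    ∫ r, |hermiteOneD n r| ≤ 2 * ((n : ℝ) + 4) ^ 2 :=
  integral_abs_lin_hermiteOne_le n (-1) 1 (by simp) (by simp)
    fun r => by rw [hermiteOneD_eq]; ring

/-! ### Mehler's formula -/

/-- The value at a real point of the `n`-th probabilists' Hermite polynomial. -/
def hermiteVal (n : ℕ) (x : ℝ) : ℝ := Polynomial.aeval x (Polynomial.hermite n)

theorem hermiteVal_add_two (n : ℕ) (x : ℝ) :
    hermiteVal (n + 2) x = x * hermiteVal (n + 1) x - (n + 1) * hermiteVal n x := by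
  rw [hermiteVal, hermite_add_two]
  simp only [map_sub, map_mul, map_add, Polynomial.aeval_X, map_natCast, map_one, hermiteVal]

/-- Young's inequality. With `b = |s|`, the coefficient `(1 + σ) / 2 < 1` leaves a part of the
weight `exp (-s²/2)` for integrability in `s`. -/
theorem abs_add_sq_mul_le {σ : ℝ} (h0 : 0 < σ) (h1 : σ < 1) :
    ∃ K : ℝ, 0 < K ∧ ∀ a b : ℝ, σ * (a + b) ^ 2 ≤ (1 + σ) / 2 * b ^ 2 + K * a ^ 2 := by
  have hd : 0 < (1 + σ) / 2 - σ := by linarith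
  refine ⟨σ + σ ^ 2 / ((1 + σ) / 2 - σ), by positivity, fun a b => ?_⟩
  set d := (1 + σ) / 2 - σ with hdd
  have e : (1 + σ) / 2 = σ + d := by rw [hdd]; ring
  have : (σ + d) * b ^ 2 + (σ + σ ^ 2 / d) * a ^ 2 - σ * (a + b) ^ 2 =
      (d * b - σ * a) ^ 2 / d := by field_simp; ring
  have h3 : 0 ≤ (d * b - σ * a) ^ 2 / d := by positivity
  rw [e]; linarith

theorem pow_le_sqrt_factorial_mul_exp (n : ℕ) {r : ℝ} (hr : 0 ≤ r) :
    r ^ n ≤ Real.sqrt n.factorial * Real.exp (r ^ 2 / 2) := by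
  have h := Real.pow_div_factorial_le_exp (r ^ 2) (by positivity) n
  rw [div_le_iff₀' (by positivity)] at h
  refine (pow_le_pow_iff_left₀ (by positivity) (by positivity) two_ne_zero).1 ?_
  rw [mul_pow, Real.sq_sqrt (by positivity), ← Real.exp_nat_mul]
  calc (r ^ n) ^ 2 = (r ^ 2) ^ n := by ring
    _ ≤ _ := h
    _ = _ := by congr 2; push_cast; ring

theorem norm_add_mul_I_le (x s : ℝ) : ‖(x : ℂ) + s * Complex.I‖ ≤ |x| + |s| := by
  refine (norm_add_le _ _).trans (le_of_eq ?_)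
  simp

/-- The integrand of the Gaussian representation of Hermite polynomials. -/
def hermiteIntegrand (n : ℕ) (x s : ℝ) : ℂ :=
  ((x : ℂ) + s * Complex.I) ^ n * (Real.exp (-(s ^ 2 / 2)) : ℂ)

theorem continuous_hermiteIntegrand (n : ℕ) (x : ℝ) : Continuous (hermiteIntegrand n x) := by
  unfold hermiteIntegrand; fun_prop

/-- Comes from `r^n ≤ √(n!) exp (r²/2)` at `r = √σ (|x| + |s|)`. Letting `σ` be arbitrarily close to
one is essential: two such factors meet `|q|^n / n!` in Mehler's series, which has to converge for
every `|q| < 1`. -/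
theorem norm_hermiteIntegrand_bound {σ : ℝ} (h0 : 0 < σ) (h1 : σ < 1) (x : ℝ) :
    ∃ C : ℝ, 0 ≤ C ∧ ∀ n : ℕ, Integrable (hermiteIntegrand n x) ∧
      ∫ s, ‖hermiteIntegrand n x s‖ ≤ C * Real.sqrt n.factorial * (Real.sqrt σ)⁻¹ ^ n := by
  obtain ⟨K, hK, hab⟩ := abs_add_sq_mul_le h0 h1
  set g : ℝ → ℝ := fun s => Real.exp (K * x ^ 2 / 2) * Real.exp (-((1 - σ) / 4) * s ^ 2) with hg
  have hgi : Integrable g := (integrable_exp_neg_mul_sq (by linarith)).const_mul _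
  have hb : ∀ n s, ‖hermiteIntegrand n x s‖ ≤
      (Real.sqrt n.factorial * (Real.sqrt σ)⁻¹ ^ n) * g s := by
    intro n s
    have hσ : 0 < Real.sqrt σ := Real.sqrt_pos.2 h0
    have h2 := pow_le_sqrt_factorial_mul_exp n
      (r := Real.sqrt σ * (|x| + |s|)) (by positivity)
    rw [mul_pow, mul_pow, Real.sq_sqrt h0.le] at h2
    have h3 : (|x| + |s|) ^ n ≤ (Real.sqrt σ)⁻¹ ^ n *
        (Real.sqrt n.factorial * Real.exp (σ * (|x| + |s|) ^ 2 / 2)) := by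
      rw [inv_pow, ← div_eq_inv_mul, le_div_iff₀' (by positivity)]
      exact h2
    rw [hermiteIntegrand, norm_mul, norm_pow, Complex.norm_real, Real.norm_eq_abs, Real.abs_exp]
    calc ‖(x : ℂ) + s * Complex.I‖ ^ n * Real.exp (-(s ^ 2 / 2))
        ≤ ((Real.sqrt σ)⁻¹ ^ n * (Real.sqrt n.factorial *
          Real.exp (σ * (|x| + |s|) ^ 2 / 2))) * Real.exp (-(s ^ 2 / 2)) := by
          gcongr
          exact (pow_le_pow_left₀ (norm_nonneg _) (norm_add_mul_I_le x s) n).trans h3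
      _ = (Real.sqrt n.factorial * (Real.sqrt σ)⁻¹ ^ n) *
          Real.exp (σ * (|x| + |s|) ^ 2 / 2 + -(s ^ 2 / 2)) := by
          rw [Real.exp_add]; ring
      _ ≤ _ := by
          rw [hg]
          simp only
          rw [← Real.exp_add]
          refine mul_le_mul_of_nonneg_left (Real.exp_le_exp.2 ?_) (by positivity)
          have := hab |x| |s|
          rw [sq_abs, sq_abs] at this
          linarith
  refine ⟨∫ s, g s, integral_nonneg fun s => by positivity, fun n => ?_⟩
  have hi : Integrable (hermiteIntegrand n x) :=
    (hgi.const_mul _).mono' (continuous_hermiteIntegrand n x).aestronglyMeasurable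
      (Eventually.of_forall fun s => hb n s)
  refine ⟨hi, ?_⟩
  calc _ ≤ ∫ s, (Real.sqrt n.factorial * (Real.sqrt σ)⁻¹ ^ n) * g s :=
        integral_mono hi.norm (hgi.const_mul _) (hb n)
    _ = _ := by rw [integral_const_mul]; ring

theorem integrable_hermiteIntegrand (n : ℕ) (x : ℝ) : Integrable (hermiteIntegrand n x) := by
  obtain ⟨C, -, h⟩ := norm_hermiteIntegrand_bound (σ := 1 / 2) (by norm_num) (by norm_num) x
  exact (h n).1

/-- One factor `x + is` is expanded, and `s exp (-s²/2)` is integrated by parts. The outcome is the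
recurrence of the Hermite polynomials, so the Gaussian representation only has to be checked for `n
= 0, 1`. -/
theorem integral_hermiteIntegrand_add_two (n : ℕ) (x : ℝ) :
    ∫ s, hermiteIntegrand (n + 2) x s = x * (∫ s, hermiteIntegrand (n + 1) x s) -
      (n + 1) * ∫ s, hermiteIntegrand n x s := by
  have hu : ∀ s : ℝ, HasDerivAt (fun s : ℝ => ((x : ℂ) + s * Complex.I) ^ (n + 1))
      ((n + 1) * Complex.I * ((x : ℂ) + s * Complex.I) ^ n) s := by
    intro s
    have h1 : HasDerivAt (fun s : ℝ => (x : ℂ) + s * Complex.I) (1 * Complex.I) s :=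
      ((hasDerivAt_id s).ofReal_comp.mul_const Complex.I).const_add _
    refine (h1.pow (n + 1)).congr_deriv ?_
    push_cast
    ring
  have hv : ∀ s : ℝ, HasDerivAt (fun s : ℝ => (Real.exp (-(s ^ 2 / 2)) : ℂ))
      (-((s : ℂ) * (Real.exp (-(s ^ 2 / 2)) : ℂ))) s := by
    intro s
    refine (hasDerivAt_gauss s).ofReal_comp.congr_deriv ?_
    push_cast; ring
  have e2 : ∀ s, hermiteIntegrand (n + 2) x s = x * hermiteIntegrand (n + 1) x s -
      Complex.I * (((x : ℂ) + s * Complex.I) ^ (n + 1) *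
        -((s : ℂ) * (Real.exp (-(s ^ 2 / 2)) : ℂ))) := by
    intro s
    simp only [hermiteIntegrand]
    ring
  have i2 : Integrable (fun s : ℝ => ((x : ℂ) + s * Complex.I) ^ (n + 1) *
        -((s : ℂ) * (Real.exp (-(s ^ 2 / 2)) : ℂ))) := by
    have h := ((integrable_hermiteIntegrand (n + 1) x).const_mul (x : ℂ)).sub
      (integrable_hermiteIntegrand (n + 2) x)
    refine (h.const_mul (-Complex.I)).congr (Eventually.of_forall fun s => ?_)
    simp only [Pi.sub_apply, e2 s]
    linear_combination (-((x : ℂ) + s * Complex.I) ^ (n + 1) *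
        -((s : ℂ) * (Real.exp (-(s ^ 2 / 2)) : ℂ))) * Complex.I_mul_I
  have hI := integral_mul_deriv_eq_deriv_mul_of_integrable
    (fun s _ => hu s) (fun s _ => hv s) i2
    (by
      refine ((integrable_hermiteIntegrand n x).const_mul ((n + 1) * Complex.I)).congr
        (Eventually.of_forall fun s => ?_)
      simp only [hermiteIntegrand, Pi.mul_apply]; ring)
    (integrable_hermiteIntegrand (n + 1) x)
  simp only [e2]
  rw [integral_sub ((integrable_hermiteIntegrand (n + 1) x).const_mul _) (i2.const_mul _),
    integral_const_mul, integral_const_mul, hI]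
  have e3 : ∫ s : ℝ, (n + 1) * Complex.I * ((x : ℂ) + s * Complex.I) ^ n *
      (Real.exp (-(s ^ 2 / 2)) : ℂ) = (n + 1) * Complex.I * ∫ s, hermiteIntegrand n x s := by
    rw [← integral_const_mul]
    congr 1; funext s; simp only [hermiteIntegrand]; ring
  rw [e3]
  linear_combination ((n : ℂ) + 1) * (∫ s, hermiteIntegrand n x s) * Complex.I_mul_I

theorem integral_exp_neg_sq_div_two : ∫ s : ℝ, Real.exp (-(s ^ 2 / 2)) = Real.sqrt (2 * Real.pi) := by
  have := integral_gaussian (1 / 2)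
  rw [show Real.pi / (1 / 2) = 2 * Real.pi by ring] at this
  rw [← this]
  congr 1; funext s; congr 1; ring

theorem integral_hermiteIntegrand (n : ℕ) (x : ℝ) :
    ∫ s, hermiteIntegrand n x s = (Real.sqrt (2 * Real.pi) : ℂ) * hermiteVal n x := by
  have h0 : ∫ s, hermiteIntegrand 0 x s = (Real.sqrt (2 * Real.pi) : ℂ) * hermiteVal 0 x := by
    simp only [hermiteIntegrand, pow_zero, one_mul, hermiteVal, Polynomial.hermite_zero]
    rw [integral_complex_ofReal, integral_exp_neg_sq_div_two]; simp
  have h1 : ∫ s, hermiteIntegrand 1 x s = (Real.sqrt (2 * Real.pi) : ℂ) * hermiteVal 1 x := by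
    have e : ∀ s, hermiteIntegrand 1 x s = (x * Real.exp (-(s ^ 2 / 2)) : ℝ) +
        Complex.I * (s * Real.exp (-(1 / 2) * s ^ 2) : ℝ) := by
      intro s
      rw [show -(1 / 2) * s ^ 2 = -(s ^ 2 / 2) by ring]
      simp only [hermiteIntegrand]; push_cast; ring
    have i1 : Integrable (fun s : ℝ => s * Real.exp (-(1 / 2) * s ^ 2)) :=
      integrable_mul_exp_neg_mul_sq (by norm_num)
    have i0 : Integrable (fun s : ℝ => x * Real.exp (-(s ^ 2 / 2))) := by
      refine ((integrable_exp_neg_mul_sq (b := 1 / 2) (by norm_num)).const_mul x).congr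
        (Eventually.of_forall fun s => ?_)
      simp only; congr 2; ring
    have hodd : ∫ s : ℝ, s * Real.exp (-(1 / 2) * s ^ 2) = 0 := by
      have := integral_neg_eq_self (fun s : ℝ => s * Real.exp (-(1 / 2) * s ^ 2)) volume
      simp only [neg_mul, neg_sq, integral_neg] at this
      simp only [neg_mul]
      linarith
    simp only [e]
    rw [integral_add i0.ofReal (i1.ofReal.const_mul _), integral_const_mul,
      integral_complex_ofReal, integral_complex_ofReal, hodd, integral_const_mul,
      integral_exp_neg_sq_div_two]
    simp [hermiteVal]
    ring
  induction n using Nat.twoStepInduction with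
  | zero => exact h0
  | one => exact h1
  | more n ih0 ih1 =>
    rw [integral_hermiteIntegrand_add_two, ih0, ih1, hermiteVal_add_two]
    push_cast; ring

theorem hermiteVal_bound {σ : ℝ} (h0 : 0 < σ) (h1 : σ < 1) (x : ℝ) :
    ∃ C : ℝ, 0 ≤ C ∧ ∀ n : ℕ,
      |hermiteVal n x| ≤ C * Real.sqrt n.factorial * (Real.sqrt σ)⁻¹ ^ n := by
  obtain ⟨C, hC, h⟩ := norm_hermiteIntegrand_bound h0 h1 x
  have hp : 0 < Real.sqrt (2 * Real.pi) := by positivity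
  refine ⟨C / Real.sqrt (2 * Real.pi), by positivity, fun n => ?_⟩
  have h2 : ‖∫ s, hermiteIntegrand n x s‖ ≤ _ := (norm_integral_le_integral_norm _).trans (h n).2
  rw [integral_hermiteIntegrand, norm_mul, Complex.norm_real, Complex.norm_real,
    Real.norm_eq_abs, Real.norm_eq_abs, abs_of_pos hp] at h2
  rw [div_mul_eq_mul_div, div_mul_eq_mul_div, le_div_iff₀' hp]
  exact h2

/-- Replacing `w^n` by the Hermite polynomial in an entire series amounts to averaging `f (x + is)`
over a Gaussian `s`. Used on the exponential series this gives the generating function; used on the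
generating function it gives Mehler's formula. -/
theorem hasSum_mul_hermiteVal {a : ℕ → ℂ} {f : ℂ → ℂ} {σ : ℝ} (h0 : 0 < σ) (h1 : σ < 1)
    (ha : Summable fun n => ‖a n‖ * (Real.sqrt n.factorial * (Real.sqrt σ)⁻¹ ^ n))
    (hf : ∀ w, HasSum (fun n => a n * w ^ n) (f w)) (x : ℝ) :
    HasSum (fun n => a n * hermiteVal n x) ((Real.sqrt (2 * Real.pi) : ℂ)⁻¹ *
      ∫ s : ℝ, f ((x : ℂ) + s * Complex.I) * Complex.exp (-(s ^ 2 / 2))) := by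
  obtain ⟨C, hC, h⟩ := norm_hermiteIntegrand_bound h0 h1 x
  have hp : (Real.sqrt (2 * Real.pi) : ℂ) ≠ 0 := by
    rw [Complex.ofReal_ne_zero]; positivity
  have key := hasSum_integral_of_summable_integral_norm
    (F := fun n s => a n * hermiteIntegrand n x s) (μ := volume)
    (fun n => (integrable_hermiteIntegrand n x).const_mul _)
    (by
      refine Summable.of_nonneg_of_le (fun n => integral_nonneg fun s => norm_nonneg _)
        (fun n => ?_) (ha.mul_left C)
      simp only [norm_mul, integral_const_mul]
      have := mul_le_mul_of_nonneg_left (h n).2 (norm_nonneg (a n))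
      linarith)
  have e : ∀ s : ℝ, ∑' n, a n * hermiteIntegrand n x s =
      f ((x : ℂ) + s * Complex.I) * Complex.exp (-(s ^ 2 / 2)) := by
    intro s
    have := ((hf ((x : ℂ) + s * Complex.I)).mul_right (Complex.exp (-(s ^ 2 / 2)))).tsum_eq
    rw [← this]
    congr 1; funext n
    simp only [hermiteIntegrand]; push_cast; ring
  simp only [e, integral_const_mul, integral_hermiteIntegrand] at key
  refine (key.mul_left (Real.sqrt (2 * Real.pi) : ℂ)⁻¹).congr_fun fun n => ?_
  field_simp

theorem summable_pow_div_sqrt_factorial {r : ℝ} (hr : 0 ≤ r) :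
    Summable fun n : ℕ => r ^ n / Real.sqrt n.factorial := by
  refine Summable.of_nonneg_of_le (fun n => by positivity) (fun n => ?_)
    ((summable_geometric_of_lt_one (r := 1 / 2) (by norm_num) (by norm_num)).mul_left
      (Real.exp ((2 * r) ^ 2 / 2)))
  have h := pow_le_sqrt_factorial_mul_exp n (r := 2 * r) (by positivity)
  have : (0 : ℝ) < Real.sqrt n.factorial := by positivity
  rw [div_le_iff₀ this, one_div, inv_pow, mul_assoc, ← div_eq_inv_mul, ← mul_div_assoc,
    le_div_iff₀ (by positivity), ← mul_pow]
  rw [mul_comm r]; linarith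

theorem hasSum_hermiteVal_generating (x : ℝ) (t : ℂ) :
    HasSum (fun n : ℕ => t ^ n / n.factorial * hermiteVal n x)
      (Complex.exp (x * t - t ^ 2 / 2)) := by
  have h := hasSum_mul_hermiteVal (a := fun n => t ^ n / n.factorial)
    (f := fun w => Complex.exp (t * w)) (σ := 1 / 2) (by norm_num) (by norm_num)
    (by
      refine (summable_pow_div_sqrt_factorial (r := ‖t‖ * (Real.sqrt (1 / 2))⁻¹)
        (by positivity)).congr fun n => ?_
      have h1 : Real.sqrt n.factorial * Real.sqrt n.factorial = n.factorial :=
        Real.mul_self_sqrt (by positivity)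
      have h2 : (0 : ℝ) < Real.sqrt n.factorial := by positivity
      rw [norm_div, norm_pow, Complex.norm_natCast, mul_pow]
      field_simp
      rw [sq, h1])
    (fun w => by
      have := NormedSpace.expSeries_div_hasSum_exp (t * w)
      rw [← Complex.exp_eq_exp_ℂ] at this
      refine this.congr_fun fun n => ?_
      rw [mul_pow]; ring) x
  convert h using 1
  have e : ∀ s : ℝ, Complex.exp (t * ((x : ℂ) + s * Complex.I)) * Complex.exp (-(s ^ 2 / 2)) =
      Complex.exp ((-(1 / 2) : ℂ) * s ^ 2 + (t * Complex.I) * s + t * x) := by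
    intro s
    rw [← Complex.exp_add]; congr 1; ring
  simp only [e]
  rw [integral_cexp_quadratic (by simp)]
  have hp : (Real.sqrt (2 * Real.pi) : ℂ) ≠ 0 := by
    rw [Complex.ofReal_ne_zero]; positivity
  have hq : ((Real.pi : ℂ) / -(-(1 / 2))) ^ (1 / 2 : ℂ) = (Real.sqrt (2 * Real.pi) : ℂ) := by
    rw [Real.sqrt_eq_rpow, Complex.ofReal_cpow (by positivity)]
    push_cast
    congr 1
    ring
  rw [hq, ← mul_assoc, inv_mul_cancel₀ hp, one_mul]
  congr 1
  have := Complex.I_sq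
  rw [mul_pow, this]
  ring

/-- Mehler's kernel `∑ q^n h_n(x) h_n(y)`. -/
def mehler (q : ℂ) (x y : ℝ) : ℂ :=
  (Real.sqrt Real.pi : ℂ)⁻¹ * (Real.sqrt (2 * Real.pi) : ℂ)⁻¹ *
    (2 * Real.pi / (1 - q ^ 2)) ^ (1 / 2 : ℂ) *
    Complex.exp (-((1 - q) / (1 + q) * (x + y) ^ 2 / 4) - (1 + q) / (1 - q) * (x - y) ^ 2 / 4)

theorem one_sub_sq_re_pos {q : ℂ} (hq : ‖q‖ < 1) : 0 < (1 - q ^ 2).re := by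
  have h1 : ‖q ^ 2‖ < 1 := by
    rw [norm_pow]; exact pow_lt_one₀ (norm_nonneg _) hq two_ne_zero
  have := Complex.re_le_norm (q ^ 2)
  simp only [Complex.sub_re, Complex.one_re]
  linarith

theorem one_sub_ne_zero_of_norm_lt {q : ℂ} (hq : ‖q‖ < 1) : 1 - q ≠ 0 := by
  intro h
  rw [sub_eq_zero] at h
  rw [← h] at hq; simp at hq

theorem one_add_ne_zero_of_norm_lt {q : ℂ} (hq : ‖q‖ < 1) : 1 + q ≠ 0 := by
  have := one_sub_ne_zero_of_norm_lt (q := -q) (by rwa [norm_neg])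
  rwa [sub_neg_eq_add] at this

theorem hermiteNorm_sq (n : ℕ) :
    hermiteNorm n * hermiteNorm n = (Real.sqrt Real.pi)⁻¹ * (n.factorial : ℝ)⁻¹ := by
  rw [hermiteNorm, ← mul_inv, Real.mul_self_sqrt (by positivity), mul_inv, mul_comm]

/-- The choice `σ = (1 + ρ) / 2` lies strictly between `ρ` and `1`. The two factors `√(n!) σ^{-n/2}`
cancel `1 / n!` and leave the geometric series of ratio `ρ / σ`. -/
theorem summable_hermiteVal_sq {ρ : ℝ} (h0 : 0 ≤ ρ) (h1 : ρ < 1) (x : ℝ) :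
    Summable fun n : ℕ => ρ ^ n / n.factorial * |hermiteVal n x| *
      (Real.sqrt n.factorial * (Real.sqrt ((1 + ρ) / 2))⁻¹ ^ n) := by
  have hσ : 0 < (1 + ρ) / 2 := by linarith
  obtain ⟨C, hC, h⟩ := hermiteVal_bound (σ := (1 + ρ) / 2) hσ (by linarith) x
  have hlt : ρ / ((1 + ρ) / 2) < 1 := by rw [div_lt_one hσ]; linarith
  refine Summable.of_nonneg_of_le (fun n => by positivity) (fun n => ?_)
    ((summable_geometric_of_lt_one (by positivity) hlt).mul_left C)
  have h1 : Real.sqrt n.factorial * Real.sqrt n.factorial = n.factorial :=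
    Real.mul_self_sqrt (by positivity)
  have h2 : (Real.sqrt ((1 + ρ) / 2))⁻¹ ^ n * (Real.sqrt ((1 + ρ) / 2))⁻¹ ^ n =
      ((1 + ρ) / 2)⁻¹ ^ n := by
    rw [← mul_pow, ← mul_inv, Real.mul_self_sqrt hσ.le]
  have h3 : (n.factorial : ℝ) ≠ 0 := by positivity
  calc _ ≤ ρ ^ n / n.factorial * (C * Real.sqrt n.factorial * (Real.sqrt ((1 + ρ) / 2))⁻¹ ^ n) *
      (Real.sqrt n.factorial * (Real.sqrt ((1 + ρ) / 2))⁻¹ ^ n) := by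
        gcongr
        exact h n
    _ = C * (ρ ^ n / n.factorial * (Real.sqrt n.factorial * Real.sqrt n.factorial) *
      ((Real.sqrt ((1 + ρ) / 2))⁻¹ ^ n * (Real.sqrt ((1 + ρ) / 2))⁻¹ ^ n)) := by ring
    _ = _ := by
        rw [h1, h2, div_mul_cancel₀ _ h3, div_eq_mul_inv ρ, mul_pow ρ]

/-- The coefficients `q^n He_n(X) / n!` are those of the generating function in the variable `q w`.
Averaging it over `w = Y + is` leaves a Gaussian integral, finite because `Re (1 - q²) > 0`. The
dilation by `√2` passes from the probabilists' polynomials to the weight `exp (-x²/2)`. -/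
theorem hasSum_mehler {q : ℂ} (hq : ‖q‖ < 1) (x y : ℝ) :
    HasSum (fun n : ℕ => q ^ n * (hermiteOne n x * hermiteOne n y : ℝ)) (mehler q x y) := by
  set X : ℝ := Real.sqrt 2 * x with hX
  set Y : ℝ := Real.sqrt 2 * y with hY
  have h := hasSum_mul_hermiteVal (a := fun n => q ^ n / n.factorial * hermiteVal n X)
    (f := fun w => Complex.exp (X * (q * w) - (q * w) ^ 2 / 2)) (σ := (1 + ‖q‖) / 2)
    (by positivity) (by linarith)
    (by
      refine (summable_hermiteVal_sq (norm_nonneg q) hq X).congr fun n => ?_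
      rw [norm_mul, norm_div, norm_pow, Complex.norm_natCast, Complex.norm_real,
        Real.norm_eq_abs])
    (fun w => by
      refine (hasSum_hermiteVal_generating X (q * w)).congr_fun fun n => ?_
      rw [mul_pow]; ring) Y
  have h2 := h.mul_left ((Real.sqrt Real.pi : ℂ)⁻¹ * (Real.exp (-(x ^ 2 / 2)) : ℂ) *
    (Real.exp (-(y ^ 2 / 2)) : ℂ))
  suffices hval : (Real.sqrt Real.pi : ℂ)⁻¹ * (Real.exp (-(x ^ 2 / 2)) : ℂ) *
      (Real.exp (-(y ^ 2 / 2)) : ℂ) * ((Real.sqrt (2 * Real.pi) : ℂ)⁻¹ *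
      ∫ s : ℝ, Complex.exp (X * (q * ((Y : ℂ) + s * Complex.I)) -
        (q * ((Y : ℂ) + s * Complex.I)) ^ 2 / 2) * Complex.exp (-(s ^ 2 / 2))) = mehler q x y by
    rw [← hval]
    refine h2.congr_fun fun n => ?_
    have := hermiteNorm_sq n
    have e : (hermiteOne n x * hermiteOne n y : ℝ) = (hermiteNorm n * hermiteNorm n) *
      (hermiteVal n X * hermiteVal n Y) * (Real.exp (-(x ^ 2 / 2)) * Real.exp (-(y ^ 2 / 2))) := by
      simp only [hermiteOne_eq, hermiteVal, hX, hY]; ring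
    rw [e, this]
    push_cast
    ring
  have e : ∀ s : ℝ, Complex.exp (X * (q * ((Y : ℂ) + s * Complex.I)) -
      (q * ((Y : ℂ) + s * Complex.I)) ^ 2 / 2) * Complex.exp (-(s ^ 2 / 2)) =
      Complex.exp (-((1 - q ^ 2) / 2) * s ^ 2 + (Complex.I * q * (X - q * Y)) * s +
        (X * q * Y - q ^ 2 * Y ^ 2 / 2)) := by
    intro s
    rw [← Complex.exp_add]; congr 1
    linear_combination (-(q ^ 2 * s ^ 2) / 2) * Complex.I_sq
  simp only [e]
  have hre := one_sub_sq_re_pos hq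
  have hne : (1 - q ^ 2 : ℂ) ≠ 0 := by
    intro h0; rw [h0] at hre; simp at hre
  rw [integral_cexp_quadratic (by
    rw [Complex.neg_re, show ((1 - q ^ 2) / 2 : ℂ) = (1 - q ^ 2) * ((1 / 2 : ℝ) : ℂ) by
      push_cast; ring, Complex.re_mul_ofReal]
    linarith)]
  have h1 := one_sub_ne_zero_of_norm_lt hq
  have h2 := one_add_ne_zero_of_norm_lt hq
  have hc : (Real.pi : ℂ) / -(-((1 - q ^ 2) / 2)) = 2 * Real.pi / (1 - q ^ 2) := by
    field_simp
  rw [hc, mehler]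
  push_cast
  have hs : (Real.sqrt 2 : ℂ) ^ 2 = 2 := by
    rw [← Complex.ofReal_pow, Real.sq_sqrt (by norm_num)]; simp
  have hexp : Complex.exp (-((1 - q) / (1 + q) * (x + y) ^ 2 / 4) -
      (1 + q) / (1 - q) * (x - y) ^ 2 / 4) = Complex.exp (-(x ^ 2 / 2)) *
      Complex.exp (-(y ^ 2 / 2)) * Complex.exp (X * q * Y - q ^ 2 * Y ^ 2 / 2 -
        (Complex.I * q * (X - q * Y)) ^ 2 / (4 * -((1 - q ^ 2) / 2))) := by
    rw [← Complex.exp_add, ← Complex.exp_add]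
    congr 1
    rw [mul_pow, mul_pow, Complex.I_sq, hX, hY]
    push_cast
    have e3 : (1 - q ^ 2 : ℂ) = (1 - q) * (1 + q) := by ring
    have e4 : (Real.sqrt 2 * x * q * (Real.sqrt 2 * y) - q ^ 2 * (Real.sqrt 2 * y) ^ 2 / 2 : ℂ) =
      2 * x * q * y - q ^ 2 * y ^ 2 := by linear_combination (x * q * y - q ^ 2 * y ^ 2 / 2) * hs
    have e5 : (Real.sqrt 2 * x - q * (Real.sqrt 2 * y) : ℂ) ^ 2 = 2 * (x - q * y) ^ 2 := by
      linear_combination (x - q * y) ^ 2 * hs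
    rw [e4, e5, e3]
    field_simp
    ring
  rw [hexp]
  ring

/-- The real parts of `(1 - q)/(1 + q)` and of its inverse are `(1 - |q|²)/|1 + q|²` and `(1 -
|q|²)/|1 - q|²`. Both are positive, so at complex times the modulus is still a decaying Gaussian in
`x + y` and `x - y`. -/
theorem norm_mehler {q : ℂ} (hq : ‖q‖ < 1) (x y : ℝ) :
    ‖mehler q x y‖ = (Real.sqrt Real.pi)⁻¹ * (Real.sqrt (‖1 + q‖ * ‖1 - q‖))⁻¹ *
      Real.exp (-((1 - ‖q‖ ^ 2) * (x + y) ^ 2 / (4 * ‖1 + q‖ ^ 2)) -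
        (1 - ‖q‖ ^ 2) * (x - y) ^ 2 / (4 * ‖1 - q‖ ^ 2)) := by
  have h1 := one_sub_ne_zero_of_norm_lt hq
  have h2 := one_add_ne_zero_of_norm_lt hq
  have n1 : 0 < ‖1 - q‖ := norm_pos_iff.2 h1
  have n2 : 0 < ‖1 + q‖ := norm_pos_iff.2 h2
  have hqs : ‖q‖ ^ 2 = q.re ^ 2 + q.im ^ 2 := by
    rw [← Complex.normSq_eq_norm_sq, Complex.normSq_apply]; ring
  have hre : ((1 - q) / (1 + q)).re = (1 - ‖q‖ ^ 2) / ‖1 + q‖ ^ 2 := by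
    rw [Complex.div_re, hqs, ← Complex.normSq_eq_norm_sq]
    simp; ring
  have hre' : ((1 + q) / (1 - q)).re = (1 - ‖q‖ ^ 2) / ‖1 - q‖ ^ 2 := by
    rw [Complex.div_re, hqs, ← Complex.normSq_eq_norm_sq]
    simp; ring
  have hc : ‖(2 * Real.pi / (1 - q ^ 2) : ℂ) ^ (1 / 2 : ℂ)‖ =
      Real.sqrt (2 * Real.pi) * (Real.sqrt (‖1 + q‖ * ‖1 - q‖))⁻¹ := by
    have := Complex.norm_cpow_real (2 * Real.pi / (1 - q ^ 2) : ℂ) (1 / 2)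
    push_cast at this
    rw [this, ← Real.sqrt_eq_rpow, norm_div, show (1 - q ^ 2 : ℂ) = (1 + q) * (1 - q) by ring,
      norm_mul (1 + q), Real.sqrt_div' _ (by positivity), div_eq_mul_inv]
    congr 2
    rw [norm_mul, Complex.norm_real, Real.norm_eq_abs, abs_of_pos Real.pi_pos]; simp
  have he : (-((1 - q) / (1 + q) * (x + y) ^ 2 / 4) - (1 + q) / (1 - q) * (x - y) ^ 2 / 4 : ℂ).re =
      -((1 - ‖q‖ ^ 2) * (x + y) ^ 2 / (4 * ‖1 + q‖ ^ 2)) -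
        (1 - ‖q‖ ^ 2) * (x - y) ^ 2 / (4 * ‖1 - q‖ ^ 2) := by
    have e1 : ((1 - q) / (1 + q) * (x + y) ^ 2 / 4 : ℂ) =
      (1 - q) / (1 + q) * (((x + y) ^ 2 / 4 : ℝ) : ℂ) := by push_cast; ring
    have e2 : ((1 + q) / (1 - q) * (x - y) ^ 2 / 4 : ℂ) =
      (1 + q) / (1 - q) * (((x - y) ^ 2 / 4 : ℝ) : ℂ) := by push_cast; ring
    rw [e1, e2, Complex.sub_re, Complex.neg_re, Complex.re_mul_ofReal, Complex.re_mul_ofReal,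
      hre, hre']
    field_simp
  rw [mehler, norm_mul, norm_mul, norm_mul, hc, Complex.norm_exp, he, norm_inv, norm_inv,
    Complex.norm_real, Complex.norm_real, Real.norm_eq_abs, Real.norm_eq_abs,
    abs_of_nonneg (Real.sqrt_nonneg _), abs_of_nonneg (Real.sqrt_nonneg _)]
  have : Real.sqrt (2 * Real.pi) ≠ 0 := by positivity
  field_simp

/-- On the diagonal and at the real point `q = ρ²`, Mehler's series has nonnegative terms, so each
of them is bounded by the sum. This crude bound, uniform in `x`, is enough for every convergence
question below. -/
theorem pow_mul_abs_hermiteOne_le {ρ : ℝ} (h0 : 0 < ρ) (h1 : ρ < 1) :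
    ∃ C : ℝ, 0 ≤ C ∧ ∀ n x, ρ ^ n * |hermiteOne n x| ≤ C := by
  set q : ℂ := ((ρ ^ 2 : ℝ) : ℂ) with hqd
  have hqn : ‖q‖ = ρ ^ 2 := by
    rw [hqd, Complex.norm_real, Real.norm_eq_abs, abs_of_pos (by positivity)]
  have hq : ‖q‖ < 1 := by rw [hqn]; exact pow_lt_one₀ h0.le h1 two_ne_zero
  set M := (Real.sqrt Real.pi)⁻¹ * (Real.sqrt (‖1 + q‖ * ‖1 - q‖))⁻¹ with hM
  have hM0 : 0 ≤ M := by positivity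
  refine ⟨Real.sqrt M, Real.sqrt_nonneg _, fun n x => ?_⟩
  have hs := hasSum_mehler hq x x
  have hs' : HasSum (fun n : ℕ => (ρ ^ 2) ^ n * (hermiteOne n x * hermiteOne n x))
      (mehler q x x).re := by
    refine (Complex.hasSum_re hs).congr_fun fun n => ?_
    rw [hqd, ← Complex.ofReal_pow, ← Complex.ofReal_mul, Complex.ofReal_re]
  have h2 := le_hasSum hs' n fun j _ => mul_nonneg (by positivity) (mul_self_nonneg _)
  have h3 : (mehler q x x).re ≤ M := by
    refine (Complex.re_le_norm _).trans ?_
    rw [norm_mehler hq]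
    refine mul_le_of_le_one_right hM0 (Real.exp_le_one_iff.2 ?_)
    have : 0 ≤ 1 - ‖q‖ ^ 2 := by nlinarith [norm_nonneg q]
    have e1 : 0 ≤ (1 - ‖q‖ ^ 2) * (x + x) ^ 2 / (4 * ‖1 + q‖ ^ 2) := by positivity
    have e2 : 0 ≤ (1 - ‖q‖ ^ 2) * (x - x) ^ 2 / (4 * ‖1 - q‖ ^ 2) := by positivity
    linarith
  refine Real.le_sqrt_of_sq_le ?_
  rw [mul_pow, sq_abs]
  calc _ = (ρ ^ 2) ^ n * (hermiteOne n x * hermiteOne n x) := by ring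
    _ ≤ M := h2.trans h3

/-- The kernel `∑ q^n h_n(x) h_n'(y)`. -/
def mehlerD (q : ℂ) (x y : ℝ) : ℂ :=
  (2 * q * x - (1 + q ^ 2) * y) / (1 - q ^ 2) * mehler q x y

/-- With `|q| < σ < 1` and `ρ = √σ`, each Hermite factor grows at most like `ρ^{-n}`, so the terms
are `O(n (|q| / σ)^n)`. -/
theorem summable_pow_mul_hermiteOne {q : ℂ} (hq : ‖q‖ < 1) (k l : ℕ) (x y : ℝ) :
    Summable fun n : ℕ => q ^ n * (ladder (n + 1) * (hermiteOne (n + k) x * hermiteOne (n + l) y) : ℝ) := by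
  obtain ⟨σ, hσ1, hσ2⟩ := exists_between hq
  have hσ : 0 < σ := (norm_nonneg q).trans_lt hσ1
  set ρ := Real.sqrt σ with hρ
  have hρ0 : 0 < ρ := Real.sqrt_pos.2 hσ
  have hρ1 : ρ < 1 := by rw [hρ, Real.sqrt_lt' one_pos]; simpa using hσ2
  have hρ2 : ρ * ρ = σ := Real.mul_self_sqrt hσ.le
  obtain ⟨C, hC, hb⟩ := pow_mul_abs_hermiteOne_le hρ0 hρ1
  have hlt : ‖‖q‖ / σ‖ < 1 := by
    rw [Real.norm_eq_abs, abs_of_nonneg (by positivity), div_lt_one hσ]; exact hσ1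
  have hs : Summable fun n : ℕ => ((n : ℝ) + 2) * (‖q‖ / σ) ^ n := by
    have h1 := summable_pow_mul_geometric_of_norm_lt_one 1 hlt
    have h2 := (summable_geometric_of_norm_lt_one hlt).mul_left 2
    refine (h1.add h2).congr fun n => ?_
    rw [pow_one]; ring
  refine Summable.of_norm_bounded (hs.mul_left ((ρ ^ k)⁻¹ * (ρ ^ l)⁻¹ * (C * C))) fun n => ?_
  rw [norm_mul, norm_pow, Complex.norm_real, Real.norm_eq_abs, abs_mul, abs_mul,
    abs_of_nonneg (ladder_nonneg _)]
  have hx : |hermiteOne (n + k) x| ≤ (ρ ^ n)⁻¹ * (ρ ^ k)⁻¹ * C := by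
    rw [← mul_inv, ← pow_add, ← div_eq_inv_mul, le_div_iff₀' (by positivity)]; exact hb _ _
  have hy : |hermiteOne (n + l) y| ≤ (ρ ^ n)⁻¹ * (ρ ^ l)⁻¹ * C := by
    rw [← mul_inv, ← pow_add, ← div_eq_inv_mul, le_div_iff₀' (by positivity)]; exact hb _ _
  have hl := ladder_le (n + 1)
  push_cast at hl
  calc _ ≤ ‖q‖ ^ n * (((n : ℝ) + 2) * (((ρ ^ n)⁻¹ * (ρ ^ k)⁻¹ * C) *
        ((ρ ^ n)⁻¹ * (ρ ^ l)⁻¹ * C))) := by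
        gcongr
        linarith
    _ = _ := by
        rw [div_pow, ← hρ2, mul_pow ρ ρ]
        field_simp

theorem hasSum_mul_ladder_shift {q : ℂ} {g : ℕ → ℕ → ℝ} {S : ℂ}
    (h : HasSum (fun n : ℕ => q ^ n * (ladder (n + 1) * g n (n + 1) : ℝ)) S) :
    HasSum (fun n : ℕ => q ^ n * (ladder n * g (n - 1) n : ℝ)) (q * S) := by
  refine (hasSum_nat_add_iff' 1).1 ?_
  simp only [Finset.range_one, Finset.sum_singleton, ladder_zero, zero_mul, Complex.ofReal_zero,
    mul_zero, sub_zero, Nat.add_sub_cancel]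
  refine (h.mul_left q).congr_fun fun n => ?_
  rw [pow_succ]; ring

/-- Term by term differentiation is avoided. Let `P` and `Q` be the sums in which the index is
raised in `x`, respectively in `y`. The recurrences give `x K = P + qQ` and `y K = Q + qP` for
Mehler's kernel `K`, while the series wanted is `qP - Q`; the linear system has determinant `1 -
q²`. -/
theorem hasSum_mehlerD {q : ℂ} (hq : ‖q‖ < 1) (x y : ℝ) :
    HasSum (fun n : ℕ => q ^ n * (hermiteOne n x * hermiteOneD n y : ℝ)) (mehlerD q x y) := by
  obtain ⟨P, hP⟩ := summable_pow_mul_hermiteOne hq 1 0 x y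
  obtain ⟨Q, hQ⟩ := summable_pow_mul_hermiteOne hq 0 1 x y
  simp only [add_zero] at hP hQ
  have hP' := hasSum_mul_ladder_shift (g := fun a b => hermiteOne b x * hermiteOne a y) hP
  have hQ' := hasSum_mul_ladder_shift (g := fun a b => hermiteOne a x * hermiteOne b y) hQ
  have hK := hasSum_mehler hq x y
  have ex : (x : ℂ) * mehler q x y = P + q * Q := by
    refine (hK.mul_left (x : ℂ)).unique ((hP.add hQ').congr_fun fun n => ?_)
    have := mul_hermiteOne n x
    have e : x * (hermiteOne n x * hermiteOne n y) =
      (ladder (n + 1) * (hermiteOne (n + 1) x * hermiteOne n y)) +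
      ladder n * (hermiteOne (n - 1) x * hermiteOne n y) := by
        linear_combination hermiteOne n y * this
    have e' := congrArg (fun r : ℝ => (r : ℂ)) e
    push_cast at e' ⊢
    linear_combination q ^ n * e'
  have ey : (y : ℂ) * mehler q x y = Q + q * P := by
    refine (hK.mul_left (y : ℂ)).unique ((hQ.add hP').congr_fun fun n => ?_)
    have := mul_hermiteOne n y
    have e : y * (hermiteOne n x * hermiteOne n y) =
      (ladder (n + 1) * (hermiteOne n x * hermiteOne (n + 1) y)) +
      ladder n * (hermiteOne n x * hermiteOne (n - 1) y) := by
        linear_combination hermiteOne n x * this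
    have e' := congrArg (fun r : ℝ => (r : ℂ)) e
    push_cast at e' ⊢
    linear_combination q ^ n * e'
  have hval : q * P - Q = mehlerD q x y := by
    have hre := one_sub_sq_re_pos hq
    have hne : (1 - q ^ 2 : ℂ) ≠ 0 := by
      intro h0; rw [h0] at hre; simp at hre
    rw [mehlerD, div_mul_eq_mul_div, eq_div_iff hne]
    linear_combination (-2 * q) * ex + (1 + q ^ 2) * ey
  rw [← hval]
  refine (hP'.sub hQ).congr_fun fun n => ?_
  rw [hermiteOneD_eq]
  push_cast
  ring

/-- A Gaussian bound for the kernels of `e^{-zH}` and of its first order derivatives. -/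
def mehlerBound (z : ℂ) (x y : ℝ) : ℝ :=
  Real.exp (-z.re / 2) * ((Real.sqrt Real.pi)⁻¹ *
    (Real.sqrt (‖1 + Complex.exp (-2 * z)‖ * ‖1 - Complex.exp (-2 * z)‖))⁻¹) *
      Real.exp (-((1 - ‖Complex.exp (-2 * z)‖ ^ 2) * (x + y) ^ 2 /
          (8 * ‖1 + Complex.exp (-2 * z)‖ ^ 2)) -
        (1 - ‖Complex.exp (-2 * z)‖ ^ 2) * (x - y) ^ 2 / (8 * ‖1 - Complex.exp (-2 * z)‖ ^ 2))

/-! ### Gaussian bounds for Mehler's kernel at complex times -/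

theorem mehlerBound_nonneg (z : ℂ) (x y : ℝ) : 0 ≤ mehlerBound z x y := by
  unfold mehlerBound; positivity

theorem mehlerBound_comm (z : ℂ) (x y : ℝ) : mehlerBound z x y = mehlerBound z y x := by
  unfold mehlerBound
  rw [add_comm x y, show (x - y) ^ 2 = (y - x) ^ 2 by ring]

theorem measurable_mehlerBound :
    Measurable fun p : ℂ × ℝ × ℝ => mehlerBound p.1 p.2.1 p.2.2 := by
  unfold mehlerBound
  fun_prop

theorem norm_exp_neg_two_mul (z : ℂ) : ‖Complex.exp (-2 * z)‖ = Real.exp (-2 * z.re) := by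
  rw [Complex.norm_exp]; simp

theorem norm_exp_neg_two_mul_lt {z : ℂ} (hz : 0 < z.re) : ‖Complex.exp (-2 * z)‖ < 1 := by
  rw [norm_exp_neg_two_mul, Real.exp_lt_one_iff]; linarith

theorem one_sub_exp_neg_ge {s : ℝ} (hs : 0 ≤ s) : s / (1 + s) ≤ 1 - Real.exp (-s) := by
  have h := Real.add_one_le_exp s
  rw [Real.exp_neg]
  have h1 : (Real.exp s)⁻¹ ≤ (1 + s)⁻¹ := inv_anti₀ (by linarith) (by linarith)
  have h2 : s / (1 + s) = 1 - (1 + s)⁻¹ := by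
    have : 1 + s ≠ 0 := by positivity
    field_simp; ring
  linarith

theorem one_sub_norm_sq_exp_ge {z : ℂ} (hz : 0 < z.re) :
    4 * z.re / (1 + 4 * z.re) ≤ 1 - ‖Complex.exp (-2 * z)‖ ^ 2 := by
  have := one_sub_exp_neg_ge (s := 4 * z.re) (by linarith)
  rw [norm_exp_neg_two_mul, ← Real.exp_nat_mul]
  convert this using 3
  push_cast; ring

theorem exp_neg_div_one_sub_norm_sq_le {z : ℂ} (hz : 0 < z.re) :
    Real.exp (-z.re) / (1 - ‖Complex.exp (-2 * z)‖ ^ 2) ≤ 1 / z.re := by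
  set a := z.re
  have h1 := one_sub_norm_sq_exp_ge hz
  have h0 : 0 < 4 * a / (1 + 4 * a) := by positivity
  have h2 := Real.add_one_le_exp a
  calc _ ≤ Real.exp (-a) / (4 * a / (1 + 4 * a)) := by gcongr
    _ = (1 + 4 * a) / (4 * (a * Real.exp a)) := by rw [Real.exp_neg]; field_simp
    _ ≤ (4 * Real.exp a) / (4 * (a * Real.exp a)) := by gcongr; linarith
    _ = 1 / a := by field_simp

/-- Up to a constant, the left side is the square of the `L¹` norm of `mehlerBound` once the factor
in `x + y` is dropped. If `4|z| ≤ 1`, then `|1 - q| ≤ 4|z|` and `|1 + q| ≥ 1`, which gives a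
multiple of `|z| / Re z`. Otherwise the polynomial growth in `Re z` is absorbed by `e^{-Re z}`, and
the remaining `(Re z)^{-2}` is controlled because `|z|` is bounded below. -/
theorem exp_neg_mul_ratio_le {z : ℂ} (hz : 0 < z.re) :
    Real.exp (-z.re) * (‖1 - Complex.exp (-2 * z)‖ /
      (‖1 + Complex.exp (-2 * z)‖ * (1 - ‖Complex.exp (-2 * z)‖ ^ 2))) ≤ 64 * (‖z‖ / z.re) ^ 2 := by
  have hq := norm_exp_neg_two_mul_lt hz
  have haz : z.re ≤ ‖z‖ := Complex.re_le_norm z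
  have hκ := exp_neg_div_one_sub_norm_sq_le hz
  have hκ1 := one_sub_norm_sq_exp_ge hz
  have hqa := norm_exp_neg_two_mul z
  have hpos : 0 < 4 * z.re / (1 + 4 * z.re) := by positivity
  set a := z.re with ha
  set q := Complex.exp (-2 * z) with hqd
  have hκ0 : 0 < 1 - ‖q‖ ^ 2 := hpos.trans_le hκ1
  have hA0 : 0 < ‖1 + q‖ := norm_pos_iff.2 (one_add_ne_zero_of_norm_lt hq)
  have hr : 1 ≤ ‖z‖ / a := by rwa [one_le_div hz]
  by_cases hc : 4 * ‖z‖ ≤ 1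
  · have hB : ‖1 - q‖ ≤ 4 * ‖z‖ := by
      have h := Complex.norm_exp_sub_one_le (x := -2 * z) (by rw [norm_mul]; simp; linarith)
      rw [norm_sub_rev]
      refine h.trans (le_of_eq ?_)
      rw [norm_mul]; simp; ring
    have hA : 1 ≤ ‖1 + q‖ := by
      have : ‖(2 : ℂ)‖ ≤ ‖1 + q‖ + ‖1 - q‖ := by
        refine le_trans (le_of_eq ?_) (norm_add_le _ _)
        congr 1; ring
      simp only [Complex.norm_ofNat] at this
      linarith
    calc _ ≤ Real.exp (-a) * (4 * ‖z‖ / (1 * (1 - ‖q‖ ^ 2))) := by gcongr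
      _ = 4 * ‖z‖ * (Real.exp (-a) / (1 - ‖q‖ ^ 2)) := by ring
      _ ≤ 4 * ‖z‖ * (1 / a) := by gcongr
      _ = 4 * (‖z‖ / a) := by ring
      _ ≤ 64 * (‖z‖ / a) ^ 2 := by nlinarith
  · push Not at hc
    have hB : ‖1 - q‖ ≤ 2 := by
      refine (norm_sub_le _ _).trans ?_
      rw [norm_one]; linarith
    have hA : 2 * a / (1 + 2 * a) ≤ ‖1 + q‖ := by
      have h1 : ‖(1 : ℂ)‖ ≤ ‖1 + q‖ + ‖q‖ := by
        have := norm_sub_le (1 + q) q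
        simpa using this
      have h2 := one_sub_exp_neg_ge (s := 2 * a) (by linarith)
      rw [norm_one, hqa] at h1
      rw [show -(2 * a) = -2 * a by ring] at h2
      linarith
    have h3 := Real.quadratic_le_exp_of_nonneg hz.le
    have hp2 : 0 < 2 * a / (1 + 2 * a) := by positivity
    calc _ ≤ Real.exp (-a) * (2 / (2 * a / (1 + 2 * a) * (4 * a / (1 + 4 * a)))) := by gcongr
      _ = ((1 + 2 * a) * (1 + 4 * a)) / (4 * a ^ 2 * Real.exp a) := by
          rw [Real.exp_neg]; field_simp
      _ ≤ (16 * Real.exp a) / (4 * a ^ 2 * Real.exp a) := by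
          refine div_le_div_of_nonneg_right ?_ (by positivity)
          nlinarith
      _ = 64 * (1 / 4 / a) ^ 2 := by field_simp; norm_num
      _ ≤ _ := by gcongr; linarith

theorem mul_exp_neg_sq_le (t : ℝ) : |t| * Real.exp (-(t ^ 2 / 4)) ≤ 2 * Real.exp (-(t ^ 2 / 8)) := by
  have h := Real.add_one_le_exp (t ^ 2 / 8)
  have h1 : |t| ≤ 2 * Real.exp (t ^ 2 / 8) := by
    have := sq_abs t
    nlinarith [sq_nonneg (|t| - 2)]
  calc |t| * Real.exp (-(t ^ 2 / 4)) ≤ 2 * Real.exp (t ^ 2 / 8) * Real.exp (-(t ^ 2 / 4)) := by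
        gcongr
    _ = 2 * Real.exp (-(t ^ 2 / 8)) := by
        rw [mul_assoc, ← Real.exp_add]; congr 2; ring

/-- Half of the Gaussian exponent is given up to absorb a linear factor; this is why `mehlerBound`
has `8` where the exact modulus has `4`. -/
theorem abs_mul_exp_neg_le {κ A : ℝ} (hκ : 0 < κ) (hA : 0 < A) (v : ℝ) :
    |v| * Real.exp (-(κ * v ^ 2 / (4 * A ^ 2))) ≤
      2 * A / Real.sqrt κ * Real.exp (-(κ * v ^ 2 / (8 * A ^ 2))) := by
  have hs : 0 < Real.sqrt κ := Real.sqrt_pos.2 hκ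
  have h := mul_exp_neg_sq_le (Real.sqrt κ * v / A)
  rw [div_pow, mul_pow, Real.sq_sqrt hκ.le, abs_div, abs_mul, abs_of_pos hs, abs_of_pos hA] at h
  have e4 : κ * v ^ 2 / A ^ 2 / 4 = κ * v ^ 2 / (4 * A ^ 2) := by field_simp
  have e8 : κ * v ^ 2 / A ^ 2 / 8 = κ * v ^ 2 / (8 * A ^ 2) := by field_simp
  rw [e4, e8] at h
  calc _ = A / Real.sqrt κ * (Real.sqrt κ * |v| / A * Real.exp (-(κ * v ^ 2 / (4 * A ^ 2)))) := by
        field_simp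
    _ ≤ A / Real.sqrt κ * (2 * Real.exp (-(κ * v ^ 2 / (8 * A ^ 2)))) := by gcongr
    _ = _ := by ring

theorem norm_exp_mul_mehler_le {z : ℂ} (hz : 0 < z.re) (x y : ℝ) :
    ‖Complex.exp (-z) * mehler (Complex.exp (-2 * z)) x y‖ ≤ mehlerBound z x y := by
  have hq := norm_exp_neg_two_mul_lt hz
  rw [norm_mul, norm_mehler hq, Complex.norm_exp, Complex.neg_re, mehlerBound, ← mul_assoc (Real.exp (-z.re))]
  have hκ : 0 ≤ 1 - ‖Complex.exp (-2 * z)‖ ^ 2 := by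
    nlinarith [norm_nonneg (Complex.exp (-2 * z))]
  set q := Complex.exp (-2 * z)
  have hA : 0 < ‖1 + q‖ := norm_pos_iff.2 (one_add_ne_zero_of_norm_lt hq)
  have hB : 0 < ‖1 - q‖ := norm_pos_iff.2 (one_sub_ne_zero_of_norm_lt hq)
  gcongr
  · linarith
  · norm_num
  · norm_num

/-- Multiplication by a coordinate and differentiation both multiply Mehler's kernel by a linear
form in `x + y` and `x - y`. These two variables have sizes `|1 + q| / √κ` and `|1 - q| / √κ` with
`κ = 1 - |q|²`. Half of `e^{-Re z}` then converts `1 / √κ` into `1 / √(Re z)`, which explains the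
factor `exp (-Re z / 2)` in `mehlerBound`. -/
theorem norm_exp_mul_mul_mehler_le {z : ℂ} (hz : 0 < z.re) (x y : ℝ) (a b : ℂ)
    (ha : ‖a‖ * ‖1 + Complex.exp (-2 * z)‖ + ‖b‖ * ‖1 - Complex.exp (-2 * z)‖ ≤ 2) :
    ‖Complex.exp (-z) * ((a * (x + y) + b * (x - y)) * mehler (Complex.exp (-2 * z)) x y)‖ ≤
      4 / Real.sqrt z.re * mehlerBound z x y := by
  have hq := norm_exp_neg_two_mul_lt hz
  have hκe := exp_neg_div_one_sub_norm_sq_le hz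
  have hκ : 0 < 1 - ‖Complex.exp (-2 * z)‖ ^ 2 := by
    nlinarith [norm_nonneg (Complex.exp (-2 * z))]
  rw [norm_mul, norm_mul, norm_mehler hq, Complex.norm_exp, Complex.neg_re, mehlerBound]
  set q := Complex.exp (-2 * z)
  set κ := 1 - ‖q‖ ^ 2
  have hA : 0 < ‖1 + q‖ := norm_pos_iff.2 (one_add_ne_zero_of_norm_lt hq)
  have hB : 0 < ‖1 - q‖ := norm_pos_iff.2 (one_sub_ne_zero_of_norm_lt hq)
  set A := ‖1 + q‖
  set B := ‖1 - q‖
  have hsκ : 0 < Real.sqrt κ := Real.sqrt_pos.2 hκ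
  have h1 := abs_mul_exp_neg_le hκ hA (x + y)
  have h2 := abs_mul_exp_neg_le hκ hB (x - y)
  have h3 : Real.exp (-(κ * (x + y) ^ 2 / (4 * A ^ 2))) ≤
      Real.exp (-(κ * (x + y) ^ 2 / (8 * A ^ 2))) := by
    refine Real.exp_le_exp.2 (neg_le_neg ?_)
    gcongr; norm_num
  have h4 : Real.exp (-(κ * (x - y) ^ 2 / (4 * B ^ 2))) ≤
      Real.exp (-(κ * (x - y) ^ 2 / (8 * B ^ 2))) := by
    refine Real.exp_le_exp.2 (neg_le_neg ?_)
    gcongr; norm_num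
  have hn : ‖a * (x + y) + b * (x - y)‖ ≤ ‖a‖ * |x + y| + ‖b‖ * |x - y| := by
    refine (norm_add_le _ _).trans (le_of_eq ?_)
    rw [norm_mul, norm_mul, ← Complex.ofReal_add, ← Complex.ofReal_sub, Complex.norm_real,
      Complex.norm_real, Real.norm_eq_abs, Real.norm_eq_abs]
  simp only [sub_eq_add_neg (-_ : ℝ), Real.exp_add]
  set E1 := Real.exp (-(κ * (x + y) ^ 2 / (4 * A ^ 2)))
  set E2 := Real.exp (-(κ * (x - y) ^ 2 / (4 * B ^ 2)))
  set G1 := Real.exp (-(κ * (x + y) ^ 2 / (8 * A ^ 2)))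
  set G2 := Real.exp (-(κ * (x - y) ^ 2 / (8 * B ^ 2)))
  have hE1 : 0 < E1 := Real.exp_pos _
  have hE2 : 0 < E2 := Real.exp_pos _
  have hG1 : 0 < G1 := Real.exp_pos _
  have hG2 : 0 < G2 := Real.exp_pos _
  have key : ‖a * (x + y) + b * (x - y)‖ * (E1 * E2) ≤ 4 / Real.sqrt κ * (G1 * G2) :=
    calc _ ≤ (‖a‖ * |x + y| + ‖b‖ * |x - y|) * (E1 * E2) := by gcongr
      _ = ‖a‖ * (|x + y| * E1) * E2 + ‖b‖ * (|x - y| * E2) * E1 := by ring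
      _ ≤ ‖a‖ * (2 * A / Real.sqrt κ * G1) * G2 + ‖b‖ * (2 * B / Real.sqrt κ * G2) * G1 := by
          gcongr
      _ = (‖a‖ * A + ‖b‖ * B) * (2 / Real.sqrt κ * (G1 * G2)) := by ring
      _ ≤ 2 * (2 / Real.sqrt κ * (G1 * G2)) := by gcongr
      _ = _ := by ring
  have hexp : Real.exp (-z.re) * (4 / Real.sqrt κ) ≤
      4 / Real.sqrt z.re * Real.exp (-z.re / 2) := by
    have e1 : Real.exp (-z.re) = Real.exp (-z.re / 2) * Real.exp (-z.re / 2) := by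
      rw [← Real.exp_add]; congr 1; ring
    have e2 : Real.exp (-z.re / 2) / Real.sqrt κ ≤ 1 / Real.sqrt z.re := by
      rw [← Real.sqrt_one, ← Real.sqrt_div zero_le_one]
      refine Real.le_sqrt_of_sq_le ?_
      rw [div_pow, Real.sq_sqrt hκ.le, sq, ← e1]
      exact hκe
    calc _ = 4 * Real.exp (-z.re / 2) * (Real.exp (-z.re / 2) / Real.sqrt κ) := by rw [e1]; ring
      _ ≤ 4 * Real.exp (-z.re / 2) * (1 / Real.sqrt z.re) := by gcongr
      _ = _ := by ring
  set N := (Real.sqrt Real.pi)⁻¹ * (Real.sqrt (A * B))⁻¹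
  have hN : 0 ≤ N := by positivity
  calc _ = Real.exp (-z.re) * N * (‖a * (x + y) + b * (x - y)‖ * (E1 * E2)) := by ring
    _ ≤ Real.exp (-z.re) * N * (4 / Real.sqrt κ * (G1 * G2)) := by gcongr
    _ = (Real.exp (-z.re) * (4 / Real.sqrt κ)) * (N * (G1 * G2)) := by ring
    _ ≤ (4 / Real.sqrt z.re * Real.exp (-z.re / 2)) * (N * (G1 * G2)) := by gcongr
    _ = _ := by ring

theorem norm_one_add_add_norm_one_sub_le {z : ℂ} (hz : 0 < z.re) :
    ‖1 + Complex.exp (-2 * z)‖ + ‖1 - Complex.exp (-2 * z)‖ ≤ 4 := by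
  have hq := norm_exp_neg_two_mul_lt hz
  have h1 := norm_add_le 1 (Complex.exp (-2 * z))
  have h2 := norm_sub_le 1 (Complex.exp (-2 * z))
  rw [norm_one] at h1 h2
  linarith

theorem norm_exp_mul_mul_mehler_right_le {z : ℂ} (hz : 0 < z.re) (x y : ℝ) :
    ‖Complex.exp (-z) * (y * mehler (Complex.exp (-2 * z)) x y)‖ ≤
      4 / Real.sqrt z.re * mehlerBound z x y := by
  have h := norm_exp_mul_mul_mehler_le hz x y (1 / 2) (-(1 / 2))
    (by
      have := norm_one_add_add_norm_one_sub_le hz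
      rw [norm_neg, norm_div, norm_one, Complex.norm_ofNat]
      linarith)
  convert h using 4
  ring

theorem norm_exp_mul_mehlerD_le {z : ℂ} (hz : 0 < z.re) (x y : ℝ) :
    ‖Complex.exp (-z) * mehlerD (Complex.exp (-2 * z)) x y‖ ≤
      4 / Real.sqrt z.re * mehlerBound z x y := by
  have hq := norm_exp_neg_two_mul_lt hz
  have h1 := one_sub_ne_zero_of_norm_lt hq
  have h2 := one_add_ne_zero_of_norm_lt hq
  -- These are the coefficients of the `y`-derivative of the exponent of Mehler's kernel, in the
  -- coordinates `x + y` and `x - y`.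
  have h := norm_exp_mul_mul_mehler_le hz x y
    (-(1 / 2) * ((1 - Complex.exp (-2 * z)) / (1 + Complex.exp (-2 * z))))
    ((1 / 2) * ((1 + Complex.exp (-2 * z)) / (1 - Complex.exp (-2 * z))))
    (by
      have := norm_one_add_add_norm_one_sub_le hz
      have n1 := (norm_pos_iff.2 h1).ne'
      have n2 := (norm_pos_iff.2 h2).ne'
      have n3 : ‖(1 / 2 : ℂ)‖ = 1 / 2 := by rw [norm_div, norm_one, Complex.norm_ofNat]
      rw [norm_mul, norm_mul, norm_div (1 - _), norm_div (1 + _), norm_neg, mul_assoc, mul_assoc,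
        div_mul_cancel₀ _ n1, div_mul_cancel₀ _ n2, n3]
      linarith)
  convert h using 3
  rw [mehlerD]
  congr 1
  have e3 : (1 - Complex.exp (-2 * z) ^ 2 : ℂ) =
    (1 - Complex.exp (-2 * z)) * (1 + Complex.exp (-2 * z)) := by ring
  rw [e3]
  field_simp
  ring

/-- The factor in `x + y` is dropped. The Gaussian in `x - y` integrates explicitly, and the square
of the result is `8` times the quantity of `exp_neg_mul_ratio_le`. -/
theorem lintegral_mehlerBound_le {z : ℂ} (hz : 0 < z.re) (x : ℝ) :
    ∫⁻ y, ENNReal.ofReal (mehlerBound z x y) ≤ ENNReal.ofReal (32 * (‖z‖ / z.re)) := by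
  have hq := norm_exp_neg_two_mul_lt hz
  have hκ : 0 < 1 - ‖Complex.exp (-2 * z)‖ ^ 2 := by
    nlinarith [norm_nonneg (Complex.exp (-2 * z))]
  have hr := exp_neg_mul_ratio_le hz
  unfold mehlerBound
  set q := Complex.exp (-2 * z)
  set κ := 1 - ‖q‖ ^ 2
  have hA : 0 < ‖1 + q‖ := norm_pos_iff.2 (one_add_ne_zero_of_norm_lt hq)
  have hB : 0 < ‖1 - q‖ := norm_pos_iff.2 (one_sub_ne_zero_of_norm_lt hq)
  set A := ‖1 + q‖
  set B := ‖1 - q‖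
  set c := Real.exp (-z.re / 2) * ((Real.sqrt Real.pi)⁻¹ * (Real.sqrt (A * B))⁻¹)
  have hc : 0 ≤ c := by positivity
  have hb : 0 < κ / (8 * B ^ 2) := by positivity
  have hgi : Integrable fun y : ℝ => c * Real.exp (-(κ / (8 * B ^ 2)) * (y - x) ^ 2) :=
    ((integrable_exp_neg_mul_sq hb).comp_sub_right x).const_mul c
  have hint : ∫ y : ℝ, c * Real.exp (-(κ / (8 * B ^ 2)) * (y - x) ^ 2) =
      c * Real.sqrt (Real.pi / (κ / (8 * B ^ 2))) := by
    rw [integral_const_mul, integral_sub_right_eq_self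
      (fun y : ℝ => Real.exp (-(κ / (8 * B ^ 2)) * y ^ 2)), integral_gaussian]
  calc _ ≤ ∫⁻ y, ENNReal.ofReal (c * Real.exp (-(κ / (8 * B ^ 2)) * (y - x) ^ 2)) := by
        refine lintegral_mono fun y => ENNReal.ofReal_le_ofReal ?_
        refine mul_le_mul_of_nonneg_left (Real.exp_le_exp.2 ?_) hc
        have e1 : 0 ≤ κ * (x + y) ^ 2 / (8 * A ^ 2) := by positivity
        have e2 : -(κ / (8 * B ^ 2)) * (y - x) ^ 2 = -(κ * (x - y) ^ 2 / (8 * B ^ 2)) := by ring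
        rw [e2]; linarith
    _ = ENNReal.ofReal (c * Real.sqrt (Real.pi / (κ / (8 * B ^ 2)))) := by
        rw [← hint, ofReal_integral_eq_lintegral_ofReal hgi
          (Eventually.of_forall fun y => by positivity)]
    _ ≤ _ := by
        refine ENNReal.ofReal_le_ofReal (abs_le_of_sq_le_sq' ?_ (by positivity)).2
        have hp := Real.pi_pos
        have e0 : Real.exp (-z.re / 2) ^ 2 = Real.exp (-z.re) := by
          rw [← Real.exp_nat_mul]; congr 1; push_cast; ring
        have e1 : (c * Real.sqrt (Real.pi / (κ / (8 * B ^ 2)))) ^ 2 =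
            8 * (Real.exp (-z.re) * (B / (A * κ))) := by
          rw [mul_pow, Real.sq_sqrt (by positivity), mul_pow, mul_pow, inv_pow, inv_pow,
            Real.sq_sqrt hp.le, Real.sq_sqrt (by positivity), e0]
          field_simp
        rw [e1, mul_pow]
        nlinarith

/-! ### Hermite functions in dimension `d` -/

theorem hasSum_mul_of_hasSum {ι κ : Type*} {f : ι → ℂ} {g : κ → ℂ} {a b : ℂ} (hf : HasSum f a)
    (hg : HasSum g b) : HasSum (fun x : ι × κ => f x.1 * g x.2) (a * b) :=
  hf.mul hg (summable_mul_of_summable_norm (f := f) (g := g) (summable_norm_iff.2 hf.summable)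
    (summable_norm_iff.2 hg.summable))

theorem hasSum_prod_pi {d : ℕ} {f : Fin d → ℕ → ℂ} {a : Fin d → ℂ}
    (h : ∀ i, HasSum (f i) (a i)) :
    HasSum (fun α : Fin d → ℕ => ∏ i, f i (α i)) (∏ i, a i) := by
  induction d with
  | zero => simp
  | succ d ih =>
    have h1 := ih fun i => h i.succ
    have h2 := hasSum_mul_of_hasSum (h 0) h1
    rw [Fin.prod_univ_succ]
    refine (Equiv.hasSum_iff (Fin.consEquiv fun _ : Fin (d + 1) => ℕ)).1 ?_
    refine h2.congr_fun fun p => ?_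
    simp [Fin.prod_univ_succ, Fin.consEquiv]

theorem summable_prod_pi {d : ℕ} {f : Fin d → ℕ → ℝ} (h : ∀ i, Summable (f i)) :
    Summable (fun α : Fin d → ℕ => ∏ i, f i (α i)) := by
  have := (hasSum_prod_pi fun i => Complex.hasSum_ofReal.2 (h i).hasSum).summable
  rw [← Complex.summable_ofReal]
  refine this.congr fun α => ?_
  push_cast; rfl

theorem integral_space_prod {d : ℕ} (f : Fin d → ℝ → ℝ) :
    ∫ x : Space d, ∏ i, f i (x i) = ∏ i, ∫ r, f i r := by
  rw [← integral_fintype_prod_volume_eq_prod]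
  exact (EuclideanSpace.volume_preserving_symm_measurableEquiv_toLp (Fin d)).integral_comp'
    (fun x : Fin d → ℝ => ∏ i, f i (x i))

theorem integrable_space_prod {d : ℕ} {f : Fin d → ℝ → ℝ} (h : ∀ i, Integrable (f i)) :
    Integrable (fun x : Space d => ∏ i, f i (x i)) := by
  have := Integrable.fintype_prod h
  exact ((EuclideanSpace.volume_preserving_symm_measurableEquiv_toLp
    (Fin d)).integrable_comp_emb (MeasurableEquiv.measurableEmbedding _)).2 this

/-- Multiplication by the `i`-th coordinate on Schwartz functions. -/
def coordMul {d : ℕ} (i : Fin d) : 𝓢(Space d, ℂ) →L[ℂ] 𝓢(Space d, ℂ) :=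
  SchwartzMap.smulLeftCLM ℂ (fun x : Space d => ((x i : ℝ) : ℂ))

theorem coord_hasTemperateGrowth {d : ℕ} (i : Fin d) :
    (fun x : Space d => ((x i : ℝ) : ℂ)).HasTemperateGrowth :=
  Function.HasTemperateGrowth.comp Function.Complex.hasTemperateGrowth_ofReal
    (EuclideanSpace.proj i : Space d →L[ℝ] ℝ).hasTemperateGrowth

theorem coordMul_apply {d : ℕ} (i : Fin d) (w : 𝓢(Space d, ℂ)) (x : Space d) :
    coordMul i w x = x i * w x := by
  rw [coordMul, SchwartzMap.smulLeftCLM_apply_apply (coord_hasTemperateGrowth i), smul_eq_mul]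

/-- The `i`-th partial derivative on Schwartz functions. -/
def coordDeriv {d : ℕ} (i : Fin d) : 𝓢(Space d, ℂ) →L[ℂ] 𝓢(Space d, ℂ) :=
  LineDeriv.lineDerivOpCLM ℂ 𝓢(Space d, ℂ) (EuclideanSpace.basisFun (Fin d) ℝ i)

theorem coordDeriv_apply {d : ℕ} (i : Fin d) (w : 𝓢(Space d, ℂ)) (x : Space d) :
    coordDeriv i w x = lineDeriv ℝ w x (EuclideanSpace.basisFun (Fin d) ℝ i) := by
  rw [coordDeriv, LineDeriv.lineDerivOpCLM_apply, SchwartzMap.lineDerivOp_apply]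

/-- The operators `1`, `x_i`, `∂_i`. -/
inductive FirstOrder (d : ℕ)
  | one : FirstOrder d
  | pos : Fin d → FirstOrder d
  | der : Fin d → FirstOrder d

namespace FirstOrder

variable {d : ℕ}

/-- The action on Schwartz functions. -/
def op : FirstOrder d → 𝓢(Space d, ℂ) →L[ℂ] 𝓢(Space d, ℂ)
  | one => ContinuousLinearMap.id ℂ _
  | pos i => coordMul i
  | der i => coordDeriv i

@[simp] theorem op_one (w : 𝓢(Space d, ℂ)) : (one : FirstOrder d).op w = w := rfl

/-- The factors of the image of a Hermite function. -/
def fac : FirstOrder d → Fin d → ℕ → ℝ → ℝ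
  | one, _, n, r => hermiteOne n r
  | pos i, j, n, r => if j = i then r * hermiteOne n r else hermiteOne n r
  | der i, j, n, r => if j = i then hermiteOneD n r else hermiteOne n r

/-- The factors of the Mehler kernel. -/
def ker : FirstOrder d → Fin d → ℂ → ℝ → ℝ → ℂ
  | one, _, q, x, y => mehler q x y
  | pos i, j, q, x, y => if j = i then y * mehler q x y else mehler q x y
  | der i, j, q, x, y => if j = i then mehlerD q x y else mehler q x y

/-- The size of the operator at time `a`. -/
def weight : FirstOrder d → ℝ → ℝ
  | one, _ => 1
  | pos _, a => 4 / Real.sqrt a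
  | der _, a => 4 / Real.sqrt a

/-- The size of the factors of the operator at time `a`. -/
def facWeight : FirstOrder d → Fin d → ℝ → ℝ
  | one, _, _ => 1
  | pos i, j, a => if j = i then 4 / Real.sqrt a else 1
  | der i, j, a => if j = i then 4 / Real.sqrt a else 1

theorem weight_nonneg (A : FirstOrder d) (a : ℝ) : 0 ≤ A.weight a := by
  cases A <;> simp only [weight] <;> positivity

theorem prod_facWeight (A : FirstOrder d) (a : ℝ) : ∏ j, A.facWeight j a = A.weight a := by
  cases A <;> simp [facWeight, weight]

theorem op_hermiteFun (A : FirstOrder d) (α : Fin d → ℕ) (x : Space d) :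
    A.op (hermiteFun α) x = ((∏ j, A.fac j (α j) (x j) : ℝ) : ℂ) := by
  have e0 : (⇑(hermiteFun α) : Space d → ℂ) =
      fun y => ((∏ i, hermiteOne (α i) (y i) : ℝ) : ℂ) := funext (hermiteFun_apply α)
  cases A with
  | one => exact hermiteFun_apply α x
  | pos i =>
    rw [op, coordMul_apply, e0, ← Complex.ofReal_mul]
    congr 1
    rw [← Finset.mul_prod_erase _ _ (Finset.mem_univ i),
      ← Finset.mul_prod_erase Finset.univ (fun j => fac (pos i) j (α j) (x j))
        (Finset.mem_univ i), ← mul_assoc]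
    congr 1
    · simp [fac]
    · refine Finset.prod_congr rfl fun j hj => ?_
      simp [fac, Finset.ne_of_mem_erase hj]
  | der i =>
    rw [op, coordDeriv_apply, e0, lineDeriv_prod _ i _ (hasDerivAt_hermiteOne (α i))]
    congr 1
    refine Finset.prod_congr rfl fun j _ => ?_
    by_cases h : j = i
    · subst h; simp [fac]
    · simp [fac, h]

theorem hasSum_ker (A : FirstOrder d) (j : Fin d) {z : ℂ} (hz : 0 < z.re) (x y : ℝ) :
    HasSum (fun n : ℕ => Complex.exp (-((2 * n + 1) * z)) * (hermiteOne n x * A.fac j n y : ℝ))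
      (Complex.exp (-z) * A.ker j (Complex.exp (-2 * z)) x y) := by
  have hq := norm_exp_neg_two_mul_lt hz
  have key : ∀ (e : ℕ → ℝ) (S : ℂ), HasSum (fun n : ℕ => Complex.exp (-2 * z) ^ n *
      (hermiteOne n x * e n : ℝ)) S → HasSum (fun n : ℕ => Complex.exp (-((2 * n + 1) * z)) *
      (hermiteOne n x * e n : ℝ)) (Complex.exp (-z) * S) := by
    intro e S h
    refine (h.mul_left (Complex.exp (-z))).congr_fun fun n => ?_
    rw [← mul_assoc, ← Complex.exp_nat_mul, ← Complex.exp_add]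
    congr 2; ring
  have h1 := hasSum_mehler hq x y
  have h2 : HasSum (fun n : ℕ => Complex.exp (-2 * z) ^ n *
      (hermiteOne n x * (y * hermiteOne n y) : ℝ)) (y * mehler (Complex.exp (-2 * z)) x y) := by
    refine (h1.mul_left (y : ℂ)).congr_fun fun n => ?_
    push_cast; ring
  cases A with
  | one => exact key _ _ h1
  | pos i =>
    by_cases h : j = i
    · simp only [fac, ker, h, if_true]; exact key _ _ h2
    · simp only [fac, ker, h, if_false]; exact key _ _ h1
  | der i =>
    by_cases h : j = i
    · simp only [fac, ker, h, if_true]; exact key _ _ (hasSum_mehlerD hq x y)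
    · simp only [fac, ker, h, if_false]; exact key _ _ h1

theorem norm_ker_le (A : FirstOrder d) (j : Fin d) {z : ℂ} (hz : 0 < z.re) (x y : ℝ) :
    ‖Complex.exp (-z) * A.ker j (Complex.exp (-2 * z)) x y‖ ≤
      A.facWeight j z.re * mehlerBound z x y := by
  have h0 := norm_exp_mul_mehler_le hz x y
  cases A with
  | one => simpa [ker, facWeight] using h0
  | pos i =>
    by_cases h : j = i
    · simp only [facWeight, ker, h, if_true]; exact norm_exp_mul_mul_mehler_right_le hz x y
    · simpa [ker, facWeight, h] using h0
  | der i =>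
    by_cases h : j = i
    · simp only [facWeight, ker, h, if_true]; exact norm_exp_mul_mehlerD_le hz x y
    · simpa [ker, facWeight, h] using h0

theorem integral_abs_fac_le (A : FirstOrder d) (j : Fin d) (n : ℕ) :
    ∫ r, |A.fac j n r| ≤ 2 * ((n : ℝ) + 4) ^ 2 := by
  have h0 : ∫ r, |hermiteOne n r| ≤ 2 * ((n : ℝ) + 4) ^ 2 := by
    have := integral_abs_hermiteOne_le n
    have : (0 : ℝ) ≤ n := by positivity
    nlinarith
  cases A with
  | one => exact h0
  | pos i =>
    by_cases h : j = i
    · simp only [fac, h, if_true]; exact integral_abs_mul_hermiteOne_le n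
    · simpa only [fac, h, if_false] using h0
  | der i =>
    by_cases h : j = i
    · simp only [fac, h, if_true]; exact integral_abs_hermiteOneD_le n
    · simpa only [fac, h, if_false] using h0

theorem integral_norm_op_hermiteFun_le (A : FirstOrder d) (α : Fin d → ℕ) :
    ∫ x, ‖A.op (hermiteFun α) x‖ ≤ ∏ j, (2 * ((α j : ℝ) + 4) ^ 2) := by
  simp only [op_hermiteFun, Complex.norm_real, Real.norm_eq_abs, Finset.abs_prod]
  rw [integral_space_prod fun j r => |A.fac j (α j) r|]
  exact Finset.prod_le_prod (fun j _ => integral_nonneg fun r => abs_nonneg _)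
    fun j _ => A.integral_abs_fac_le j (α j)

end FirstOrder

theorem integral_hermiteFun_mul {d : ℕ} (α β : Fin d → ℕ) :
    ∫ x, hermiteFun α x * hermiteFun β x = if α = β then 1 else 0 := by
  have e : ∀ x : Space d, hermiteFun α x * hermiteFun β x =
      ((∏ i, hermiteOne (α i) (x i) * hermiteOne (β i) (x i) : ℝ) : ℂ) := by
    intro x
    rw [Finset.prod_mul_distrib, Complex.ofReal_mul]
    exact congrArg₂ _ (hermiteFun_apply α x) (hermiteFun_apply β x)
  simp only [e]
  rw [integral_complex_ofReal, integral_space_prod fun i r => hermiteOne (α i) r * hermiteOne (β i) r]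
  simp only [integral_hermiteOne_mul]
  rw [Finset.prod_ite_zero]
  simp only [funext_iff, Finset.mem_univ, true_imp_iff, Finset.prod_const_one]
  split_ifs <;> simp

theorem one_le_eigenvalue {d : ℕ} (hd : 1 ≤ d) (α : Fin d → ℕ) : 1 ≤ eigenvalue α := by
  have h : (1 : ℝ) ≤ d := by exact_mod_cast hd
  have : 0 ≤ ∑ i, (α i : ℝ) := by positivity
  rw [eigenvalue]; linarith

theorem eigenvalue_eq_sum {d : ℕ} (α : Fin d → ℕ) : eigenvalue α = ∑ i, (2 * (α i : ℝ) + 1) := by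
  rw [eigenvalue, Finset.sum_add_distrib, Finset.mul_sum]; simp

theorem exp_neg_mul_eigenvalue {d : ℕ} (z : ℂ) (α : Fin d → ℕ) :
    Complex.exp (-(z * eigenvalue α)) = ∏ i, Complex.exp (-((2 * (α i : ℂ) + 1) * z)) := by
  rw [← Complex.exp_sum, eigenvalue_eq_sum]
  congr 1
  push_cast
  rw [Finset.mul_sum, Finset.sum_neg_distrib]
  congr 1
  exact Finset.sum_congr rfl fun i _ => mul_comm _ _

/-- Both `e^{-zλ_α}` and `φ_α` factor over the coordinates, and a first order operator touches at
most one of them. -/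
theorem hasSum_mehler_space {d : ℕ} (A : FirstOrder d) {z : ℂ} (hz : 0 < z.re) (x y : Space d) :
    HasSum (fun α : Fin d → ℕ => Complex.exp (-(z * eigenvalue α)) *
      (hermiteFun α x * A.op (hermiteFun α) y))
      (∏ j, Complex.exp (-z) * A.ker j (Complex.exp (-2 * z)) (x j) (y j)) := by
  refine (hasSum_prod_pi fun j => A.hasSum_ker j hz (x j) (y j)).congr_fun fun α => ?_
  rw [Finset.prod_mul_distrib, exp_neg_mul_eigenvalue, A.op_hermiteFun,
    show hermiteFun α x = ((∏ j, hermiteOne (α j) (x j) : ℝ) : ℂ) from hermiteFun_apply α x,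
    ← Complex.ofReal_mul, ← Finset.prod_mul_distrib, Complex.ofReal_prod]

/-! ### Kernels of spectral multipliers -/

/-- The factor `e^{-2tα_j}` is shared in two: one `e^{-tα_j}` absorbs the sup norm of the Hermite
function, the other makes the polynomially growing `L¹` norms summable. -/
theorem norm_hermiteFun_mul_bound {d : ℕ} {t : ℝ} (ht : 0 < t) :
    ∃ b : (Fin d → ℕ) → ℝ, Summable b ∧ ∀ (α : Fin d → ℕ) (x : Space d) (A : FirstOrder d),
      Real.exp (-(t * eigenvalue α)) * ‖hermiteFun α x‖ * (∫ y, ‖A.op (hermiteFun α) y‖) ≤ b α := by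
  obtain ⟨C, hC, hb⟩ := pow_mul_abs_hermiteOne_le (ρ := Real.exp (-t)) (Real.exp_pos _)
    (by rw [Real.exp_lt_one_iff]; linarith)
  refine ⟨fun α => ∏ j, (Real.exp (-t) ^ (α j) * C * (2 * ((α j : ℝ) + 4) ^ 2)),
    summable_prod_pi (f := fun _ n => Real.exp (-t) ^ n * C * (2 * ((n : ℝ) + 4) ^ 2))
      fun _ => ?_, fun α x A => ?_⟩
  · have hlt : ‖Real.exp (-t)‖ < 1 := by
      rw [Real.norm_eq_abs, Real.abs_exp, Real.exp_lt_one_iff]; linarith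
    have h0 := (summable_geometric_of_norm_lt_one hlt).mul_left (32 * C)
    have h1 := (summable_pow_mul_geometric_of_norm_lt_one 1 hlt).mul_left (16 * C)
    have h2 := (summable_pow_mul_geometric_of_norm_lt_one 2 hlt).mul_left (2 * C)
    refine ((h0.add h1).add h2).congr fun n => ?_
    ring
  · have e1 : Real.exp (-(t * eigenvalue α)) ≤ ∏ j, Real.exp (-t) ^ (2 * α j) := by
      rw [Finset.prod_pow_eq_pow_sum, ← Real.exp_nat_mul]
      refine Real.exp_le_exp.2 ?_
      rw [eigenvalue, ← Finset.mul_sum]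
      push_cast
      have : (0 : ℝ) ≤ d := by positivity
      nlinarith
    have e2 : ∏ j, Real.exp (-t) ^ (2 * α j) * |hermiteOne (α j) (x j)| ≤
        ∏ j, (Real.exp (-t) ^ (α j) * C) := by
      refine Finset.prod_le_prod (fun j _ => by positivity) fun j _ => ?_
      rw [two_mul, pow_add, mul_assoc]
      exact mul_le_mul_of_nonneg_left (hb _ _) (by positivity)
    have e3 := A.integral_norm_op_hermiteFun_le α
    have e4 : ‖hermiteFun α x‖ = ∏ j, |hermiteOne (α j) (x j)| := by
      have : hermiteFun α x = ((∏ j, hermiteOne (α j) (x j) : ℝ) : ℂ) := hermiteFun_apply α x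
      rw [this, Complex.norm_real, Real.norm_eq_abs, Finset.abs_prod]
    rw [Finset.prod_mul_distrib] at e2
    show _ ≤ ∏ j, (Real.exp (-t) ^ (α j) * C * (2 * ((α j : ℝ) + 4) ^ 2))
    rw [e4, Finset.prod_mul_distrib]
    have p1 : 0 ≤ ∏ j, |hermiteOne (α j) (x j)| := Finset.prod_nonneg fun j _ => abs_nonneg _
    have p2 : 0 ≤ ∫ y, ‖A.op (hermiteFun α) y‖ := integral_nonneg fun y => norm_nonneg _
    calc _ ≤ ((∏ j, Real.exp (-t) ^ (2 * α j)) * ∏ j, |hermiteOne (α j) (x j)|) *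
          ∫ y, ‖A.op (hermiteFun α) y‖ := by gcongr
      _ ≤ _ := by gcongr

/-- The complex time `a - 2πiτ / R`. -/
def cplxTime (a R τ : ℝ) : ℂ := a - 2 * Real.pi * τ / R * Complex.I

@[simp] theorem cplxTime_re (a R τ : ℝ) : (cplxTime a R τ).re = a := by
  have : (2 * Real.pi * τ / R : ℂ) = ((2 * Real.pi * τ / R : ℝ) : ℂ) := by push_cast; ring
  rw [cplxTime, this]; simp

theorem continuous_cplxTime (a R : ℝ) : Continuous (cplxTime a R) := by
  unfold cplxTime; fun_prop

/-- When the real part is at least `1 / R`, the imaginary part `2πτ / R` costs a factor linear in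
`τ`, whatever `R` is. This is the source of the uniformity in the frequency. -/
theorem norm_cplxTime_div_le {a R : ℝ} (hR : 0 < R) (h : 1 ≤ R * a) (τ : ℝ) :
    ‖cplxTime a R τ‖ / a ≤ 1 + 2 * Real.pi * |τ| := by
  have ha : 0 < a := by
    by_contra h0
    push Not at h0
    nlinarith
  have e : (2 * Real.pi * τ / R : ℂ) = ((2 * Real.pi * τ / R : ℝ) : ℂ) := by push_cast; ring
  rw [div_le_iff₀ ha, cplxTime, e]
  refine (norm_sub_le _ _).trans ?_
  rw [norm_mul, Complex.norm_I, mul_one, Complex.norm_real, Complex.norm_real, Real.norm_eq_abs,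
    Real.norm_eq_abs, abs_of_pos ha, abs_div, abs_mul, abs_of_pos hR,
    abs_of_pos (by positivity : 0 < 2 * Real.pi), add_mul, one_mul]
  gcongr
  rw [div_le_iff₀ hR]
  have : 0 ≤ 2 * Real.pi * |τ| := by positivity
  nlinarith

open FourierTransform in
theorem schwartz_fourier_inversion (g : 𝓢(ℝ, ℂ)) (ξ : ℝ) :
    g ξ = ∫ τ : ℝ, 𝓕 g τ * Complex.exp (2 * Real.pi * τ * ξ * Complex.I) := by
  have h : 𝓕⁻ (𝓕 g) = g := FourierTransform.fourierInv_fourier_eq g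
  conv_lhs => rw [← h, SchwartzMap.fourierInv_coe, Real.fourierInv_eq']
  congr 1; funext τ
  rw [smul_eq_mul, mul_comm]
  congr 2
  simp
  ring

theorem exp_cplxTime (a R τ l : ℝ) : Complex.exp (-(cplxTime a R τ * l)) =
    (Real.exp (-(a * l)) : ℂ) * Complex.exp (2 * Real.pi * τ * (l / R : ℝ) * Complex.I) := by
  push_cast
  rw [← Complex.exp_add, cplxTime]
  congr 1; ring

open FourierTransform in
-- By Fourier inversion, `e^{-aλ} g(λ/R)` is the superposition with weight `𝓕 g τ` of the `e^{-zλ}`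
-- at the complex times `z = a - 2πiτ/R`. The kernel is therefore the same superposition of Mehler
-- kernels.
theorem hasSum_multiplier_kernel {d : ℕ} (g : 𝓢(ℝ, ℂ)) (A : FirstOrder d) {a R : ℝ} (ha : 0 < a)
    (x y : Space d) :
    HasSum (fun α : Fin d → ℕ => (Real.exp (-(a * eigenvalue α)) : ℂ) * g (eigenvalue α / R) *
      (hermiteFun α x * A.op (hermiteFun α) y))
      (∫ τ : ℝ, 𝓕 g τ * ∏ j, (Complex.exp (-cplxTime a R τ) *
        A.ker j (Complex.exp (-2 * cplxTime a R τ)) (x j) (y j))) := by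
  have hint : Integrable (fun τ => 𝓕 g τ) := (𝓕 g).integrable
  have hF : ∀ α : Fin d → ℕ, Integrable fun τ => 𝓕 g τ *
      (Complex.exp (-(cplxTime a R τ * eigenvalue α)) *
        (hermiteFun α x * A.op (hermiteFun α) y)) := by
    intro α
    refine hint.mul_bdd (c := Real.exp (-(a * eigenvalue α)) *
      ‖hermiteFun α x * A.op (hermiteFun α) y‖) ?_ (Eventually.of_forall fun τ => ?_)
    · refine Continuous.aestronglyMeasurable ?_
      have := continuous_cplxTime a R
      fun_prop
    · rw [norm_mul, Complex.norm_exp, Complex.neg_re, Complex.re_mul_ofReal, cplxTime_re]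
  have hnorm : ∀ (α : Fin d → ℕ) τ, ‖𝓕 g τ * (Complex.exp (-(cplxTime a R τ * eigenvalue α)) *
        (hermiteFun α x * A.op (hermiteFun α) y))‖ = ‖𝓕 g τ‖ *
        ‖Complex.exp (-((a : ℂ) * eigenvalue α)) * (hermiteFun α x * A.op (hermiteFun α) y)‖ := by
    intro α τ
    rw [norm_mul, norm_mul, norm_mul (Complex.exp (-((a : ℂ) * eigenvalue α))), Complex.norm_exp,
      Complex.norm_exp, Complex.neg_re, Complex.re_mul_ofReal, cplxTime_re, Complex.neg_re,
      Complex.re_mul_ofReal, Complex.ofReal_re]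
  have key := hasSum_integral_of_summable_integral_norm hF (by
    simp only [hnorm, integral_mul_const]
    exact (summable_norm_iff.2 (hasSum_mehler_space A (z := a) (by simpa using ha)
      x y).summable).mul_left _)
  have e : ∀ τ, ∑' α : Fin d → ℕ, 𝓕 g τ * (Complex.exp (-(cplxTime a R τ * eigenvalue α)) *
        (hermiteFun α x * A.op (hermiteFun α) y)) =
      𝓕 g τ * ∏ j, (Complex.exp (-cplxTime a R τ) *
        A.ker j (Complex.exp (-2 * cplxTime a R τ)) (x j) (y j)) := fun τ =>
    ((hasSum_mehler_space A (z := cplxTime a R τ) (by simpa using ha) x y).mul_left _).tsum_eq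
  simp only [e] at key
  refine key.congr_fun fun α => ?_
  rw [schwartz_fourier_inversion, ← integral_const_mul, ← integral_mul_const]
  congr 1; funext τ
  rw [exp_cplxTime]
  ring

theorem integrable_mehlerBound {z : ℂ} (hz : 0 < z.re) (x : ℝ) :
    Integrable (mehlerBound z x) := by
  refine ⟨?_, ?_⟩
  · have : Measurable fun y => mehlerBound z x y :=
      measurable_mehlerBound.comp (f := fun y : ℝ => (z, x, y)) (by fun_prop)
    exact this.aestronglyMeasurable
  · rw [hasFiniteIntegral_iff_ofReal (Eventually.of_forall fun y => mehlerBound_nonneg z x y)]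
    exact (lintegral_mehlerBound_le hz x).trans_lt ENNReal.ofReal_lt_top

theorem integral_mehlerBound_le {z : ℂ} (hz : 0 < z.re) (x : ℝ) :
    ∫ y, mehlerBound z x y ≤ 32 * (‖z‖ / z.re) := by
  have h := lintegral_mehlerBound_le hz x
  rw [← ofReal_integral_eq_lintegral_ofReal (integrable_mehlerBound hz x)
    (Eventually.of_forall fun y => mehlerBound_nonneg z x y)] at h
  exact (ENNReal.ofReal_le_ofReal_iff (by positivity)).1 h

theorem lintegral_prod_mehlerBound_le {d : ℕ} {z : ℂ} (hz : 0 < z.re) (x : Space d) :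
    ∫⁻ y : Space d, ENNReal.ofReal (∏ j, mehlerBound z (x j) (y j)) ≤
      ENNReal.ofReal ((32 * (‖z‖ / z.re)) ^ d) := by
  have hi := integrable_space_prod fun j : Fin d => integrable_mehlerBound hz (x j)
  rw [← ofReal_integral_eq_lintegral_ofReal hi (Eventually.of_forall fun y =>
    Finset.prod_nonneg fun j _ => mehlerBound_nonneg z (x j) (y j)),
    integral_space_prod fun j => mehlerBound z (x j)]
  refine ENNReal.ofReal_le_ofReal ?_
  calc _ ≤ ∏ _j : Fin d, (32 * (‖z‖ / z.re)) :=
        Finset.prod_le_prod (fun j _ => integral_nonneg fun y => mehlerBound_nonneg z (x j) y)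
          fun j _ => integral_mehlerBound_le hz (x j)
    _ = _ := by simp

open FourierTransform in
/-- The constant of the kernel estimates for the multiplier `g`. -/
def kernelConst (d : ℕ) (g : 𝓢(ℝ, ℂ)) : ℝ≥0∞ :=
  ∫⁻ τ : ℝ, ENNReal.ofReal (‖𝓕 g τ‖ * (32 * (1 + 2 * Real.pi * |τ|)) ^ d)

open FourierTransform in
theorem kernelConst_lt_top (d : ℕ) (g : 𝓢(ℝ, ℂ)) : kernelConst d g < ⊤ := by
  have h0 := ((𝓕 g).integrable_pow_mul volume 0)
  have h1 := ((𝓕 g).integrable_pow_mul volume d)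
  have hi : Integrable fun τ : ℝ => ‖𝓕 g τ‖ * (32 * (1 + 2 * Real.pi * |τ|)) ^ d := by
    refine (((h0.add (h1.const_mul ((2 * Real.pi) ^ d))).const_mul
      (32 ^ d * 2 ^ (d - 1)))).mono' ?_ (Eventually.of_forall fun τ => ?_)
    · have := (𝓕 g).continuous
      exact Continuous.aestronglyMeasurable (by fun_prop)
    · rw [Real.norm_eq_abs, abs_of_nonneg (by positivity), mul_pow]
      have := add_pow_le zero_le_one (by positivity : 0 ≤ 2 * Real.pi * |τ|) d
      rw [one_pow, mul_pow] at this
      simp only [Pi.add_apply, pow_zero, one_mul, Real.norm_eq_abs]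
      calc _ ≤ ‖𝓕 g τ‖ * (32 ^ d * (2 ^ (d - 1) * (1 + (2 * Real.pi) ^ d * |τ| ^ d))) := by gcongr
        _ = _ := by ring
  have := hi.2
  rwa [hasFiniteIntegral_iff_ofReal (Eventually.of_forall fun τ => by positivity)] at this

open FourierTransform in
theorem enorm_multiplier_kernel_le {d : ℕ} (g : 𝓢(ℝ, ℂ)) (A : FirstOrder d) {a R : ℝ} (ha : 0 < a)
    {S : Finset (Fin d → ℕ)} (hS : ∀ α ∉ S, g (eigenvalue α / R) = 0) (x y : Space d) :
    ‖∑ α ∈ S, (Real.exp (-(a * eigenvalue α)) : ℂ) * g (eigenvalue α / R) *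
      (hermiteFun α x * A.op (hermiteFun α) y)‖ₑ ≤ ENNReal.ofReal (A.weight a) *
      ∫⁻ τ : ℝ, ‖𝓕 g τ‖ₑ *
        ENNReal.ofReal (∏ j, mehlerBound (cplxTime a R τ) (x j) (y j)) := by
  have h := (hasSum_multiplier_kernel g A (R := R) ha x y).unique
    (hasSum_sum_of_ne_finset_zero (s := S) fun α hα => by rw [hS α hα]; simp)
  rw [← h, ← lintegral_const_mul' _ _ ENNReal.ofReal_ne_top]
  refine (enorm_integral_le_lintegral_enorm _).trans (lintegral_mono fun τ => ?_)
  rw [enorm_mul, mul_left_comm]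
  gcongr
  rw [← ENNReal.ofReal_mul (A.weight_nonneg a), ← ofReal_norm]
  refine ENNReal.ofReal_le_ofReal ?_
  rw [norm_prod, ← A.prod_facWeight a, ← Finset.prod_mul_distrib]
  refine Finset.prod_le_prod (fun j _ => norm_nonneg _) fun j _ => ?_
  have := A.norm_ker_le j (z := cplxTime a R τ) (by simpa using ha) (x j) (y j)
  rwa [cplxTime_re] at this

open FourierTransform in
theorem lintegral_mehlerBound_cplxTime_le {d : ℕ} (g : 𝓢(ℝ, ℂ)) {a R : ℝ} (hR : 0 < R)
    (h : 1 ≤ R * a) (x : Space d) :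
    ∫⁻ y : Space d, ∫⁻ τ : ℝ, ‖𝓕 g τ‖ₑ *
        ENNReal.ofReal (∏ j, mehlerBound (cplxTime a R τ) (x j) (y j)) ≤ kernelConst d g := by
  have ha : 0 < a := by
    by_contra h0
    push Not at h0
    nlinarith
  have hm : ∀ j : Fin d, Measurable fun p : Space d × ℝ =>
      mehlerBound (cplxTime a R p.2) (x j) (p.1 j) := by
    intro j
    have h1 : Measurable (cplxTime a R) := (continuous_cplxTime a R).measurable
    exact measurable_mehlerBound.comp
      (f := fun p : Space d × ℝ => (cplxTime a R p.2, x j, p.1 j)) (by fun_prop)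
  have hg : Measurable (fun τ : ℝ => 𝓕 g τ) := (𝓕 g).continuous.measurable
  rw [lintegral_lintegral_swap (by
    refine Measurable.aemeasurable ?_
    refine Measurable.mul ?_ (Measurable.ennreal_ofReal (Finset.measurable_prod _ fun j _ => hm j))
    exact (hg.comp measurable_snd).enorm)]
  refine lintegral_mono fun τ => ?_
  rw [lintegral_const_mul' _ _ enorm_ne_top, ENNReal.ofReal_mul (norm_nonneg _),
    ofReal_norm]
  gcongr
  refine (lintegral_prod_mehlerBound_le (by simpa using ha) x).trans
    (ENNReal.ofReal_le_ofReal ?_)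
  rw [cplxTime_re]
  have := norm_cplxTime_div_le hR h τ
  gcongr

/-- The kernel of the multiplier `e^{-aλ} g(λ / R)`, composed with a first order operator on the
right variable. -/
def multKernel {d : ℕ} (g : 𝓢(ℝ, ℂ)) (A : FirstOrder d) (a R : ℝ) (S : Finset (Fin d → ℕ))
    (x y : Space d) : ℂ :=
  ∑ α ∈ S, (Real.exp (-(a * eigenvalue α)) : ℂ) * g (eigenvalue α / R) *
      (hermiteFun α x * A.op (hermiteFun α) y)

theorem integrable_multKernel_right {d : ℕ} (g : 𝓢(ℝ, ℂ)) (A : FirstOrder d) (a R : ℝ)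
    (S : Finset (Fin d → ℕ)) (x : Space d) : Integrable (fun y => multKernel g A a R S x y) :=
  integrable_finsetSum _ fun α _ => ((A.op (hermiteFun α)).integrable.const_mul _).const_mul _

theorem integrable_multKernel_left {d : ℕ} (g : 𝓢(ℝ, ℂ)) (A : FirstOrder d) (a R : ℝ)
    (S : Finset (Fin d → ℕ)) (y : Space d) : Integrable (fun x => multKernel g A a R S x y) :=
  integrable_finsetSum _ fun α _ => ((hermiteFun α).integrable.mul_const _).const_mul _

/-- The two bounds of Schur's test. The kernel itself is not symmetric, since the operator `A` acts
on one variable only; the second bound rests on the symmetry of `mehlerBound`. -/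
theorem integral_norm_multKernel_le {d : ℕ} (g : 𝓢(ℝ, ℂ)) (A : FirstOrder d) {a R : ℝ}
    (hR : 0 < R) (h : 1 ≤ R * a) {S : Finset (Fin d → ℕ)}
    (hS : ∀ α ∉ S, g (eigenvalue α / R) = 0) (x : Space d) :
    ∫ y, ‖multKernel g A a R S x y‖ ≤ A.weight a * (kernelConst d g).toReal ∧
    ∫ y, ‖multKernel g A a R S y x‖ ≤ A.weight a * (kernelConst d g).toReal := by
  have ha : 0 < a := by
    by_contra h0
    push Not at h0
    nlinarith
  have hK := lintegral_mehlerBound_cplxTime_le g hR h x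
  have hfin : ENNReal.ofReal (A.weight a) * kernelConst d g ≠ ⊤ :=
    ENNReal.mul_ne_top ENNReal.ofReal_ne_top (kernelConst_lt_top d g).ne
  have e : A.weight a * (kernelConst d g).toReal =
      (ENNReal.ofReal (A.weight a) * kernelConst d g).toReal := by
    rw [ENNReal.toReal_mul, ENNReal.toReal_ofReal (A.weight_nonneg a)]
  constructor
  · rw [integral_norm_eq_lintegral_enorm (integrable_multKernel_right g A a R S x).1, e]
    refine ENNReal.toReal_mono hfin ?_
    refine (lintegral_mono fun y => enorm_multiplier_kernel_le g A ha hS x y).trans ?_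
    rw [lintegral_const_mul' _ _ ENNReal.ofReal_ne_top]
    gcongr
  · rw [integral_norm_eq_lintegral_enorm (integrable_multKernel_left g A a R S x).1, e]
    refine ENNReal.toReal_mono hfin ?_
    refine (lintegral_mono fun y => enorm_multiplier_kernel_le g A ha hS y x).trans ?_
    rw [lintegral_const_mul' _ _ ENNReal.ofReal_ne_top]
    gcongr
    refine le_trans (le_of_eq ?_) hK
    refine lintegral_congr fun y => lintegral_congr fun τ => ?_
    simp only [mehlerBound_comm (cplxTime a R τ) (y _)]

/-! ### Functions with Hermite coefficients in a window -/

theorem finite_eigenvalue_le (d : ℕ) (r : ℝ) : {α : Fin d → ℕ | eigenvalue α ≤ r}.Finite := by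
  refine (Set.finite_Iic (fun _ : Fin d => ⌊r⌋₊)).subset fun α hα => ?_
  refine Set.mem_Iic.2 fun i => Nat.le_floor ?_
  have hα : eigenvalue α ≤ r := hα
  refine le_trans ?_ hα
  rw [eigenvalue]
  have h := Finset.single_le_sum (f := fun i => (α i : ℝ)) (fun j _ => Nat.cast_nonneg (α j))
    (Finset.mem_univ i)
  have h2 : (0 : ℝ) ≤ α i := Nat.cast_nonneg _
  have : (0 : ℝ) ≤ d := Nat.cast_nonneg _
  linarith

/-- The indices of the eigenvalues at most `2 R`. -/
def modes (d : ℕ) (R : ℝ) : Finset (Fin d → ℕ) := (finite_eigenvalue_le d (2 * R)).toFinset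

theorem mem_modes {d : ℕ} {R : ℝ} {α : Fin d → ℕ} : α ∈ modes d R ↔ eigenvalue α ≤ 2 * R := by
  simp [modes]

/-- The sum of the `c_α φ_α` over `λ_α ≤ 2 R`. -/
def expansion {d : ℕ} (R : ℝ) (c : (Fin d → ℕ) → ℂ) : 𝓢(Space d, ℂ) :=
  ∑ α ∈ modes d R, c α • hermiteFun α

theorem expansion_apply {d : ℕ} (R : ℝ) (c : (Fin d → ℕ) → ℂ) (x : Space d) :
    expansion R c x = ∑ α ∈ modes d R, c α * hermiteFun α x := by
  simp [expansion]

theorem op_expansion_apply {d : ℕ} (A : FirstOrder d) (R : ℝ) (c : (Fin d → ℕ) → ℂ)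
    (x : Space d) :
    A.op (expansion R c) x = ∑ α ∈ modes d R, c α * A.op (hermiteFun α) x := by
  simp [expansion]

/-- The coefficients `c_α` vanish unless `λ_α / R` lies in `[1/8, 15/8]`. -/
def Windowed {d : ℕ} (R : ℝ) (c : (Fin d → ℕ) → ℂ) : Prop :=
  ∀ α, c α ≠ 0 → eigenvalue α / R ∈ Set.Icc (1 / 8 : ℝ) (15 / 8)

theorem integral_hermiteFun_mul_expansion {d : ℕ} {R : ℝ} (c : (Fin d → ℕ) → ℂ)
    {α : Fin d → ℕ} (hα : α ∈ modes d R) :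
    ∫ y, expansion R c y * hermiteFun α y = c α := by
  simp only [expansion_apply, Finset.sum_mul]
  have hi : ∀ β : Fin d → ℕ, Integrable fun y => hermiteFun β y * hermiteFun α y := fun β => by
    have := (SchwartzMap.pairing (ContinuousLinearMap.mul ℂ ℂ) (hermiteFun β)
      (hermiteFun α)).integrable (μ := volume)
    exact this.congr (Eventually.of_forall fun y => by simp [SchwartzMap.pairing_apply_apply])
  have e : ∀ β y, c β * hermiteFun β y * hermiteFun α y =
    c β * (hermiteFun β y * hermiteFun α y) := fun β y => mul_assoc _ _ _
  simp only [e]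
  rw [integral_finsetSum _ fun β _ => (hi β).const_mul _]
  simp only [integral_const_mul, integral_hermiteFun_mul]
  simp [hα]

theorem integral_expansion_mul_multKernel {d : ℕ} (g : 𝓢(ℝ, ℂ)) (A : FirstOrder d) (a R : ℝ)
    (c : (Fin d → ℕ) → ℂ) (x : Space d) :
    ∫ y, expansion R c y * multKernel g A a R (modes d R) y x =
      A.op (expansion R fun α =>
        (Real.exp (-(a * eigenvalue α)) : ℂ) * g (eigenvalue α / R) * c α) x := by
  have hi : ∀ β : Fin d → ℕ, Integrable fun y => expansion R c y * hermiteFun β y := fun β => by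
    have := (SchwartzMap.pairing (ContinuousLinearMap.mul ℂ ℂ) (expansion R c)
      (hermiteFun β)).integrable (μ := volume)
    exact this.congr (Eventually.of_forall fun y => by simp [SchwartzMap.pairing_apply_apply])
  have e : ∀ y, expansion R c y * multKernel g A a R (modes d R) y x =
      ∑ α ∈ modes d R, ((Real.exp (-(a * eigenvalue α)) : ℂ) * g (eigenvalue α / R) *
        A.op (hermiteFun α) x) * (expansion R c y * hermiteFun α y) := fun y => by
    rw [multKernel, Finset.mul_sum]
    exact Finset.sum_congr rfl fun α _ => by ring
  simp only [e]
  rw [integral_finsetSum _ fun β _ => (hi β).const_mul _, op_expansion_apply]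
  refine Finset.sum_congr rfl fun α hα => ?_
  rw [integral_const_mul, integral_hermiteFun_mul_expansion c hα]
  ring

/-- A smooth function of one variable, equal to one on the window `[1/8, 15/8]`. -/
def windowBump : ContDiffBump (1 : ℝ) := ⟨7 / 8, 15 / 16, by norm_num, by norm_num⟩

theorem windowBump_eq_one {ξ : ℝ} (h : ξ ∈ Set.Icc (1 / 8 : ℝ) (15 / 8)) : windowBump ξ = 1 := by
  refine windowBump.one_of_mem_closedBall ?_
  rw [Metric.mem_closedBall, Real.dist_eq, abs_le]
  show -(7 / 8 : ℝ) ≤ _ ∧ _ ≤ (7 / 8 : ℝ)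
  constructor <;> linarith [h.1, h.2]

/-- Vanishing near zero keeps away from the singularity of `ξ^k` and of `√ξ`; vanishing beyond `2`
matches the cutoff `λ_α ≤ 2R` of `modes`. -/
theorem windowBump_eq_zero {ξ : ℝ} (h : ξ ≤ 1 / 16 ∨ 2 ≤ ξ) : windowBump ξ = 0 := by
  refine windowBump.zero_of_le_dist ?_
  rw [Real.dist_eq]
  show (15 / 16 : ℝ) ≤ _
  rcases h with h | h
  · rw [abs_sub_comm]; exact le_trans (by linarith) (le_abs_self _)
  · exact le_trans (by linarith) (le_abs_self _)

theorem contDiff_windowBump_mul {f : ℝ → ℝ} (hf : ∀ ξ, 0 < ξ → ContDiffAt ℝ ∞ f ξ) :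
    ContDiff ℝ ∞ fun ξ => windowBump ξ * f ξ := by
  rw [contDiff_iff_contDiffAt]
  intro ξ
  by_cases h : 0 < ξ
  · exact windowBump.contDiffAt.mul (hf ξ h)
  · have : (fun ξ => windowBump ξ * f ξ) =ᶠ[𝓝 ξ] fun _ => 0 := by
      filter_upwards [Iio_mem_nhds (show ξ < 1 / 16 by push Not at h; linarith)] with ζ hζ
      rw [windowBump_eq_zero (Or.inl (le_of_lt hζ)), zero_mul]
    exact contDiffAt_const.congr_of_eventuallyEq this

theorem hasCompactSupport_windowBump_mul (f : ℝ → ℝ) :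
    HasCompactSupport fun ξ => windowBump ξ * f ξ :=
  windowBump.hasCompactSupport.mul_right

/-- The multiplier `ξ^k`, localized to the window. -/
def windowMult (k : ℤ) : 𝓢(ℝ, ℂ) :=
  SchwartzMap.postcompCLM Complex.ofRealCLM
    ((hasCompactSupport_windowBump_mul fun ξ => Real.exp ξ * ξ ^ k).toSchwartzMap
    (contDiff_windowBump_mul fun _ hξ => Real.contDiff_exp.contDiffAt.mul
      (analyticAt_id.zpow hξ.ne').contDiffAt) : 𝓢(ℝ, ℝ))

theorem windowMult_apply (k : ℤ) (ξ : ℝ) :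
    windowMult k ξ = ((windowBump ξ * (Real.exp ξ * ξ ^ k) : ℝ) : ℂ) := rfl


theorem windowMult_eq_zero {d : ℕ} {R : ℝ} (hR : 0 < R) (k : ℤ) :
    ∀ α ∉ modes d R, windowMult k (eigenvalue α / R) = 0 := by
  intro α hα
  rw [mem_modes, not_le] at hα
  rw [windowMult_apply, windowBump_eq_zero (Or.inr ((le_div_iff₀ hR).2 hα.le)), zero_mul,
    Complex.ofReal_zero]

/-- The constant of the kernel estimates for the multiplier `ξ^k` localized to the window. -/
def windowConst (d : ℕ) (k : ℤ) : ℝ := (kernelConst d (windowMult k)).toReal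

theorem windowConst_nonneg (d : ℕ) (k : ℤ) : 0 ≤ windowConst d k := ENNReal.toReal_nonneg

theorem one_le_mul_add_inv {t R : ℝ} (ht : 0 ≤ t) (hR : 0 < R) : 1 ≤ R * (t + 1 / R) := by
  rw [mul_add, mul_one_div_cancel hR.ne']
  have := mul_nonneg hR.le ht
  linarith

/-- A factor `e^{-λ/R}` is inserted and compensated by the `exp ξ` in `windowMult`. The time becomes
`t + 1/R`, so that the condition `1 ≤ R a` of the kernel estimates holds down to `t = 0`. -/
theorem multiplier_expansion_eq {d : ℕ} (k : ℤ) (t : ℝ) {R : ℝ}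
    {c : (Fin d → ℕ) → ℂ} (hc : Windowed R c) :
    (expansion R fun α => ((Real.exp (-(t * eigenvalue α)) * (eigenvalue α / R) ^ k : ℝ) : ℂ) * c α)
      = expansion R fun α => (Real.exp (-((t + 1 / R) * eigenvalue α)) : ℂ) *
          windowMult k (eigenvalue α / R) * c α := by
  refine Finset.sum_congr rfl fun α _ => ?_
  by_cases h : c α = 0
  · simp [h]
  show (_ * c α) • hermiteFun α = (_ * c α) • hermiteFun α
  congr 2
  rw [windowMult_apply, windowBump_eq_one (hc α h), ← Complex.ofReal_mul, one_mul, ← mul_assoc,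
    ← Real.exp_add]
  congr 3
  ring

/-- A Bernstein inequality: by orthonormality the function is obtained by integrating the windowed
one against the multiplier kernel, whose `L¹` norm is bounded uniformly in `R`. -/
theorem norm_op_expansion_le {d : ℕ} (k : ℤ) {t R B : ℝ} (ht : 0 ≤ t) (hR : 0 < R)
    {c : (Fin d → ℕ) → ℂ} (hc : Windowed R c) (hB : ∀ x, ‖expansion R c x‖ ≤ B)
    (A : FirstOrder d) (x : Space d) :
    ‖A.op (expansion R fun α =>
      ((Real.exp (-(t * eigenvalue α)) * (eigenvalue α / R) ^ k : ℝ) : ℂ) * c α) x‖ ≤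
      A.weight (t + 1 / R) * windowConst d k * B := by
  rw [multiplier_expansion_eq k t hc, ← integral_expansion_mul_multKernel]
  have hK := (integral_norm_multKernel_le (windowMult k) A hR (one_le_mul_add_inv ht hR)
    (windowMult_eq_zero (d := d) hR k) x).2
  have hB0 : 0 ≤ B := (norm_nonneg _).trans (hB 0)
  have hi := (integrable_multKernel_left (windowMult k) A (t + 1 / R) R (modes d R) x).norm
  calc _ ≤ ∫ y, B * ‖multKernel (windowMult k) A (t + 1 / R) R (modes d R) y x‖ := by
        refine norm_integral_le_of_norm_le (hi.const_mul _) (Eventually.of_forall fun y => ?_)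
        rw [norm_mul]
        gcongr
        exact hB y
    _ = B * ∫ y, ‖multKernel (windowMult k) A (t + 1 / R) R (modes d R) y x‖ :=
        integral_const_mul _ _
    _ ≤ B * (A.weight (t + 1 / R) * windowConst d k) := by gcongr; exact hK
    _ = _ := by ring

/-! ### Integration by parts for the harmonic oscillator -/

open scoped LineDeriv Laplacian in
theorem harmonicOscillator_apply {d : ℕ} (w : 𝓢(Space d, ℂ)) (x : Space d) :
    harmonicOscillator w x = ∑ i, (-coordDeriv i (coordDeriv i w) x + coordMul i (coordMul i w) x) := by
  have hn : (fun x : Space d => ((‖x‖ ^ 2 : ℝ) : ℂ)).HasTemperateGrowth :=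
    Function.HasTemperateGrowth.comp Function.Complex.hasTemperateGrowth_ofReal
      (Function.hasTemperateGrowth_norm_sq (Space d))
  rw [harmonicOscillator, _root_.add_apply, _root_.neg_apply,
    SchwartzMap.laplacian_eq_sum (EuclideanSpace.basisFun (Fin d) ℝ), _root_.sum_apply,
    SchwartzMap.smulLeftCLM_apply_apply hn, Finset.sum_add_distrib, Finset.sum_neg_distrib]
  congr 1
  simp only [coordMul_apply, ← mul_assoc]
  rw [← Finset.sum_mul, smul_eq_mul, EuclideanSpace.real_norm_sq_eq]
  congr 1
  push_cast
  exact Finset.sum_congr rfl fun i _ => sq _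

theorem integrable_mul {d : ℕ} (v w : 𝓢(Space d, ℂ)) : Integrable fun x => v x * w x :=
  ((SchwartzMap.pairing (ContinuousLinearMap.mul ℂ ℂ) v w).integrable (μ := volume)).congr
    (Eventually.of_forall fun y => by simp [SchwartzMap.pairing_apply_apply])

/-- `H` is split evenly, so that each factor receives a single first order operator. A first order
norm of the test function is then all that is ever needed. -/
theorem integral_mul_harmonicOscillator {d : ℕ} (v w : 𝓢(Space d, ℂ)) :
    ∫ x, v x * harmonicOscillator w x =
      ∑ i, (∫ x, coordDeriv i v x * coordDeriv i w x) + ∑ i, ∫ x, coordMul i v x * coordMul i w x := by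
  simp only [harmonicOscillator_apply, Finset.mul_sum, mul_add]
  have i1 : ∀ i, Integrable fun x => v x * -coordDeriv i (coordDeriv i w) x := fun i =>
    (integrable_mul v (coordDeriv i (coordDeriv i w))).neg.congr
      (Eventually.of_forall fun x => by simp)
  have i2 : ∀ i, Integrable fun x => v x * -coordDeriv i (coordDeriv i w) x +
      v x * coordMul i (coordMul i w) x := fun i => (i1 i).add (integrable_mul v _)
  rw [integral_finsetSum _ fun i _ => i2 i, ← Finset.sum_add_distrib]
  refine Finset.sum_congr rfl fun i _ => ?_
  have e := SchwartzMap.integral_mul_lineDerivOp_right_eq_neg_left v (coordDeriv i w)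
    (EuclideanSpace.basisFun (Fin d) ℝ i) (μ := volume)
  rw [integral_add (i1 i) (integrable_mul v (coordMul i (coordMul i w)))]
  congr 1
  · simp only [mul_neg, integral_neg]
    rw [neg_eq_iff_eq_neg]
    exact e
  · congr 1; funext x
    simp only [coordMul_apply]; ring

/-- The weighted norm `∑ i, ‖∂_i ψ‖_{L¹} + ‖x_i ψ‖_{L¹}`. -/
def gradNorm {d : ℕ} (ψ : 𝓢(Space d, ℂ)) : ℝ :=
  ∑ i, (∫ x, ‖coordDeriv i ψ x‖) + ∑ i, ∫ x, ‖coordMul i ψ x‖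

theorem norm_integral_mul_le {d : ℕ} {v w : 𝓢(Space d, ℂ)} {B : ℝ} (h : ∀ x, ‖w x‖ ≤ B) :
    ‖∫ x, v x * w x‖ ≤ (∫ x, ‖v x‖) * B := by
  rw [← integral_mul_const]
  refine norm_integral_le_of_norm_le (v.integrable.norm.mul_const _)
    (Eventually.of_forall fun y => ?_)
  rw [norm_mul]
  gcongr
  exact h y

theorem norm_integral_mul_harmonicOscillator_le {d : ℕ} {v w : 𝓢(Space d, ℂ)} {B : ℝ}
    (h1 : ∀ i x, ‖coordDeriv i w x‖ ≤ B) (h2 : ∀ i x, ‖coordMul i w x‖ ≤ B) :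
    ‖∫ x, v x * harmonicOscillator w x‖ ≤ gradNorm v * B := by
  rw [integral_mul_harmonicOscillator, gradNorm, add_mul, Finset.sum_mul, Finset.sum_mul]
  refine (norm_add_le _ _).trans (add_le_add ?_ ?_)
  · exact (norm_sum_le _ _).trans (Finset.sum_le_sum fun i _ => norm_integral_mul_le (h1 i))
  · exact (norm_sum_le _ _).trans (Finset.sum_le_sum fun i _ => norm_integral_mul_le (h2 i))

theorem harmonicOscillator_expansion {d : ℕ} (R : ℝ) (c : (Fin d → ℕ) → ℂ) :
    harmonicOscillator (expansion R c) = expansion R fun α => (eigenvalue α : ℂ) * c α := by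
  ext x
  have h : ∀ α : Fin d → ℕ, (eigenvalue α : ℂ) * hermiteFun α x =
      ∑ i, (-coordDeriv i (coordDeriv i (hermiteFun α)) x +
        coordMul i (coordMul i (hermiteFun α)) x) := fun α => by
    rw [← harmonicOscillator_apply, harmonicOscillator_hermiteFun]; rfl
  have e : expansion R (fun α => (eigenvalue α : ℂ) * c α) x =
      ∑ α ∈ modes d R, c α * ∑ i, (-coordDeriv i (coordDeriv i (hermiteFun α)) x +
        coordMul i (coordMul i (hermiteFun α)) x) := by
    rw [expansion_apply]
    exact Finset.sum_congr rfl fun α _ => by rw [← h]; ring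
  rw [e, harmonicOscillator_apply]
  simp only [expansion, map_sum, map_smul, _root_.sum_apply, _root_.smul_apply, smul_eq_mul,
    Finset.mul_sum]
  rw [Finset.sum_comm]
  refine Finset.sum_congr rfl fun i _ => ?_
  rw [← Finset.sum_neg_distrib, ← Finset.sum_add_distrib]
  exact Finset.sum_congr rfl fun α _ => by ring

/-! ### Estimates for windowed functions -/

theorem expansion_const_mul {d : ℕ} (R : ℝ) (k : ℂ) (c : (Fin d → ℕ) → ℂ) (x : Space d) :
    expansion R (fun α => k * c α) x = k * expansion R c x := by
  simp only [expansion_apply, Finset.mul_sum, mul_assoc]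

theorem expansion_congr {d : ℕ} {R : ℝ} {c c' : (Fin d → ℕ) → ℂ}
    (h : ∀ α, c α = c' α) : expansion R c = expansion R c' := by
  rw [funext h]

theorem Windowed.ne_zero {d : ℕ} {R : ℝ} {c : (Fin d → ℕ) → ℂ} (h : Windowed R c)
    {α : Fin d → ℕ} (hα : c α ≠ 0) : eigenvalue α ≠ 0 ∧ R ≠ 0 := by
  have := (h α hα).1
  constructor <;> rintro e <;> rw [e] at this <;> norm_num at this

theorem norm_op_windowed_le {d : ℕ} {R B : ℝ} (hR : 0 < R)
    {c : (Fin d → ℕ) → ℂ} (hc : Windowed R c) (hB : ∀ x, ‖expansion R c x‖ ≤ B)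
    (A : FirstOrder d) (x : Space d) :
    ‖A.op (expansion R c) x‖ ≤ A.weight (1 / R) * windowConst d 0 * B := by
  have h := norm_op_expansion_le 0 le_rfl hR hc hB A x
  simpa using h

theorem norm_heat_expansion_le {d : ℕ} {t R B : ℝ} (ht : 0 ≤ t) (hR : 0 < R)
    {c : (Fin d → ℕ) → ℂ} (hc : Windowed R c) (hB : ∀ x, ‖expansion R c x‖ ≤ B) (x : Space d) :
    ‖expansion R (fun α => (Real.exp (-(t * eigenvalue α)) : ℂ) * c α) x‖ ≤
      windowConst d 0 * B := by
  have h := norm_op_expansion_le 0 ht hR hc hB .one x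
  simpa [FirstOrder.weight] using h

/-- On a window the spectrum stays away from zero at scale `R`, so `H` can be divided out. This puts
an `H` in front of a windowed function, ready for integration by parts. -/
theorem harmonicOscillator_inv_expansion {d : ℕ} {R : ℝ}
    {c : (Fin d → ℕ) → ℂ} (hc : Windowed R c) (m : (Fin d → ℕ) → ℝ) :
    harmonicOscillator (expansion R fun α =>
      ((m α * (eigenvalue α / R) ^ (-1 : ℤ) : ℝ) : ℂ) * c α) =
      expansion R fun α => R * (m α * c α) := by
  rw [harmonicOscillator_expansion]
  refine expansion_congr fun α => ?_
  by_cases h : c α = 0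
  · simp [h]
  obtain ⟨h1, h2⟩ := hc.ne_zero h
  have h1' : (eigenvalue α : ℂ) ≠ 0 := by exact_mod_cast h1
  have h2' : (R : ℂ) ≠ 0 := by exact_mod_cast h2
  push_cast
  rw [zpow_neg_one]
  field_simp

/-- Writing the function as `R⁻¹ H v` and integrating by parts, one first order operator falls on
`ψ` and the other costs `√R` on `v`; the net gain is `R^{-1/2}`. -/
theorem norm_integral_mul_windowed_le {d : ℕ} {R B : ℝ} (hR : 0 < R)
    {c : (Fin d → ℕ) → ℂ} (hc : Windowed R c) (hB : ∀ x, ‖expansion R c x‖ ≤ B)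
    (ψ : 𝓢(Space d, ℂ)) :
    ‖∫ x, ψ x * expansion R c x‖ ≤ gradNorm ψ * (4 / Real.sqrt R * windowConst d (-1) * B) := by
  have e := harmonicOscillator_inv_expansion hc fun _ => 1
  have e2 : ∀ x, ψ x * expansion R c x = (R : ℂ)⁻¹ * (ψ x * harmonicOscillator (expansion R fun α =>
      ((1 * (eigenvalue α / R) ^ (-1 : ℤ) : ℝ) : ℂ) * c α) x) := fun x => by
    have h2' : (R : ℂ) ≠ 0 := by exact_mod_cast hR.ne'
    rw [e]
    simp only [Complex.ofReal_one, one_mul]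
    rw [expansion_const_mul]
    field_simp
  simp only [e2]
  rw [integral_const_mul, norm_mul]
  have h := fun A : FirstOrder d => norm_op_expansion_le (-1) le_rfl hR hc hB A
  simp only [zero_mul, neg_zero, Real.exp_zero, zero_add] at h
  have h3 := norm_integral_mul_harmonicOscillator_le (v := ψ)
    (w := expansion R fun α => ((1 * (eigenvalue α / R) ^ (-1 : ℤ) : ℝ) : ℂ) * c α)
    (B := 4 / Real.sqrt (1 / R) * windowConst d (-1) * B) (fun i x => h (.der i) x)
    (fun i x => h (.pos i) x)
  calc _ ≤ ‖(R : ℂ)⁻¹‖ * (gradNorm ψ * (4 / Real.sqrt (1 / R) * windowConst d (-1) * B)) := by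
        gcongr
    _ = _ := by
        rw [norm_inv, Complex.norm_real, Real.norm_eq_abs, abs_of_pos hR, one_div, Real.sqrt_inv]
        have hs := Real.sqrt_pos.2 hR
        have hs2 := Real.mul_self_sqrt hR.le
        rw [← hs2, Real.sqrt_mul_self hs.le]
        field_simp

/-- The constant of the decay estimate of the semigroup on windowed functions. -/
def heatConst (d : ℕ) : ℝ := 64 * d * windowConst d 0 * windowConst d (-1)

theorem heatConst_nonneg (d : ℕ) : 0 ≤ heatConst d := by
  have := windowConst_nonneg d 0
  have := windowConst_nonneg d (-1)
  unfold heatConst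
  positivity

theorem gradNorm_multKernel_le {d : ℕ} {a R : ℝ} (hR : 0 < R) (h : 1 ≤ R * a) (x : Space d) :
    gradNorm (expansion R fun α => (Real.exp (-(a * eigenvalue α)) : ℂ) *
      windowMult 0 (eigenvalue α / R) * hermiteFun α x) ≤
      2 * d * (4 / Real.sqrt a * windowConst d 0) := by
  have hA : ∀ A : FirstOrder d, ∫ y, ‖A.op (expansion R fun α =>
      (Real.exp (-(a * eigenvalue α)) : ℂ) * windowMult 0 (eigenvalue α / R) * hermiteFun α x) y‖
      ≤ A.weight a * windowConst d 0 := fun A => by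
    refine le_trans (le_of_eq ?_)
      (integral_norm_multKernel_le (windowMult 0) A hR h (windowMult_eq_zero hR 0) x).1
    congr 1; funext y
    rw [op_expansion_apply, multKernel]
    congr 1
    exact Finset.sum_congr rfl fun α _ => by ring
  rw [gradNorm]
  calc _ ≤ (∑ _i : Fin d, 4 / Real.sqrt a * windowConst d 0) +
        ∑ _i : Fin d, 4 / Real.sqrt a * windowConst d 0 :=
        add_le_add (Finset.sum_le_sum fun i _ => hA (.der i))
          (Finset.sum_le_sum fun i _ => hA (.pos i))
    _ = _ := by simp; ring

/-- The semigroup is split into two halves. `R e^{-tH} w` is the pairing of the kernel of one half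
with `H` applied to a function of the other half; after integration by parts each side costs
`a^{-1/2}` with `a = t/2 + 1/R`. Hence `R |e^{-tH} w|` is of order `B / a`. This decay, weaker than
exponential, suffices because at most two derivatives are ever gained. -/
theorem norm_heat_expansion_le_div {d : ℕ} {t R B : ℝ} (ht : 0 ≤ t) (hR : 0 < R)
    {c : (Fin d → ℕ) → ℂ} (hc : Windowed R c) (hB : ∀ x, ‖expansion R c x‖ ≤ B) (x : Space d) :
    ‖expansion R (fun α => (Real.exp (-(t * eigenvalue α)) : ℂ) * c α) x‖ ≤
      heatConst d * B / (1 + t * R) := by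
  set a := t / 2 + 1 / R with ha
  have hRa : 1 ≤ R * a := one_le_mul_add_inv (by positivity) hR
  have ha0 : 0 < a := by positivity
  have hB0 : 0 ≤ B := (norm_nonneg _).trans (hB 0)
  have hk := windowConst_nonneg d 0
  have hk' := windowConst_nonneg d (-1)
  have h := fun A : FirstOrder d => norm_op_expansion_le (-1) (by positivity : 0 ≤ t / 2) hR hc hB A
  have h3 := norm_integral_mul_harmonicOscillator_le
    (v := expansion R fun α => (Real.exp (-(a * eigenvalue α)) : ℂ) *
      windowMult 0 (eigenvalue α / R) * hermiteFun α x)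
    (w := expansion R fun α => ((Real.exp (-(t / 2 * eigenvalue α)) *
      (eigenvalue α / R) ^ (-1 : ℤ) : ℝ) : ℂ) * c α)
    (B := 4 / Real.sqrt a * windowConst d (-1) * B) (fun i x => h (.der i) x)
    (fun i x => h (.pos i) x)
  have hc' : Windowed R fun α => (R : ℂ) * ((Real.exp (-(t / 2 * eigenvalue α)) : ℂ) * c α) :=
    fun α hα => hc α (right_ne_zero_of_mul (right_ne_zero_of_mul hα))
  have e := integral_expansion_mul_multKernel (windowMult 0) .one a R
    (fun α => (R : ℂ) * ((Real.exp (-(t / 2 * eigenvalue α)) : ℂ) * c α)) x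
  -- The kernel at time `t/2 + 1/R` acts on `R e^{-(t/2)H} w`. The window cancels the `1/R`, so the
  -- total time is `t`, and the function acted upon is rewritten as a value of `H`.
  rw [ha, ← multiplier_expansion_eq 0 (t / 2) hc', ← ha,
    ← harmonicOscillator_inv_expansion hc fun α => Real.exp (-(t / 2 * eigenvalue α))] at e
  have e2 : ∫ y, (expansion R fun α => (Real.exp (-(a * eigenvalue α)) : ℂ) *
      windowMult 0 (eigenvalue α / R) * hermiteFun α x) y * harmonicOscillator (expansion R fun α =>
      ((Real.exp (-(t / 2 * eigenvalue α)) * (eigenvalue α / R) ^ (-1 : ℤ) : ℝ) : ℂ) * c α) y =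
      R * expansion R (fun α => (Real.exp (-(t * eigenvalue α)) : ℂ) * c α) x := by
    rw [← expansion_const_mul]
    refine Eq.trans ?_ (e.trans ?_)
    · congr 1; funext y
      rw [mul_comm]
      congr 1
      rw [multKernel, expansion_apply]
      exact Finset.sum_congr rfl fun α _ => by simp only [FirstOrder.op_one]; ring
    · rw [FirstOrder.op_one]
      refine congrArg (fun v : 𝓢(Space d, ℂ) => v x) (expansion_congr fun α => ?_)
      have e4 : Real.exp (-(t * eigenvalue α)) =
          Real.exp (-(t / 2 * eigenvalue α)) * Real.exp (-(t / 2 * eigenvalue α)) := by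
        rw [← Real.exp_add]; congr 1; ring
      rw [e4, zpow_zero]
      push_cast
      ring
  rw [e2, norm_mul, Complex.norm_real, Real.norm_eq_abs, abs_of_pos hR] at h3
  have h4 : R * ‖expansion R (fun α => (Real.exp (-(t * eigenvalue α)) : ℂ) * c α) x‖ ≤
      (2 * d * (4 / Real.sqrt a * windowConst d 0)) *
        (4 / Real.sqrt a * windowConst d (-1) * B) := by
    refine h3.trans ?_
    gcongr
    exact gradNorm_multKernel_le hR hRa x
  rw [le_div_iff₀ (by positivity), heatConst]
  have hs : Real.sqrt a ≠ 0 := (Real.sqrt_pos.2 ha0).ne'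
  have e5 : (2 * d * (4 / Real.sqrt a * windowConst d 0)) *
        (4 / Real.sqrt a * windowConst d (-1) * B) =
        32 * d * windowConst d 0 * windowConst d (-1) * B / a := by
    rw [← Real.mul_self_sqrt ha0.le, Real.sqrt_mul_self (Real.sqrt_nonneg a)]
    field_simp; ring
  rw [e5, le_div_iff₀ ha0] at h4
  have e6 : R * a = t * R / 2 + 1 := by rw [ha]; field_simp
  set N := ‖expansion R (fun α => (Real.exp (-(t * eigenvalue α)) : ℂ) * c α) x‖
  have hN : 0 ≤ N := norm_nonneg _
  have : N * (R * a) ≤ 32 * d * windowConst d 0 * windowConst d (-1) * B := by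
    calc _ = R * N * a := by ring
      _ ≤ _ := h4
  rw [e6] at this
  linarith

/-- Mean value inequality in time: the derivative is `-R` times the multiplier `e^{-sλ} (λ/R)`,
which is bounded uniformly in `s ≥ 0`. -/
theorem norm_heat_sub_expansion_le {d : ℕ} {h R B : ℝ} (hh : 0 ≤ h) (hR : 0 < R)
    {c : (Fin d → ℕ) → ℂ} (hc : Windowed R c) (hB : ∀ x, ‖expansion R c x‖ ≤ B) (x : Space d) :
    ‖expansion R (fun α => (Real.exp (-(h * eigenvalue α)) : ℂ) * c α) x - expansion R c x‖ ≤
      windowConst d 1 * B * (h * R) := by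
  have hd : ∀ s : ℝ, HasDerivAt
      (fun s : ℝ => expansion R (fun α => (Real.exp (-(s * eigenvalue α)) : ℂ) * c α) x)
      (-R * expansion R (fun α => ((Real.exp (-(s * eigenvalue α)) *
        (eigenvalue α / R) ^ (1 : ℤ) : ℝ) : ℂ) * c α) x) s := by
    intro s
    simp only [expansion_apply, Finset.mul_sum]
    refine HasDerivAt.fun_sum fun α _ => ?_
    have h1 : HasDerivAt (fun s : ℝ => Real.exp (-(s * eigenvalue α)))
        (Real.exp (-(s * eigenvalue α)) * -(1 * eigenvalue α)) s :=
      (((hasDerivAt_id s).mul_const _).neg).exp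
    refine ((h1.ofReal_comp.mul_const (c α)).mul_const (hermiteFun α x)).congr_deriv ?_
    have h2' : (R : ℂ) ≠ 0 := by exact_mod_cast hR.ne'
    push_cast
    rw [zpow_one]
    field_simp
  have key := (convex_Ici (0 : ℝ)).norm_image_sub_le_of_norm_hasDerivWithin_le
    (C := R * (windowConst d 1 * B))
    (fun s _ => (hd s).hasDerivWithinAt) (fun s hs => by
      rw [norm_mul, norm_neg, Complex.norm_real, Real.norm_eq_abs, abs_of_pos hR]
      have := norm_op_expansion_le 1 (Set.mem_Ici.1 hs) hR hc hB .one x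
      simp only [FirstOrder.op_one, FirstOrder.weight, one_mul] at this
      gcongr) (Set.mem_Ici.2 le_rfl) (Set.mem_Ici.2 hh)
  simp only [zero_mul, neg_zero, Real.exp_zero, Complex.ofReal_one, one_mul, sub_zero] at key
  rw [Real.norm_eq_abs, abs_of_nonneg hh] at key
  linarith

/-! ### Littlewood-Paley blocks -/

/-- The profile of the `n`-th block, as a function of `√(λ / 4 ^ n)`. -/
def DyadicPartition.profile (P : DyadicPartition) : ℕ → ℝ → ℝ
  | 0 => P.low
  | _ + 1 => fun ξ => P.chi (2 * ξ)

theorem DyadicPartition.profile_smooth (P : DyadicPartition) (n : ℕ) :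
    ContDiff ℝ ∞ (P.profile n) := by
  cases n with
  | zero => exact P.low_smooth
  | succ n => exact P.chi_smooth.comp (contDiff_const.mul contDiff_id)

/-- At scale `4^n` all blocks with `n ≥ 1` have the same profile `χ(2·)`, so two kernel constants
are enough for the whole decomposition. -/
theorem DyadicPartition.symbol_eq_profile (P : DyadicPartition) (n : ℕ) {l : ℝ} :
    P.symbol n (Real.sqrt l) = P.profile n (Real.sqrt (l / 4 ^ n)) := by
  cases n with
  | zero => simp [DyadicPartition.symbol, DyadicPartition.profile]
  | succ n =>
    simp only [DyadicPartition.symbol, DyadicPartition.profile]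
    congr 1
    rw [Real.sqrt_div' _ (by positivity), pow_succ, Real.sqrt_mul (by positivity),
      show (4 : ℝ) = 2 ^ 2 by norm_num, ← pow_mul, mul_comm 2 n, pow_mul,
      Real.sqrt_sq (by positivity), Real.sqrt_sq (by positivity)]
    field_simp

theorem DyadicPartition.low_eq_zero (P : DyadicPartition) {ξ : ℝ} (h : 4 / 3 < ξ) :
    P.low ξ = 0 := by
  by_contra h0
  have := (P.low_support (subset_tsupport _ h0)).2
  linarith

theorem DyadicPartition.chi_eq_zero (P : DyadicPartition) {ξ : ℝ} (h : ξ < 3 / 4 ∨ 8 / 3 < ξ) :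
    P.chi ξ = 0 := by
  by_contra h0
  have := P.chi_support (subset_tsupport _ h0)
  rcases h with h | h <;> linarith [this.1, this.2]

/-- For `n ≥ 1` the support gives `√(l / 4^n) ∈ [3/8, 4/3]`, and `1/8 ≤ 9/64` while `16/9 ≤ 15/8`.
For the low block the lower bound comes from `1 ≤ l` instead. -/
theorem DyadicPartition.symbol_window (P : DyadicPartition) {n : ℕ} {l : ℝ} (hl : 1 ≤ l)
    (h : P.symbol n (Real.sqrt l) ≠ 0) : l / 4 ^ n ∈ Set.Icc (1 / 8 : ℝ) (15 / 8) := by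
  have hs : Real.sqrt (l / 4 ^ n) ^ 2 = l / 4 ^ n := Real.sq_sqrt (by positivity)
  have hs0 := Real.sqrt_nonneg (l / 4 ^ n)
  rw [P.symbol_eq_profile] at h
  cases n with
  | zero =>
    have h1 : Real.sqrt (l / 4 ^ 0) ≤ 4 / 3 := by
      by_contra hc
      exact h (P.low_eq_zero (not_le.1 hc))
    simp only [pow_zero, div_one] at *
    constructor
    · linarith
    · nlinarith
  | succ n =>
    have h1 : ¬ (2 * Real.sqrt (l / 4 ^ (n + 1)) < 3 / 4 ∨ 8 / 3 < 2 * Real.sqrt (l / 4 ^ (n + 1))) :=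
      fun hc => h (P.chi_eq_zero hc)
    push Not at h1
    rw [← hs]
    constructor <;> nlinarith [h1.1, h1.2]

theorem DyadicPartition.symbol_nonneg (P : DyadicPartition) (n : ℕ) (ξ : ℝ) : 0 ≤ P.symbol n ξ := by
  cases n with
  | zero => exact (P.low_mem ξ).1
  | succ n => exact (P.chi_mem _).1

theorem DyadicPartition.hasSum_symbol (P : DyadicPartition) {ξ : ℝ} (h : 0 ≤ ξ) :
    HasSum (fun n => P.symbol n ξ) 1 := by
  rw [← hasSum_nat_add_iff' 1]
  simpa [DyadicPartition.symbol] using P.hasSum_one ξ h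

/-- The multiplier of the `n`-th block, as a Schwartz function of `λ / 4 ^ n`. -/
def DyadicPartition.mult (P : DyadicPartition) (n : ℕ) : 𝓢(ℝ, ℂ) :=
  SchwartzMap.postcompCLM Complex.ofRealCLM
    ((hasCompactSupport_windowBump_mul fun ξ => Real.exp ξ * P.profile n (Real.sqrt ξ)).toSchwartzMap
    (contDiff_windowBump_mul fun _ hξ => Real.contDiff_exp.contDiffAt.mul
      ((P.profile_smooth n).contDiffAt.comp _ (Real.contDiffAt_sqrt hξ.ne'))) : 𝓢(ℝ, ℝ))

theorem DyadicPartition.mult_apply (P : DyadicPartition) (n : ℕ) (ξ : ℝ) :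
    P.mult n ξ = ((windowBump ξ * (Real.exp ξ * P.profile n (Real.sqrt ξ)) : ℝ) : ℂ) := rfl

theorem DyadicPartition.mult_eq_zero (P : DyadicPartition) (n : ℕ) {d : ℕ} {R : ℝ} (hR : 0 < R) :
    ∀ α ∉ modes d R, P.mult n (eigenvalue α / R) = 0 := by
  intro α hα
  rw [mem_modes, not_le] at hα
  rw [P.mult_apply, windowBump_eq_zero (Or.inr ((le_div_iff₀ hR).2 hα.le)), zero_mul,
    Complex.ofReal_zero]

theorem DyadicPartition.exp_mul_mult (P : DyadicPartition) (n : ℕ) {l : ℝ} (hl : 1 ≤ l) :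
    (Real.exp (-(1 / 4 ^ n * l)) : ℂ) * P.mult n (l / 4 ^ n) = (P.symbol n (Real.sqrt l) : ℂ) := by
  rw [P.mult_apply, ← P.symbol_eq_profile, ← Complex.ofReal_mul]
  congr 1
  by_cases h : P.symbol n (Real.sqrt l) = 0
  · simp [h]
  rw [windowBump_eq_one (P.symbol_window hl h), one_mul, ← mul_assoc, ← Real.exp_add,
    show -(1 / 4 ^ n * l) + l / 4 ^ n = 0 by ring, Real.exp_zero, one_mul]

variable {d : ℕ}

/-- The coefficients of the `n`-th block. -/
def blockCoeff (P : DyadicPartition) (n : ℕ) (c : (Fin d → ℕ) → ℂ) (α : Fin d → ℕ) : ℂ :=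
  (P.symbol n (Real.sqrt (eigenvalue α)) : ℂ) * c α

theorem windowed_blockCoeff (hd : 1 ≤ d) (P : DyadicPartition) (n : ℕ) (c : (Fin d → ℕ) → ℂ) :
    Windowed (4 ^ n) (blockCoeff P n c) := fun α hα =>
  P.symbol_window (one_le_eigenvalue hd α) (by
    have := left_ne_zero_of_mul hα
    exact_mod_cast this)

theorem block_eq_expansion (hd : 1 ≤ d) (P : DyadicPartition) (n : ℕ) (w : 𝓢'(Space d, ℂ)) :
    block P n w = expansion (4 ^ n) (blockCoeff P n fun α => w (hermiteFun α)) := by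
  rw [block, expansion]
  refine finsum_eq_sum_of_support_subset _ fun α hα => ?_
  have h : blockCoeff P n (fun α => w (hermiteFun α)) α ≠ 0 := fun h => by
    refine hα ?_
    show (blockCoeff P n (fun α => w (hermiteFun α)) α) • hermiteFun α = 0
    rw [h, zero_smul]
  have := (windowed_blockCoeff hd P n _ α h).2
  rw [div_le_iff₀ (by positivity)] at this
  rw [Finset.mem_coe, mem_modes]
  have h4 : (0 : ℝ) < 4 ^ n := by positivity
  linarith

/-- The kernel of the `n`-th block. -/
def blockKernel (P : DyadicPartition) (n : ℕ) (x : Space d) : 𝓢(Space d, ℂ) :=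
  expansion (4 ^ n) (blockCoeff P n fun α => hermiteFun α x)

/-- Turns any bound on `w ψ` in terms of norms of `ψ` into a bound on the blocks of `w`, through the
same norms of the kernel. -/
theorem block_apply (hd : 1 ≤ d) (P : DyadicPartition) (n : ℕ) (w : 𝓢'(Space d, ℂ)) (x : Space d) :
    block P n w x = w (blockKernel P n x) := by
  rw [block_eq_expansion hd, expansion_apply, blockKernel, expansion, map_sum]
  refine Finset.sum_congr rfl fun α _ => ?_
  rw [map_smul, smul_eq_mul, blockCoeff, blockCoeff]
  ring

/-- The constant of the kernel estimates for the blocks. -/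
def blockConst (d : ℕ) (P : DyadicPartition) : ℝ :=
  (kernelConst d (P.mult 0)).toReal + (kernelConst d (P.mult 1)).toReal

theorem blockConst_nonneg (d : ℕ) (P : DyadicPartition) : 0 ≤ blockConst d P :=
  add_nonneg ENNReal.toReal_nonneg ENNReal.toReal_nonneg

theorem kernelConst_mult_le (d : ℕ) (P : DyadicPartition) (n : ℕ) :
    (kernelConst d (P.mult n)).toReal ≤ blockConst d P := by
  cases n with
  | zero => exact le_add_of_nonneg_right ENNReal.toReal_nonneg
  | succ n => exact le_add_of_nonneg_left ENNReal.toReal_nonneg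

theorem integral_norm_op_blockKernel_le (hd : 1 ≤ d) (P : DyadicPartition) (n : ℕ)
    (A : FirstOrder d) (x : Space d) :
    ∫ y, ‖A.op (blockKernel P n x) y‖ ≤ A.weight (1 / 4 ^ n) * blockConst d P := by
  have h4 : (0 : ℝ) < 4 ^ n := by positivity
  have h := (integral_norm_multKernel_le (P.mult n) A h4 (a := 1 / 4 ^ n)
    (by rw [mul_one_div_cancel h4.ne']) (P.mult_eq_zero n h4) x).1
  refine le_trans (le_trans (le_of_eq ?_) h) (mul_le_mul_of_nonneg_left
    (kernelConst_mult_le d P n) (A.weight_nonneg _))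
  congr 1; funext y
  rw [blockKernel, op_expansion_apply, multKernel]
  congr 1
  refine Finset.sum_congr rfl fun α _ => ?_
  rw [P.exp_mul_mult n (one_le_eigenvalue hd α), blockCoeff, mul_assoc]

theorem sqrt_one_div_four_pow (n : ℕ) : Real.sqrt (1 / 4 ^ n) = 1 / 2 ^ n := by
  rw [Real.sqrt_div' _ (by positivity), Real.sqrt_one, show (4 : ℝ) = 2 ^ 2 by norm_num,
    ← pow_mul, mul_comm 2 n, pow_mul, Real.sqrt_sq (by positivity)]

theorem integral_norm_blockKernel_le (hd : 1 ≤ d) (P : DyadicPartition) (n : ℕ) (x : Space d) :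
    ∫ y, ‖blockKernel P n x y‖ ≤ blockConst d P := by
  simpa [FirstOrder.weight] using integral_norm_op_blockKernel_le hd P n .one x

theorem gradNorm_blockKernel_le (hd : 1 ≤ d) (P : DyadicPartition) (n : ℕ) (x : Space d) :
    gradNorm (blockKernel P n x) ≤ 8 * d * blockConst d P * 2 ^ n := by
  have h := fun A : FirstOrder d => integral_norm_op_blockKernel_le hd P n A x
  rw [gradNorm]
  calc _ ≤ (∑ _i : Fin d, 4 / Real.sqrt (1 / 4 ^ n) * blockConst d P) +
        ∑ _i : Fin d, 4 / Real.sqrt (1 / 4 ^ n) * blockConst d P :=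
        add_le_add (Finset.sum_le_sum fun i _ => h (.der i))
          (Finset.sum_le_sum fun i _ => h (.pos i))
    _ = _ := by
      rw [sqrt_one_div_four_pow]
      simp only [Finset.sum_const, Finset.card_univ, Fintype.card_fin, nsmul_eq_mul]
      field_simp; ring

theorem block_add (hd : 1 ≤ d) (P : DyadicPartition) (n : ℕ) (v w : 𝓢'(Space d, ℂ)) :
    block P n (v + w) = block P n v + block P n w := by
  ext x
  rw [_root_.add_apply, block_apply hd, block_apply hd, block_apply hd]; rfl

theorem block_sub (hd : 1 ≤ d) (P : DyadicPartition) (n : ℕ) (v w : 𝓢'(Space d, ℂ)) :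
    block P n (v - w) = block P n v - block P n w := by
  ext x
  rw [_root_.sub_apply, block_apply hd, block_apply hd, block_apply hd]; rfl

theorem block_zero (P : DyadicPartition) (n : ℕ) : block P n (0 : 𝓢'(Space d, ℂ)) = 0 := by
  refine (finsum_congr fun α => ?_).trans finsum_zero
  show (_ * (0 : ℂ)) • hermiteFun α = 0
  simp

/-- `‖δ_{n-1} w‖_{L^∞} ≤ B 2^{-nσ}` for all `n`. -/
def BlockLE (P : DyadicPartition) (σ B : ℝ) (w : 𝓢'(Space d, ℂ)) : Prop :=
  ∀ n x, ‖block P n w x‖ ≤ B * (2 : ℝ) ^ (-(n * σ))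

/-! ### Besov bounds in terms of blocks -/

theorem BlockLE.nonneg {P : DyadicPartition} {σ B : ℝ} {w : 𝓢'(Space d, ℂ)}
    (h : BlockLE P σ B w) : 0 ≤ B := by
  have := (norm_nonneg _).trans (h 0 0)
  simpa using this

theorem BlockLE.mono {P : DyadicPartition} {σ σ' B B' : ℝ} {w : 𝓢'(Space d, ℂ)}
    (h : BlockLE P σ B w) (hσ : σ' ≤ σ) (hB : B ≤ B') : BlockLE P σ' B' w := fun n x => by
  refine (h n x).trans ?_
  have h0 := h.nonneg
  gcongr
  · exact h0.trans hB
  · norm_num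

theorem BlockLE.add (hd : 1 ≤ d) {P : DyadicPartition} {σ B B' : ℝ} {v w : 𝓢'(Space d, ℂ)}
    (h : BlockLE P σ B v) (h' : BlockLE P σ B' w) : BlockLE P σ (B + B') (v + w) := fun n x => by
  rw [block_add hd, _root_.add_apply, add_mul]
  exact (norm_add_le _ _).trans (add_le_add (h n x) (h' n x))

theorem BlockLE.sub (hd : 1 ≤ d) {P : DyadicPartition} {σ B B' : ℝ} {v w : 𝓢'(Space d, ℂ)}
    (h : BlockLE P σ B v) (h' : BlockLE P σ B' w) : BlockLE P σ (B + B') (v - w) := fun n x => by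
  rw [block_sub hd, _root_.sub_apply, add_mul]
  exact (norm_sub_le _ _).trans (add_le_add (h n x) (h' n x))

theorem blockLE_zero (P : DyadicPartition) (σ : ℝ) : BlockLE P σ 0 (0 : 𝓢'(Space d, ℂ)) :=
  fun n x => by rw [block_zero]; simp

theorem BlockLE.sum (hd : 1 ≤ d) {ι : Type*} (s : Finset ι) {P : DyadicPartition} {σ : ℝ}
    {B : ι → ℝ} {w : ι → 𝓢'(Space d, ℂ)} (h : ∀ i ∈ s, BlockLE P σ (B i) (w i)) :
    BlockLE P σ (∑ i ∈ s, B i) (∑ i ∈ s, w i) := by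
  classical
  induction s using Finset.induction_on with
  | empty => simpa using blockLE_zero P σ
  | insert i s hi ih =>
    rw [Finset.sum_insert hi, Finset.sum_insert hi]
    exact (h i (Finset.mem_insert_self _ _)).add hd
      (ih fun j hj => h j (Finset.mem_insert_of_mem hj))

theorem enorm_le_eLpNorm_top {f : Space d → ℂ} (hf : Continuous f) (x : Space d) :
    ‖f x‖ₑ ≤ eLpNorm f ⊤ volume := by
  rw [eLpNorm_exponent_top]
  by_contra hc
  push Not at hc
  have ho : IsOpen {y | eLpNormEssSup f volume < ‖f y‖ₑ} :=
    isOpen_lt continuous_const hf.enorm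
  have h0 : volume {y | eLpNormEssSup f volume < ‖f y‖ₑ} = 0 := by
    have := enorm_ae_le_eLpNormEssSup f (volume : Measure (Space d))
    rw [ae_iff] at this
    simpa using this
  exact (ho.measure_pos volume ⟨x, hc⟩).ne' h0

theorem two_rpow_shift (n : ℕ) (σ : ℝ) :
    (2 : ℝ≥0∞) ^ (((n : ℝ) - 1) * σ) = ENNReal.ofReal ((2 : ℝ) ^ (((n : ℝ) - 1) * σ)) := by
  rw [← ENNReal.ofReal_rpow_of_pos two_pos]; simp

/-- The factor `2^σ` accounts for the shift of index: the norm weighs the `n`-th block by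
`2^{(n-1)σ}`, and `BlockLE` by `2^{nσ}`. -/
theorem besovNorm_le_iff {P : DyadicPartition} {σ M : ℝ} (hM : 0 ≤ M) {w : 𝓢'(Space d, ℂ)} :
    besovNorm P σ w ≤ ENNReal.ofReal M ↔ BlockLE P σ (2 ^ σ * M) w := by
  have key : ∀ n : ℕ, (2 : ℝ) ^ σ * M * 2 ^ (-(n * σ)) = M / 2 ^ (((n : ℝ) - 1) * σ) := by
    intro n
    rw [div_eq_mul_inv, ← Real.rpow_neg zero_le_two, mul_comm (2 ^ σ : ℝ), mul_assoc,
      ← Real.rpow_add two_pos]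
    congr 2; ring
  have hp : ∀ n : ℕ, (0 : ℝ) < 2 ^ (((n : ℝ) - 1) * σ) := fun n => by positivity
  rw [besovNorm, iSup_le_iff]
  refine forall_congr' fun n => ?_
  rw [two_rpow_shift]
  constructor
  · intro h x
    rw [key, le_div_iff₀' (hp n), ← ENNReal.ofReal_le_ofReal_iff hM,
      ENNReal.ofReal_mul (hp n).le, ofReal_norm]
    refine le_trans ?_ h
    gcongr
    exact enorm_le_eLpNorm_top (block P n w).continuous x
  · intro h
    have h1 : eLpNorm (block P n w) ⊤ volume ≤
        ENNReal.ofReal (M / 2 ^ (((n : ℝ) - 1) * σ)) := by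
      rw [eLpNorm_exponent_top]
      refine eLpNormEssSup_le_of_ae_bound (Eventually.of_forall fun x => ?_)
      rw [← key]
      exact h x
    calc _ ≤ ENNReal.ofReal ((2 : ℝ) ^ (((n : ℝ) - 1) * σ)) *
          ENNReal.ofReal (M / 2 ^ (((n : ℝ) - 1) * σ)) := by gcongr
      _ = _ := by
        rw [← ENNReal.ofReal_mul (hp n).le, mul_div_cancel₀ _ (hp n).ne']

theorem blockLE_toReal {P : DyadicPartition} {σ : ℝ} {w : 𝓢'(Space d, ℂ)}
    (h : besovNorm P σ w < ⊤) : BlockLE P σ (2 ^ σ * (besovNorm P σ w).toReal) w :=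
  (besovNorm_le_iff ENNReal.toReal_nonneg).1 (by rw [ENNReal.ofReal_toReal h.ne])

theorem BlockLE.besovNorm_le {P : DyadicPartition} {σ B : ℝ} {w : 𝓢'(Space d, ℂ)}
    (h : BlockLE P σ B w) : besovNorm P σ w ≤ ENNReal.ofReal (2 ^ (-σ) * B) := by
  rw [besovNorm_le_iff (mul_nonneg (by positivity) h.nonneg), ← mul_assoc,
    ← Real.rpow_add two_pos, add_neg_cancel, Real.rpow_zero, one_mul]
  exact h

/-! ### Products -/

/-- With truncated subtraction the exponent is `|m - l|`. -/
theorem geom_abs_sum {q : ℝ} (h0 : 0 ≤ q) (h1 : q < 1) (m : ℕ) :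
    Summable (fun l : ℕ => q ^ ((m - l) + (l - m))) ∧
      ∑' l : ℕ, q ^ ((m - l) + (l - m)) ≤ 2 / (1 - q) := by
  have hg := hasSum_geometric_of_lt_one h0 h1
  have hs : HasSum (fun l : ℕ => q ^ ((m - l) + (l - m)))
      ((1 - q)⁻¹ + ∑ l ∈ Finset.range m, q ^ ((m - l) + (l - m))) := by
    rw [← hasSum_nat_add_iff]
    refine hg.congr_fun fun n => ?_
    congr 1; omega
  refine ⟨hs.summable, ?_⟩
  rw [hs.tsum_eq]
  have h2 : ∑ l ∈ Finset.range m, q ^ ((m - l) + (l - m)) ≤ (1 - q)⁻¹ := by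
    rw [← Finset.sum_range_reflect]
    refine le_trans (Finset.sum_le_sum fun j hj => ?_) (hg.summable.sum_le_tsum (Finset.range m)
      (fun i _ => by positivity) |>.trans hg.tsum_eq.le)
    rw [Finset.mem_range] at hj
    exact pow_le_pow_of_le_one h0 h1.le (by omega)
  calc _ ≤ (1 - q)⁻¹ + (1 - q)⁻¹ := by gcongr
    _ = _ := by ring

theorem geom_double_sum {r q : ℝ} (hr0 : 0 ≤ r) (hr1 : r < 1) (h0 : 0 ≤ q) (h1 : q < 1) (n : ℕ) :
    Summable (fun p : ℕ × ℕ => r ^ p.1 * q ^ ((p.1 + n - p.2) + (p.2 - (p.1 + n)))) ∧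
      ∑' p : ℕ × ℕ, r ^ p.1 * q ^ ((p.1 + n - p.2) + (p.2 - (p.1 + n))) ≤
        (1 - r)⁻¹ * (2 / (1 - q)) := by
  have hg := hasSum_geometric_of_lt_one hr0 hr1
  have hle : ∀ k : ℕ, ∑' l : ℕ, r ^ k * q ^ ((k + n - l) + (l - (k + n))) ≤
      r ^ k * (2 / (1 - q)) := fun k => by
    rw [tsum_mul_left]
    exact mul_le_mul_of_nonneg_left (geom_abs_sum h0 h1 (k + n)).2 (by positivity)
  have hs : Summable fun k : ℕ => ∑' l : ℕ, r ^ k * q ^ ((k + n - l) + (l - (k + n))) :=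
    Summable.of_nonneg_of_le
      (fun k => tsum_nonneg fun l => mul_nonneg (pow_nonneg hr0 _) (pow_nonneg h0 _)) hle
      (hg.summable.mul_right _)
  have hS : Summable (fun p : ℕ × ℕ => r ^ p.1 * q ^ ((p.1 + n - p.2) + (p.2 - (p.1 + n)))) := by
    refine (summable_prod_of_nonneg fun p => ?_).2
      ⟨fun k => (geom_abs_sum h0 h1 (k + n)).1.mul_left (r ^ k), hs⟩
    exact mul_nonneg (pow_nonneg hr0 _) (pow_nonneg h0 _)
  refine ⟨hS, ?_⟩
  rw [hS.tsum_prod]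
  calc _ ≤ ∑' k : ℕ, r ^ k * (2 / (1 - q)) := hs.tsum_le_tsum hle (hg.summable.mul_right _)
    _ = (1 - r)⁻¹ * (2 / (1 - q)) := by rw [tsum_mul_right, hg.tsum_eq]

/-- The product of two Schwartz functions. -/
def mulS (v w : 𝓢(Space d, ℂ)) : 𝓢(Space d, ℂ) :=
  SchwartzMap.pairing (ContinuousLinearMap.mul ℂ ℂ) v w

theorem mulS_apply (v w : 𝓢(Space d, ℂ)) (x : Space d) : mulS v w x = v x * w x := by
  simp [mulS, SchwartzMap.pairing_apply_apply]

theorem coordDeriv_mulS (i : Fin d) (v w : 𝓢(Space d, ℂ)) (x : Space d) :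
    coordDeriv i (mulS v w) x = coordDeriv i v x * w x + v x * coordDeriv i w x := by
  have e : (⇑(mulS v w) : Space d → ℂ) = fun y => v y * w y := funext (mulS_apply v w)
  have h : ∀ z : 𝓢(Space d, ℂ), HasLineDerivAt ℝ z (coordDeriv i z x) x
      (EuclideanSpace.basisFun (Fin d) ℝ i) := fun z => by
    rw [coordDeriv_apply]
    exact z.differentiableAt.lineDifferentiableAt.hasLineDerivAt
  rw [coordDeriv_apply, e]
  refine HasLineDerivAt.lineDeriv ?_
  have := HasDerivAt.mul (h v) (h w)
  simp only [zero_smul, add_zero] at this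
  exact this

theorem integral_norm_nonneg (ψ : 𝓢(Space d, ℂ)) : 0 ≤ ∫ x, ‖ψ x‖ :=
  integral_nonneg fun _ => norm_nonneg _

theorem gradNorm_nonneg (ψ : 𝓢(Space d, ℂ)) : 0 ≤ gradNorm ψ :=
  add_nonneg (Finset.sum_nonneg fun _ _ => integral_norm_nonneg _)
    (Finset.sum_nonneg fun _ _ => integral_norm_nonneg _)

theorem gradNorm_mulS_le {ψ v : 𝓢(Space d, ℂ)} {B B' : ℝ} (h : ∀ x, ‖v x‖ ≤ B)
    (h' : ∀ i x, ‖coordDeriv i v x‖ ≤ B') :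
    gradNorm (mulS ψ v) ≤ gradNorm ψ * B + d * ((∫ x, ‖ψ x‖) * B') := by
  have h1 : ∀ i, ∫ x, ‖coordDeriv i (mulS ψ v) x‖ ≤
      (∫ x, ‖coordDeriv i ψ x‖) * B + (∫ x, ‖ψ x‖) * B' := fun i => by
    rw [← integral_mul_const, ← integral_mul_const, ← integral_add
      ((coordDeriv i ψ).integrable.norm.mul_const _) (ψ.integrable.norm.mul_const _)]
    refine integral_mono (coordDeriv i (mulS ψ v)).integrable.norm
      (((coordDeriv i ψ).integrable.norm.mul_const _).add (ψ.integrable.norm.mul_const _))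
      fun x => ?_
    show ‖coordDeriv i (mulS ψ v) x‖ ≤ ‖coordDeriv i ψ x‖ * B + ‖ψ x‖ * B'
    rw [coordDeriv_mulS]
    refine (norm_add_le _ _).trans ?_
    rw [norm_mul, norm_mul]
    gcongr
    · exact h x
    · exact h' i x
  have h2 : ∀ i, ∫ x, ‖coordMul i (mulS ψ v) x‖ ≤ (∫ x, ‖coordMul i ψ x‖) * B := fun i => by
    rw [← integral_mul_const]
    refine integral_mono (coordMul i (mulS ψ v)).integrable.norm
      ((coordMul i ψ).integrable.norm.mul_const _) fun x => ?_
    show ‖coordMul i (mulS ψ v) x‖ ≤ ‖coordMul i ψ x‖ * B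
    rw [coordMul_apply, coordMul_apply, mulS_apply, ← mul_assoc, norm_mul]
    gcongr
    exact h x
  rw [gradNorm]
  calc _ ≤ (∑ i, ((∫ x, ‖coordDeriv i ψ x‖) * B + (∫ x, ‖ψ x‖) * B')) +
        ∑ i, (∫ x, ‖coordMul i ψ x‖) * B :=
        add_le_add (Finset.sum_le_sum fun i _ => h1 i) (Finset.sum_le_sum fun i _ => h2 i)
    _ = _ := by
      rw [Finset.sum_add_distrib, ← Finset.sum_mul, ← Finset.sum_mul, ← Finset.sum_mul, gradNorm,
        add_mul]
      simp only [Finset.sum_const, Finset.card_univ, Fintype.card_fin, nsmul_eq_mul]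
      ring

/-- The contribution of a pair of blocks to a product. -/
def prodTerm (P : DyadicPartition) (u f : 𝓢'(Space d, ℂ)) (ψ : 𝓢(Space d, ℂ)) (p : ℕ × ℕ) : ℂ :=
  ∫ x, ψ x * (block P p.1 u x * block P p.2 f x)

theorem norm_prodTerm_le {P : DyadicPartition} {β σ U F : ℝ} {u f : 𝓢'(Space d, ℂ)}
    (hu : BlockLE P β U u) (hf : BlockLE P σ F f) (ψ : 𝓢(Space d, ℂ)) (k l : ℕ) :
    ‖prodTerm P u f ψ (k, l)‖ ≤
      (∫ x, ‖ψ x‖) * (U * 2 ^ (-(k * β)) * (F * 2 ^ (-(l * σ)))) := by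
  have h : ∀ x, ‖mulS (block P k u) (block P l f) x‖ ≤
      U * 2 ^ (-(k * β)) * (F * 2 ^ (-(l * σ))) := fun x => by
    rw [mulS_apply, norm_mul]
    have := hu.nonneg
    exact mul_le_mul (hu k x) (hf l x) (norm_nonneg _) (by positivity)
  have := norm_integral_mul_le (v := ψ) h
  simpa only [mulS_apply, prodTerm] using this

/-- The constant of the paraproduct estimates. -/
def paraConst (d : ℕ) : ℝ := 4 * windowConst d (-1) * (1 + 4 * d * windowConst d 0)

theorem paraConst_nonneg (d : ℕ) : 0 ≤ paraConst d := by
  have := windowConst_nonneg d 0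
  have := windowConst_nonneg d (-1)
  unfold paraConst
  positivity

theorem sqrt_four_pow (n : ℕ) : Real.sqrt (4 ^ n) = 2 ^ n := by
  rw [show (4 : ℝ) = 2 ^ 2 by norm_num, ← pow_mul, mul_comm 2 n, pow_mul,
    Real.sqrt_sq (by positivity)]

/-- The block of `f` is the oscillating factor: integrating by parts against it gains `2^{-l}`. The
first order operator falls either on `ψ` or on the block of `u`, where it costs `2^k`. -/
theorem norm_prodTerm_le_grad (hd : 1 ≤ d) {P : DyadicPartition} {β σ U F : ℝ}
    {u f : 𝓢'(Space d, ℂ)} (hu : BlockLE P β U u) (hf : BlockLE P σ F f) (ψ : 𝓢(Space d, ℂ))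
    (k l : ℕ) :
    ‖prodTerm P u f ψ (k, l)‖ ≤ paraConst d * (gradNorm ψ + 2 ^ k * ∫ x, ‖ψ x‖) *
      (U * 2 ^ (-(k * β)) * (F * 2 ^ (-(l * σ)))) / 2 ^ l := by
  have hu0 := hu.nonneg
  have hf0 := hf.nonneg
  have hk0 := windowConst_nonneg d 0
  have hk1 := windowConst_nonneg d (-1)
  have hG := gradNorm_nonneg ψ
  have hM := integral_norm_nonneg ψ
  have hb : ∀ i x, ‖coordDeriv i (block P k u) x‖ ≤
      4 * 2 ^ k * windowConst d 0 * (U * 2 ^ (-(k * β))) := fun i x => by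
    have h := hu k
    rw [block_eq_expansion hd] at h ⊢
    have := norm_op_windowed_le (by positivity : (0 : ℝ) < 4 ^ k)
      (windowed_blockCoeff hd P k _) h (.der i) x
    simpa only [FirstOrder.op, FirstOrder.weight, sqrt_one_div_four_pow, div_div_eq_mul_div,
      div_one] using this
  have hg := gradNorm_mulS_le (ψ := ψ) (hu k) hb
  have h := hf l
  have e : prodTerm P u f ψ (k, l) = ∫ x, mulS ψ (block P k u) x * block P l f x := by
    simp only [prodTerm, mulS_apply, mul_assoc]
  rw [e]
  rw [block_eq_expansion hd P l] at h ⊢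
  have := norm_integral_mul_windowed_le (by positivity : (0 : ℝ) < 4 ^ l)
      (windowed_blockCoeff hd P l _) h (mulS ψ (block P k u))
  rw [sqrt_four_pow] at this
  refine this.trans ?_
  calc _ ≤ (gradNorm ψ * (U * 2 ^ (-(k * β))) + d * ((∫ x, ‖ψ x‖) *
        (4 * 2 ^ k * windowConst d 0 * (U * 2 ^ (-(k * β)))))) *
        (4 / 2 ^ l * windowConst d (-1) * (F * 2 ^ (-(l * σ)))) := by gcongr
    _ = (4 * windowConst d (-1) * (gradNorm ψ + 4 * d * windowConst d 0 * (2 ^ k * ∫ x, ‖ψ x‖))) *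
      (U * 2 ^ (-(k * β)) * (F * 2 ^ (-(l * σ)))) / 2 ^ l := by ring
    _ ≤ _ := by
      have h3 : 0 ≤ 4 * d * windowConst d 0 * gradNorm ψ := by positivity
      have h4 : 0 ≤ 2 ^ k * ∫ x, ‖ψ x‖ := by positivity
      rw [paraConst, mul_assoc (4 * windowConst d (-1)) (1 + 4 * d * windowConst d 0)]
      refine div_le_div_of_nonneg_right (mul_le_mul_of_nonneg_right (mul_le_mul_of_nonneg_left ?_
        (by positivity)) (by positivity)) (by positivity)
      linarith

/-- The ratio of the geometric decay away from the diagonal. -/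
def offRatio (η : ℝ) : ℝ := max (2 ^ (-η)) (2 ^ (-(1 - η)))

theorem two_rpow_neg_lt_one {x : ℝ} (h : 0 < x) : (2 : ℝ) ^ (-x) < 1 :=
  Real.rpow_lt_one_of_one_lt_of_neg one_lt_two (neg_lt_zero.2 h)

theorem offRatio_nonneg (η : ℝ) : 0 ≤ offRatio η := le_max_of_le_left (by positivity)

theorem offRatio_lt_one {η : ℝ} (h0 : 0 < η) (h1 : η < 1) : offRatio η < 1 :=
  max_lt (two_rpow_neg_lt_one h0) (two_rpow_neg_lt_one (sub_pos.2 h1))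

theorem two_rpow_nat_mul (x : ℝ) (n : ℕ) : (2 : ℝ) ^ (n * x) = ((2 : ℝ) ^ x) ^ n := by
  rw [mul_comm, Real.rpow_mul_natCast zero_le_two]

/-- The quantity controlling products tested against `ψ`, at the scale `2 ^ n`. -/
def testNorm (η : ℝ) (n : ℕ) (ψ : 𝓢(Space d, ℂ)) : ℝ :=
  2 ^ (n * η) * (∫ x, ‖ψ x‖) + 2 ^ (-(n * (1 - η))) * gradNorm ψ

theorem testNorm_nonneg (η : ℝ) (n : ℕ) (ψ : 𝓢(Space d, ℂ)) : 0 ≤ testNorm η n ψ := by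
  have := gradNorm_nonneg ψ
  have := integral_norm_nonneg ψ
  unfold testNorm; positivity

/-- Replaces the spectral localization of paraproducts. For `l ≤ k + n` the sup bound is enough,
since `2^{lη}` decays geometrically below `l = k + n`. For `l ≥ k + n` the gain `2^{-l}` of one
integration by parts beats `2^{lη}`, because `η < 1`. In both cases what remains in `k` is
`2^{-k(β-η)}`. -/
theorem norm_prodTerm_le_testNorm (hd : 1 ≤ d) {P : DyadicPartition} {β η U F : ℝ} (h0 : 0 < η)
    (h1 : η < 1) {u f : 𝓢'(Space d, ℂ)} (hu : BlockLE P β U u) (hf : BlockLE P (-η) F f)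
    (ψ : 𝓢(Space d, ℂ)) (n k l : ℕ) :
    ‖prodTerm P u f ψ (k, l)‖ ≤ (1 + paraConst d) * (U * F) * testNorm η n ψ *
      (((2 : ℝ) ^ (-(β - η))) ^ k * offRatio η ^ ((k + n - l) + (l - (k + n)))) := by
  have hu0 := hu.nonneg
  have hf0 := hf.nonneg
  have hG := gradNorm_nonneg ψ
  have hM := integral_norm_nonneg ψ
  have hp := paraConst_nonneg d
  have hq := offRatio_nonneg η
  set M := ∫ x, ‖ψ x‖
  set G := gradNorm ψ
  rcases le_total l (k + n) with h | h
  · obtain ⟨j, hj⟩ := Nat.exists_eq_add_of_le h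
    rw [show k + n - l = j by omega, show l - (k + n) = 0 by omega, add_zero]
    have e : (2 : ℝ) ^ (-(k * β)) * 2 ^ (-(l * -η)) =
        2 ^ (n * η) * (((2 : ℝ) ^ (-(β - η))) ^ k * ((2 : ℝ) ^ (-η)) ^ j) := by
      rw [← two_rpow_nat_mul, ← two_rpow_nat_mul, ← Real.rpow_add two_pos, ← Real.rpow_add two_pos,
        ← Real.rpow_add two_pos]
      congr 1
      have : (k : ℝ) + n = l + j := by exact_mod_cast hj
      have e2 : (l : ℝ) = k + n - j := by linarith
      rw [e2]; ring
    calc _ ≤ M * (U * 2 ^ (-(k * β)) * (F * 2 ^ (-(l * -η)))) := norm_prodTerm_le hu hf ψ k l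
      _ = (U * F) * (2 ^ (n * η) * M) * (((2 : ℝ) ^ (-(β - η))) ^ k * ((2 : ℝ) ^ (-η)) ^ j) := by
        linear_combination (M * U * F) * e
      _ ≤ (1 + paraConst d) * (U * F) * testNorm η n ψ *
          (((2 : ℝ) ^ (-(β - η))) ^ k * offRatio η ^ j) := by
        have t1 : 2 ^ (n * η) * M ≤ testNorm η n ψ := le_add_of_nonneg_right (by positivity)
        have t2 : (2 : ℝ) ^ (-η) ≤ offRatio η := le_max_left _ _
        have t3 : U * F ≤ (1 + paraConst d) * (U * F) := by
          have : 0 ≤ paraConst d * (U * F) := by positivity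
          linarith
        have t4 := testNorm_nonneg η n ψ
        gcongr
  · obtain ⟨j, hj⟩ := Nat.exists_eq_add_of_le h
    rw [show k + n - l = 0 by omega, show l - (k + n) = j by omega, zero_add]
    have hl : (l : ℝ) = k + n + j := by exact_mod_cast hj
    have e : (2 : ℝ) ^ (-(k * β)) * 2 ^ (-(l * -η)) / 2 ^ l =
        (((2 : ℝ) ^ (-(β - η))) ^ k * ((2 : ℝ) ^ (-(1 - η))) ^ j) *
          (2 ^ (-(n * (1 - η))) * 2 ^ (-(k : ℝ))) := by
      rw [← two_rpow_nat_mul, ← two_rpow_nat_mul, ← Real.rpow_natCast 2 l, div_eq_mul_inv,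
        ← Real.rpow_neg zero_le_two, ← Real.rpow_add two_pos, ← Real.rpow_add two_pos,
        ← Real.rpow_add two_pos, ← Real.rpow_add two_pos, ← Real.rpow_add two_pos]
      congr 1
      rw [hl]; ring
    have t1 : 2 ^ (-(n * (1 - η))) * 2 ^ (-(k : ℝ)) * (G + 2 ^ k * M) ≤ testNorm η n ψ := by
      have a1 : (2 : ℝ) ^ (-(k : ℝ)) ≤ 1 := Real.rpow_le_one_of_one_le_of_nonpos one_le_two (by simp)
      have a2 : (2 : ℝ) ^ (-(k : ℝ)) * 2 ^ k = 1 := by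
        rw [Real.rpow_neg zero_le_two, Real.rpow_natCast, inv_mul_cancel₀ (by positivity)]
      have a3 : (2 : ℝ) ^ (-(n * (1 - η))) ≤ 2 ^ (n * η) := by
        refine Real.rpow_le_rpow_of_exponent_le one_le_two ?_
        have : (0 : ℝ) ≤ n := Nat.cast_nonneg n
        nlinarith
      calc _ = 2 ^ (-(n * (1 - η))) * M * (2 ^ (-(k : ℝ)) * 2 ^ k) +
            2 ^ (-(n * (1 - η))) * G * 2 ^ (-(k : ℝ)) := by ring
        _ ≤ 2 ^ (n * η) * M * 1 + 2 ^ (-(n * (1 - η))) * G * 1 := by rw [a2]; gcongr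
        _ = _ := by rw [mul_one, mul_one]; rfl
    calc _ ≤ paraConst d * (G + 2 ^ k * M) * (U * 2 ^ (-(k * β)) * (F * 2 ^ (-(l * -η)))) / 2 ^ l :=
          norm_prodTerm_le_grad hd hu hf ψ k l
      _ = paraConst d * (U * F) * (2 ^ (-(n * (1 - η))) * 2 ^ (-(k : ℝ)) * (G + 2 ^ k * M)) *
          (((2 : ℝ) ^ (-(β - η))) ^ k * ((2 : ℝ) ^ (-(1 - η))) ^ j) := by
        linear_combination (paraConst d * (G + 2 ^ k * M) * U * F) * e
      _ ≤ (1 + paraConst d) * (U * F) * testNorm η n ψ *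
          (((2 : ℝ) ^ (-(β - η))) ^ k * offRatio η ^ j) := by
        have t2 : (2 : ℝ) ^ (-(1 - η)) ≤ offRatio η := le_max_right _ _
        have t3 : paraConst d ≤ 1 + paraConst d := by linarith
        have t4 := testNorm_nonneg η n ψ
        gcongr

/-- The constant of the product estimate. -/
def prodConst (d : ℕ) (η β : ℝ) : ℝ :=
  (1 + paraConst d) * ((1 - (2 : ℝ) ^ (-(β - η)))⁻¹ * (2 / (1 - offRatio η)))

theorem prodConst_nonneg {η β : ℝ} (h0 : 0 < η) (h1 : η < 1) (hβ : η < β) :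
    0 ≤ prodConst d η β := by
  have := paraConst_nonneg d
  have a := two_rpow_neg_lt_one (sub_pos.2 hβ)
  have b := offRatio_lt_one h0 h1
  have a' : 0 < 1 - (2 : ℝ) ^ (-(β - η)) := by linarith
  have b' : 0 < 1 - offRatio η := by linarith
  unfold prodConst
  positivity

/-- The scale `n` is free: `n = 0` shows that the product is a tempered distribution, and taking for
`n` the index of a block gives the Besov bound. -/
theorem summable_prodTerm (hd : 1 ≤ d) {P : DyadicPartition} {β η U F : ℝ} (h0 : 0 < η)
    (h1 : η < 1) (hβ : η < β) {u f : 𝓢'(Space d, ℂ)} (hu : BlockLE P β U u)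
    (hf : BlockLE P (-η) F f) (ψ : 𝓢(Space d, ℂ)) :
    Summable (prodTerm P u f ψ) ∧ ∀ n : ℕ, ‖∑' p, prodTerm P u f ψ p‖ ≤
      prodConst d η β * (U * F) * testNorm η n ψ := by
  have hg := fun n => geom_double_sum (r := (2 : ℝ) ^ (-(β - η))) (by positivity)
    (two_rpow_neg_lt_one (sub_pos.2 hβ)) (offRatio_nonneg η) (offRatio_lt_one h0 h1) n
  have hb := fun n (p : ℕ × ℕ) => norm_prodTerm_le_testNorm hd h0 h1 hu hf ψ n p.1 p.2
  refine ⟨Summable.of_norm_bounded ((hg 0).1.mul_left _) (hb 0), fun n => ?_⟩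
  refine (tsum_of_norm_bounded ((hg n).1.hasSum.mul_left _) (hb n)).trans ?_
  have := paraConst_nonneg d
  have := testNorm_nonneg η n ψ
  have := hu.nonneg
  have := hf.nonneg
  calc _ ≤ (1 + paraConst d) * (U * F) * testNorm η n ψ *
        ((1 - (2 : ℝ) ^ (-(β - η)))⁻¹ * (2 / (1 - offRatio η))) := by
        gcongr
        exact (hg n).2
    _ = _ := by rw [prodConst]; ring

/-- A linear functional bounded by first order `L¹` norms is a tempered distribution. -/
def mkDistribution (l : 𝓢(Space d, ℂ) →ₗ[ℂ] ℂ) {C : ℝ}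
    (h : ∀ ψ, ‖l ψ‖ ≤ C * ((∫ x, ‖ψ x‖) + gradNorm ψ)) : 𝓢'(Space d, ℂ) :=
  ContinuousLinearMap.toPointwiseConvergenceCLM _ _ _ _ (⟨l, by
    refine continuous_of_continuousAt_zero l ?_
    have hc : ∀ A : FirstOrder d, Continuous fun ψ : 𝓢(Space d, ℂ) => ∫ x, ‖A.op ψ x‖ := fun A => by
      have := ((SchwartzMap.toLpCLM ℂ ℂ 1 (volume : Measure (Space d))).continuous.comp
        A.op.continuous).norm
      refine this.congr fun ψ => ?_
      exact SchwartzMap.norm_toLp_one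
    have hc2 : Continuous fun ψ : 𝓢(Space d, ℂ) => C * ((∫ x, ‖ψ x‖) + gradNorm ψ) := by
      refine continuous_const.mul ((hc .one).add ?_)
      exact (continuous_finsetSum _ fun i _ => hc (.der i)).add
        (continuous_finsetSum _ fun i _ => hc (.pos i))
    have h0 : Tendsto (fun ψ : 𝓢(Space d, ℂ) => C * ((∫ x, ‖ψ x‖) + gradNorm ψ)) (𝓝 0) (𝓝 0) := by
      have := hc2.tendsto 0
      simpa [gradNorm] using this
    show Tendsto l (𝓝 0) (𝓝 (l 0))
    rw [map_zero]
    exact squeeze_zero_norm h h0⟩ : 𝓢(Space d, ℂ) →L[ℂ] ℂ)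

theorem integrable_mul_mul (ψ v w : 𝓢(Space d, ℂ)) : Integrable fun x => ψ x * (v x * w x) := by
  have := integrable_mul ψ (mulS v w)
  simpa only [mulS_apply] using this

theorem coe_schwartz_apply (v ψ : 𝓢(Space d, ℂ)) : (v : 𝓢'(Space d, ℂ)) ψ = ∫ x, ψ x * v x :=
  SchwartzMap.toTemperedDistributionCLM_apply_apply volume v ψ

theorem partial_product_apply (P : DyadicPartition) (u f : 𝓢'(Space d, ℂ)) (ψ : 𝓢(Space d, ℂ))
    (N : ℕ) :
    (SchwartzMap.pairing (ContinuousLinearMap.mul ℂ ℂ) (∑ n ∈ Finset.range N, block P n u)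
      (∑ n ∈ Finset.range N, block P n f) : 𝓢'(Space d, ℂ)) ψ =
      ∑ p ∈ Finset.range N ×ˢ Finset.range N, prodTerm P u f ψ p := by
  rw [coe_schwartz_apply]
  simp only [prodTerm]
  rw [← integral_finsetSum _ fun p _ => integrable_mul_mul ψ _ _]
  congr 1; funext x
  rw [SchwartzMap.pairing_apply_apply, ContinuousLinearMap.mul_apply', _root_.sum_apply,
    _root_.sum_apply, Finset.sum_mul_sum, ← Finset.sum_product', Finset.mul_sum]

theorem tendsto_range_product :
    Tendsto (fun N : ℕ => Finset.range N ×ˢ Finset.range N) atTop atTop := by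
  refine tendsto_atTop_finset_of_monotone (fun a b h => ?_) fun p => ⟨max p.1 p.2 + 1, ?_⟩
  · exact Finset.product_subset_product (Finset.range_mono h) (Finset.range_mono h)
  · simp only [Finset.mem_product, Finset.mem_range]
    omega

/-- Absolute summability makes the sums over squares converge to the full double series.
`mkDistribution` provides the limit in `𝓢'`, so the `limUnder` in the definition of the product is a
true limit. -/
theorem besovMul_apply (hd : 1 ≤ d) {P : DyadicPartition} {β η U F : ℝ} (h0 : 0 < η)
    (h1 : η < 1) (hβ : η < β) {u f : 𝓢'(Space d, ℂ)} (hu : BlockLE P β U u)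
    (hf : BlockLE P (-η) F f) (ψ : 𝓢(Space d, ℂ)) :
    besovMul P u f ψ = ∑' p, prodTerm P u f ψ p := by
  have hs := fun ψ => summable_prodTerm hd h0 h1 hβ hu hf ψ
  let l : 𝓢(Space d, ℂ) →ₗ[ℂ] ℂ :=
    { toFun := fun ψ => ∑' p, prodTerm P u f ψ p
      map_add' := fun ψ φ => by
        rw [← (hs ψ).1.tsum_add (hs φ).1]
        congr 1; funext p
        simp only [prodTerm]
        rw [← integral_add (integrable_mul_mul ψ _ _) (integrable_mul_mul φ _ _)]
        congr 1; funext x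
        rw [_root_.add_apply]; ring
      map_smul' := fun c ψ => by
        rw [smul_eq_mul, ← tsum_mul_left]
        congr 1; funext p
        simp only [prodTerm]
        rw [RingHom.id_apply, ← integral_const_mul]
        congr 1; funext x
        rw [_root_.smul_apply, smul_eq_mul]; ring }
  have hl : ∀ ψ, ‖l ψ‖ ≤ prodConst d η β * (U * F) * ((∫ x, ‖ψ x‖) + gradNorm ψ) := fun ψ => by
    have := (hs ψ).2 0
    simp only [testNorm, Nat.cast_zero, zero_mul, neg_zero, Real.rpow_zero, one_mul] at this
    exact this
  have ht : Tendsto (fun N : ℕ => (SchwartzMap.pairing (ContinuousLinearMap.mul ℂ ℂ)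
      (∑ n ∈ Finset.range N, block P n u) (∑ n ∈ Finset.range N, block P n f) : 𝓢'(Space d, ℂ)))
      atTop (𝓝 (mkDistribution l hl)) := by
    rw [PointwiseConvergenceCLM.tendsto_iff_forall_tendsto]
    intro ψ
    simp only [partial_product_apply]
    exact (hs ψ).1.hasSum.comp tendsto_range_product
  rw [besovMul, ht.limUnder_eq]
  rfl

theorem norm_besovMul_le (hd : 1 ≤ d) {P : DyadicPartition} {β η U F : ℝ} (h0 : 0 < η)
    (h1 : η < 1) (hβ : η < β) {u f : 𝓢'(Space d, ℂ)} (hu : BlockLE P β U u)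
    (hf : BlockLE P (-η) F f) (ψ : 𝓢(Space d, ℂ)) (n : ℕ) :
    ‖besovMul P u f ψ‖ ≤ prodConst d η β * (U * F) * testNorm η n ψ := by
  rw [besovMul_apply hd h0 h1 hβ hu hf]
  exact (summable_prodTerm hd h0 h1 hβ hu hf ψ).2 n

/-- The constant of the product estimate in Besov norms. -/
def mulConst (d : ℕ) (P : DyadicPartition) (η β : ℝ) : ℝ :=
  prodConst d η β * (blockConst d P * (1 + 8 * d))

theorem mulConst_nonneg {P : DyadicPartition} {η β : ℝ} (h0 : 0 < η) (h1 : η < 1) (hβ : η < β) :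
    0 ≤ mulConst d P η β := by
  have := prodConst_nonneg (d := d) h0 h1 hβ
  have := blockConst_nonneg d P
  unfold mulConst; positivity

/-- The kernel of the `n`-th block has bounded `L¹` norm and weighted gradient norm `O(2^n)`. At the
scale `n` both terms of `testNorm` are then of order `2^{nη}`. -/
theorem blockLE_besovMul (hd : 1 ≤ d) {P : DyadicPartition} {β η U F : ℝ} (h0 : 0 < η)
    (h1 : η < 1) (hβ : η < β) {u f : 𝓢'(Space d, ℂ)} (hu : BlockLE P β U u)
    (hf : BlockLE P (-η) F f) : BlockLE P (-η) (mulConst d P η β * (U * F)) (besovMul P u f) := by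
  intro n x
  have hu0 := hu.nonneg
  have hf0 := hf.nonneg
  have hp := prodConst_nonneg (d := d) h0 h1 hβ
  rw [block_apply hd]
  refine (norm_besovMul_le hd h0 h1 hβ hu hf _ n).trans ?_
  have h2 : testNorm η n (blockKernel P n x) ≤ blockConst d P * (1 + 8 * d) * 2 ^ (n * η) := by
    have e : (2 : ℝ) ^ (-(n * (1 - η))) * 2 ^ n = 2 ^ (n * η) := by
      rw [← Real.rpow_natCast, ← Real.rpow_add two_pos]
      congr 1; ring
    calc _ ≤ 2 ^ (n * η) * blockConst d P +
          2 ^ (-(n * (1 - η))) * (8 * d * blockConst d P * 2 ^ n) :=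
          add_le_add (mul_le_mul_of_nonneg_left (integral_norm_blockKernel_le hd P n x)
            (by positivity)) (mul_le_mul_of_nonneg_left (gradNorm_blockKernel_le hd P n x)
            (by positivity))
      _ = _ := by linear_combination (8 * d * blockConst d P) * e
  calc _ ≤ prodConst d η β * (U * F) * (blockConst d P * (1 + 8 * d) * 2 ^ (n * η)) := by gcongr
    _ = _ := by rw [mulConst, mul_neg, neg_neg]; ring

/-! ### The semigroup on distributions -/

/-- The distribution is bounded by first order `L¹` norms. -/
def OrderOne (C : ℝ) (w : 𝓢'(Space d, ℂ)) : Prop :=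
  ∀ ψ : 𝓢(Space d, ℂ), ‖w ψ‖ ≤ C * ((∫ x, ‖ψ x‖) + gradNorm ψ)

/-- The distribution is the sum of its Hermite series. -/
def IsHermiteSum (w : 𝓢'(Space d, ℂ)) : Prop :=
  ∀ ψ : 𝓢(Space d, ℂ), HasSum (fun α : Fin d → ℕ => w (hermiteFun α) * ∫ x, ψ x * hermiteFun α x)
    (w ψ)

theorem IsHermiteSum.add {v w : 𝓢'(Space d, ℂ)} (hv : IsHermiteSum v) (hw : IsHermiteSum w) :
    IsHermiteSum (v + w) := fun ψ => by
  refine ((hv ψ).add (hw ψ)).congr_fun fun α => ?_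
  rw [← add_mul]; rfl

theorem IsHermiteSum.sub {v w : 𝓢'(Space d, ℂ)} (hv : IsHermiteSum v) (hw : IsHermiteSum w) :
    IsHermiteSum (v - w) := fun ψ => by
  refine ((hv ψ).sub (hw ψ)).congr_fun fun α => ?_
  rw [← sub_mul]; rfl

theorem isHermiteSum_zero : IsHermiteSum (0 : 𝓢'(Space d, ℂ)) := fun ψ => by
  refine (hasSum_zero (α := ℂ) (β := Fin d → ℕ)).congr_fun fun α => ?_
  show (0 : ℂ) * _ = 0
  rw [zero_mul]

theorem IsHermiteSum.sum {ι : Type*} (s : Finset ι) {w : ι → 𝓢'(Space d, ℂ)}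
    (h : ∀ i ∈ s, IsHermiteSum (w i)) : IsHermiteSum (∑ i ∈ s, w i) := by
  classical
  induction s using Finset.induction_on with
  | empty => simpa using isHermiteSum_zero
  | insert i s hi ih =>
    rw [Finset.sum_insert hi]
    exact (h i (Finset.mem_insert_self _ _)).add
      (ih fun j hj => h j (Finset.mem_insert_of_mem hj))

/-- The dominating sequence depends on `t` and `C` only, which also allows dominated convergence
when the distribution varies. -/
theorem exists_heat_term_bound {t : ℝ} (ht : 0 < t) (C : ℝ) :
    ∃ b : (Fin d → ℕ) → ℝ, Summable b ∧ ∀ w : 𝓢'(Space d, ℂ), OrderOne C w →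
      ∀ (ψ : 𝓢(Space d, ℂ)) (α : Fin d → ℕ), ‖((Real.exp (-(t * eigenvalue α)) : ℝ) : ℂ) *
        w (hermiteFun α) * ∫ x, ψ x * hermiteFun α x‖ ≤ b α * ∫ x, ‖ψ x‖ := by
  obtain ⟨b, hb, hbb⟩ := norm_hermiteFun_mul_bound (d := d) ht
  refine ⟨fun α => |C| * (1 + 2 * d) * b α, hb.mul_left _, fun w hw ψ α => ?_⟩
  have hC : ∀ α : Fin d → ℕ, ‖w (hermiteFun α)‖ ≤ |C| * ((∫ x, ‖hermiteFun α x‖) +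
      gradNorm (hermiteFun α)) := fun α => (hw _).trans (mul_le_mul_of_nonneg_right (le_abs_self C)
        (add_nonneg (integral_norm_nonneg _) (gradNorm_nonneg _)))
  have key : ∀ (α : Fin d → ℕ) x, Real.exp (-(t * eigenvalue α)) * ‖w (hermiteFun α)‖ *
      ‖hermiteFun α x‖ ≤ |C| * (1 + 2 * d) * b α := by
    intro α x
    have h := fun A => hbb α x A
    set e := Real.exp (-(t * eigenvalue α)) * ‖hermiteFun α x‖ with he
    have he0 : 0 ≤ e := by positivity
    calc _ = e * ‖w (hermiteFun α)‖ := by rw [he]; ring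
      _ ≤ e * (|C| * ((∫ x, ‖hermiteFun α x‖) + gradNorm (hermiteFun α))) := by
        gcongr; exact hC α
      _ = |C| * (e * (∫ x, ‖hermiteFun α x‖) + ((∑ i, e * ∫ x, ‖coordDeriv i (hermiteFun α) x‖) +
          ∑ i, e * ∫ x, ‖coordMul i (hermiteFun α) x‖)) := by
        rw [gradNorm, ← Finset.mul_sum, ← Finset.mul_sum]; ring
      _ ≤ |C| * (b α + ((∑ _i : Fin d, b α) + ∑ _i : Fin d, b α)) := by
        gcongr with i _ i _
        · exact h .one
        · exact h (.der i)
        · exact h (.pos i)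
      _ = _ := by simp; ring
  rw [← integral_const_mul, ← integral_const_mul]
  refine norm_integral_le_of_norm_le (ψ.integrable.norm.const_mul _)
    (Eventually.of_forall fun x => ?_)
  rw [norm_mul, norm_mul, norm_mul, Complex.norm_real, Real.norm_eq_abs, Real.abs_exp]
  calc _ = Real.exp (-(t * eigenvalue α)) * ‖w (hermiteFun α)‖ * ‖hermiteFun α x‖ * ‖ψ x‖ := by
        ring
    _ ≤ _ := mul_le_mul_of_nonneg_right (key α x) (norm_nonneg _)

theorem hasSum_heat_aux {t C : ℝ} (ht : 0 < t) {w : 𝓢'(Space d, ℂ)} (hw : OrderOne C w) :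
    ∃ B : ℝ, ∀ ψ : 𝓢(Space d, ℂ), Summable (fun α : Fin d → ℕ =>
      ((Real.exp (-(t * eigenvalue α)) : ℝ) : ℂ) * w (hermiteFun α) *
        ∫ x, ψ x * hermiteFun α x) ∧
      ‖∑' α : Fin d → ℕ, ((Real.exp (-(t * eigenvalue α)) : ℝ) : ℂ) * w (hermiteFun α) *
        ∫ x, ψ x * hermiteFun α x‖ ≤ B * ∫ x, ‖ψ x‖ := by
  obtain ⟨b, hb, hbb⟩ := exists_heat_term_bound (d := d) ht C
  refine ⟨∑' α, b α, fun ψ => ?_⟩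
  have hs := hb.mul_right (∫ x, ‖ψ x‖)
  refine ⟨Summable.of_norm_bounded hs (hbb w hw ψ), ?_⟩
  refine (tsum_of_norm_bounded hs.hasSum (hbb w hw ψ)).trans ?_
  rw [tsum_mul_right]

theorem hasSum_heat {t C : ℝ} (ht : 0 < t) {w : 𝓢'(Space d, ℂ)} (hw : OrderOne C w)
    (ψ : 𝓢(Space d, ℂ)) : HasSum (fun α : Fin d → ℕ =>
      ((Real.exp (-(t * eigenvalue α)) : ℝ) : ℂ) * w (hermiteFun α) *
        ∫ x, ψ x * hermiteFun α x) (heat t w ψ) := by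
  obtain ⟨B, hB⟩ := hasSum_heat_aux ht hw
  let l : 𝓢(Space d, ℂ) →ₗ[ℂ] ℂ :=
    { toFun := fun ψ => ∑' α : Fin d → ℕ, ((Real.exp (-(t * eigenvalue α)) : ℝ) : ℂ) *
        w (hermiteFun α) * ∫ x, ψ x * hermiteFun α x
      map_add' := fun ψ φ => by
        rw [← (hB ψ).1.tsum_add (hB φ).1]
        congr 1; funext α
        rw [← mul_add, ← integral_add (integrable_mul ψ _) (integrable_mul φ _)]
        congr 2; funext x
        rw [_root_.add_apply]; ring
      map_smul' := fun c ψ => by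
        rw [smul_eq_mul, ← tsum_mul_left]
        congr 1; funext α
        simp only [RingHom.id_apply, _root_.smul_apply, smul_eq_mul, mul_assoc, integral_const_mul]
        ring }
  have hl : ∀ ψ, ‖l ψ‖ ≤ |B| * ((∫ x, ‖ψ x‖) + gradNorm ψ) := fun ψ => by
    refine (hB ψ).2.trans ?_
    have h1 := integral_norm_nonneg ψ
    have h2 := gradNorm_nonneg ψ
    calc _ ≤ |B| * ∫ x, ‖ψ x‖ := by gcongr; exact le_abs_self B
      _ ≤ _ := by gcongr; linarith
  have e : ∀ (α : Fin d → ℕ) (ψ : 𝓢(Space d, ℂ)),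
      ((((Real.exp (-(t * eigenvalue α)) : ℝ) : ℂ) * w (hermiteFun α)) •
      (hermiteFun α : 𝓢'(Space d, ℂ))) ψ = ((Real.exp (-(t * eigenvalue α)) : ℝ) : ℂ) *
        w (hermiteFun α) * ∫ x, ψ x * hermiteFun α x := fun α ψ => by
    rw [← coe_schwartz_apply]; rfl
  have hs : HasSum (fun α : Fin d → ℕ =>
      (((Real.exp (-(t * eigenvalue α)) : ℝ) : ℂ) * w (hermiteFun α)) •
      (hermiteFun α : 𝓢'(Space d, ℂ))) (mkDistribution l hl) := by
    rw [HasSum, PointwiseConvergenceCLM.tendsto_iff_forall_tendsto]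
    intro ψ
    refine ((hB ψ).1.hasSum).congr fun s => ?_
    rw [← Finset.sum_congr rfl fun α _ => e α ψ]
    exact (_root_.sum_apply ..).symm
  rw [heat, hs.tsum_eq]
  exact (hB ψ).1.hasSum

theorem heat_hermiteFun {t C : ℝ} (ht : 0 < t) {w : 𝓢'(Space d, ℂ)} (hw : OrderOne C w)
    (β : Fin d → ℕ) :
    heat t w (hermiteFun β) = ((Real.exp (-(t * eigenvalue β)) : ℝ) : ℂ) * w (hermiteFun β) := by
  refine (hasSum_heat ht hw (hermiteFun β)).unique ?_
  have h := hasSum_single (α := ℂ) (f := fun α : Fin d → ℕ =>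
      ((Real.exp (-(t * eigenvalue α)) : ℝ) : ℂ) * w (hermiteFun α) *
        ∫ x, hermiteFun β x * hermiteFun α x) β fun α hα => by
    rw [integral_hermiteFun_mul, if_neg (Ne.symm hα), mul_zero]
  simp only [integral_hermiteFun_mul, if_true, mul_one] at h ⊢
  exact h

/-- Completeness of the Hermite functions is never needed: every term of a Riemann sum has passed
through the semigroup at a positive time, hence is given as a Hermite series. -/
theorem isHermiteSum_heat {t C : ℝ} (ht : 0 < t) {w : 𝓢'(Space d, ℂ)} (hw : OrderOne C w) :
    IsHermiteSum (heat t w) := fun ψ => by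
  refine (hasSum_heat ht hw ψ).congr_fun fun α => ?_
  rw [heat_hermiteFun ht hw]

theorem heat_zero (t : ℝ) : heat t (0 : 𝓢'(Space d, ℂ)) = 0 := by
  rw [heat]
  refine (tsum_congr fun α => ?_).trans tsum_zero
  show (_ * (0 : ℂ)) • _ = _
  rw [mul_zero, zero_smul]

/-! ### Smoothing and time continuity of the semigroup in Besov spaces -/

theorem blockCoeff_mul (P : DyadicPartition) (n : ℕ) (m c : (Fin d → ℕ) → ℂ) :
    blockCoeff P n (fun α => m α * c α) = fun α => m α * blockCoeff P n c α := by
  funext α; simp only [blockCoeff]; ring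

theorem rpow_le_one_add {x p : ℝ} (hx : 0 ≤ x) (h0 : 0 ≤ p) (h1 : p ≤ 1) : x ^ p ≤ 1 + x := by
  rcases le_total x 1 with h | h
  · exact (Real.rpow_le_one hx h h0).trans (by linarith)
  · calc x ^ p ≤ x ^ (1 : ℝ) := Real.rpow_le_rpow_of_exponent_le h h1
      _ ≤ 1 + x := by rw [Real.rpow_one]; linarith

theorem four_pow_rpow (n : ℕ) (p : ℝ) : ((4 : ℝ) ^ n) ^ p = 2 ^ (n * (2 * p)) := by
  rw [show (4 : ℝ) = 2 ^ 2 by norm_num, ← pow_mul, ← Real.rpow_natCast, ← Real.rpow_mul zero_le_two]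
  congr 1; push_cast; ring

/-- On the `n`-th block, `1 / (1 + t 4^n) ≤ (t 4^n)^{-p}` for `0 ≤ p ≤ 1`. Only the Hermite
coefficients of `v` are prescribed, because the blocks see nothing else. -/
theorem BlockLE.heat (hd : 1 ≤ d) {P : DyadicPartition} {σ B t p : ℝ} (ht : 0 < t) (h0 : 0 ≤ p)
    (h1 : p ≤ 1) {w v : 𝓢'(Space d, ℂ)} (hw : BlockLE P σ B w)
    (hv : ∀ α, v (hermiteFun α) =
      ((Real.exp (-(t * eigenvalue α)) : ℝ) : ℂ) * w (hermiteFun α)) :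
    BlockLE P (σ + 2 * p) (heatConst d * (t ^ (-p) * B)) v := by
  intro n x
  have hc := heatConst_nonneg d
  have hB := hw.nonneg
  have h := hw n
  rw [block_eq_expansion hd] at h ⊢
  simp only [hv, blockCoeff_mul P n _ fun α => w (hermiteFun α)]
  have h4 : (0 : ℝ) < 4 ^ n := by positivity
  refine (norm_heat_expansion_le_div ht.le h4 (windowed_blockCoeff hd P n _) h x).trans ?_
  rw [div_le_iff₀ (by positivity)]
  have key := rpow_le_one_add (by positivity : 0 ≤ t * 4 ^ n) h0 h1
  rw [Real.mul_rpow ht.le h4.le, four_pow_rpow] at key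
  have e1 : t ^ (-p) * t ^ p = 1 := by
    rw [← Real.rpow_add ht, neg_add_cancel, Real.rpow_zero]
  have e2 : (2 : ℝ) ^ (-(n * (σ + 2 * p))) * 2 ^ (n * (2 * p)) = 2 ^ (-(n * σ)) := by
    rw [← Real.rpow_add two_pos]; congr 1; ring
  calc heatConst d * (B * 2 ^ (-(n * σ))) =
      heatConst d * (t ^ (-p) * B) * 2 ^ (-(n * (σ + 2 * p))) * (t ^ p * 2 ^ (n * (2 * p))) := by
        rw [← e2]; linear_combination (-(heatConst d * B * 2 ^ (-(n * (σ + 2 * p))) *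
          2 ^ (n * (2 * p)))) * e1
    _ ≤ _ := by gcongr

/-- The constant of the time continuity of the semigroup. -/
def diffConst (d : ℕ) : ℝ := 1 + windowConst d 0 + windowConst d 1

theorem diffConst_nonneg (d : ℕ) : 0 ≤ diffConst d := by
  have := windowConst_nonneg d 0
  have := windowConst_nonneg d 1
  unfold diffConst; positivity

/-- Interpolation on each block between the mean value bound `h 4^n`, used when `h 4^n ≤ 1`, and the
trivial bound otherwise; `(h 4^n)^θ` dominates both. -/
theorem BlockLE.sub_heat (hd : 1 ≤ d) {P : DyadicPartition} {σ B h θ : ℝ} (hh : 0 ≤ h)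
    (h0 : 0 ≤ θ) (h1 : θ ≤ 1) {w v : 𝓢'(Space d, ℂ)} (hw : BlockLE P σ B w)
    (hv : ∀ α, v (hermiteFun α) =
      ((Real.exp (-(h * eigenvalue α)) : ℝ) : ℂ) * w (hermiteFun α)) :
    BlockLE P (σ - 2 * θ) (diffConst d * (h ^ θ * B)) (w - v) := by
  intro n x
  have hc0 := windowConst_nonneg d 0
  have hc1 := windowConst_nonneg d 1
  have hc := diffConst_nonneg d
  have hB := hw.nonneg
  have hwn := hw n
  rw [block_sub hd, _root_.sub_apply, norm_sub_rev]
  rw [block_eq_expansion hd] at hwn ⊢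
  rw [block_eq_expansion hd]
  simp only [hv, blockCoeff_mul P n _ fun α => w (hermiteFun α)]
  have h4 : (0 : ℝ) < 4 ^ n := by positivity
  have b1 := norm_heat_sub_expansion_le hh h4 (windowed_blockCoeff hd P n _) hwn x
  have b2 := (norm_sub_le _ _).trans (add_le_add
    (norm_heat_expansion_le hh h4 (windowed_blockCoeff hd P n _) hwn x) (hwn x))
  have e2 : (2 : ℝ) ^ (-(n * (σ - 2 * θ))) = 2 ^ (-(n * σ)) * (4 ^ n) ^ θ := by
    rw [four_pow_rpow, ← Real.rpow_add two_pos]; congr 1; ring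
  have e3 : diffConst d * (h ^ θ * B) * 2 ^ (-(n * (σ - 2 * θ))) =
      diffConst d * (B * 2 ^ (-(n * σ))) * (h * 4 ^ n) ^ θ := by
    rw [e2, Real.mul_rpow hh h4.le]; ring
  rw [e3]
  rcases le_total (h * 4 ^ n) 1 with hle | hle
  · refine b1.trans ?_
    have : h * 4 ^ n ≤ (h * 4 ^ n) ^ θ := by
      rcases eq_or_lt_of_le (by positivity : 0 ≤ h * 4 ^ n) with h00 | h00
      · rw [← h00]; exact Real.rpow_nonneg le_rfl _
      · conv_lhs => rw [← Real.rpow_one (h * 4 ^ n)]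
        exact Real.rpow_le_rpow_of_exponent_ge h00 hle h1
    have h3 : windowConst d 1 ≤ diffConst d := by unfold diffConst; linarith
    gcongr
  · refine b2.trans ?_
    have : 1 ≤ (h * 4 ^ n) ^ θ := Real.one_le_rpow hle h0
    have h3 : windowConst d 0 + 1 ≤ diffConst d := by unfold diffConst; linarith
    calc _ = (windowConst d 0 + 1) * (B * 2 ^ (-(n * σ))) * 1 := by ring
      _ ≤ _ := by gcongr

/-- A Hermite series in a Besov space of positive regularity is bounded by the `L¹` norm. -/
theorem IsHermiteSum.norm_le (hd : 1 ≤ d) {P : DyadicPartition} {σ B : ℝ} (hσ : 0 < σ)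
    {w : 𝓢'(Space d, ℂ)} (hw : IsHermiteSum w) (hB : BlockLE P σ B w) (ψ : 𝓢(Space d, ℂ)) :
    ‖w ψ‖ ≤ (1 - (2 : ℝ) ^ (-σ))⁻¹ * B * ∫ x, ‖ψ x‖ := by
  have hB0 := hB.nonneg
  have hs := hw ψ
  set a : (Fin d → ℕ) → ℂ := fun α => w (hermiteFun α) * ∫ x, ψ x * hermiteFun α x with ha
  have hsym := fun α : Fin d → ℕ => P.hasSum_symbol (Real.sqrt_nonneg (eigenvalue α))
  -- The partition of unity is inserted into the Hermite series. Its partial sums lie in `[0, 1]`,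
  -- so dominated convergence recovers `w ψ` as the limit of the sums of pairings with the blocks.
  have hlim : Tendsto (fun N : ℕ => ∑' α : Fin d → ℕ,
      ((∑ n ∈ Finset.range N, P.symbol n (Real.sqrt (eigenvalue α)) : ℝ) : ℂ) * a α) atTop
      (𝓝 (∑' α, a α)) := by
    refine tendsto_tsum_of_dominated_convergence (bound := fun α => ‖a α‖) hs.summable.norm
      (fun α => ?_) (Eventually.of_forall fun N α => ?_)
    · have := ((Complex.continuous_ofReal.tendsto _).comp (hsym α).tendsto_sum_nat).mul_const (a α)
      simpa using this
    · rw [norm_mul, Complex.norm_real, Real.norm_eq_abs, abs_of_nonneg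
        (Finset.sum_nonneg fun n _ => P.symbol_nonneg n _)]
      refine mul_le_of_le_one_left (norm_nonneg _) ?_
      exact sum_le_hasSum _ (fun n _ => P.symbol_nonneg n _) (hsym α)
  rw [hs.tsum_eq] at hlim
  have hblock : ∀ n, HasSum (fun α : Fin d → ℕ =>
      (P.symbol n (Real.sqrt (eigenvalue α)) : ℂ) * a α) (∫ x, ψ x * block P n w x) := by
    intro n
    have e : ∫ x, ψ x * block P n w x = ∑ α ∈ modes d (4 ^ n),
        (P.symbol n (Real.sqrt (eigenvalue α)) : ℂ) * a α := by
      have e2 : ∀ x, ψ x * block P n w x = ∑ α ∈ modes d (4 ^ n),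
          blockCoeff P n (fun α => w (hermiteFun α)) α * (ψ x * hermiteFun α x) := fun x => by
        rw [block_eq_expansion hd, expansion_apply, Finset.mul_sum]
        exact Finset.sum_congr rfl fun α _ => by ring
      simp only [e2]
      rw [integral_finsetSum _ fun α _ => (integrable_mul ψ _).const_mul _]
      refine Finset.sum_congr rfl fun α _ => ?_
      rw [integral_const_mul, blockCoeff, ha]
      ring
    rw [e]
    refine hasSum_sum_of_ne_finset_zero fun α hα => ?_
    have : P.symbol n (Real.sqrt (eigenvalue α)) = 0 := by
      by_contra h
      have h2 := (P.symbol_window (one_le_eigenvalue hd α) h).2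
      rw [mem_modes, not_le] at hα
      rw [div_le_iff₀ (by positivity)] at h2
      have : (0 : ℝ) < 4 ^ n := by positivity
      linarith
    rw [this, Complex.ofReal_zero, zero_mul]
  refine le_of_tendsto hlim.norm (Eventually.of_forall fun N => ?_)
  have e : ∑' α : Fin d → ℕ,
      ((∑ n ∈ Finset.range N, P.symbol n (Real.sqrt (eigenvalue α)) : ℝ) : ℂ) * a α =
      ∑ n ∈ Finset.range N, ∫ x, ψ x * block P n w x := by
    refine (HasSum.congr_fun (hasSum_sum fun n _ => hblock n) fun α => ?_).tsum_eq
    rw [← Finset.sum_mul, Complex.ofReal_sum]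
  rw [e]
  have hq := two_rpow_neg_lt_one hσ
  have hg := hasSum_geometric_of_lt_one (by positivity : 0 ≤ (2 : ℝ) ^ (-σ)) hq
  calc _ ≤ ∑ n ∈ Finset.range N, (∫ x, ‖ψ x‖) * (B * ((2 : ℝ) ^ (-σ)) ^ n) := by
        refine (norm_sum_le _ _).trans (Finset.sum_le_sum fun n _ => ?_)
        have := norm_integral_mul_le (v := ψ) (hB n)
        rwa [← mul_neg, two_rpow_nat_mul] at this
    _ = (∫ x, ‖ψ x‖) * B * ∑ n ∈ Finset.range N, ((2 : ℝ) ^ (-σ)) ^ n := by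
        rw [Finset.mul_sum]; exact Finset.sum_congr rfl fun n _ => by ring
    _ ≤ (∫ x, ‖ψ x‖) * B * (1 - (2 : ℝ) ^ (-σ))⁻¹ := by
        have := integral_norm_nonneg ψ
        gcongr
        exact sum_le_hasSum _ (fun n _ => by positivity) hg
    _ = _ := by ring

/-! ### Sewing -/

theorem orderOne_besovMul (hd : 1 ≤ d) {P : DyadicPartition} {β η U F : ℝ} (h0 : 0 < η)
    (h1 : η < 1) (hβ : η < β) {u f : 𝓢'(Space d, ℂ)} (hu : BlockLE P β U u)
    (hf : BlockLE P (-η) F f) : OrderOne (prodConst d η β * (U * F)) (besovMul P u f) := fun ψ => by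
  have := norm_besovMul_le hd h0 h1 hβ hu hf ψ 0
  simp only [testNorm, Nat.cast_zero, zero_mul, neg_zero, Real.rpow_zero, one_mul] at this
  exact this

theorem besovMul_sub_left (hd : 1 ≤ d) {P : DyadicPartition} {β η U U' F : ℝ} (h0 : 0 < η)
    (h1 : η < 1) (hβ : η < β) {u u' f : 𝓢'(Space d, ℂ)} (hu : BlockLE P β U u)
    (hu' : BlockLE P β U' u') (hf : BlockLE P (-η) F f) :
    besovMul P (u - u') f = besovMul P u f - besovMul P u' f := by
  ext ψ
  rw [_root_.sub_apply, besovMul_apply hd h0 h1 hβ (hu.sub hd hu') hf,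
    besovMul_apply hd h0 h1 hβ hu hf, besovMul_apply hd h0 h1 hβ hu' hf,
    ← (summable_prodTerm hd h0 h1 hβ hu hf ψ).1.tsum_sub
      (summable_prodTerm hd h0 h1 hβ hu' hf ψ).1]
  congr 1; funext p
  simp only [prodTerm]
  rw [← integral_sub (integrable_mul_mul ψ _ _) (integrable_mul_mul ψ _ _), block_sub hd]
  congr 1; funext x
  rw [_root_.sub_apply]; ring

theorem besovMul_add_right (hd : 1 ≤ d) {P : DyadicPartition} {β η U F F' : ℝ} (h0 : 0 < η)
    (h1 : η < 1) (hβ : η < β) {u f f' : 𝓢'(Space d, ℂ)} (hu : BlockLE P β U u)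
    (hf : BlockLE P (-η) F f) (hf' : BlockLE P (-η) F' f') :
    besovMul P u (f + f') = besovMul P u f + besovMul P u f' := by
  ext ψ
  rw [_root_.add_apply, besovMul_apply hd h0 h1 hβ hu (hf.add hd hf'),
    besovMul_apply hd h0 h1 hβ hu hf, besovMul_apply hd h0 h1 hβ hu hf',
    ← (summable_prodTerm hd h0 h1 hβ hu hf ψ).1.tsum_add
      (summable_prodTerm hd h0 h1 hβ hu hf' ψ).1]
  congr 1; funext p
  simp only [prodTerm]
  rw [← integral_add (integrable_mul_mul ψ _ _) (integrable_mul_mul ψ _ _), block_add hd]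
  congr 1; funext x
  rw [_root_.add_apply]; ring

/-- Blocks depend only on Hermite coefficients, so algebraic identities behind Besov bounds need
only be checked on these. -/
theorem BlockLE.congr (hd : 1 ≤ d) {P : DyadicPartition} {σ B : ℝ} {v w : 𝓢'(Space d, ℂ)}
    (h : BlockLE P σ B w) (hv : ∀ α : Fin d → ℕ, v (hermiteFun α) = w (hermiteFun α)) :
    BlockLE P σ B v := fun n x => by
  have := h n x
  rw [block_eq_expansion hd] at this ⊢
  simpa only [hv] using this

/-- Quantitative form of the assumptions on the paths. -/
structure PathBounds (P : DyadicPartition) (T lam η γ β F U : ℝ) (f u : ℝ → 𝓢'(Space d, ℂ)) :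
    Prop where
  F_nonneg : 0 ≤ F
  U_nonneg : 0 ≤ U
  f_le : ∀ r ∈ Set.Icc 0 T, ∀ v ∈ Set.Icc 0 T,
    BlockLE P (-η) (F * |v - r| ^ (1 - lam)) (f v - f r)
  u_le : ∀ r ∈ Set.Icc 0 T, BlockLE P β U (u r)
  u_sub : ∀ r ∈ Set.Icc 0 T, ∀ v ∈ Set.Icc 0 T, BlockLE P β (U * |v - r| ^ γ) (u v - u r)

/-- The elementary term `e^{-(t-a)H} (u_a · (f_b - f_a))`. -/
def elem (P : DyadicPartition) (u f : ℝ → 𝓢'(Space d, ℂ)) (t a b : ℝ) : 𝓢'(Space d, ℂ) :=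
  heat (t - a) (besovMul P (u a) (f b - f a))

section Sewing

variable {P : DyadicPartition} {T lam η γ β F U : ℝ} {f u : ℝ → 𝓢'(Space d, ℂ)}

theorem PathBounds.orderOne (hd : 1 ≤ d) (h0 : 0 < η) (h1 : η < 1) (hβ : η < β)
    (H : PathBounds P T lam η γ β F U f u) {a b c : ℝ} (ha : a ∈ Set.Icc 0 T)
    (hb : b ∈ Set.Icc 0 T) (hc : c ∈ Set.Icc 0 T) :
    OrderOne (prodConst d η β * (U * (F * |c - b| ^ (1 - lam)))) (besovMul P (u a) (f c - f b)) :=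
  orderOne_besovMul hd h0 h1 hβ (H.u_le a ha) (H.f_le b hb c hc)

theorem PathBounds.elem_hermiteFun (hd : 1 ≤ d) (h0 : 0 < η) (h1 : η < 1) (hβ : η < β)
    (H : PathBounds P T lam η γ β F U f u) {t a b : ℝ} (ha : a ∈ Set.Icc 0 T)
    (hb : b ∈ Set.Icc 0 T) (hat : a < t) (α : Fin d → ℕ) :
    elem P u f t a b (hermiteFun α) = ((Real.exp (-((t - a) * eigenvalue α)) : ℝ) : ℂ) *
      besovMul P (u a) (f b - f a) (hermiteFun α) :=
  heat_hermiteFun (sub_pos.2 hat) (H.orderOne hd h0 h1 hβ ha ha hb) α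

theorem PathBounds.isHermiteSum_elem (hd : 1 ≤ d) (h0 : 0 < η) (h1 : η < 1) (hβ : η < β)
    (H : PathBounds P T lam η γ β F U f u) {t a b : ℝ} (ha : a ∈ Set.Icc 0 T)
    (hb : b ∈ Set.Icc 0 T) (hat : a < t) : IsHermiteSum (elem P u f t a b) :=
  isHermiteSum_heat (sub_pos.2 hat) (H.orderOne hd h0 h1 hβ ha ha hb)

theorem PathBounds.blockLE_elem (hd : 1 ≤ d) (h0 : 0 < η) (h1 : η < 1) (hβ : η < β)
    (H : PathBounds P T lam η γ β F U f u) {t a b p : ℝ} (ha : a ∈ Set.Icc 0 T)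
    (hb : b ∈ Set.Icc 0 T) (hat : a < t) (hp0 : 0 ≤ p) (hp1 : p ≤ 1) :
    BlockLE P (-η + 2 * p) (heatConst d * ((t - a) ^ (-p) *
      (mulConst d P η β * (U * (F * |b - a| ^ (1 - lam)))))) (elem P u f t a b) :=
  (blockLE_besovMul hd h0 h1 hβ (H.u_le a ha) (H.f_le a ha b hb)).heat hd (sub_pos.2 hat) hp0 hp1
    fun α => heat_hermiteFun (sub_pos.2 hat) (H.orderOne hd h0 h1 hβ ha ha hb) α

/-- The defect equals `e^{-(t-c)H}((u_c - u_a)·(f_b - f_c)) + (1 - e^{-hH}) e^{-(t-c)H}(u_a·(f_b -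
f_c))`. The first term gains `h^γ` from `u`. The second gains `h^θ` from the semigroup, which first
has to smooth by `2θ` more derivatives, at the price of `θ` more powers of `(t-c)⁻¹`. -/
theorem PathBounds.blockLE_defect (hd : 1 ≤ d) (h0 : 0 < η) (h1 : η < 1) (hβ : η < β)
    (H : PathBounds P T lam η γ β F U f u) {t a b c h p θ : ℝ} (ha : a ∈ Set.Icc 0 T)
    (hb : b ∈ Set.Icc 0 T) (hc : c ∈ Set.Icc 0 T) (hct : c < t) (hh : 0 < h) (hac : c - a = h)
    (hcb : b - c = h) (hp0 : 0 ≤ p) (hθ0 : 0 ≤ θ) (hpθ : p + θ ≤ 1) :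
    BlockLE P (-η + 2 * p)
      (heatConst d * ((t - c) ^ (-p) * (mulConst d P η β * (U * h ^ γ * (F * h ^ (1 - lam))))) +
        diffConst d * (h ^ θ * (heatConst d * ((t - c) ^ (-(p + θ)) *
          (mulConst d P η β * (U * (F * h ^ (1 - lam))))))))
      (elem P u f t a c + elem P u f t c b - elem P u f t a b) := by
  have hat : a < t := by linarith
  have hfc := H.f_le c hc b hb
  have hfa := H.f_le a ha c hc
  have hus := H.u_sub a ha c hc
  rw [hcb, abs_of_pos hh] at hfc
  rw [hac, abs_of_pos hh] at hfa hus
  have hua := H.u_le a ha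
  have huc := H.u_le c hc
  have o1 := orderOne_besovMul hd h0 h1 hβ hus hfc
  have o2 := orderOne_besovMul hd h0 h1 hβ hua hfc
  have b1 := (blockLE_besovMul hd h0 h1 hβ hus hfc).heat hd (sub_pos.2 hct) hp0 (by linarith)
    fun α => heat_hermiteFun (sub_pos.2 hct) o1 α
  have b2 := (blockLE_besovMul hd h0 h1 hβ hua hfc).heat hd (sub_pos.2 hct)
    (add_nonneg hp0 hθ0) hpθ fun α => heat_hermiteFun (sub_pos.2 hct) o2 α
  have b3 := b2.sub_heat hd hh.le hθ0 (by linarith)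
    (v := heat (t - a) (besovMul P (u a) (f b - f c))) fun α => by
      rw [heat_hermiteFun (sub_pos.2 hat) o2, heat_hermiteFun (sub_pos.2 hct) o2, ← mul_assoc,
        ← Complex.ofReal_mul, ← Real.exp_add]
      congr 4
      rw [← hac]; ring
  rw [show -η + 2 * (p + θ) - 2 * θ = -η + 2 * p by ring] at b3
  refine (b1.add hd b3).congr hd fun α => ?_
  rw [_root_.sub_apply, _root_.add_apply, _root_.add_apply, _root_.sub_apply,
    H.elem_hermiteFun hd h0 h1 hβ ha hc hat, H.elem_hermiteFun hd h0 h1 hβ hc hb hct,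
    H.elem_hermiteFun hd h0 h1 hβ ha hb hat, heat_hermiteFun (sub_pos.2 hct) o1,
    heat_hermiteFun (sub_pos.2 hct) o2, heat_hermiteFun (sub_pos.2 hat) o2,
    besovMul_sub_left hd h0 h1 hβ huc hua hfc,
    show f b - f a = (f b - f c) + (f c - f a) by abel,
    besovMul_add_right hd h0 h1 hβ hua hfc hfa, _root_.sub_apply, _root_.add_apply]
  ring

/-! ### Summing the defects over dyadic refinements -/

theorem sum_range_two_mul {M : Type*} [AddCommMonoid M] (g : ℕ → M) (N : ℕ) :
    ∑ i ∈ Finset.range (2 * N), g i = ∑ i ∈ Finset.range N, (g (2 * i) + g (2 * i + 1)) := by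
  induction N with
  | zero => simp
  | succ N ih =>
    rw [show 2 * (N + 1) = 2 * N + 1 + 1 by ring, Finset.sum_range_succ, Finset.sum_range_succ, ih,
      Finset.sum_range_succ, add_assoc]

/-- Discrete form of `∫ x^{-q} dx = x^{1-q} / (1-q)`. The induction step is Bernoulli's inequality
for `(N / (N+1))^{1-q}`. -/
theorem sum_range_rpow_neg_le {q : ℝ} (h1 : q < 1) (N : ℕ) (h0 : 0 ≤ q) :
    ∑ k ∈ Finset.range N, ((k : ℝ) + 1) ^ (-q) ≤ (N : ℝ) ^ (1 - q) / (1 - q) := by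
  have hq : 0 < 1 - q := by linarith
  induction N with
  | zero => simp [Real.zero_rpow hq.ne']
  | succ N ih =>
    rw [Finset.sum_range_succ]
    refine (add_le_add_left ih _).trans ?_
    rw [le_div_iff₀ hq, add_mul, div_mul_cancel₀ _ hq.ne']
    push_cast
    have hN : (0 : ℝ) < N + 1 := by positivity
    have hb := rpow_one_add_le_one_add_mul_self (s := -1 / ((N : ℝ) + 1)) (p := 1 - q)
      (by rw [le_div_iff₀ hN]; linarith [(Nat.cast_nonneg N : (0 : ℝ) ≤ N)]) hq.le (by linarith)
    have e : (1 : ℝ) + -1 / ((N : ℝ) + 1) = N / (N + 1) := by field_simp; ring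
    rw [e, Real.div_rpow (Nat.cast_nonneg N) hN.le, div_le_iff₀ (by positivity)] at hb
    have e2 : ((N : ℝ) + 1) ^ (1 - q) = (N + 1) * ((N : ℝ) + 1) ^ (-q) := by
      rw [sub_eq_add_neg, Real.rpow_add hN, Real.rpow_one]
    have e3 : (1 + (1 - q) * (-1 / ((N : ℝ) + 1))) * ((N : ℝ) + 1) ^ (1 - q) =
        ((N : ℝ) + 1) ^ (1 - q) - (1 - q) * ((N : ℝ) + 1) ^ (-q) := by
      rw [e2]; field_simp; ring
    linarith

/-- A Riemann sum of the integrable singularity `(t - r)^{-q}`; reversing the order counts the steps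
from the endpoint. -/
theorem sum_rpow_neg_le {q h : ℝ} (h0 : 0 ≤ q) (h1 : q < 1) (hh : 0 < h) (N : ℕ) {τ : ℕ → ℝ}
    (hτ : ∀ i < N, ((N : ℝ) - i) * h ≤ τ i) :
    h * ∑ i ∈ Finset.range N, τ i ^ (-q) ≤ (N * h) ^ (1 - q) / (1 - q) := by
  have e : ∑ i ∈ Finset.range N, τ i ^ (-q) ≤
      ∑ k ∈ Finset.range N, h ^ (-q) * ((k : ℝ) + 1) ^ (-q) := by
    rw [← Finset.sum_range_reflect]
    refine Finset.sum_le_sum fun k hk => ?_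
    rw [Finset.mem_range] at hk
    have h2 := hτ (N - 1 - k) (by omega)
    have e2 : ((N - 1 - k : ℕ) : ℝ) = N - 1 - k := by
      rw [Nat.cast_sub (by omega), Nat.cast_sub (by omega)]; simp
    rw [e2] at h2
    have h3 : h * ((k : ℝ) + 1) ≤ τ (N - 1 - k) := by linarith
    rw [← Real.mul_rpow hh.le (by positivity)]
    exact Real.rpow_le_rpow_of_nonpos (by positivity) h3 (by linarith)
  have hq := sum_range_rpow_neg_le h1 N h0
  calc _ ≤ h * (h ^ (-q) * ((N : ℝ) ^ (1 - q) / (1 - q))) := by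
        rw [← Finset.mul_sum] at e
        refine mul_le_mul_of_nonneg_left (e.trans ?_) hh.le
        gcongr
    _ = _ := by
      rw [Real.mul_rpow (Nat.cast_nonneg N) hh.le, sub_eq_add_neg, Real.rpow_add hh, Real.rpow_one]
      ring

theorem dyadicPoint_mem {s t : ℝ} (hs : 0 ≤ s) (hst : s ≤ t) (htT : t ≤ T) {n i : ℕ}
    (hi : i ≤ 2 ^ n) : dyadicPoint s t n i ∈ Set.Icc 0 T := by
  have h2 : (0 : ℝ) < 2 ^ n := by positivity
  have hi' : (i : ℝ) ≤ 2 ^ n := by exact_mod_cast hi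
  have h3 : 0 ≤ t - s := by linarith
  have h4 : (i : ℝ) * (t - s) / 2 ^ n ≤ t - s := by
    rw [div_le_iff₀ h2]; nlinarith
  have h5 : 0 ≤ (i : ℝ) * (t - s) / 2 ^ n := by positivity
  rw [dyadicPoint]
  constructor <;> linarith

theorem dyadicPoint_lt {s t : ℝ} (hst : s < t) {n i : ℕ} (hi : i < 2 ^ n) :
    dyadicPoint s t n i < t := by
  have h2 : (0 : ℝ) < 2 ^ n := by positivity
  have hi' : (i : ℝ) < 2 ^ n := by exact_mod_cast hi
  have h4 : (i : ℝ) * (t - s) / 2 ^ n < t - s := by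
    rw [div_lt_iff₀ h2]; nlinarith
  rw [dyadicPoint]
  linarith

theorem riemannSum_eq_sum_elem (s t : ℝ) (n : ℕ) :
    riemannSum P u f s t n = ∑ i ∈ Finset.range (2 ^ n),
      elem P u f t (dyadicPoint s t n i) (dyadicPoint s t n (i + 1)) := rfl

theorem dyadicPoint_succ_two_mul (s t : ℝ) (n i : ℕ) :
    dyadicPoint s t (n + 1) (2 * i) = dyadicPoint s t n i := by
  rw [dyadicPoint, dyadicPoint, pow_succ]
  push_cast
  field_simp

theorem riemannSum_succ_sub (s t : ℝ) (n : ℕ) :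
    riemannSum P u f s t (n + 1) - riemannSum P u f s t n = ∑ i ∈ Finset.range (2 ^ n),
      (elem P u f t (dyadicPoint s t n i) (dyadicPoint s t (n + 1) (2 * i + 1)) +
        elem P u f t (dyadicPoint s t (n + 1) (2 * i + 1)) (dyadicPoint s t n (i + 1)) -
        elem P u f t (dyadicPoint s t n i) (dyadicPoint s t n (i + 1))) := by
  rw [riemannSum_eq_sum_elem, riemannSum_eq_sum_elem, pow_succ, mul_comm, sum_range_two_mul,
    ← Finset.sum_sub_distrib]
  refine Finset.sum_congr rfl fun i _ => ?_
  rw [show 2 * i + 1 + 1 = 2 * (i + 1) by ring, dyadicPoint_succ_two_mul, dyadicPoint_succ_two_mul]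

theorem PathBounds.isHermiteSum_riemannSum (hd : 1 ≤ d) (h0 : 0 < η) (h1 : η < 1) (hβ : η < β)
    (H : PathBounds P T lam η γ β F U f u) {s t : ℝ} (hs : 0 ≤ s) (hst : s < t) (htT : t ≤ T)
    (n : ℕ) : IsHermiteSum (riemannSum P u f s t n) :=
  IsHermiteSum.sum _ fun i hi => by
    rw [Finset.mem_range] at hi
    exact H.isHermiteSum_elem hd h0 h1 hβ (dyadicPoint_mem hs hst.le htT hi.le)
      (dyadicPoint_mem hs hst.le htT hi) (dyadicPoint_lt hst hi)

/-- The constant of the sewing estimate. -/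
def sewConst (d : ℕ) (P : DyadicPartition) (T η γ β p θ : ℝ) : ℝ :=
  heatConst d * mulConst d P η β *
    (1 + T ^ γ / (1 - p) + diffConst d / (1 - (p + θ)))

/-- The rate of convergence in the sewing estimate. -/
def sewRate (lam γ θ : ℝ) : ℝ := max (2 ^ (-(γ - lam))) (2 ^ (-(θ - lam)))

theorem sewRate_nonneg (lam γ θ : ℝ) : 0 ≤ sewRate lam γ θ := le_max_of_le_left (by positivity)

theorem sewRate_lt_one {θ : ℝ} (h0 : lam < γ) (h1 : lam < θ) : sewRate lam γ θ < 1 :=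
  max_lt (two_rpow_neg_lt_one (sub_pos.2 h0)) (two_rpow_neg_lt_one (sub_pos.2 h1))

theorem sewConst_nonneg (hT : 0 < T) (h0 : 0 < η) (h1 : η < 1) (hβ : η < β) {p θ : ℝ}
    (hθ : 0 ≤ θ) (hpθ : p + θ < 1) : 0 ≤ sewConst d P T η γ β p θ := by
  have := heatConst_nonneg d
  have := diffConst_nonneg d
  have := mulConst_nonneg (d := d) (P := P) h0 h1 hβ
  have h2 : 0 < 1 - (p + θ) := by linarith
  have h3 : 0 < 1 - p := by linarith
  unfold sewConst; positivity

theorem rpow_step_le {L κ e : ℝ} (hL : 0 < L) (hκ : 0 ≤ κ) (he : 0 ≤ e) (n : ℕ) :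
    (L / 2 ^ (n + 1)) ^ κ * (2 ^ n * (L / 2 ^ (n + 1))) ^ e ≤
      L ^ (κ + e) * ((2 : ℝ) ^ (-κ)) ^ n := by
  have e1 : L / 2 ^ (n + 1) ≤ L * 2 ^ (-(n : ℝ)) := by
    rw [Real.rpow_neg zero_le_two, Real.rpow_natCast, div_eq_mul_inv]
    gcongr
    · norm_num
    · omega
  have e2 : 2 ^ n * (L / 2 ^ (n + 1)) ≤ L := by
    rw [pow_succ]
    have : (2 : ℝ) ^ n * (L / (2 ^ n * 2)) = L / 2 := by field_simp
    rw [this]; linarith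
  have e3 : (L * 2 ^ (-(n : ℝ))) ^ κ = L ^ κ * ((2 : ℝ) ^ (-κ)) ^ n := by
    rw [Real.mul_rpow hL.le (by positivity), ← two_rpow_nat_mul, ← Real.rpow_mul zero_le_two]
    congr 2; ring
  calc _ ≤ (L * 2 ^ (-(n : ℝ))) ^ κ * L ^ e := by gcongr
    _ = _ := by rw [e3, Real.rpow_add hL]; ring

/-- One power of `h` combines with the sum of `τ_i^{-p}`, respectively `τ_i^{-(p+θ)}`, into a
bounded Riemann sum, both exponents being less than one. The powers `h^{γ-λ}` and `h^{θ-λ}` left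
over are positive and provide the geometric rate. -/
theorem PathBounds.blockLE_succ_sub (hd : 1 ≤ d) (h0 : 0 < η) (h1 : η < 1) (hβ : η < β)
    (H : PathBounds P T lam η γ β F U f u) {s t p θ : ℝ} (hs : 0 ≤ s) (hst : s < t) (htT : t ≤ T)
    (hp0 : 0 ≤ p) (hl0 : 0 < lam) (hγ : lam < γ) (hθ : lam < θ) (hpθ : p + θ < 1) (n : ℕ) :
    BlockLE P (-η + 2 * p) (sewConst d P T η γ β p θ * (U * F) * (t - s) ^ (1 - p - lam) *
      sewRate lam γ θ ^ n)
      (riemannSum P u f s t (n + 1) - riemannSum P u f s t n) := by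
  have hU := H.U_nonneg
  have hF := H.F_nonneg
  have hθ0 : 0 < θ := hl0.trans hθ
  have hL : 0 < t - s := sub_pos.2 hst
  set h := (t - s) / 2 ^ (n + 1) with hh
  have hh0 : 0 < h := by positivity
  have hhc := heatConst_nonneg d
  have hdc := diffConst_nonneg d
  have hmc := mulConst_nonneg (d := d) (P := P) h0 h1 hβ
  have hp1 : 0 < 1 - p := by linarith
  have hpθ1 : 0 < 1 - (p + θ) := by linarith
  rw [riemannSum_succ_sub]
  -- The distance from the `i`-th new midpoint to `t` is `(2^{n+1} - 2i - 1) h`, which is at least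
  -- `(2^n - i) h` because `i + 1 ≤ 2^n`.
  set τ : ℕ → ℝ := fun i => t - dyadicPoint s t (n + 1) (2 * i + 1) with hτ
  have e0 : (2 : ℝ) ^ (n + 1) * h = t - s := by rw [hh]; field_simp
  have hτ1 : ∀ i < 2 ^ n, (((2 ^ n : ℕ) : ℝ) - i) * h ≤ τ i := fun i hi => by
    have e1 : τ i = (2 ^ (n + 1) - (2 * i + 1)) * h := by
      rw [hτ, sub_mul, e0, hh]
      simp only [dyadicPoint]
      push_cast; ring
    have hi' : (i : ℝ) + 1 ≤ 2 ^ n := by exact_mod_cast hi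
    rw [e1]
    refine mul_le_mul_of_nonneg_right ?_ hh0.le
    rw [pow_succ]; push_cast
    linarith
  have key : ∀ i ∈ Finset.range (2 ^ n), _ := fun i hi => by
    rw [Finset.mem_range] at hi
    have hi2 : 2 * i + 1 < 2 ^ (n + 1) := by rw [pow_succ]; omega
    exact H.blockLE_defect hd h0 h1 hβ (t := t) (h := h) (dyadicPoint_mem hs hst.le htT hi.le)
      (dyadicPoint_mem hs hst.le htT (i := i + 1) hi) (dyadicPoint_mem hs hst.le htT hi2.le)
      (dyadicPoint_lt hst hi2) hh0
      (by rw [hh]; simp only [dyadicPoint]; rw [pow_succ]; push_cast; field_simp; ring)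
      (by rw [hh]; simp only [dyadicPoint]; rw [pow_succ]; push_cast; field_simp; ring)
      hp0 hθ0.le hpθ.le
  refine (BlockLE.sum hd _ key).mono le_rfl ?_
  have s1 := sum_rpow_neg_le hp0 (by linarith) hh0 (2 ^ n) hτ1
  have s2 := sum_rpow_neg_le (by linarith : 0 ≤ p + θ) hpθ hh0 (2 ^ n) hτ1
  have r1 := rpow_step_le hL (sub_pos.2 hγ).le hp1.le n
  have r2 := rpow_step_le hL (sub_pos.2 hθ).le hpθ1.le n
  rw [← hh] at r1 r2
  push_cast at s1 s2
  have p1 : h ^ γ * h ^ (1 - lam) = h ^ (γ - lam) * h := by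
    rw [← Real.rpow_add hh0, ← Real.rpow_add_one hh0.ne']; congr 1; ring
  have p2 : h ^ θ * h ^ (1 - lam) = h ^ (θ - lam) * h := by
    rw [← Real.rpow_add hh0, ← Real.rpow_add_one hh0.ne']; congr 1; ring
  have q1 : h ^ (γ - lam) * (h * ∑ i ∈ Finset.range (2 ^ n), τ i ^ (-p)) ≤
      T ^ γ / (1 - p) * (t - s) ^ (1 - p - lam) * sewRate lam γ θ ^ n := by
    calc _ ≤ h ^ (γ - lam) * ((2 ^ n * h) ^ (1 - p) / (1 - p)) := by gcongr
      _ = (h ^ (γ - lam) * (2 ^ n * h) ^ (1 - p)) / (1 - p) := by ring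
      _ ≤ ((t - s) ^ (γ - lam + (1 - p)) * ((2 : ℝ) ^ (-(γ - lam))) ^ n) / (1 - p) := by gcongr
      _ = (t - s) ^ γ / (1 - p) * (t - s) ^ (1 - p - lam) * ((2 : ℝ) ^ (-(γ - lam))) ^ n := by
        rw [show γ - lam + (1 - p) = γ + (1 - p - lam) by ring, Real.rpow_add hL]; ring
      _ ≤ _ := by
        have : 0 < γ := hl0.trans hγ
        have hT : 0 < T := by linarith
        gcongr
        · linarith
        · exact le_max_left _ _
  have q2 : h ^ (θ - lam) * (h * ∑ i ∈ Finset.range (2 ^ n), τ i ^ (-(p + θ))) ≤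
      1 / (1 - (p + θ)) * (t - s) ^ (1 - p - lam) * sewRate lam γ θ ^ n := by
    calc _ ≤ h ^ (θ - lam) * ((2 ^ n * h) ^ (1 - (p + θ)) / (1 - (p + θ))) := by gcongr
      _ = (h ^ (θ - lam) * (2 ^ n * h) ^ (1 - (p + θ))) / (1 - (p + θ)) := by ring
      _ ≤ ((t - s) ^ (θ - lam + (1 - (p + θ))) * ((2 : ℝ) ^ (-(θ - lam))) ^ n) /
          (1 - (p + θ)) := by gcongr
      _ = 1 / (1 - (p + θ)) * (t - s) ^ (1 - p - lam) * ((2 : ℝ) ^ (-(θ - lam))) ^ n := by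
        rw [show θ - lam + (1 - (p + θ)) = 1 - p - lam by ring]; ring
      _ ≤ _ := by
        gcongr
        exact le_max_right _ _
  have e : ∑ i ∈ Finset.range (2 ^ n),
      (heatConst d * (τ i ^ (-p) * (mulConst d P η β * (U * h ^ γ * (F * h ^ (1 - lam))))) +
        diffConst d * (h ^ θ * (heatConst d * (τ i ^ (-(p + θ)) *
          (mulConst d P η β * (U * (F * h ^ (1 - lam)))))))) =
      heatConst d * mulConst d P η β * (U * F) *
        (h ^ (γ - lam) * (h * ∑ i ∈ Finset.range (2 ^ n), τ i ^ (-p))) +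
      heatConst d * mulConst d P η β * (U * F) * diffConst d *
        (h ^ (θ - lam) * (h * ∑ i ∈ Finset.range (2 ^ n), τ i ^ (-(p + θ)))) := by
    rw [← mul_assoc (h ^ (γ - lam)), ← mul_assoc (h ^ (θ - lam)), ← p1, ← p2,
      Finset.sum_add_distrib]
    simp only [Finset.mul_sum]
    congr 1
    · exact Finset.sum_congr rfl fun i _ => by ring
    · exact Finset.sum_congr rfl fun i _ => by ring
  refine (le_of_eq e).trans ?_
  calc _ ≤ heatConst d * mulConst d P η β * (U * F) *
        (T ^ γ / (1 - p) * (t - s) ^ (1 - p - lam) * sewRate lam γ θ ^ n) +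
      heatConst d * mulConst d P η β * (U * F) * diffConst d *
        (1 / (1 - (p + θ)) * (t - s) ^ (1 - p - lam) * sewRate lam γ θ ^ n) := by gcongr
    _ = heatConst d * mulConst d P η β * (T ^ γ / (1 - p) + diffConst d / (1 - (p + θ))) *
        ((U * F) * (t - s) ^ (1 - p - lam) * sewRate lam γ θ ^ n) := by ring
    _ ≤ heatConst d * mulConst d P η β * (1 + T ^ γ / (1 - p) + diffConst d / (1 - (p + θ))) *
        ((U * F) * (t - s) ^ (1 - p - lam) * sewRate lam γ θ ^ n) := by
        have := sewRate_nonneg lam γ θ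
        gcongr
        linarith
    _ = _ := by rw [sewConst]; ring

end Sewing

/-! ### The mild integral -/

/-- At positive regularity, Hermite series are bounded by the `L¹` norm of the test function, so the
sequence tested against `ψ` is geometrically Cauchy and the limit is bounded by the same norm, hence
tempered. -/
theorem exists_limit_of_geometric (hd : 1 ≤ d) {P : DyadicPartition} {σ A B ρ : ℝ} (hσ : 0 < σ)
    (hρ1 : ρ < 1) {X : ℕ → 𝓢'(Space d, ℂ)} (hX : ∀ n, IsHermiteSum (X n))
    (hB : BlockLE P σ B (X 0)) (hA : ∀ n, BlockLE P σ (A * ρ ^ n) (X (n + 1) - X n)) :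
    ∃ I : 𝓢'(Space d, ℂ), Tendsto X atTop (𝓝 I) := by
  set K : ℝ := (1 - (2 : ℝ) ^ (-σ))⁻¹ with hK
  have hstep : ∀ ψ n, dist (X n ψ) (X (n + 1) ψ) ≤ (K * A * ∫ x, ‖ψ x‖) * ρ ^ n := fun ψ n => by
    rw [dist_comm, dist_eq_norm]
    have := ((hX (n + 1)).sub (hX n)).norm_le hd hσ (hA n) ψ
    calc _ ≤ K * (A * ρ ^ n) * ∫ x, ‖ψ x‖ := this
      _ = _ := by ring
  have hlim : ∀ ψ, ∃ a, Tendsto (fun n => X n ψ) atTop (𝓝 a) := fun ψ =>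
    cauchySeq_tendsto_of_complete (cauchySeq_of_le_geometric ρ _ hρ1 (hstep ψ))
  choose a ha using hlim
  let l : 𝓢(Space d, ℂ) →ₗ[ℂ] ℂ :=
    { toFun := a
      map_add' := fun ψ φ => tendsto_nhds_unique (ha (ψ + φ)) (((ha ψ).add (ha φ)).congr
        fun n => (map_add (X n) ψ φ).symm)
      map_smul' := fun c ψ => tendsto_nhds_unique (ha (c • ψ)) (((ha ψ).const_mul c).congr
        fun n => (map_smul (X n) c ψ).symm) }
  have hl : ∀ ψ, ‖l ψ‖ ≤ (|K * A / (1 - ρ)| + |K * B|) * ((∫ x, ‖ψ x‖) + gradNorm ψ) := by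
    intro ψ
    have h1 := dist_le_of_le_geometric_of_tendsto₀ ρ _ hρ1 (hstep ψ) (ha ψ)
    have h2 := (hX 0).norm_le hd hσ hB ψ
    have hM := integral_norm_nonneg ψ
    have hG := gradNorm_nonneg ψ
    rw [dist_comm, dist_eq_norm] at h1
    have h3 : ‖a ψ‖ ≤ ‖a ψ - X 0 ψ‖ + ‖X 0 ψ‖ := by
      have := norm_add_le (a ψ - X 0 ψ) (X 0 ψ)
      rwa [sub_add_cancel] at this
    calc ‖a ψ‖ ≤ (K * A * ∫ x, ‖ψ x‖) / (1 - ρ) + K * B * ∫ x, ‖ψ x‖ := h3.trans (add_le_add h1 h2)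
      _ = (K * A / (1 - ρ) + K * B) * ∫ x, ‖ψ x‖ := by ring
      _ ≤ (|K * A / (1 - ρ)| + |K * B|) * ((∫ x, ‖ψ x‖) + gradNorm ψ) := by
        gcongr
        · exact le_abs_self _
        · exact le_abs_self _
        · linarith
  refine ⟨mkDistribution l hl, ?_⟩
  rw [PointwiseConvergenceCLM.tendsto_iff_forall_tendsto]
  exact ha

/-- The value of a block at a point is a test against a Schwartz function, so convergence in `𝓢'`
implies convergence of the blocks, and the geometric tail passes to the limit. -/
theorem BlockLE.sub_limit (hd : 1 ≤ d) {P : DyadicPartition} {σ A ρ : ℝ}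
    (hρ1 : ρ < 1) {X : ℕ → 𝓢'(Space d, ℂ)} {I : 𝓢'(Space d, ℂ)} (hI : Tendsto X atTop (𝓝 I))
    (hA : ∀ n, BlockLE P σ (A * ρ ^ n) (X (n + 1) - X n)) (N : ℕ) :
    BlockLE P σ (A * ρ ^ N / (1 - ρ)) (X N - I) := by
  intro n x
  rw [PointwiseConvergenceCLM.tendsto_iff_forall_tendsto] at hI
  have ht := hI (blockKernel P n x)
  simp only [← block_apply hd] at ht
  have := dist_le_of_le_geometric_of_tendsto ρ (A * 2 ^ (-(n * σ))) hρ1 (fun m => by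
    have := hA m n x
    rw [block_sub hd, _root_.sub_apply] at this
    rw [dist_comm, dist_eq_norm]
    calc _ ≤ A * ρ ^ m * 2 ^ (-(n * σ)) := this
      _ = _ := by ring) ht N
  rw [block_sub hd, _root_.sub_apply, ← dist_eq_norm]
  refine this.trans (le_of_eq ?_)
  ring

section MildIntegral

variable {P : DyadicPartition} {T lam η γ β F U : ℝ} {f u : ℝ → 𝓢'(Space d, ℂ)}

theorem dyadicPoint_zero_zero (s t : ℝ) : dyadicPoint s t 0 0 = s := by simp [dyadicPoint]

theorem dyadicPoint_zero_one (s t : ℝ) : dyadicPoint s t 0 1 = t := by simp [dyadicPoint]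

theorem riemannSum_zero (s t : ℝ) : riemannSum P u f s t 0 = elem P u f t s t := by
  rw [riemannSum_eq_sum_elem, pow_zero, Finset.sum_range_one, dyadicPoint_zero_zero, zero_add,
    dyadicPoint_zero_one]

theorem PathBounds.blockLE_riemannSum_zero (hd : 1 ≤ d) (h0 : 0 < η) (h1 : η < 1) (hβ : η < β)
    (H : PathBounds P T lam η γ β F U f u) {s t p θ : ℝ} (hs : 0 ≤ s) (hst : s < t) (htT : t ≤ T)
    (hp0 : 0 ≤ p) (hθ : 0 ≤ θ) (hpθ : p + θ < 1) :
    BlockLE P (-η + 2 * p) (sewConst d P T η γ β p θ * (U * F) * (t - s) ^ (1 - p - lam))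
      (riemannSum P u f s t 0) := by
  have hL : 0 < t - s := sub_pos.2 hst
  rw [riemannSum_zero]
  refine (H.blockLE_elem hd h0 h1 hβ (t := t) (p := p) (Set.mem_Icc.2 ⟨hs, hst.le.trans htT⟩)
    (Set.mem_Icc.2 ⟨hs.trans hst.le, htT⟩) hst hp0 (by linarith)).mono le_rfl ?_
  rw [abs_of_pos hL, show 1 - p - lam = -p + (1 - lam) by ring, Real.rpow_add hL, sewConst]
  have := heatConst_nonneg d
  have := diffConst_nonneg d
  have := mulConst_nonneg (d := d) (P := P) h0 h1 hβ
  have hU := H.U_nonneg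
  have hF := H.F_nonneg
  have h2 : 0 < 1 - (p + θ) := by linarith
  have h3 : 0 < 1 - p := by linarith
  have hT : 0 < T := by linarith
  have h4 : 0 ≤ T ^ γ / (1 - p) + diffConst d / (1 - (p + θ)) := by positivity
  calc _ = heatConst d * mulConst d P η β * 1 * ((U * F) * ((t - s) ^ (-p) * (t - s) ^ (1 - lam))) := by
        ring
    _ ≤ heatConst d * mulConst d P η β * (1 + T ^ γ / (1 - p) + diffConst d / (1 - (p + θ))) *
        ((U * F) * ((t - s) ^ (-p) * (t - s) ^ (1 - lam))) := by
        gcongr; linarith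
    _ = _ := by ring

theorem exists_mild_bounds (d : ℕ) (hd : 1 ≤ d) (P : DyadicPartition) {T lam η γ β μ : ℝ}
    (hT : 0 < T) (hl0 : 0 < lam) (h0 : 0 < η) (h1 : η < 1) (hβ : η < β) (hγ : lam < γ)
    (hμ0 : 0 ≤ μ) (hμ : μ < 2 - η - 2 * lam) :
    ∃ K ρ : ℝ, 0 ≤ K ∧ 0 ≤ ρ ∧ ρ < 1 ∧ ∀ (F U : ℝ) (f u : ℝ → 𝓢'(Space d, ℂ)),
      PathBounds P T lam η γ β F U f u → ∀ s t : ℝ, 0 ≤ s → s < t → t ≤ T →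
        BlockLE P μ (K * (U * F) * (t - s) ^ (1 - (μ + η) / 2 - lam)) (riemannSum P u f s t 0) ∧
        ∀ n, BlockLE P μ (K * (U * F) * (t - s) ^ (1 - (μ + η) / 2 - lam) * ρ ^ n)
          (riemannSum P u f s t (n + 1) - riemannSum P u f s t n) := by
  -- `p` is determined by `-η + 2p = μ`. The assumption on `μ` is `p + lam < 1`, which leaves room
  -- for `θ`, taken as the midpoint of `lam` and `1 - p`.
  set p := (μ + η) / 2 with hp
  set θ := (lam + (1 - p)) / 2 with hθ
  have hp0 : 0 ≤ p := by positivity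
  have hpl : p + lam < 1 := by rw [hp]; linarith
  have hθ1 : lam < θ := by rw [hθ]; linarith
  have hpθ : p + θ < 1 := by rw [hθ]; linarith
  have hμp : -η + 2 * p = μ := by rw [hp]; ring
  refine ⟨sewConst d P T η γ β p θ, sewRate lam γ θ,
    sewConst_nonneg hT h0 h1 hβ (hl0.trans hθ1).le hpθ, sewRate_nonneg _ _ _,
    sewRate_lt_one hγ hθ1, fun F U f u H s t hs hst htT => ?_⟩
  have a := H.blockLE_riemannSum_zero hd h0 h1 hβ hs hst htT hp0 (hl0.trans hθ1).le hpθ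
  have b := H.blockLE_succ_sub hd h0 h1 hβ hs hst htT hp0 hl0 hγ hθ1 hpθ
  rw [hμp] at a b
  exact ⟨a, b⟩

theorem PathBounds.tendsto_riemannSum (hd : 1 ≤ d) (hl0 : 0 < lam) (h0 : 0 < η) (h1 : η < 1)
    (hβ : η < β) (hγ : lam < γ) (hpos : 0 < 2 - η - 2 * lam)
    (H : PathBounds P T lam η γ β F U f u) {s t : ℝ} (hs : 0 ≤ s) (hst : s < t) (htT : t ≤ T) :
    Tendsto (riemannSum P u f s t) atTop (𝓝 (mildIntegral P u f s t)) := by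
  -- Any positive regularity in the admissible range would do. Since the limit is taken in `𝓢'`, it
  -- is the same for all `μ`.
  obtain ⟨K, ρ, -, -, hρ1, hK⟩ := exists_mild_bounds d hd P (T := T) (μ := (2 - η - 2 * lam) / 2)
    (by linarith) hl0 h0 h1 hβ hγ (by linarith) (by linarith)
  obtain ⟨a, b⟩ := hK F U f u H s t hs hst htT
  obtain ⟨I, hI⟩ := exists_limit_of_geometric hd (by linarith) hρ1
    (H.isHermiteSum_riemannSum hd h0 h1 hβ hs hst htT) a b
  rw [mildIntegral, hI.limUnder_eq]
  exact hI

theorem exists_mildIntegral_bounds (d : ℕ) (hd : 1 ≤ d) (P : DyadicPartition)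
    {T lam η γ β μ : ℝ} (hT : 0 < T) (hl0 : 0 < lam) (h0 : 0 < η) (h1 : η < 1) (hβ : η < β)
    (hγ : lam < γ) (hμ0 : 0 ≤ μ) (hμ : μ < 2 - η - 2 * lam) :
    ∃ K ρ : ℝ, 0 ≤ K ∧ 0 ≤ ρ ∧ ρ < 1 ∧ ∀ (F U : ℝ) (f u : ℝ → 𝓢'(Space d, ℂ)),
      PathBounds P T lam η γ β F U f u → ∀ s t : ℝ, 0 ≤ s → s < t → t ≤ T →
        BlockLE P μ (K * (U * F) * (t - s) ^ (1 - (μ + η) / 2 - lam)) (mildIntegral P u f s t) ∧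
        ∀ n, BlockLE P μ (K * (U * F) * (t - s) ^ (1 - (μ + η) / 2 - lam) * ρ ^ n)
          (riemannSum P u f s t n - mildIntegral P u f s t) := by
  obtain ⟨K, ρ, hK0, hρ0, hρ1, hK⟩ := exists_mild_bounds d hd P hT hl0 h0 h1 hβ hγ hμ0 hμ
  have hρ : 0 < 1 - ρ := by linarith
  refine ⟨K + K / (1 - ρ), ρ, by positivity, hρ0, hρ1, fun F U f u H s t hs hst htT => ?_⟩
  obtain ⟨a, b⟩ := hK F U f u H s t hs hst htT
  have ht := H.tendsto_riemannSum hd hl0 h0 h1 hβ hγ (by linarith) hs hst htT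
  have hL : 0 < t - s := sub_pos.2 hst
  have hU := H.U_nonneg
  have hF := H.F_nonneg
  have hlim := BlockLE.sub_limit hd hρ1 ht b
  constructor
  -- The limit is the zeroth Riemann sum corrected by the whole geometric series of differences.
  · have := a.sub hd (hlim 0)
    rw [sub_sub_cancel] at this
    refine this.mono le_rfl (le_of_eq ?_)
    rw [pow_zero]; ring
  · intro n
    refine (hlim n).mono le_rfl ?_
    have : 0 ≤ K * (U * F) * (t - s) ^ (1 - (μ + η) / 2 - lam) * ρ ^ n := by positivity
    calc _ = K / (1 - ρ) * (U * F) * (t - s) ^ (1 - (μ + η) / 2 - lam) * ρ ^ n := by ring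
      _ ≤ _ := by
        gcongr
        linarith

end MildIntegral

/-! ### Hölder paths -/

theorem besovMul_zero_right (P : DyadicPartition) (u : 𝓢'(Space d, ℂ)) : besovMul P u 0 = 0 := by
  rw [besovMul]
  refine Tendsto.limUnder_eq (tendsto_const_nhds.congr fun N => ?_)
  simp [block_zero]

theorem riemannSum_self (P : DyadicPartition) (u f : ℝ → 𝓢'(Space d, ℂ)) (s : ℝ) (n : ℕ) :
    riemannSum P u f s s n = 0 := by
  rw [riemannSum]
  refine Finset.sum_eq_zero fun i _ => ?_
  simp [dyadicPoint, besovMul_zero_right, heat_zero]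

theorem mildIntegral_self (P : DyadicPartition) (u f : ℝ → 𝓢'(Space d, ℂ)) (s : ℝ) :
    mildIntegral P u f s s = 0 := by
  rw [mildIntegral]
  exact Tendsto.limUnder_eq (tendsto_const_nhds.congr fun N => (riemannSum_self P u f s N).symm)

theorem besovNorm_zero (P : DyadicPartition) (σ : ℝ) : besovNorm P σ (0 : 𝓢'(Space d, ℂ)) = 0 := by
  have := (blockLE_zero (d := d) P σ).besovNorm_le
  simpa using this

theorem holder_blockLE {P : DyadicPartition} {σ κ T : ℝ} (hκ : 0 < κ) {f : ℝ → 𝓢'(Space d, ℂ)}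
    (hf : holderSeminorm P σ κ T f < ⊤) {r v : ℝ} (hr : r ∈ Set.Icc 0 T) (hv : v ∈ Set.Icc 0 T) :
    BlockLE P σ (2 ^ σ * (holderSeminorm P σ κ T f).toReal * |v - r| ^ κ) (f v - f r) := by
  rcases eq_or_ne r v with h | h
  · subst h
    rw [sub_self, sub_self, abs_zero, Real.zero_rpow hκ.ne', mul_zero]
    exact blockLE_zero P σ
  · have h1 : besovNorm P σ (f v - f r) / ENNReal.ofReal (|v - r| ^ κ) ≤
        holderSeminorm P σ κ T f := by
      rw [holderSeminorm]
      exact le_iSup₂_of_le r hr (le_iSup₂_of_le v hv (le_iSup_of_le h le_rfl))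
    have hp : 0 < |v - r| ^ κ := Real.rpow_pos_of_pos (abs_pos.2 (sub_ne_zero.2 h.symm)) κ
    rw [ENNReal.div_le_iff (by simpa using hp) ENNReal.ofReal_ne_top] at h1
    rw [mul_assoc]
    refine (besovNorm_le_iff (mul_nonneg ENNReal.toReal_nonneg hp.le)).1 ?_
    rw [ENNReal.ofReal_mul ENNReal.toReal_nonneg, ENNReal.ofReal_toReal hf.ne]
    exact h1

theorem IsHolderPath.holderNorm_lt_top {P : DyadicPartition} {σ κ T : ℝ} (hT : 0 ≤ T)
    {f : ℝ → 𝓢'(Space d, ℂ)} (hf : IsHolderPath P σ κ T f) : holderNorm P σ κ T f < ⊤ :=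
  ENNReal.add_lt_top.2 ⟨hf.mem 0 ⟨le_rfl, hT⟩, hf.seminorm_lt_top⟩

theorem IsHolderPath.blockLE (hd : 1 ≤ d) {P : DyadicPartition} {σ κ T : ℝ} (hT : 0 ≤ T)
    (hκ : 0 < κ) {f : ℝ → 𝓢'(Space d, ℂ)} (hf : IsHolderPath P σ κ T f) {r : ℝ}
    (hr : r ∈ Set.Icc 0 T) :
    BlockLE P σ (2 ^ σ * (1 + T ^ κ) * (holderNorm P σ κ T f).toReal) (f r) := by
  have h00 : (0 : ℝ) ∈ Set.Icc 0 T := ⟨le_rfl, hT⟩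
  have h1 := holder_blockLE hκ hf.seminorm_lt_top h00 hr
  have h2 := blockLE_toReal (hf.mem 0 h00)
  have h3 := h2.add hd h1
  rw [add_sub_cancel] at h3
  refine h3.mono le_rfl ?_
  rw [holderNorm, ENNReal.toReal_add (hf.mem 0 h00).ne hf.seminorm_lt_top.ne, sub_zero,
    abs_of_nonneg hr.1]
  have a : 0 ≤ (besovNorm P σ (f 0)).toReal := ENNReal.toReal_nonneg
  have b : 0 ≤ (holderSeminorm P σ κ T f).toReal := ENNReal.toReal_nonneg
  have c : r ^ κ ≤ T ^ κ := Real.rpow_le_rpow hr.1 hr.2 hκ.le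
  have e : 0 ≤ T ^ κ := Real.rpow_nonneg hT _
  have g : (0 : ℝ) < 2 ^ σ := by positivity
  calc _ ≤ 2 ^ σ * (besovNorm P σ (f 0)).toReal +
        2 ^ σ * (holderSeminorm P σ κ T f).toReal * T ^ κ := by gcongr
    _ ≤ _ := by
      have := mul_nonneg a e
      rw [mul_assoc, mul_assoc, ← mul_add]
      refine mul_le_mul_of_nonneg_left ?_ g.le
      nlinarith

/-- The constant is enlarged to that of `IsHolderPath.blockLE`, so that one `U` serves for the
values and for the increments in `PathBounds`. -/
theorem IsHolderPath.blockLE_sub {P : DyadicPartition} {σ κ T : ℝ} (hT : 0 < T)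
    (hκ : 0 < κ) {f : ℝ → 𝓢'(Space d, ℂ)} (hf : IsHolderPath P σ κ T f) {r v : ℝ}
    (hr : r ∈ Set.Icc 0 T) (hv : v ∈ Set.Icc 0 T) :
    BlockLE P σ (2 ^ σ * (1 + T ^ κ) * (holderNorm P σ κ T f).toReal * |v - r| ^ κ)
      (f v - f r) := by
  refine (holder_blockLE hκ hf.seminorm_lt_top hr hv).mono le_rfl ?_
  have : (holderSeminorm P σ κ T f).toReal ≤ (holderNorm P σ κ T f).toReal :=
    ENNReal.toReal_mono (hf.holderNorm_lt_top hT.le).ne le_add_self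
  have h1 : 0 ≤ T ^ κ := by positivity
  have h2 : 0 ≤ (holderNorm P σ κ T f).toReal := ENNReal.toReal_nonneg
  refine mul_le_mul_of_nonneg_right ?_ (by positivity)
  rw [mul_assoc]
  refine mul_le_mul_of_nonneg_left ?_ (by positivity)
  nlinarith

theorem pathBounds_of_isHolderPath (hd : 1 ≤ d) {P : DyadicPartition} {T lam η γ β : ℝ}
    (hT : 0 < T) (hlam : lam < 1) (hγ : 0 < γ)
    {f u : ℝ → 𝓢'(Space d, ℂ)} (hf : IsHolderPath P (-η) (1 - lam) T f)
    (hu : IsHolderPath P β γ T u) :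
    PathBounds P T lam η γ β (2 ^ (-η) * (holderSeminorm P (-η) (1 - lam) T f).toReal)
      (2 ^ β * (1 + T ^ γ) * (holderNorm P β γ T u).toReal) f u where
  F_nonneg := by positivity
  U_nonneg := by positivity
  f_le r hr v hv := holder_blockLE (sub_pos.2 hlam) hf.seminorm_lt_top hr hv
  u_le r hr := hu.blockLE hd hT.le hγ hr
  u_sub r hr v hv := hu.blockLE_sub hT hγ hr hv

/-! ### Additivity of sewn integrals -/

/-- The Riemann sum of `Ξ` over the partition of `[s, t]` in `N` equal parts. -/
def uniformSum (Ξ : ℝ → ℝ → ℂ) (N : ℕ) (s t : ℝ) : ℂ :=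
  ∑ i ∈ Finset.range N, Ξ (s + i * ((t - s) / N)) (s + (i + 1) * ((t - s) / N))

theorem sum_range_mul_block {M : Type*} [AddCommMonoid M] (g : ℕ → M) (N K : ℕ) :
    ∑ j ∈ Finset.range (N * K), g j =
      ∑ i ∈ Finset.range K, ∑ r ∈ Finset.range N, g (N * i + r) := by
  induction K with
  | zero => simp
  | succ K ih => rw [Nat.mul_succ, Finset.sum_range_add, ih, Finset.sum_range_succ]

section ScalarSewing

variable {Ξ : ℝ → ℝ → ℂ} {T C δ : ℝ}

theorem uniformSum_mul (N K : ℕ) (hN : N ≠ 0) (hK : K ≠ 0) (s t : ℝ) :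
    uniformSum Ξ (N * K) s t = ∑ i ∈ Finset.range K,
      uniformSum Ξ N (s + i * ((t - s) / K)) (s + (i + 1) * ((t - s) / K)) := by
  have hN' : (N : ℝ) ≠ 0 := by exact_mod_cast hN
  have hK' : (K : ℝ) ≠ 0 := by exact_mod_cast hK
  rw [uniformSum, sum_range_mul_block]
  refine Finset.sum_congr rfl fun i _ => Finset.sum_congr rfl fun r _ => ?_
  congr 1
  · push_cast; field_simp; ring
  · push_cast; field_simp; ring

/-- The pieces are merged from the left, one at a time, with one defect for each. Linear growth in
`N` is harmless: `N` stays fixed while the mesh goes to zero. -/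
theorem norm_uniformSum_sub_le (hC : 0 ≤ C) (hδ : 0 < δ)
    (h : ∀ a c b, 0 ≤ a → a ≤ c → c ≤ b → b ≤ T →
      ‖Ξ a b - Ξ a c - Ξ c b‖ ≤ C * (b - a) ^ (1 + δ))
    {s t : ℝ} (hs : 0 ≤ s) (hst : s ≤ t) (htT : t ≤ T) {N : ℕ} (hN : N ≠ 0) :
    ‖uniformSum Ξ N s t - Ξ s t‖ ≤ N * (C * (t - s) ^ (1 + δ)) := by
  have hN' : (0 : ℝ) < N := by exact_mod_cast Nat.pos_of_ne_zero hN
  set e := (t - s) / N with he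
  have he0 : 0 ≤ e := div_nonneg (by linarith) hN'.le
  have hNe : N * e = t - s := by rw [he]; field_simp
  have key : ∀ k : ℕ, k + 1 ≤ N →
      ‖∑ i ∈ Finset.range (k + 1), Ξ (s + i * e) (s + (i + 1) * e) - Ξ s (s + (k + 1) * e)‖ ≤
        k * (C * (t - s) ^ (1 + δ)) := by
    intro k
    induction k with
    | zero => intro _; simp
    | succ k ih =>
      intro hk
      rw [Finset.sum_range_succ]
      have h1 := ih (by omega)
      have hk' : ((k : ℝ) + 1 + 1) * e ≤ N * e :=
        mul_le_mul_of_nonneg_right (by exact_mod_cast hk) he0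
      have hk0 : 0 ≤ ((k : ℝ) + 1) * e := by positivity
      have h2 := h s (s + (k + 1) * e) (s + ((k : ℝ) + 1 + 1) * e) hs (by linarith)
        (by linarith) (by linarith)
      have h3 : C * (s + ((k : ℝ) + 1 + 1) * e - s) ^ (1 + δ) ≤ C * (t - s) ^ (1 + δ) := by
        refine mul_le_mul_of_nonneg_left (Real.rpow_le_rpow ?_ ?_ (by linarith)) hC <;> linarith
      push_cast
      rw [norm_sub_rev] at h1 ⊢
      calc _ = ‖(Ξ s (s + ((k : ℝ) + 1) * e) -
            ∑ i ∈ Finset.range (k + 1), Ξ (s + i * e) (s + (i + 1) * e)) +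
            (Ξ s (s + ((k : ℝ) + 1 + 1) * e) - Ξ s (s + ((k : ℝ) + 1) * e) -
              Ξ (s + ((k : ℝ) + 1) * e) (s + ((k : ℝ) + 1 + 1) * e))‖ := by congr 1; ring
        _ ≤ k * (C * (t - s) ^ (1 + δ)) + C * (t - s) ^ (1 + δ) :=
          (norm_add_le _ _).trans (add_le_add h1 (h2.trans h3))
        _ = _ := by ring
  obtain ⟨k, rfl⟩ := Nat.exists_eq_succ_of_ne_zero hN
  have h1 := key k le_rfl
  have e1 : s + ((k : ℝ) + 1) * e = t := by
    push_cast at hNe; linarith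
  rw [e1] at h1
  refine h1.trans (mul_le_mul_of_nonneg_right (by push_cast; linarith) ?_)
  exact mul_nonneg hC (Real.rpow_nonneg (by linarith) _)

/-- Each of the `K` pieces is compared with its own subdivision into `N` parts; `K` errors of order
`K^{-1-δ}` add up to `K^{-δ}`. -/
theorem norm_uniformSum_mul_sub_le (hC : 0 ≤ C) (hδ : 0 < δ)
    (h : ∀ a c b, 0 ≤ a → a ≤ c → c ≤ b → b ≤ T →
      ‖Ξ a b - Ξ a c - Ξ c b‖ ≤ C * (b - a) ^ (1 + δ))
    {s t : ℝ} (hs : 0 ≤ s) (hst : s ≤ t) (htT : t ≤ T) {N K : ℕ} (hN : N ≠ 0) (hK : K ≠ 0) :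
    ‖uniformSum Ξ (N * K) s t - uniformSum Ξ K s t‖ ≤
      N * (C * (t - s) ^ (1 + δ)) * (K : ℝ) ^ (-δ) := by
  have hK' : (0 : ℝ) < K := by exact_mod_cast Nat.pos_of_ne_zero hK
  have hts : 0 ≤ t - s := by linarith
  rw [uniformSum_mul N K hN hK, uniformSum, ← Finset.sum_sub_distrib]
  set e := (t - s) / K with he
  have he0 : 0 ≤ e := div_nonneg hts hK'.le
  have hKe : K * e = t - s := by rw [he]; field_simp
  calc _ ≤ ∑ i ∈ Finset.range K, N * (C * e ^ (1 + δ)) := by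
        refine (norm_sum_le _ _).trans (Finset.sum_le_sum fun i hi => ?_)
        rw [Finset.mem_range] at hi
        have hi' : ((i : ℝ) + 1) * e ≤ K * e :=
          mul_le_mul_of_nonneg_right (by exact_mod_cast hi) he0
        have h0 : 0 ≤ (i : ℝ) * e := by positivity
        have := norm_uniformSum_sub_le hC hδ h (s := s + i * e) (t := s + (i + 1) * e)
          (by linarith) (by linarith) (by linarith) hN
        rwa [show s + ((i : ℝ) + 1) * e - (s + i * e) = e by ring] at this
    _ = _ := by
      rw [Finset.sum_const, Finset.card_range, nsmul_eq_mul, he, Real.div_rpow hts hK'.le,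
        Real.rpow_neg hK'.le, Real.rpow_add hK', Real.rpow_one]
      field_simp

theorem tendsto_uniformSum_mul (hC : 0 ≤ C) (hδ : 0 < δ)
    (h : ∀ a c b, 0 ≤ a → a ≤ c → c ≤ b → b ≤ T →
      ‖Ξ a b - Ξ a c - Ξ c b‖ ≤ C * (b - a) ^ (1 + δ))
    {s t : ℝ} (hs : 0 ≤ s) (hst : s ≤ t) (htT : t ≤ T) {N : ℕ} (hN : N ≠ 0) {J : ℂ}
    (hJ : Tendsto (fun m : ℕ => uniformSum Ξ (2 ^ m) s t) atTop (𝓝 J)) :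
    Tendsto (fun m : ℕ => uniformSum Ξ (N * 2 ^ m) s t) atTop (𝓝 J) := by
  have h0 : Tendsto (fun m : ℕ => uniformSum Ξ (N * 2 ^ m) s t - uniformSum Ξ (2 ^ m) s t) atTop
      (𝓝 0) := by
    refine squeeze_zero_norm (fun m => norm_uniformSum_mul_sub_le hC hδ h hs hst htT hN
      (pow_ne_zero m two_ne_zero)) ?_
    rw [← mul_zero ((N : ℝ) * (C * (t - s) ^ (1 + δ)))]
    refine Tendsto.const_mul _ ?_
    have := (tendsto_rpow_neg_atTop hδ).comp
      (tendsto_pow_atTop_atTop_of_one_lt (one_lt_two : (1 : ℝ) < 2))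
    refine this.congr fun m => ?_
    simp
  have := h0.add hJ
  simpa using this

/-- If `c` divides `[s, t]` in the ratio `k : l`, the partition into `(k+l) 2^m` equal parts is
exactly the union of the partitions of the two pieces into `k 2^m` and `l 2^m` equal parts. These
uniform sums have the same limits as the dyadic ones. -/
theorem sewn_additive_rational (hC : 0 ≤ C) (hδ : 0 < δ)
    (h : ∀ a c b, 0 ≤ a → a ≤ c → c ≤ b → b ≤ T →
      ‖Ξ a b - Ξ a c - Ξ c b‖ ≤ C * (b - a) ^ (1 + δ)) {J : ℝ → ℝ → ℂ}
    (hJ : ∀ s t, 0 ≤ s → s < t → t ≤ T →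
      Tendsto (fun m : ℕ => uniformSum Ξ (2 ^ m) s t) atTop (𝓝 (J s t)))
    {s t : ℝ} (hs : 0 ≤ s) (hst : s < t) (htT : t ≤ T) {k l : ℕ} (hk : k ≠ 0) (hl : l ≠ 0) {c : ℝ}
    (hc : c = s + k * ((t - s) / (k + l))) : J s t = J s c + J c t := by
  have hk' : (0 : ℝ) < k := by exact_mod_cast Nat.pos_of_ne_zero hk
  have hl' : (0 : ℝ) < l := by exact_mod_cast Nat.pos_of_ne_zero hl
  have hL : 0 < t - s := sub_pos.2 hst
  have hcs : s < c := by rw [hc]; linarith [(by positivity : 0 < k * ((t - s) / (k + l)))]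
  have hct : c = t - l * ((t - s) / (k + l)) := by rw [hc]; field_simp; ring
  have hct' : c < t := by rw [hct]; linarith [(by positivity : 0 < l * ((t - s) / (k + l)))]
  have t1 := tendsto_uniformSum_mul hC hδ h hs hst.le htT (N := k + l) (by omega)
    (hJ s t hs hst htT)
  have t2 := tendsto_uniformSum_mul hC hδ h hs hcs.le (hct'.le.trans htT) hk
    (hJ s c hs hcs (hct'.le.trans htT))
  have t3 := tendsto_uniformSum_mul hC hδ h (hs.trans hcs.le) hct'.le htT hl
    (hJ c t (hs.trans hcs.le) hct' htT)
  refine tendsto_nhds_unique t1 ((t2.add t3).congr fun m => ?_)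
  have h2 : (0 : ℝ) < 2 ^ m := by positivity
  have e1 : (c - s) / ((k * 2 ^ m : ℕ) : ℝ) = (t - s) / (((k + l) * 2 ^ m : ℕ) : ℝ) := by
    rw [hc]; push_cast; field_simp; ring
  have e2 : (t - c) / ((l * 2 ^ m : ℕ) : ℝ) = (t - s) / (((k + l) * 2 ^ m : ℕ) : ℝ) := by
    rw [hct]; push_cast; field_simp; ring
  have e3 : c = s + ((k * 2 ^ m : ℕ) : ℝ) * ((t - s) / (((k + l) * 2 ^ m : ℕ) : ℝ)) := by
    rw [hc]; push_cast; field_simp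
  rw [uniformSum, uniformSum, uniformSum, e1, e2, add_mul, Finset.sum_range_add, ← add_mul]
  congr 1
  refine Finset.sum_congr rfl fun i _ => ?_
  generalize (t - s) / (((k + l) * 2 ^ m : ℕ) : ℝ) = e at e3
  rw [e3]
  congr 1
  · push_cast; ring
  · push_cast; ring

/-- The uniform sums are continuous in the endpoints and converge uniformly, at the geometric rate
`2^{-δ}`. -/
theorem continuousOn_sewn (hC : 0 ≤ C) (hδ : 0 < δ)
    (h : ∀ a c b, 0 ≤ a → a ≤ c → c ≤ b → b ≤ T →
      ‖Ξ a b - Ξ a c - Ξ c b‖ ≤ C * (b - a) ^ (1 + δ))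
    (hcont : ContinuousOn (fun p : ℝ × ℝ => Ξ p.1 p.2) (Set.Icc 0 T ×ˢ Set.Icc 0 T))
    {J : ℝ → ℝ → ℂ} (hJ : ∀ s t, 0 ≤ s → s < t → t ≤ T →
      Tendsto (fun m : ℕ => uniformSum Ξ (2 ^ m) s t) atTop (𝓝 (J s t))) :
    ContinuousOn (fun p : ℝ × ℝ => J p.1 p.2) {p : ℝ × ℝ | 0 ≤ p.1 ∧ p.1 < p.2 ∧ p.2 ≤ T} := by
  set S : Set (ℝ × ℝ) := {p : ℝ × ℝ | 0 ≤ p.1 ∧ p.1 < p.2 ∧ p.2 ≤ T} with hS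
  have hr : (2 : ℝ) ^ (-δ) < 1 := two_rpow_neg_lt_one hδ
  have hunif : TendstoUniformlyOn (fun (m : ℕ) (p : ℝ × ℝ) => uniformSum Ξ (2 ^ m) p.1 p.2)
      (fun p => J p.1 p.2) atTop S := by
    have hb : ∀ m : ℕ, ∀ p ∈ S, dist (uniformSum Ξ (2 ^ m) p.1 p.2) (J p.1 p.2) ≤
        (2 * (C * T ^ (1 + δ))) * ((2 : ℝ) ^ (-δ)) ^ m / (1 - (2 : ℝ) ^ (-δ)) := by
      rintro m p ⟨h0, h1, h2⟩
      refine dist_le_of_le_geometric_of_tendsto _ _ hr (fun m => ?_) (hJ p.1 p.2 h0 h1 h2) m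
      have := norm_uniformSum_mul_sub_le hC hδ h h0 h1.le h2 two_ne_zero
        (pow_ne_zero m two_ne_zero : (2 : ℕ) ^ m ≠ 0)
      rw [← pow_succ'] at this
      rw [dist_comm, dist_eq_norm]
      refine this.trans ?_
      have e : (((2 ^ m : ℕ) : ℝ)) ^ (-δ) = ((2 : ℝ) ^ (-δ)) ^ m := by
        push_cast
        rw [← Real.rpow_natCast, ← Real.rpow_mul zero_le_two, mul_comm, Real.rpow_mul zero_le_two,
          Real.rpow_natCast]
      rw [e]
      push_cast
      gcongr
      linarith
    rw [Metric.tendstoUniformlyOn_iff]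
    intro ε hε
    have ht : Tendsto (fun m : ℕ => (2 * (C * T ^ (1 + δ))) * ((2 : ℝ) ^ (-δ)) ^ m /
        (1 - (2 : ℝ) ^ (-δ))) atTop (𝓝 0) := by
      have := ((tendsto_pow_atTop_nhds_zero_of_lt_one (by positivity) hr).const_mul
        (2 * (C * T ^ (1 + δ)))).div_const (1 - (2 : ℝ) ^ (-δ))
      simpa using this
    filter_upwards [ht.eventually (gt_mem_nhds hε)] with m hm p hp
    rw [dist_comm]
    exact (hb m p hp).trans_lt hm
  refine hunif.continuousOn (Eventually.of_forall fun m => ?_).frequently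
  simp only [uniformSum]
  refine continuousOn_finsetSum _ fun i hi => ?_
  rw [Finset.mem_range] at hi
  refine hcont.comp (f := fun p : ℝ × ℝ => (p.1 + i * ((p.2 - p.1) / ((2 ^ m : ℕ) : ℝ)),
    p.1 + (i + 1) * ((p.2 - p.1) / ((2 ^ m : ℕ) : ℝ)))) (by fun_prop) ?_
  rintro p ⟨h0, h1, h2⟩
  have h2m : (0 : ℝ) < ((2 ^ m : ℕ) : ℝ) := by positivity
  have hi' : (i : ℝ) + 1 ≤ ((2 ^ m : ℕ) : ℝ) := by exact_mod_cast hi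
  have he0 : 0 ≤ (p.2 - p.1) / ((2 ^ m : ℕ) : ℝ) := div_nonneg (by linarith) h2m.le
  have he1 : ((2 ^ m : ℕ) : ℝ) * ((p.2 - p.1) / ((2 ^ m : ℕ) : ℝ)) = p.2 - p.1 := by field_simp
  have h3 := mul_le_mul_of_nonneg_right hi' he0
  have h4 : 0 ≤ (i : ℝ) * ((p.2 - p.1) / ((2 ^ m : ℕ) : ℝ)) := by positivity
  refine ⟨⟨by simp only; linarith, by simp only; linarith⟩,
    ⟨by simp only; linarith, by simp only; linarith⟩⟩

theorem sewn_additive (hC : 0 ≤ C) (hδ : 0 < δ)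
    (h : ∀ a c b, 0 ≤ a → a ≤ c → c ≤ b → b ≤ T →
      ‖Ξ a b - Ξ a c - Ξ c b‖ ≤ C * (b - a) ^ (1 + δ))
    (hcont : ContinuousOn (fun p : ℝ × ℝ => Ξ p.1 p.2) (Set.Icc 0 T ×ˢ Set.Icc 0 T))
    {J : ℝ → ℝ → ℂ} (hJ : ∀ s t, 0 ≤ s → s < t → t ≤ T →
      Tendsto (fun m : ℕ => uniformSum Ξ (2 ^ m) s t) atTop (𝓝 (J s t)))
    {s c t : ℝ} (hs : 0 ≤ s) (hsc : s < c) (hct : c < t) (htT : t ≤ T) :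
    J s t = J s c + J c t := by
  have hL : 0 < t - s := by linarith
  have hJc := continuousOn_sewn hC hδ h hcont hJ
  have hg : ContinuousOn (fun x : ℝ => J s (s + x * (t - s)) + J (s + x * (t - s)) t)
      (Set.Ioo 0 1) := by
    refine ContinuousOn.add ?_ ?_
    · refine hJc.comp (f := fun x : ℝ => (s, s + x * (t - s))) (by fun_prop) ?_
      intro x hx
      have := mul_pos hx.1 hL
      have := mul_lt_mul_of_pos_right hx.2 hL
      exact ⟨hs, by simp only; linarith, by simp only; linarith⟩
    · refine hJc.comp (f := fun x : ℝ => (s + x * (t - s), t)) (by fun_prop) ?_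
      intro x hx
      have := mul_pos hx.1 hL
      have := mul_lt_mul_of_pos_right hx.2 hL
      exact ⟨by simp only; linarith, by simp only; linarith, htT⟩
  -- A rational parameter `q` in `(0, 1)` is the ratio `k / (k + l)` with `k` its numerator and `k +
  -- l` its denominator; density of the rationals and continuity do the rest.
  have hEq : Set.EqOn (fun x : ℝ => J s (s + x * (t - s)) + J (s + x * (t - s)) t)
      (fun _ => J s t) (Set.Ioo (0 : ℝ) 1 ∩ Set.range ((↑) : ℚ → ℝ)) := by
    rintro x ⟨hx, q, rfl⟩
    have hq0 : 0 < q := by exact_mod_cast hx.1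
    have hq1 : q < 1 := by exact_mod_cast hx.2
    have hnum : 0 < q.num := Rat.num_pos.2 hq0
    have hlt : q.num < q.den := by
      have := Rat.num_lt_denom_iff.2 hq1
      exact this
    obtain ⟨k, hk⟩ := Int.eq_ofNat_of_zero_le hnum.le
    have hk0 : k ≠ 0 := by rintro rfl; simp at hk; rw [hk] at hnum; exact lt_irrefl _ hnum
    have hkd : k < q.den := by rw [hk] at hlt; exact_mod_cast hlt
    refine (sewn_additive_rational hC hδ h hJ hs (by linarith) htT hk0
      (l := q.den - k) (by omega) ?_).symm
    have e1 : (q : ℝ) = k / q.den := by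
      have := Rat.cast_def (K := ℝ) q
      rw [this, hk]; simp
    have hd : (q.den : ℝ) ≠ 0 := by exact_mod_cast q.den_ne_zero
    rw [e1, Nat.cast_sub hkd.le]
    congr 1
    rw [add_sub_cancel]
    field_simp
  have hall := hEq.of_subset_closure hg continuousOn_const Set.inter_subset_left
    (Rat.denseRange_cast.open_subset_closure_inter isOpen_Ioo)
  have hx : (c - s) / (t - s) ∈ Set.Ioo (0 : ℝ) 1 :=
    ⟨div_pos (by linarith) hL, (div_lt_one hL).2 (by linarith)⟩
  have := hall hx
  simp only [div_mul_cancel₀ _ hL.ne', add_sub_cancel] at this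
  exact this.symm

end ScalarSewing

/-! ### Additivity and time regularity of the mild integral -/

section Additivity

variable {P : DyadicPartition} {T lam η γ β F U : ℝ} {f u : ℝ → 𝓢'(Space d, ℂ)}

/-- The Hermite coefficients of the elementary terms, with the semigroup removed. -/
def coeffGerm (P : DyadicPartition) (u f : ℝ → 𝓢'(Space d, ℂ)) (α : Fin d → ℕ) (a b : ℝ) : ℂ :=
  ((Real.exp (a * eigenvalue α) : ℝ) : ℂ) * besovMul P (u a) (f b - f a) (hermiteFun α)

/-- On a fixed Hermite function the semigroup is a number, and `e^{-(t-a)λ} = e^{-tλ} e^{aλ}`. The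
sum becomes that of a germ which no longer depends on the final time `t`. -/
theorem PathBounds.riemannSum_hermiteFun (hd : 1 ≤ d) (h0 : 0 < η) (h1 : η < 1) (hβ : η < β)
    (H : PathBounds P T lam η γ β F U f u) {s t : ℝ} (hs : 0 ≤ s) (hst : s < t) (htT : t ≤ T)
    (α : Fin d → ℕ) (n : ℕ) :
    riemannSum P u f s t n (hermiteFun α) = ((Real.exp (-(t * eigenvalue α)) : ℝ) : ℂ) *
      uniformSum (coeffGerm P u f α) (2 ^ n) s t := by
  rw [riemannSum_eq_sum_elem, _root_.sum_apply, uniformSum, Finset.mul_sum]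
  refine Finset.sum_congr rfl fun i hi => ?_
  rw [Finset.mem_range] at hi
  rw [H.elem_hermiteFun hd h0 h1 hβ (dyadicPoint_mem hs hst.le htT hi.le)
    (dyadicPoint_mem hs hst.le htT (i := i + 1) hi) (dyadicPoint_lt hst hi), coeffGerm, ← mul_assoc,
    ← Complex.ofReal_mul, ← Real.exp_add]
  have e1 : s + i * ((t - s) / ((2 ^ n : ℕ) : ℝ)) = dyadicPoint s t n i := by
    rw [dyadicPoint]; push_cast; ring
  have e2 : s + (i + 1) * ((t - s) / ((2 ^ n : ℕ) : ℝ)) = dyadicPoint s t n (i + 1) := by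
    rw [dyadicPoint]; push_cast; ring
  rw [e1, e2]
  congr 4
  ring

/-- The constant of the product estimate tested against `ψ`. -/
def prodTestConst (η β : ℝ) (ψ : 𝓢(Space d, ℂ)) : ℝ := prodConst d η β * testNorm η 0 ψ

theorem prodTestConst_nonneg (h0 : 0 < η) (h1 : η < 1) (hβ : η < β) (ψ : 𝓢(Space d, ℂ)) :
    0 ≤ prodTestConst η β ψ :=
  mul_nonneg (prodConst_nonneg h0 h1 hβ) (testNorm_nonneg _ _ _)

theorem norm_besovMul_le_test (hd : 1 ≤ d) (h0 : 0 < η) (h1 : η < 1) (hβ : η < β)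
    {v g : 𝓢'(Space d, ℂ)} (hv : BlockLE P β U v) (hg : BlockLE P (-η) F g) (ψ : 𝓢(Space d, ℂ)) :
    ‖besovMul P v g ψ‖ ≤ prodTestConst η β ψ * (U * F) := by
  refine (norm_besovMul_le hd h0 h1 hβ hv hg ψ 0).trans (le_of_eq ?_)
  rw [prodTestConst]; ring

theorem abs_exp_sub_exp_le {x y l T : ℝ} (hl : 0 ≤ l) (hx : x ≤ T) (hy : y ≤ T) :
    |Real.exp (x * l) - Real.exp (y * l)| ≤ l * Real.exp (T * l) * |x - y| := by
  have := (convex_Iic T).norm_image_sub_le_of_norm_hasDerivWithin_le (C := l * Real.exp (T * l))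
    (f := fun x => Real.exp (x * l)) (f' := fun x => Real.exp (x * l) * (1 * l))
    (fun x _ => (((hasDerivAt_id x).mul_const l).exp).hasDerivWithinAt) (fun x hx => by
      rw [one_mul, Real.norm_eq_abs, abs_of_nonneg (by positivity), mul_comm]
      gcongr
      exact hx) (Set.mem_Iic.2 hy) (Set.mem_Iic.2 hx)
  simpa only [Real.norm_eq_abs] using this

/-- The defect has two parts: the increment of `u` gives the exponent `γ + 1 - λ`, and that of the
smooth factor `e^{aλ_α}` gives `1 + 1 - λ`. Hence the excess `δ = min (γ - λ) (1 - λ)`; no smoothing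
is involved. -/
theorem PathBounds.exists_norm_coeffGerm_defect_le (hd : 1 ≤ d) (hT : 0 < T) (h0 : 0 < η)
    (h1 : η < 1) (hβ : η < β) (hl0 : 0 < lam) (hl1 : lam < 1) (hγ : lam < γ)
    (H : PathBounds P T lam η γ β F U f u) (α : Fin d → ℕ) :
    ∃ C : ℝ, 0 ≤ C ∧ ∀ a c b, 0 ≤ a → a ≤ c → c ≤ b → b ≤ T →
      ‖coeffGerm P u f α a b - coeffGerm P u f α a c - coeffGerm P u f α c b‖ ≤
        C * (b - a) ^ (1 + min (γ - lam) (1 - lam)) := by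
  set K := prodTestConst η β (hermiteFun α) with hK
  have hK0 : 0 ≤ K := prodTestConst_nonneg h0 h1 hβ _
  set l := eigenvalue α with hl
  have hl0 : 0 ≤ l := zero_le_one.trans (one_le_eigenvalue hd α)
  set δ := min (γ - lam) (1 - lam) with hδ
  have hδ0 : 0 < δ := lt_min (by linarith) (by linarith)
  have hδ1 : δ ≤ γ - lam := min_le_left _ _
  have hδ2 : δ ≤ 1 - lam := min_le_right _ _
  have hU := H.U_nonneg
  have hF := H.F_nonneg
  refine ⟨Real.exp (T * l) * (K * (U * F)) * (T ^ (γ - lam - δ) + l * T ^ (1 - lam - δ)),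
    by positivity, ?_⟩
  intro a c b ha hac hcb hbT
  have ma : a ∈ Set.Icc 0 T := ⟨ha, by linarith⟩
  have mc : c ∈ Set.Icc 0 T := ⟨by linarith, by linarith⟩
  have mb : b ∈ Set.Icc 0 T := ⟨by linarith, by linarith⟩
  have hL : 0 ≤ b - a := by linarith
  have hua := H.u_le a ma
  have huc := H.u_le c mc
  have hcb' := H.f_le c mc b mb
  have n1 := norm_besovMul_le_test hd h0 h1 hβ (H.u_sub a ma c mc) hcb' (hermiteFun α)
  have n2 := norm_besovMul_le_test hd h0 h1 hβ hua hcb' (hermiteFun α)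
  have n3 := abs_exp_sub_exp_le hl0 mc.2 ma.2
  have e : coeffGerm P u f α a b - coeffGerm P u f α a c - coeffGerm P u f α c b =
      -(((Real.exp (c * l) : ℝ) : ℂ) * besovMul P (u c - u a) (f b - f c) (hermiteFun α) +
        ((Real.exp (c * l) - Real.exp (a * l) : ℝ) : ℂ) *
          besovMul P (u a) (f b - f c) (hermiteFun α)) := by
    simp only [coeffGerm]
    rw [show f b - f a = (f b - f c) + (f c - f a) by abel,
      besovMul_add_right hd h0 h1 hβ hua hcb' (H.f_le a ma c mc),
      besovMul_sub_left hd h0 h1 hβ huc hua hcb', _root_.add_apply, _root_.sub_apply,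
      Complex.ofReal_sub]
    ring
  rw [abs_of_nonneg (by linarith : 0 ≤ b - c)] at n1 n2
  rw [abs_of_nonneg (by linarith : 0 ≤ c - a)] at n1 n3
  have a1 : (c - a) ^ γ ≤ (b - a) ^ γ :=
    Real.rpow_le_rpow (by linarith) (by linarith) (by linarith)
  have a2 : (b - c) ^ (1 - lam) ≤ (b - a) ^ (1 - lam) :=
    Real.rpow_le_rpow (by linarith) (by linarith) (by linarith)
  have a3 : (b - a) ^ γ * (b - a) ^ (1 - lam) ≤ T ^ (γ - lam - δ) * (b - a) ^ (1 + δ) := by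
    rw [← Real.rpow_add_of_nonneg hL (by linarith) (by linarith),
      show γ + (1 - lam) = (γ - lam - δ) + (1 + δ) by ring,
      Real.rpow_add_of_nonneg hL (by linarith) (by linarith)]
    gcongr
    linarith
  have a4 : (b - a) * (b - a) ^ (1 - lam) ≤ T ^ (1 - lam - δ) * (b - a) ^ (1 + δ) := by
    have e1 : (b - a) * (b - a) ^ (1 - lam) = (b - a) ^ (1 - lam - δ) * (b - a) ^ (1 + δ) := by
      rw [← Real.rpow_add_of_nonneg hL (by linarith) (by linarith),
        show (1 - lam - δ) + (1 + δ) = 1 + (1 - lam) by ring,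
        Real.rpow_add_of_nonneg hL zero_le_one (by linarith), Real.rpow_one]
    rw [e1]
    gcongr
    linarith
  rw [e, norm_neg]
  have x1 : Real.exp (c * l) ≤ Real.exp (T * l) := by
    gcongr; exact mc.2
  calc _ ≤ Real.exp (c * l) * ‖besovMul P (u c - u a) (f b - f c) (hermiteFun α)‖ +
        |Real.exp (c * l) - Real.exp (a * l)| *
          ‖besovMul P (u a) (f b - f c) (hermiteFun α)‖ := by
        refine (norm_add_le _ _).trans (le_of_eq ?_)
        rw [norm_mul, norm_mul, Complex.norm_real, Complex.norm_real, Real.norm_eq_abs,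
          Real.norm_eq_abs, Real.abs_exp]
    _ ≤ Real.exp (T * l) * (K * (U * (b - a) ^ γ * (F * (b - a) ^ (1 - lam)))) +
        (l * Real.exp (T * l) * (b - a)) * (K * (U * (F * (b - a) ^ (1 - lam)))) := by
        refine add_le_add (mul_le_mul x1 (n1.trans ?_) (norm_nonneg _) (Real.exp_pos _).le)
          (mul_le_mul (n3.trans ?_) (n2.trans ?_) (norm_nonneg _) (by positivity))
        · have : 0 ≤ (b - c) ^ (1 - lam) := Real.rpow_nonneg (by linarith) _
          gcongr
        · gcongr
        · gcongr
    _ = Real.exp (T * l) * (K * (U * F)) * ((b - a) ^ γ * (b - a) ^ (1 - lam) +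
        l * ((b - a) * (b - a) ^ (1 - lam))) := by ring
    _ ≤ Real.exp (T * l) * (K * (U * F)) * (T ^ (γ - lam - δ) * (b - a) ^ (1 + δ) +
        l * (T ^ (1 - lam - δ) * (b - a) ^ (1 + δ))) := by gcongr
    _ = _ := by ring

theorem PathBounds.continuousOn_coeffGerm (hd : 1 ≤ d) (h0 : 0 < η)
    (h1 : η < 1) (hβ : η < β) (hl0 : 0 < lam) (hl1 : lam < 1) (hγ : lam < γ)
    (H : PathBounds P T lam η γ β F U f u) (α : Fin d → ℕ) :
    ContinuousOn (fun p : ℝ × ℝ => coeffGerm P u f α p.1 p.2) (Set.Icc 0 T ×ˢ Set.Icc 0 T) := by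
  refine ContinuousOn.mul (by fun_prop) ?_
  rintro ⟨a₀, b₀⟩ ⟨ma₀, mb₀⟩
  simp only at ma₀ mb₀
  set K := prodTestConst η β (hermiteFun α) with hK
  have hK0 : 0 ≤ K := prodTestConst_nonneg h0 h1 hβ _
  have hU := H.U_nonneg
  have hF := H.F_nonneg
  rw [ContinuousWithinAt, tendsto_iff_norm_sub_tendsto_zero]
  have hlim : Tendsto (fun p : ℝ × ℝ =>
      K * (U * |p.1 - a₀| ^ γ * (F * |p.2 - p.1| ^ (1 - lam))) +
        K * (U * (F * |p.2 - b₀| ^ (1 - lam))) + K * (U * (F * |p.1 - a₀| ^ (1 - lam))))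
      (𝓝 (a₀, b₀)) (𝓝 0) := by
    have hγ0 : 0 ≤ γ := by linarith
    have hl1' : 0 ≤ 1 - lam := by linarith
    have hc : Continuous (fun p : ℝ × ℝ =>
      K * (U * |p.1 - a₀| ^ γ * (F * |p.2 - p.1| ^ (1 - lam))) +
        K * (U * (F * |p.2 - b₀| ^ (1 - lam))) + K * (U * (F * |p.1 - a₀| ^ (1 - lam)))) := by
      have c1 : Continuous fun p : ℝ × ℝ => |p.1 - a₀| ^ γ :=
        (Continuous.rpow_const (by fun_prop) fun _ => Or.inr hγ0)
      have c2 : Continuous fun p : ℝ × ℝ => |p.2 - p.1| ^ (1 - lam) :=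
        (Continuous.rpow_const (by fun_prop) fun _ => Or.inr hl1')
      have c3 : Continuous fun p : ℝ × ℝ => |p.2 - b₀| ^ (1 - lam) :=
        (Continuous.rpow_const (by fun_prop) fun _ => Or.inr hl1')
      have c4 : Continuous fun p : ℝ × ℝ => |p.1 - a₀| ^ (1 - lam) :=
        (Continuous.rpow_const (by fun_prop) fun _ => Or.inr hl1')
      fun_prop
    have := hc.tendsto (a₀, b₀)
    have z1 : (0 : ℝ) ^ γ = 0 := Real.zero_rpow (by linarith)
    have z2 : (0 : ℝ) ^ (1 - lam) = 0 := Real.zero_rpow (by linarith)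
    simpa [z1, z2] using this
  refine squeeze_zero' (Eventually.of_forall fun _ => norm_nonneg _) ?_
    (hlim.mono_left nhdsWithin_le_nhds)
  filter_upwards [self_mem_nhdsWithin] with p hp
  obtain ⟨ma, mb⟩ := hp
  have hua₀ := H.u_le a₀ ma₀
  have e1 := besovMul_sub_left hd h0 h1 hβ (H.u_le _ ma) hua₀ (H.f_le _ ma _ mb)
  have e2 := besovMul_add_right hd h0 h1 hβ hua₀ (H.f_le _ mb₀ _ mb) (H.f_le _ ma₀ _ mb₀)
  have e3 := besovMul_add_right hd h0 h1 hβ hua₀ (H.f_le _ ma _ mb) (H.f_le _ ma₀ _ ma)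
  rw [sub_add_sub_cancel] at e2 e3
  have e : besovMul P (u p.1) (f p.2 - f p.1) - besovMul P (u a₀) (f b₀ - f a₀) =
      besovMul P (u p.1 - u a₀) (f p.2 - f p.1) + besovMul P (u a₀) (f p.2 - f b₀) -
        besovMul P (u a₀) (f p.1 - f a₀) := by
    have e4 := e2.symm.trans e3
    rw [e1, eq_sub_of_add_eq e4]
    abel
  rw [← _root_.sub_apply, e, _root_.sub_apply, _root_.add_apply]
  refine (norm_sub_le _ _).trans (add_le_add ((norm_add_le _ _).trans (add_le_add ?_ ?_)) ?_)
  · exact norm_besovMul_le_test hd h0 h1 hβ (H.u_sub _ ma₀ _ ma) (H.f_le _ ma _ mb) _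
  · exact norm_besovMul_le_test hd h0 h1 hβ hua₀ (H.f_le _ mb₀ _ mb) _
  · exact norm_besovMul_le_test hd h0 h1 hβ hua₀ (H.f_le _ ma₀ _ ma) _

/-- Multiplied by `e^{tλ_α}`, the coefficient of the mild integral is the sewn limit of a germ
independent of `t`, hence additive in the interval. An identity of Hermite coefficients is all that
the Besov bounds require. -/
theorem PathBounds.mildIntegral_add_hermiteFun (hd : 1 ≤ d) (hT : 0 < T) (h0 : 0 < η)
    (h1 : η < 1) (hβ : η < β) (hl0 : 0 < lam) (hl1 : lam < 1) (hγ : lam < γ)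
    (hpos : 0 < 2 - η - 2 * lam) (H : PathBounds P T lam η γ β F U f u) {r s t : ℝ} (hr : 0 ≤ r)
    (hrs : r < s) (hst : s < t) (htT : t ≤ T) (α : Fin d → ℕ) :
    mildIntegral P u f r t (hermiteFun α) =
      ((Real.exp (-((t - s) * eigenvalue α)) : ℝ) : ℂ) * mildIntegral P u f r s (hermiteFun α) +
        mildIntegral P u f s t (hermiteFun α) := by
  obtain ⟨C, hC, hdef⟩ := H.exists_norm_coeffGerm_defect_le hd hT h0 h1 hβ hl0 hl1 hγ α
  have hcont := H.continuousOn_coeffGerm hd h0 h1 hβ hl0 hl1 hγ α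
  have hJ : ∀ s t, 0 ≤ s → s < t → t ≤ T →
      Tendsto (fun m : ℕ => uniformSum (coeffGerm P u f α) (2 ^ m) s t) atTop
        (𝓝 (((Real.exp (t * eigenvalue α) : ℝ) : ℂ) * mildIntegral P u f s t (hermiteFun α))) := by
    intro s t hs hst htT
    have ht := H.tendsto_riemannSum hd hl0 h0 h1 hβ hγ hpos hs hst htT
    rw [PointwiseConvergenceCLM.tendsto_iff_forall_tendsto] at ht
    refine ((ht (hermiteFun α)).const_mul ((Real.exp (t * eigenvalue α) : ℝ) : ℂ)).congr
      fun n => ?_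
    rw [H.riemannSum_hermiteFun hd h0 h1 hβ hs hst htT, ← mul_assoc, ← Complex.ofReal_mul,
      ← Real.exp_add, add_neg_cancel, Real.exp_zero, Complex.ofReal_one, one_mul]
  have key := sewn_additive (J := fun s t => ((Real.exp (t * eigenvalue α) : ℝ) : ℂ) *
    mildIntegral P u f s t (hermiteFun α)) hC (lt_min (by linarith) (by linarith)) hdef hcont hJ
    hr hrs hst htT
  have e : ((Real.exp (-((t - s) * eigenvalue α)) : ℝ) : ℂ) =
      ((Real.exp (-(t * eigenvalue α)) : ℝ) : ℂ) * ((Real.exp (s * eigenvalue α) : ℝ) : ℂ) := by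
    rw [← Complex.ofReal_mul, ← Real.exp_add]
    congr 2; ring
  have e1 : ((Real.exp (-(t * eigenvalue α)) : ℝ) : ℂ) *
      ((Real.exp (t * eigenvalue α) : ℝ) : ℂ) = 1 := by
    rw [← Complex.ofReal_mul, ← Real.exp_add, neg_add_cancel, Real.exp_zero, Complex.ofReal_one]
  rw [e]
  linear_combination ((Real.exp (-(t * eigenvalue α)) : ℝ) : ℂ) * key -
    (mildIntegral P u f r t (hermiteFun α) - mildIntegral P u f s t (hermiteFun α)) * e1

theorem BlockLE.sub_comm (hd : 1 ≤ d) {σ B : ℝ} {v w : 𝓢'(Space d, ℂ)}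
    (h : BlockLE P σ B (v - w)) : BlockLE P σ B (w - v) := fun n x => by
  have := h n x
  rw [block_sub hd, _root_.sub_apply] at this ⊢
  rwa [norm_sub_rev]

/-- Time regularity of the mild integral. -/
theorem PathBounds.exists_mildIntegral_sub_le (hd : 1 ≤ d) (hT : 0 < T) (h0 : 0 < η)
    (h1 : η < 1) (hβ : η < β) (hl0 : 0 < lam) (hl1 : lam < 1) (hγ : lam < γ)
    (H : PathBounds P T lam η γ β F U f u) {μ κ : ℝ} (hμ : 0 ≤ μ) (hκ : 0 < κ)
    (hκμ : κ < 1 - (μ + η) / 2 - lam) :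
    ∃ B : ℝ, ∀ r ∈ Set.Icc 0 T, ∀ v ∈ Set.Icc 0 T,
      BlockLE P μ (B * |v - r| ^ κ) (mildIntegral P u f 0 v - mildIntegral P u f 0 r) := by
  have hU := H.U_nonneg
  have hF := H.F_nonneg
  have hdc := diffConst_nonneg d
  obtain ⟨K, ρ, hK0, -, -, hK⟩ := exists_mildIntegral_bounds d hd P (μ := μ) hT hl0 h0 h1 hβ hγ hμ
    (by linarith)
  -- The integral up to time `r` is controlled with `2κ` more derivatives, which `1 - e^{-(v-r)H}`
  -- turns into the factor `(v - r)^κ`. This regularity is admissible precisely because of `hκμ`.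
  obtain ⟨K', ρ', hK0', -, -, hK'⟩ := exists_mildIntegral_bounds d hd P (μ := μ + 2 * κ) hT hl0 h0
    h1 hβ hγ (by linarith) (by linarith)
  set e := 1 - (μ + η) / 2 - lam with he
  have he' : 1 - (μ + 2 * κ + η) / 2 - lam = e - κ := by rw [he]; ring
  set B := K * (U * F) * T ^ (e - κ) + diffConst d * (K' * (U * F) * T ^ (e - κ)) with hB
  have hB1 : 0 ≤ diffConst d * (K' * (U * F) * T ^ (e - κ)) := by positivity
  have hsmall : ∀ L, 0 < L → L ≤ T → L ^ e ≤ T ^ (e - κ) * L ^ κ := fun L hL hLT => by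
    rw [show e = (e - κ) + κ by ring, Real.rpow_add hL, show (e - κ) + κ - κ = e - κ by ring]
    gcongr
  have main : ∀ r v, 0 ≤ r → r < v → v ≤ T →
      BlockLE P μ (B * (v - r) ^ κ) (mildIntegral P u f 0 v - mildIntegral P u f 0 r) := by
    intro r v hr hrv hvT
    have hL : 0 < v - r := by linarith
    have b1 := (hK F U f u H r v hr hrv hvT).1
    have hs := hsmall (v - r) hL (by linarith)
    have b1' : K * (U * F) * (v - r) ^ e ≤ K * (U * F) * T ^ (e - κ) * (v - r) ^ κ := by
      rw [mul_assoc (K * (U * F))]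
      gcongr
    -- At `r = 0` there is no earlier integral to propagate, and the bounds assume a nondegenerate
    -- interval.
    rcases eq_or_lt_of_le hr with h | h
    · subst h
      rw [mildIntegral_self, sub_zero (mildIntegral P u f 0 v)]
      refine b1.mono le_rfl (b1'.trans ?_)
      rw [hB]
      have : 0 ≤ (v - 0) ^ κ := by positivity
      nlinarith
    · have b2 := (hK' F U f u H 0 r le_rfl h (by linarith)).1
      rw [he', sub_zero] at b2
      have b3 := b2.sub_heat hd hL.le hκ.le (by linarith)
        (v := mildIntegral P u f 0 v - mildIntegral P u f r v) fun α => by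
          rw [_root_.sub_apply, H.mildIntegral_add_hermiteFun hd hT h0 h1 hβ hl0 hl1 hγ
            (by linarith) le_rfl h hrv hvT, add_sub_cancel_right]
      rw [add_sub_cancel_right] at b3
      have b4 := b1.sub hd b3
      have e5 : mildIntegral P u f r v - (mildIntegral P u f 0 r -
          (mildIntegral P u f 0 v - mildIntegral P u f r v)) =
          mildIntegral P u f 0 v - mildIntegral P u f 0 r := by abel
      rw [e5] at b4
      refine b4.mono le_rfl ?_
      have : r ^ (e - κ) ≤ T ^ (e - κ) := Real.rpow_le_rpow hr (by linarith) (by linarith)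
      calc _ ≤ K * (U * F) * T ^ (e - κ) * (v - r) ^ κ +
            diffConst d * ((v - r) ^ κ * (K' * (U * F) * T ^ (e - κ))) := by gcongr
        _ = _ := by rw [hB]; ring
  refine ⟨B, fun r hr v hv => ?_⟩
  rcases lt_trichotomy r v with h | h | h
  · rw [abs_of_pos (by linarith)]
    exact main r v hr.1 h hv.2
  · subst h
    rw [sub_self, sub_self, abs_zero, Real.zero_rpow hκ.ne', mul_zero]
    exact blockLE_zero P μ
  · rw [abs_sub_comm, abs_of_pos (by linarith)]
    exact (main v r hv.1 h hr.2).sub_comm hd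

/-- The larger exponent `κ'` is positive, so continuity of the path also holds when `κ = 0`. -/
theorem isHolderPath_of_blockLE {σ κ κ' B : ℝ} (hT : 0 < T) (hκ : 0 ≤ κ) (hκ' : κ < κ')
    {g : ℝ → 𝓢'(Space d, ℂ)} (hmem : ∀ r ∈ Set.Icc 0 T, besovNorm P σ (g r) < ⊤)
    (hg : ∀ r ∈ Set.Icc 0 T, ∀ v ∈ Set.Icc 0 T, BlockLE P σ (B * |v - r| ^ κ') (g v - g r)) :
    IsHolderPath P σ κ T g := by
  have hκ0 : 0 < κ' := by linarith
  refine ⟨hmem, fun r hr => ?_, ?_⟩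
  · have hlim : Tendsto (fun v : ℝ => ENNReal.ofReal (2 ^ (-σ) * (B * |v - r| ^ κ')))
        (𝓝[Set.Icc 0 T] r) (𝓝 0) := by
      have c : Continuous fun v : ℝ => 2 ^ (-σ) * (B * |v - r| ^ κ') :=
        continuous_const.mul (continuous_const.mul
          (Continuous.rpow_const (by fun_prop) fun _ => Or.inr hκ0.le))
      have := (ENNReal.continuous_ofReal.comp c).tendsto r
      simp only [Function.comp, sub_self, abs_zero, Real.zero_rpow hκ0.ne', mul_zero,
        ENNReal.ofReal_zero] at this
      exact this.mono_left nhdsWithin_le_nhds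
    refine tendsto_of_tendsto_of_tendsto_of_le_of_le' tendsto_const_nhds hlim
      (Eventually.of_forall fun _ => zero_le) ?_
    filter_upwards [self_mem_nhdsWithin] with v hv
    exact (hg r hr v hv).besovNorm_le
  · refine lt_of_le_of_lt (b := ENNReal.ofReal (2 ^ (-σ) * (|B| * T ^ (κ' - κ)))) ?_
      ENNReal.ofReal_lt_top
    refine iSup₂_le fun r hr => iSup₂_le fun v hv => iSup_le fun hrv => ?_
    have hp : 0 < |v - r| := abs_pos.2 (sub_ne_zero.2 hrv.symm)
    have hpκ : 0 < |v - r| ^ κ := Real.rpow_pos_of_pos hp κ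
    rw [ENNReal.div_le_iff (by simpa using hpκ) ENNReal.ofReal_ne_top,
      ← ENNReal.ofReal_mul (by positivity)]
    refine (hg r hr v hv).besovNorm_le.trans (ENNReal.ofReal_le_ofReal ?_)
    have hvr : |v - r| ≤ T := by
      rw [abs_le]; constructor <;> linarith [hr.1, hr.2, hv.1, hv.2]
    have e : |v - r| ^ κ' = |v - r| ^ (κ' - κ) * |v - r| ^ κ := by
      rw [← Real.rpow_add hp, sub_add_cancel]
    rw [e]
    calc _ = 2 ^ (-σ) * (B * |v - r| ^ (κ' - κ)) * |v - r| ^ κ := by ring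
      _ ≤ _ := by
        gcongr
        exact le_abs_self B

end Additivity

/-! ### The estimates for Hölder paths -/

section Bounds

variable {P : DyadicPartition} {T lam η γ β : ℝ} {f u : ℝ → 𝓢'(Space d, ℂ)}

theorem riemannSum_mem_and_tendsto (hd : 1 ≤ d) (hT : 0 < T) (hl0 : 0 < lam) (hl1 : lam < 1)
    (h0 : 0 < η) (h1 : η < 1) (hγ : lam < γ) (hβ : η < β)
    (hf : IsHolderPath P (-η) (1 - lam) T f) (hu : IsHolderPath P β γ T u) {s t : ℝ} (hs : 0 ≤ s)
    (hst : s ≤ t) (htT : t ≤ T) {μ : ℝ} (hμ0 : 0 ≤ μ) (hμ : μ < 2 - η - 2 * lam) :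
    (∀ n, besovNorm P μ (riemannSum P u f s t n) < ⊤) ∧
      besovNorm P μ (mildIntegral P u f s t) < ⊤ ∧
      Tendsto (fun n => besovNorm P μ (riemannSum P u f s t n - mildIntegral P u f s t))
        atTop (𝓝 0) := by
  rcases eq_or_lt_of_le hst with h | h
  · subst h
    simp [riemannSum_self, mildIntegral_self, besovNorm_zero]
  obtain ⟨K, ρ, -, hρ0, hρ1, hK⟩ :=
    exists_mildIntegral_bounds d hd P hT hl0 h0 h1 hβ hγ hμ0 hμ
  obtain ⟨a, b⟩ := hK _ _ f u (pathBounds_of_isHolderPath hd hT hl1 (hl0.trans hγ) hf hu) s t hs h htT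
  refine ⟨fun n => ?_, a.besovNorm_le.trans_lt ENNReal.ofReal_lt_top, ?_⟩
  · have := ((b n).add hd a).besovNorm_le
    rw [sub_add_cancel] at this
    exact this.trans_lt ENNReal.ofReal_lt_top
  · refine tendsto_of_tendsto_of_tendsto_of_le_of_le tendsto_const_nhds ?_ (fun _ => zero_le)
      (fun n => (b n).besovNorm_le)
    have h2 := ((tendsto_pow_atTop_nhds_zero_of_lt_one hρ0 hρ1).const_mul
      (K * (2 ^ β * (1 + T ^ γ) * (holderNorm P β γ T u).toReal *
        (2 ^ (-η) * (holderSeminorm P (-η) (1 - lam) T f).toReal)) *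
          (t - s) ^ (1 - (μ + η) / 2 - lam))).const_mul (2 ^ (-μ))
    rw [mul_zero, mul_zero] at h2
    simpa using ENNReal.tendsto_ofReal h2

/-- The sewing bound has the exponent without loss. The `ε` is introduced through `t - s ≤ T`,
whence the factor `T^ε`, and it need not be small. -/
theorem exists_besovNorm_mildIntegral_le (d : ℕ) (hd : 1 ≤ d) (P : DyadicPartition) (hT : 0 < T)
    (hl0 : 0 < lam) (hl1 : lam < 1) (h0 : 0 < η) (h1 : η < 1) (hγ : lam < γ) (hβ : η < β) {μ ε : ℝ}
    (hμ0 : 0 ≤ μ) (hμ : μ < 2 - η - 2 * lam) (hε : 0 < ε) :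
    ∃ C : ℝ≥0, ∀ f u : ℝ → 𝓢'(Space d, ℂ),
      IsHolderPath P (-η) (1 - lam) T f → IsHolderPath P β γ T u →
      ∀ s t : ℝ, 0 ≤ s → s < t → t ≤ T →
        besovNorm P μ (mildIntegral P u f s t) ≤
          C * ENNReal.ofReal ((t - s) ^ (1 - (μ + η) / 2 - lam - ε)) *
            holderNorm P β γ T u * holderSeminorm P (-η) (1 - lam) T f := by
  obtain ⟨K, ρ, hK0, -, -, hK⟩ :=
    exists_mildIntegral_bounds d hd P hT hl0 h0 h1 hβ hγ hμ0 hμ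
  refine ⟨Real.toNNReal (2 ^ (-μ) * K * (2 ^ β * (1 + T ^ γ)) * 2 ^ (-η) * T ^ ε),
    fun f u hf hu s t hs hst htT => ?_⟩
  have a := (hK _ _ f u (pathBounds_of_isHolderPath hd hT hl1 (hl0.trans hγ) hf hu) s t hs hst
    htT).1.besovNorm_le
  refine a.trans ?_
  rw [← ENNReal.ofReal_toReal (hu.holderNorm_lt_top hT.le).ne,
    ← ENNReal.ofReal_toReal hf.seminorm_lt_top.ne]
  have hL : 0 < t - s := sub_pos.2 hst
  change _ ≤ ENNReal.ofReal _ * _ * _ * _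
  rw [← ENNReal.ofReal_mul (by positivity), ← ENNReal.ofReal_mul (by positivity),
    ← ENNReal.ofReal_mul (by positivity), ENNReal.toReal_ofReal (by positivity),
    ENNReal.toReal_ofReal (by positivity)]
  refine ENNReal.ofReal_le_ofReal ?_
  set e := 1 - (μ + η) / 2 - lam
  have h3 : (t - s) ^ e ≤ T ^ ε * (t - s) ^ (e - ε) := by
    rw [show e = ε + (e - ε) by ring, Real.rpow_add hL, show ε + (e - ε) - ε = e - ε by ring]
    gcongr
    linarith
  calc _ = 2 ^ (-μ) * K * (2 ^ β * (1 + T ^ γ)) * 2 ^ (-η) * (holderNorm P β γ T u).toReal *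
        (holderSeminorm P (-η) (1 - lam) T f).toReal * (t - s) ^ e := by ring
    _ ≤ 2 ^ (-μ) * K * (2 ^ β * (1 + T ^ γ)) * 2 ^ (-η) * (holderNorm P β γ T u).toReal *
        (holderSeminorm P (-η) (1 - lam) T f).toReal * (T ^ ε * (t - s) ^ (e - ε)) := by gcongr
    _ = _ := by ring

theorem isHolderPath_mildIntegral (hd : 1 ≤ d) (hT : 0 < T) (hl0 : 0 < lam) (hl1 : lam < 1)
    (h0 : 0 < η) (h1 : η < 1) (hγ : lam < γ) (hβ : η < β)
    (hf : IsHolderPath P (-η) (1 - lam) T f) (hu : IsHolderPath P β γ T u) {μ κ : ℝ} (hμ0 : 0 ≤ μ)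
    (hμ : μ < 2 - η - 2 * lam) (hκ0 : 0 ≤ κ) (hκ : κ < (1 - η / 2 - lam) - μ / 2) :
    IsHolderPath P μ κ T (fun t => mildIntegral P u f 0 t) := by
  -- The midpoint is positive and still below the admissible limit, even if `κ = 0`.
  set κ' := (κ + ((1 - η / 2 - lam) - μ / 2)) / 2 with hκ'
  obtain ⟨B, hB⟩ := (pathBounds_of_isHolderPath hd hT hl1 (hl0.trans hγ) hf
    hu).exists_mildIntegral_sub_le hd hT h0 h1 hβ hl0 hl1 hγ hμ0 (κ := κ') (by linarith)
    (by linarith)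
  exact isHolderPath_of_blockLE hT hκ0 (by linarith : κ < κ')
    (fun r hr => (riemannSum_mem_and_tendsto hd hT hl0 hl1 h0 h1 hγ hβ hf hu le_rfl hr.1 hr.2 hμ0
      hμ).2.1) hB

end Bounds

/-! ### Paths that are Lipschitz with values in `L^∞` -/

/-! ### The fundamental theorem of calculus for Lipschitz functions -/

section FundamentalTheorem

theorem integral_eq_sub_of_lipschitzOn_real {h g : ℝ → ℝ} {a b : ℝ} {C : ℝ≥0} (hab : a ≤ b)
    (hl : LipschitzOnWith C h (Set.Icc a b))
    (hd : ∀ᵐ r, r ∈ Set.Ioo a b → HasDerivAt h (g r) r) :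
    IntervalIntegrable g volume a b ∧ ∫ r in a..b, g r = h b - h a := by
  have hac : AbsolutelyContinuousOnInterval h a b :=
    LipschitzOnWith.absolutelyContinuousOnInterval (by rwa [Set.uIcc_of_le hab])
  have he : ∀ᵐ r, r ∈ Set.uIoc a b → deriv h r = g r := by
    have hb : ∀ᵐ r : ℝ, r ≠ b := by simp [ae_iff, measure_singleton]
    filter_upwards [hd, hb] with r hr hrb hr'
    rw [Set.uIoc_of_le hab] at hr'
    exact (hr ⟨hr'.1, lt_of_le_of_ne hr'.2 hrb⟩).deriv
  refine ⟨hac.intervalIntegrable_deriv.congr_ae ?_, ?_⟩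
  · exact (ae_restrict_iff' measurableSet_uIoc).2 he
  · rw [← hac.integral_deriv_eq_sub]
    exact intervalIntegral.integral_congr_ae (he.mono fun r hr h => (hr h).symm)

theorem integral_eq_sub_of_lipschitzOn {h g : ℝ → ℂ} {a b : ℝ} {C : ℝ≥0} (hab : a ≤ b)
    (hl : LipschitzOnWith C h (Set.Icc a b))
    (hd : ∀ᵐ r, r ∈ Set.Ioo a b → HasDerivAt h (g r) r) :
    IntervalIntegrable g volume a b ∧ ∫ r in a..b, g r = h b - h a := by
  obtain ⟨i1, e1⟩ := integral_eq_sub_of_lipschitzOn_real (h := fun r => (h r).re)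
    (g := fun r => (g r).re) (C := C) hab (LipschitzOnWith.of_dist_le_mul fun x hx y hy => by
      refine le_trans ?_ (hl.dist_le_mul x hx y hy)
      rw [Real.dist_eq, ← Complex.sub_re, dist_eq_norm]
      exact Complex.abs_re_le_norm _)
    (hd.mono fun r hr hr' => Complex.reCLM.hasFDerivAt.comp_hasDerivAt r (hr hr'))
  obtain ⟨i2, e2⟩ := integral_eq_sub_of_lipschitzOn_real (h := fun r => (h r).im)
    (g := fun r => (g r).im) (C := C) hab (LipschitzOnWith.of_dist_le_mul fun x hx y hy => by
      refine le_trans ?_ (hl.dist_le_mul x hx y hy)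
      rw [Real.dist_eq, ← Complex.sub_im, dist_eq_norm]
      exact Complex.abs_im_le_norm _)
    (hd.mono fun r hr hr' => Complex.imCLM.hasFDerivAt.comp_hasDerivAt r (hr hr'))
  have j1 : IntervalIntegrable (fun r => ((g r).re : ℂ)) volume a b := ⟨i1.1.ofReal, i1.2.ofReal⟩
  have j2 : IntervalIntegrable (fun r => ((g r).im : ℂ) * Complex.I) volume a b :=
    IntervalIntegrable.mul_const ⟨i2.1.ofReal, i2.2.ofReal⟩ _
  have e : g = fun r => ((g r).re : ℂ) + ((g r).im : ℂ) * Complex.I := by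
    funext r; exact (Complex.re_add_im _).symm
  rw [e]
  refine ⟨j1.add j2, ?_⟩
  rw [intervalIntegral.integral_add j1 j2, intervalIntegral.integral_mul_const,
    intervalIntegral.integral_ofReal, intervalIntegral.integral_ofReal, e1, e2]
  apply Complex.ext <;> simp

end FundamentalTheorem

/-! ### Continuity of products and of the semigroup under bounded weak convergence -/

section Continuity

variable {P : DyadicPartition} {η β F U : ℝ} {ι : Type*} {l : Filter ι}

/-- A single block involves finitely many Hermite coefficients, so coefficientwise convergence is
enough. -/
theorem tendsto_prodTerm (hd : 1 ≤ d) {u w : 𝓢'(Space d, ℂ)} {q : ι → 𝓢'(Space d, ℂ)}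
    (hq : ∀ α, Tendsto (fun i => q i (hermiteFun α)) l (𝓝 (w (hermiteFun α))))
    (ψ : 𝓢(Space d, ℂ)) (p : ℕ × ℕ) :
    Tendsto (fun i => prodTerm P u (q i) ψ p) l (𝓝 (prodTerm P u w ψ p)) := by
  have e : ∀ w : 𝓢'(Space d, ℂ), prodTerm P u w ψ p = ∑ α ∈ modes d (4 ^ p.2),
      blockCoeff P p.2 (fun α => w (hermiteFun α)) α *
        ∫ x, ψ x * (block P p.1 u x * hermiteFun α x) := fun w => by
    rw [prodTerm, block_eq_expansion hd P p.2 w]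
    simp only [expansion_apply]
    rw [Finset.sum_congr rfl fun α _ => (integral_const_mul _ _).symm,
      ← integral_finsetSum _ fun α _ => (integrable_mul_mul ψ _ _).const_mul _]
    congr 1; funext x
    rw [Finset.mul_sum, Finset.mul_sum]
    exact Finset.sum_congr rfl fun α _ => by ring
  simp only [e]
  refine tendsto_finsetSum _ fun α _ => Tendsto.mul_const _ ?_
  simp only [blockCoeff]
  exact (hq α).const_mul _

/-- Products are continuous in the second factor for bounded weak convergence. -/
theorem tendsto_besovMul (hd : 1 ≤ d) (h0 : 0 < η) (h1 : η < 1) (hβ : η < β)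
    {u w : 𝓢'(Space d, ℂ)} {q : ι → 𝓢'(Space d, ℂ)} (hu : BlockLE P β U u)
    (hw : BlockLE P (-η) F w) (hqF : ∀ᶠ i in l, BlockLE P (-η) F (q i))
    (hq : ∀ α, Tendsto (fun i => q i (hermiteFun α)) l (𝓝 (w (hermiteFun α))))
    (ψ : 𝓢(Space d, ℂ)) :
    Tendsto (fun i => besovMul P u (q i) ψ) l (𝓝 (besovMul P u w ψ)) := by
  rw [besovMul_apply hd h0 h1 hβ hu hw]
  refine Tendsto.congr' (hqF.mono fun i hi => (besovMul_apply hd h0 h1 hβ hu hi ψ).symm) ?_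
  have hg := geom_double_sum (r := (2 : ℝ) ^ (-(β - η))) (by positivity)
    (two_rpow_neg_lt_one (sub_pos.2 hβ)) (offRatio_nonneg η) (offRatio_lt_one h0 h1) 0
  refine tendsto_tsum_of_dominated_convergence
    (hg.1.mul_left ((1 + paraConst d) * (U * F) * testNorm η 0 ψ))
    (fun p => tendsto_prodTerm hd hq ψ p) (hqF.mono fun i hi p => ?_)
  exact norm_prodTerm_le_testNorm hd h0 h1 hu hi ψ 0 p.1 p.2

/-- The semigroup is jointly continuous at positive times for bounded weak convergence. -/
theorem tendsto_heat (hd : 1 ≤ d) {t C : ℝ} (ht : 0 < t) {w : 𝓢'(Space d, ℂ)}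
    {τ : ι → ℝ} {q : ι → 𝓢'(Space d, ℂ)} (hτ : Tendsto τ l (𝓝 t)) (hw : OrderOne C w)
    (hqC : ∀ᶠ i in l, OrderOne C (q i))
    (hq : ∀ α, Tendsto (fun i => q i (hermiteFun α)) l (𝓝 (w (hermiteFun α))))
    (ψ : 𝓢(Space d, ℂ)) :
    Tendsto (fun i => heat (τ i) (q i) ψ) l (𝓝 (heat t w ψ)) := by
  obtain ⟨b, hb, hbb⟩ := exists_heat_term_bound (d := d) (half_pos ht) C
  have hτ' : ∀ᶠ i in l, t / 2 < τ i := hτ.eventually_const_lt (by linarith)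
  rw [← (hasSum_heat ht hw ψ).tsum_eq]
  refine Tendsto.congr' (by
    filter_upwards [hqC, hτ'] with i hi hi'
    exact (hasSum_heat ((half_pos ht).trans hi') hi ψ).tsum_eq) ?_
  refine tendsto_tsum_of_dominated_convergence (hb.mul_right (∫ x, ‖ψ x‖)) (fun α => ?_) ?_
  · refine Tendsto.mul_const _ (Tendsto.mul ?_ (hq α))
    refine (Complex.continuous_ofReal.tendsto _).comp ((Real.continuous_exp.tendsto _).comp ?_)
    exact (hτ.mul_const _).neg
  · filter_upwards [hqC, hτ'] with i hi hi' α
    refine le_trans ?_ (hbb (q i) hi ψ α)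
    have hl := one_le_eigenvalue hd α
    rw [norm_mul, norm_mul, norm_mul, norm_mul, Complex.norm_real, Complex.norm_real,
      Real.norm_eq_abs, Real.norm_eq_abs, Real.abs_exp, Real.abs_exp]
    gcongr

/-- Linearity in `f` of the elementary term. -/
theorem heat_besovMul_smul_sub (hd : 1 ≤ d) (h0 : 0 < η) (h1 : η < 1) (hβ : η < β) {t F' F'' : ℝ}
    (ht : 0 < t) {u v w q : 𝓢'(Space d, ℂ)} (c : ℂ) (hu : BlockLE P β U u)
    (hv : BlockLE P (-η) F v) (hw : BlockLE P (-η) F' w) (hq : BlockLE P (-η) F'' q)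
    (hqe : ∀ ψ, q ψ = c * (v ψ - w ψ)) (ψ : 𝓢(Space d, ℂ)) :
    heat t (besovMul P u q) ψ =
      c * (heat t (besovMul P u v) ψ - heat t (besovMul P u w) ψ) := by
  have hp : ∀ φ, besovMul P u q φ = c * (besovMul P u v φ - besovMul P u w φ) := fun φ => by
    rw [besovMul_apply hd h0 h1 hβ hu hv, besovMul_apply hd h0 h1 hβ hu hw,
      besovMul_apply hd h0 h1 hβ hu hq, ← (summable_prodTerm hd h0 h1 hβ hu hv φ).1.tsum_sub
      (summable_prodTerm hd h0 h1 hβ hu hw φ).1, ← tsum_mul_left]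
    congr 1; funext p
    simp only [prodTerm]
    rw [← integral_sub (integrable_mul_mul φ _ _) (integrable_mul_mul φ _ _),
      ← integral_const_mul]
    congr 1; funext x
    rw [block_apply hd P p.2 q, block_apply hd P p.2 v, block_apply hd P p.2 w, hqe]
    ring
  have s1 := hasSum_heat ht (orderOne_besovMul hd h0 h1 hβ hu hv) ψ
  have s2 := hasSum_heat ht (orderOne_besovMul hd h0 h1 hβ hu hw) ψ
  have s3 := hasSum_heat ht (orderOne_besovMul hd h0 h1 hβ hu hq) ψ
  refine s3.unique (((s1.sub s2).mul_left c).congr_fun fun α => ?_)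
  rw [hp]; ring

/-- The constant of the `L^∞` bound of the elementary term. -/
def elemConst (d : ℕ) (P : DyadicPartition) (η β : ℝ) : ℝ :=
  (1 - (2 : ℝ) ^ (-1 : ℝ))⁻¹ * (heatConst d * mulConst d P η β)

/-- The choice `p = (1 + η) / 2` raises the regularity from `-η` to `1`, where a Hermite series is
bounded by the `L¹` norm of the test function. As `η < 1`, the exponent is less than one and the
singularity in time is integrable. -/
theorem norm_heat_besovMul_le (hd : 1 ≤ d) (h0 : 0 < η) (h1 : η < 1) (hβ : η < β) {t : ℝ}
    (ht : 0 < t) {u w : 𝓢'(Space d, ℂ)} (hu : BlockLE P β U u) (hw : BlockLE P (-η) F w)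
    (ψ : 𝓢(Space d, ℂ)) :
    ‖heat t (besovMul P u w) ψ‖ ≤
      elemConst d P η β * (U * F) * (∫ x, ‖ψ x‖) * t ^ (-((1 + η) / 2)) := by
  have ho := orderOne_besovMul hd h0 h1 hβ hu hw
  have hb := (blockLE_besovMul hd h0 h1 hβ hu hw).heat hd ht (p := (1 + η) / 2) (by linarith)
    (by linarith) fun α => heat_hermiteFun ht ho α
  rw [show -η + 2 * ((1 + η) / 2) = 1 by ring] at hb
  refine ((isHermiteSum_heat ht ho).norm_le hd zero_lt_one hb ψ).trans (le_of_eq ?_)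
  rw [elemConst]; ring

end Continuity

/-! ### Weak time derivatives of Lipschitz paths -/

section LipschitzPaths

/-- The path is Lipschitz on `[0, T]` with values in the dual of `L¹`. -/
def IsLipschitzPath (T L : ℝ) (f : ℝ → 𝓢'(Space d, ℂ)) : Prop :=
  ∀ r ∈ Set.Icc 0 T, ∀ v ∈ Set.Icc 0 T, ∀ ψ : 𝓢(Space d, ℂ),
    ‖f v ψ - f r ψ‖ ≤ L * (∫ x, ‖ψ x‖) * |v - r|

theorem isLipschitzPath_of_lipschitzOnWith {T : ℝ} {L : ℝ≥0}
    {f : ℝ → Lp ℂ ⊤ (volume : Measure (Space d))} (hf : LipschitzOnWith L f (Set.Icc 0 T)) :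
    IsLipschitzPath T L fun r => (f r : 𝓢'(Space d, ℂ)) := by
  intro r hr v hv ψ
  have e : (f v : 𝓢'(Space d, ℂ)) ψ - (f r : 𝓢'(Space d, ℂ)) ψ =
      ((f v - f r : Lp ℂ ⊤ (volume : Measure (Space d))) : 𝓢'(Space d, ℂ)) ψ := by
    have := (Lp.toTemperedDistributionCLM ℂ (volume : Measure (Space d)) ⊤).map_sub (f v) (f r)
    simp only [Lp.toTemperedDistributionCLM_apply] at this
    rw [this, _root_.sub_apply]
  rw [e, Lp.toTemperedDistribution_apply]
  have hb : ∀ᵐ x, ‖(f v - f r : Lp ℂ ⊤ (volume : Measure (Space d))) x‖ ≤ L * |v - r| := by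
    have h1 := hf.dist_le_mul v hv r hr
    rw [dist_eq_norm, Real.dist_eq] at h1
    filter_upwards [ae_le_eLpNormEssSup (f := (f v - f r : Lp ℂ ⊤ (volume : Measure (Space d))))]
      with x hx
    rw [← eLpNorm_exponent_top] at hx
    refine le_trans ?_ h1
    rw [Lp.norm_def, ← toReal_enorm]
    exact ENNReal.toReal_mono (Lp.eLpNorm_ne_top _) hx
  calc _ ≤ ∫ x, L * |v - r| * ‖ψ x‖ := by
        refine norm_integral_le_of_norm_le (ψ.integrable.norm.const_mul _) (hb.mono fun x hx => ?_)
        rw [norm_smul, mul_comm]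
        gcongr
    _ = _ := by rw [integral_const_mul]; ring

theorem blockLE_of_norm_le (hd : 1 ≤ d) (P : DyadicPartition) {A σ : ℝ} (hA : 0 ≤ A) (hσ : σ ≤ 0)
    {w : 𝓢'(Space d, ℂ)} (hw : ∀ ψ : 𝓢(Space d, ℂ), ‖w ψ‖ ≤ A * ∫ x, ‖ψ x‖) :
    BlockLE P σ (A * blockConst d P) w := by
  have h : BlockLE P 0 (A * blockConst d P) w := fun n x => by
    rw [block_apply hd, mul_zero, neg_zero, Real.rpow_zero, mul_one]
    exact (hw _).trans (mul_le_mul_of_nonneg_left (integral_norm_blockKernel_le hd P n x) hA)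
  exact h.mono hσ le_rfl

variable {T L : ℝ} {f f' : ℝ → 𝓢'(Space d, ℂ)}

theorem IsLipschitzPath.blockLE (hd : 1 ≤ d) (P : DyadicPartition) (hL : 0 ≤ L)
    (hf : IsLipschitzPath T L f) {σ r v : ℝ} (hσ : σ ≤ 0) (hr : r ∈ Set.Icc 0 T)
    (hv : v ∈ Set.Icc 0 T) : BlockLE P σ (L * |v - r| * blockConst d P) (f v - f r) :=
  blockLE_of_norm_le hd P (by positivity) hσ fun ψ => by
    rw [_root_.sub_apply]
    refine (hf r hr v hv ψ).trans (le_of_eq (by ring))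

theorem IsLipschitzPath.norm_deriv_le (hL : 0 ≤ L) (hf : IsLipschitzPath T L f) {r : ℝ}
    (hr : r ∈ Set.Ioo 0 T) {ψ : 𝓢(Space d, ℂ)} {c : ℂ} (hc : HasDerivAt (fun v => f v ψ) c r) :
    ‖c‖ ≤ L * ∫ x, ‖ψ x‖ := by
  refine hc.le_of_lip' (mul_nonneg hL (integral_norm_nonneg ψ)) ?_
  filter_upwards [Icc_mem_nhds hr.1 hr.2] with v hv
  exact hf r (Set.Ioo_subset_Icc_self hr) v hv ψ

/-- The image of the Schwartz space in the separable space `L¹` is separable. Countability lets the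
exceptional null sets of times be united into one. -/
theorem exists_countable_dense_schwartz (d : ℕ) :
    ∃ S : Set 𝓢(Space d, ℂ), S.Countable ∧ ∀ (ψ : 𝓢(Space d, ℂ)) (ε : ℝ), 0 < ε →
      ∃ φ ∈ S, ∫ x, ‖(ψ - φ) x‖ < ε := by
  have : Fact ((1 : ℝ≥0∞) ≠ ⊤) := ⟨ENNReal.one_ne_top⟩
  obtain ⟨t, hts, htc, ht⟩ := (TopologicalSpace.IsSeparable.of_separableSpace
    (Set.range (SchwartzMap.toLpCLM ℂ ℂ 1
      (volume : Measure (Space d))))).exists_countable_dense_subset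
  choose g hg using hts
  have := htc.to_subtype
  refine ⟨Set.range fun x : t => g x.2, Set.countable_range _, fun ψ ε hε => ?_⟩
  obtain ⟨x, hx, hlt⟩ := Metric.mem_closure_iff.1 (ht ⟨ψ, rfl⟩) ε hε
  refine ⟨g hx, ⟨⟨x, hx⟩, rfl⟩, ?_⟩
  rw [← hg hx, dist_eq_norm, ← map_sub] at hlt
  exact (SchwartzMap.norm_toLp_one (f := ψ - g hx)).symm.trans_lt hlt

/-- The slopes depend on `ψ` in a way that is Lipschitz for the `L¹` norm, uniformly in the
increment. The Cauchy property therefore passes from an `L¹`-dense set of test functions to all of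
them. -/
theorem IsLipschitzPath.exists_hasDerivAt (hL : 0 ≤ L) (hf : IsLipschitzPath T L f)
    {S : Set 𝓢(Space d, ℂ)} (hS : ∀ (ψ : 𝓢(Space d, ℂ)) (ε : ℝ), 0 < ε →
      ∃ φ ∈ S, ∫ x, ‖(ψ - φ) x‖ < ε) {r : ℝ} (hr : r ∈ Set.Ioo 0 T)
    (hd : ∀ φ ∈ S, DifferentiableAt ℝ (fun v => f v φ) r) (ψ : 𝓢(Space d, ℂ)) :
    DifferentiableAt ℝ (fun v => f v ψ) r := by
  suffices h : Cauchy (map (slope (fun v => f v ψ) r) (𝓝[≠] r)) by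
    obtain ⟨c, hc⟩ := CompleteSpace.complete h
    exact (hasDerivAt_iff_tendsto_slope.2 hc).differentiableAt
  rw [Metric.cauchy_iff]
  refine ⟨inferInstance, fun ε hε => ?_⟩
  obtain ⟨φ, hφ, hlt⟩ := hS ψ (ε / (4 * (L + 1))) (by positivity)
  obtain ⟨c, hc⟩ : ∃ c, HasDerivAt (fun v => f v φ) c r := ⟨_, (hd φ hφ).hasDerivAt⟩
  have hs := hasDerivAt_iff_tendsto_slope.1 hc
  refine ⟨Metric.ball c (ε / 2), ?_, fun x hx y hy => ?_⟩
  · have h1 := hs.eventually (Metric.ball_mem_nhds c (show (0 : ℝ) < ε / 4 by linarith))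
    have h2 : ∀ᶠ v in 𝓝[≠] r, v ∈ Set.Icc 0 T :=
      mem_nhdsWithin_of_mem_nhds (Icc_mem_nhds hr.1 hr.2)
    rw [mem_map]
    filter_upwards [h1, h2, self_mem_nhdsWithin] with v hv hvT hvr
    have hv0 : 0 < |v - r| := abs_pos.2 (sub_ne_zero.2 hvr)
    have h3 := hf r (Set.Ioo_subset_Icc_self hr) v hvT (ψ - φ)
    have h4 : dist (slope (fun v => f v ψ) r v) (slope (fun v => f v φ) r v) ≤
        L * ∫ x, ‖(ψ - φ) x‖ := by
      rw [dist_eq_norm, slope_def_module, slope_def_module, ← smul_sub, norm_smul, norm_inv,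
        Real.norm_eq_abs, inv_mul_le_iff₀ hv0]
      refine le_trans (le_of_eq ?_) (h3.trans (le_of_eq (by ring)))
      rw [map_sub, map_sub]
      congr 1; ring
    have h5 : L * ∫ x, ‖(ψ - φ) x‖ ≤ ε / 4 := by
      calc _ ≤ (L + 1) * (ε / (4 * (L + 1))) := by gcongr; linarith
        _ = ε / 4 := by field_simp
    have := dist_triangle (slope (fun v => f v ψ) r v) (slope (fun v => f v φ) r v) c
    rw [Set.mem_preimage, Metric.mem_ball]
    linarith
  · rw [Metric.mem_ball] at hx hy
    have := dist_triangle_right x y c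
    linarith

theorem IsLipschitzPath.exists_isTimeDerivative (hL : 0 ≤ L) (hf : IsLipschitzPath T L f) :
    ∃ f' : ℝ → 𝓢'(Space d, ℂ), IsTimeDerivative T f f' := by
  obtain ⟨S, hSc, hS⟩ := exists_countable_dense_schwartz d
  have hae : ∀ᵐ r ∂(volume.restrict (Set.Ioo 0 T)), ∀ φ ∈ S,
      DifferentiableAt ℝ (fun v => f v φ) r := by
    rw [ae_ball_iff hSc]
    intro φ _
    have hl : LipschitzOnWith (Real.toNNReal (L * ∫ x, ‖φ x‖)) (fun v => f v φ) (Set.Icc 0 T) :=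
      LipschitzOnWith.of_dist_le_mul fun x hx y hy => by
        rw [Real.coe_toNNReal _ (mul_nonneg hL (integral_norm_nonneg φ)), dist_eq_norm,
          Real.dist_eq]
        exact hf y hy x hx φ
    rw [ae_restrict_iff' measurableSet_Ioo]
    filter_upwards [hl.ae_differentiableWithinAt_of_mem_real] with r hr hr'
    exact (hr (Set.Ioo_subset_Icc_self hr')).differentiableAt (Icc_mem_nhds hr'.1 hr'.2)
  -- The derivative is chosen at every time, with the value zero at the exceptional ones, so that a
  -- single function `f'` can be extracted.
  have hex : ∀ r, ∃ w : 𝓢'(Space d, ℂ), r ∈ Set.Ioo 0 T →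
      (∀ φ ∈ S, DifferentiableAt ℝ (fun v => f v φ) r) →
      ∀ ψ : 𝓢(Space d, ℂ), HasDerivAt (fun v => f v ψ) (w ψ) r := by
    intro r
    by_cases h : r ∈ Set.Ioo 0 T ∧ ∀ φ ∈ S, DifferentiableAt ℝ (fun v => f v φ) r
    · have hder := fun ψ => (hf.exists_hasDerivAt hL hS h.1 h.2 ψ).hasDerivAt
      let l : 𝓢(Space d, ℂ) →ₗ[ℂ] ℂ :=
        { toFun := fun ψ => deriv (fun v => f v ψ) r
          map_add' := fun ψ φ => by
            have := ((hder ψ).add (hder φ)).congr_of_eventuallyEq (f₁ := fun v => f v (ψ + φ))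
              (Eventually.of_forall fun v => map_add _ _ _)
            exact this.deriv
          map_smul' := fun c ψ => by
            have := ((hder ψ).const_mul c).congr_of_eventuallyEq (f₁ := fun v => f v (c • ψ))
              (Eventually.of_forall fun v => map_smul _ _ _)
            exact this.deriv }
      have hl : ∀ ψ, ‖l ψ‖ ≤ L * ((∫ x, ‖ψ x‖) + gradNorm ψ) := fun ψ => by
        refine (hf.norm_deriv_le hL h.1 (hder ψ)).trans ?_
        have := gradNorm_nonneg ψ
        gcongr
        linarith
      exact ⟨mkDistribution l hl, fun _ _ ψ => hder ψ⟩
    · exact ⟨0, fun h1 h2 => absurd ⟨h1, h2⟩ h⟩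
  choose f' hf' using hex
  refine ⟨f', ?_⟩
  filter_upwards [hae, ae_restrict_mem measurableSet_Ioo] with r hr hr'
  exact hf' r hr' hr

theorem IsTimeDerivative.ae (h : IsTimeDerivative T f f') :
    ∀ᵐ r, r ∈ Set.Ioo 0 T → ∀ ψ : 𝓢(Space d, ℂ), HasDerivAt (fun v => f v ψ) (f' r ψ) r :=
  (ae_restrict_iff' measurableSet_Ioo).1 h

variable {P : DyadicPartition} {η β U : ℝ}

theorem IsLipschitzPath.blockLE_deriv (hd : 1 ≤ d) (P : DyadicPartition) (hL : 0 ≤ L)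
    (hf : IsLipschitzPath T L f) {σ r : ℝ} (hσ : σ ≤ 0) (hr : r ∈ Set.Ioo 0 T)
    (hder : ∀ ψ : 𝓢(Space d, ℂ), HasDerivAt (fun v => f v ψ) (f' r ψ) r) :
    BlockLE P σ (L * blockConst d P) (f' r) :=
  blockLE_of_norm_le hd P hL hσ fun ψ => hf.norm_deriv_le hL hr (hder ψ)

/-- For fixed `τ` and `w`, the scalar function `r ↦ ⟨e^{-τH}(w·(f_r - f_a)), ψ⟩` is Lipschitz. Where
`f` is differentiable, the difference quotients of `f` are bounded in `B^{-η}` and converge weakly,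
so this function has the expected derivative, and the fundamental theorem of calculus applies. -/
theorem IsLipschitzPath.integral_heat_besovMul (hd : 1 ≤ d) (h0 : 0 < η) (h1 : η < 1)
    (hβ : η < β) (hL : 0 ≤ L) (hf : IsLipschitzPath T L f) (hf' : IsTimeDerivative T f f')
    {w : 𝓢'(Space d, ℂ)} (hw : BlockLE P β U w) {τ a b : ℝ} (hτ : 0 < τ) (ha : 0 ≤ a)
    (hab : a ≤ b) (hb : b ≤ T) (ψ : 𝓢(Space d, ℂ)) :
    IntervalIntegrable (fun r => heat τ (besovMul P w (f' r)) ψ) volume a b ∧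
      ∫ r in a..b, heat τ (besovMul P w (f' r)) ψ = heat τ (besovMul P w (f b - f a)) ψ := by
  have hη : -η ≤ 0 := by linarith
  have hsub : Set.Icc a b ⊆ Set.Icc 0 T := Set.Icc_subset_Icc ha hb
  have haT : a ∈ Set.Icc 0 T := ⟨ha, hab.trans hb⟩
  have hB := fun {r v : ℝ} (hr : r ∈ Set.Icc 0 T) (hv : v ∈ Set.Icc 0 T) =>
    hf.blockLE hd P hL hη hr hv
  have hdiff : ∀ r ∈ Set.Icc 0 T, ∀ v ∈ Set.Icc 0 T,
      heat τ (besovMul P w (f v - f a)) ψ - heat τ (besovMul P w (f r - f a)) ψ =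
        heat τ (besovMul P w (f v - f r)) ψ := fun r hr v hv => by
    have := heat_besovMul_smul_sub hd h0 h1 hβ hτ 1 hw (hB haT hv) (hB haT hr) (hB hr hv)
      (fun φ => by simp only [_root_.sub_apply]; ring) ψ
    rw [this, one_mul]
  set C := elemConst d P η β * (U * (L * blockConst d P)) * (∫ x, ‖ψ x‖) *
    τ ^ (-((1 + η) / 2)) with hC
  have hlip : LipschitzOnWith (Real.toNNReal C)
      (fun r => heat τ (besovMul P w (f r - f a)) ψ) (Set.Icc a b) :=
    LipschitzOnWith.of_dist_le_mul fun v hv r hr => by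
      rw [dist_eq_norm, Real.dist_eq, hdiff r (hsub hr) v (hsub hv)]
      refine (norm_heat_besovMul_le hd h0 h1 hβ hτ hw (hB (hsub hr) (hsub hv)) ψ).trans ?_
      calc _ = C * |v - r| := by rw [hC]; ring
        _ ≤ _ := by gcongr; exact Real.le_coe_toNNReal C
  have key := integral_eq_sub_of_lipschitzOn hab hlip
    (g := fun r => heat τ (besovMul P w (f' r)) ψ) ?_
  · refine ⟨key.1, key.2.trans ?_⟩
    rw [hdiff a haT b ⟨ha.trans hab, hb⟩]
  filter_upwards [hf'.ae] with r hr hr'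
  have hrT : r ∈ Set.Ioo 0 T := ⟨ha.trans_lt hr'.1, hr'.2.trans_le hb⟩
  have hrT' := Set.Ioo_subset_Icc_self hrT
  have hder := hr hrT
  rw [hasDerivAt_iff_tendsto_slope]
  have hq : ∀ᶠ v : ℝ in 𝓝[≠] r, BlockLE P (-η) (L * blockConst d P) (((v - r)⁻¹ : ℂ) • (f v - f r)) := by
    have h2 : ∀ᶠ v in 𝓝[≠] r, v ∈ Set.Icc 0 T :=
      mem_nhdsWithin_of_mem_nhds (Icc_mem_nhds hrT.1 hrT.2)
    filter_upwards [h2, self_mem_nhdsWithin] with v hv hvr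
    have hv0 : 0 < |v - r| := abs_pos.2 (sub_ne_zero.2 hvr)
    refine blockLE_of_norm_le hd P hL hη fun φ => ?_
    rw [_root_.smul_apply, _root_.sub_apply, norm_smul, norm_inv, ← Complex.ofReal_sub,
      Complex.norm_real, Real.norm_eq_abs, inv_mul_le_iff₀ hv0]
    exact (hf r hrT' v hv φ).trans (le_of_eq (by ring))
  have hlim : ∀ φ : 𝓢(Space d, ℂ), Tendsto (fun v : ℝ => (((v - r)⁻¹ : ℂ) • (f v - f r)) φ) (𝓝[≠] r)
      (𝓝 (f' r φ)) := fun φ => by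
    refine (hasDerivAt_iff_tendsto_slope.1 (hder φ)).congr fun v => ?_
    rw [_root_.smul_apply, _root_.sub_apply, slope_def_module, Complex.real_smul, smul_eq_mul]
    push_cast
    rfl
  have hf'B := hf.blockLE_deriv hd P hL hη hrT hder
  have h3 := tendsto_heat hd hτ tendsto_const_nhds (orderOne_besovMul hd h0 h1 hβ hw hf'B)
    (hq.mono fun v hv => orderOne_besovMul hd h0 h1 hβ hw hv)
    (fun α => tendsto_besovMul hd h0 h1 hβ hw hf'B hq (fun α => hlim _) (hermiteFun α)) ψ
  refine h3.congr' ?_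
  have h2 : ∀ᶠ v in 𝓝[≠] r, v ∈ Set.Icc 0 T :=
    mem_nhdsWithin_of_mem_nhds (Icc_mem_nhds hrT.1 hrT.2)
  filter_upwards [hq, h2] with v hv hvT
  rw [heat_besovMul_smul_sub hd h0 h1 hβ hτ ((v - r)⁻¹ : ℂ) hw (hB haT hvT) (hB haT hrT') hv
    (fun φ => by simp only [_root_.smul_apply, _root_.sub_apply, smul_eq_mul]; ring),
    slope_def_module, Complex.real_smul]
  push_cast
  rfl

end LipschitzPaths

/-! ### Riemann sums as integrals of step integrands -/

section LipschitzIntegral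

/-- The dyadic point at the left of `r`. -/
def leftPoint (s t : ℝ) (n : ℕ) (r : ℝ) : ℝ := dyadicPoint s t n ⌊(r - s) * 2 ^ n / (t - s)⌋₊

theorem leftPoint_le {s t r : ℝ} (hst : s < t) (hr : s ≤ r) (n : ℕ) : leftPoint s t n r ≤ r := by
  have hL : 0 < t - s := sub_pos.2 hst
  have h := Nat.floor_le (show 0 ≤ (r - s) * 2 ^ n / (t - s) from
    div_nonneg (mul_nonneg (sub_nonneg.2 hr) (by positivity)) hL.le)
  rw [le_div_iff₀ hL] at h
  have h2 : (⌊(r - s) * 2 ^ n / (t - s)⌋₊ : ℝ) * (t - s) / 2 ^ n ≤ r - s := by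
    rwa [div_le_iff₀ (by positivity)]
  unfold leftPoint dyadicPoint
  linarith

theorem le_leftPoint {s t : ℝ} (hst : s < t) (n : ℕ) (r : ℝ) : s ≤ leftPoint s t n r := by
  have hL : 0 < t - s := sub_pos.2 hst
  unfold leftPoint dyadicPoint
  have : (0 : ℝ) ≤ (⌊(r - s) * 2 ^ n / (t - s)⌋₊ : ℝ) * (t - s) / 2 ^ n := by positivity
  linarith

theorem sub_le_leftPoint {s t : ℝ} (hst : s < t) (n : ℕ) (r : ℝ) :
    r - (t - s) / 2 ^ n ≤ leftPoint s t n r := by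
  have hL : 0 < t - s := sub_pos.2 hst
  have h := (Nat.lt_floor_add_one ((r - s) * 2 ^ n / (t - s))).le
  rw [div_le_iff₀ hL, ← le_div_iff₀ (by positivity)] at h
  have e : ((⌊(r - s) * 2 ^ n / (t - s)⌋₊ : ℝ) + 1) * (t - s) / 2 ^ n =
      (⌊(r - s) * 2 ^ n / (t - s)⌋₊ : ℝ) * (t - s) / 2 ^ n + (t - s) / 2 ^ n := by ring
  rw [e] at h
  unfold leftPoint dyadicPoint
  linarith

theorem tendsto_leftPoint {s t r : ℝ} (hst : s < t) (hr : s ≤ r) :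
    Tendsto (fun n => leftPoint s t n r) atTop (𝓝 r) := by
  refine tendsto_of_tendsto_of_tendsto_of_le_of_le ?_ tendsto_const_nhds
    (fun n => sub_le_leftPoint hst n r) fun n => leftPoint_le hst hr n
  have h : Tendsto (fun n : ℕ => r - (t - s) * (1 / 2 : ℝ) ^ n) atTop (𝓝 (r - (t - s) * 0)) :=
    ((tendsto_pow_atTop_nhds_zero_of_lt_one (by norm_num) (by norm_num)).const_mul _).const_sub r
  rw [mul_zero, sub_zero] at h
  refine h.congr fun n => ?_
  rw [one_div, inv_pow, div_eq_mul_inv]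

theorem leftPoint_eq {s t r : ℝ} (hst : s < t) {n i : ℕ}
    (hr : r ∈ Set.Ico (dyadicPoint s t n i) (dyadicPoint s t n (i + 1))) :
    leftPoint s t n r = dyadicPoint s t n i := by
  have hL : 0 < t - s := sub_pos.2 hst
  have h2 : (0 : ℝ) < 2 ^ n := by positivity
  obtain ⟨a, b⟩ := hr
  unfold dyadicPoint at a b
  have a' : (i : ℝ) * (t - s) / 2 ^ n ≤ r - s := by linarith
  have b' : r - s < ((i + 1 : ℕ) : ℝ) * (t - s) / 2 ^ n := by linarith
  rw [div_le_iff₀ h2, ← le_div_iff₀ hL] at a'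
  rw [lt_div_iff₀ h2, ← div_lt_iff₀ hL] at b'
  rw [leftPoint, (Nat.floor_eq_iff ((Nat.cast_nonneg i).trans a')).2 ⟨a', by exact_mod_cast b'⟩]

variable {P : DyadicPartition} {T lam η γ β F U L : ℝ} {f u f' : ℝ → 𝓢'(Space d, ℂ)}

/-- An `L^∞` bound controls the blocks at any nonpositive regularity, and on a bounded interval a
Lipschitz bound implies every smaller Hölder exponent. The exponent `lam` may thus be chosen at
will. -/
theorem IsLipschitzPath.pathBounds (hd : 1 ≤ d) (hlam0 : 0 ≤ lam) (hlam1 : lam < 1) (hη : 0 ≤ η)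
    (hT : 0 < T) (hγ : 0 < γ) (hL : 0 ≤ L) (hf : IsLipschitzPath T L f)
    (hu : IsHolderPath P β γ T u) :
    PathBounds P T lam η γ β (L * blockConst d P * T ^ lam)
      (2 ^ β * (1 + T ^ γ) * (holderNorm P β γ T u).toReal) f u where
  F_nonneg := by have := blockConst_nonneg d P; positivity
  U_nonneg := by positivity
  f_le r hr v hv := by
    refine (hf.blockLE hd P hL (by linarith) hr hv).mono le_rfl ?_
    have hb := blockConst_nonneg d P
    have h1 : |v - r| ≤ T := by rw [abs_le]; constructor <;> linarith [hr.1, hr.2, hv.1, hv.2]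
    have h2 : |v - r| = |v - r| ^ lam * |v - r| ^ (1 - lam) := by
      rw [← Real.rpow_add_of_nonneg (abs_nonneg _) hlam0 (by linarith), add_sub_cancel,
        Real.rpow_one]
    calc _ = L * blockConst d P * (|v - r| ^ lam * |v - r| ^ (1 - lam)) := by rw [← h2]; ring
      _ ≤ L * blockConst d P * (T ^ lam * |v - r| ^ (1 - lam)) := by gcongr
      _ = _ := by ring
  u_le r hr := hu.blockLE hd hT.le hγ hr
  u_sub r hr v hv := hu.blockLE_sub hT hγ hr hv

/-- The integrand of the integral representing the `n`-th Riemann sum. -/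
def stepIntegrand (P : DyadicPartition) (u f' : ℝ → 𝓢'(Space d, ℂ)) (s t : ℝ) (ψ : 𝓢(Space d, ℂ))
    (n : ℕ) (r : ℝ) : ℂ :=
  heat (t - leftPoint s t n r) (besovMul P (u (leftPoint s t n r)) (f' r)) ψ

/-- On each dyadic interval the left point is constant, so the integral there is that of
`IsLipschitzPath.integral_heat_besovMul`. Right endpoints belong to the next interval, which matters
only on a null set. -/
theorem IsLipschitzPath.integral_stepIntegrand (hd : 1 ≤ d) (h0 : 0 < η) (h1 : η < 1)
    (hβ : η < β) (hL : 0 ≤ L) (hf : IsLipschitzPath T L f) (hf' : IsTimeDerivative T f f')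
    (H : PathBounds P T lam η γ β F U f u) {s t : ℝ} (hs : 0 ≤ s) (hst : s < t) (htT : t ≤ T)
    (ψ : 𝓢(Space d, ℂ)) (n : ℕ) :
    IntervalIntegrable (stepIntegrand P u f' s t ψ n) volume s t ∧
      ∫ r in s..t, stepIntegrand P u f' s t ψ n r = riemannSum P u f s t n ψ := by
  have hL0 : 0 < t - s := sub_pos.2 hst
  have e0 : dyadicPoint s t n 0 = s := by simp [dyadicPoint]
  have e1 : dyadicPoint s t n (2 ^ n) = t := by
    simp only [dyadicPoint]; push_cast; field_simp; ring
  have hle : ∀ i, dyadicPoint s t n i ≤ dyadicPoint s t n (i + 1) := fun i => by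
    unfold dyadicPoint; push_cast; gcongr; linarith
  have key : ∀ i < 2 ^ n, IntervalIntegrable (stepIntegrand P u f' s t ψ n) volume
      (dyadicPoint s t n i) (dyadicPoint s t n (i + 1)) ∧
      ∫ r in (dyadicPoint s t n i)..(dyadicPoint s t n (i + 1)), stepIntegrand P u f' s t ψ n r =
        elem P u f t (dyadicPoint s t n i) (dyadicPoint s t n (i + 1)) ψ := by
    intro i hi
    have hm := dyadicPoint_mem (T := T) hs hst.le htT hi.le
    have hm' := dyadicPoint_mem (T := T) hs hst.le htT (Nat.succ_le_of_lt hi)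
    obtain ⟨a, b⟩ := hf.integral_heat_besovMul hd h0 h1 hβ hL hf' (H.u_le _ hm)
      (sub_pos.2 (dyadicPoint_lt hst hi)) hm.1 (hle i) hm'.2 ψ
    have he : ∀ᵐ r, r ∈ Set.uIoc (dyadicPoint s t n i) (dyadicPoint s t n (i + 1)) →
        heat (t - dyadicPoint s t n i) (besovMul P (u (dyadicPoint s t n i)) (f' r)) ψ =
          stepIntegrand P u f' s t ψ n r := by
      have hb : ∀ᵐ r : ℝ, r ≠ dyadicPoint s t n (i + 1) := by simp [ae_iff, measure_singleton]
      filter_upwards [hb] with r hrb hr'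
      rw [Set.uIoc_of_le (hle i)] at hr'
      rw [stepIntegrand, leftPoint_eq hst ⟨hr'.1.le, lt_of_le_of_ne hr'.2 hrb⟩]
    refine ⟨a.congr_ae ((ae_restrict_iff' measurableSet_uIoc).2 he), ?_⟩
    rw [elem, ← b]
    exact intervalIntegral.integral_congr_ae (he.mono fun r hr h => (hr h).symm)
  have i1 := IntervalIntegrable.trans_iterate fun k hk => (key k hk).1
  have i2 := intervalIntegral.sum_integral_adjacent_intervals fun k hk => (key k hk).1
  rw [e0, e1] at i1 i2
  refine ⟨i1, ?_⟩
  rw [← i2, riemannSum_eq_sum_elem, _root_.sum_apply]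
  exact Finset.sum_congr rfl fun i hi => (key i (Finset.mem_range.1 hi)).2

/-- For a Lipschitz path the mild integral is a Lebesgue integral. -/
theorem IsLipschitzPath.mildIntegral_eq (hd : 1 ≤ d) (h0 : 0 < η) (h1 : η < 1)
    (hβ : η < β) (hL : 0 ≤ L) (hl0 : 0 < lam) (hγ : lam < γ) (hpos : 0 < 2 - η - 2 * lam)
    (hf : IsLipschitzPath T L f) (hf' : IsTimeDerivative T f f')
    (H : PathBounds P T lam η γ β F U f u) {s t : ℝ} (hs : 0 ≤ s) (hst : s < t) (htT : t ≤ T)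
    (ψ : 𝓢(Space d, ℂ)) :
    IntervalIntegrable (fun r => heat (t - r) (besovMul P (u r) (f' r)) ψ) volume s t ∧
      mildIntegral P u f s t ψ = ∫ r in s..t, heat (t - r) (besovMul P (u r) (f' r)) ψ := by
  have hη : -η ≤ 0 := by linarith
  have hstep := hf.integral_stepIntegrand hd h0 h1 hβ hL hf' H hs hst htT ψ
  set D := L * blockConst d P with hD
  set K := elemConst d P η β * (U * D) * (∫ x, ‖ψ x‖) with hK
  have hgood : ∀ᵐ r, r ∈ Set.uIoc s t → r ∈ Set.Ioo s t ∧ BlockLE P (-η) D (f' r) := by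
    have hb : ∀ᵐ r : ℝ, r ≠ t := by simp [ae_iff, measure_singleton]
    filter_upwards [hb, hf'.ae] with r hrt hr hr'
    rw [Set.uIoc_of_le hst.le] at hr'
    have h : r ∈ Set.Ioo s t := ⟨hr'.1, lt_of_le_of_ne hr'.2 hrt⟩
    have hT : r ∈ Set.Ioo 0 T := ⟨hs.trans_lt h.1, h.2.trans_le htT⟩
    exact ⟨h, hf.blockLE_deriv hd P hL hη hT (hr hT)⟩
  have hmem : ∀ n, ∀ r ∈ Set.Ioo s t, leftPoint s t n r ∈ Set.Icc 0 T := fun n r hr =>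
    ⟨hs.trans (le_leftPoint hst n r), ((leftPoint_le hst hr.1.le n).trans hr.2.le).trans htT⟩
  -- The left point precedes `r`, so its distance to `t` is larger than `t - r`, and the singularity
  -- at `r` dominates for all `n` at once.
  have hbound : ∀ n, ∀ᵐ r, r ∈ Set.uIoc s t →
      ‖stepIntegrand P u f' s t ψ n r‖ ≤ |K| * (t - r) ^ (-((1 + η) / 2)) := fun n => by
    filter_upwards [hgood] with r hr hr'
    obtain ⟨hrI, hB⟩ := hr hr'
    have hle := leftPoint_le hst hrI.1.le n
    refine (norm_heat_besovMul_le hd h0 h1 hβ (by linarith [hrI.2]) (H.u_le _ (hmem n r hrI)) hB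
      ψ).trans ?_
    have : (t - leftPoint s t n r) ^ (-((1 + η) / 2)) ≤ (t - r) ^ (-((1 + η) / 2)) :=
      Real.rpow_le_rpow_of_nonpos (by linarith [hrI.2]) (by linarith) (by linarith)
    have ht0 : 0 ≤ (t - leftPoint s t n r) ^ (-((1 + η) / 2)) :=
      Real.rpow_nonneg (by linarith [hrI.2]) _
    calc _ = K * (t - leftPoint s t n r) ^ (-((1 + η) / 2)) := by rw [hK]
      _ ≤ |K| * (t - r) ^ (-((1 + η) / 2)) := by gcongr; exact le_abs_self K
  have hint : IntervalIntegrable (fun r => |K| * (t - r) ^ (-((1 + η) / 2))) volume s t := by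
    have := (intervalIntegral.intervalIntegrable_rpow' (a := t - s) (b := 0)
      (show -1 < -((1 + η) / 2) by linarith)).comp_sub_left t
    rw [sub_sub_cancel, sub_zero] at this
    exact this.const_mul _
  -- The left points converge to `r`; the product converges by the Hölder continuity of `u`, and the
  -- semigroup is jointly continuous since `t - r > 0`.
  have hlim : ∀ᵐ r, r ∈ Set.uIoc s t → Tendsto (fun n => stepIntegrand P u f' s t ψ n r) atTop
      (𝓝 (heat (t - r) (besovMul P (u r) (f' r)) ψ)) := by
    filter_upwards [hgood] with r hr hr'
    obtain ⟨hrI, hB⟩ := hr hr'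
    have hrT : r ∈ Set.Icc 0 T := ⟨hs.trans hrI.1.le, hrI.2.le.trans htT⟩
    have hp := tendsto_leftPoint hst hrI.1.le
    refine tendsto_heat hd (sub_pos.2 hrI.2) (hp.const_sub t)
      (orderOne_besovMul hd h0 h1 hβ (H.u_le r hrT) hB)
      (Eventually.of_forall fun n => orderOne_besovMul hd h0 h1 hβ (H.u_le _ (hmem n r hrI)) hB)
      (fun α => ?_) ψ
    rw [tendsto_iff_norm_sub_tendsto_zero]
    have hγ0 : 0 < γ := hl0.trans hγ
    refine squeeze_zero (fun _ => norm_nonneg _) (fun n => ?_)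
      (g := fun n => prodTestConst η β (hermiteFun α) * (U * |leftPoint s t n r - r| ^ γ * D)) ?_
    · rw [← _root_.sub_apply, ← besovMul_sub_left hd h0 h1 hβ (H.u_le _ (hmem n r hrI))
        (H.u_le r hrT) hB]
      exact norm_besovMul_le_test hd h0 h1 hβ (H.u_sub r hrT _ (hmem n r hrI)) hB _
    · have h2 : Tendsto (fun n => |leftPoint s t n r - r| ^ γ) atTop (𝓝 0) := by
        have h3 := (hp.sub_const r).abs
        rw [sub_self, abs_zero] at h3
        have h4 := h3.rpow_const (p := γ) (Or.inr hγ0.le)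
        rwa [Real.zero_rpow hγ0.ne'] at h4
      simpa using ((h2.const_mul U).mul_const D).const_mul (prodTestConst η β (hermiteFun α))
  have hmeas : ∀ n, AEStronglyMeasurable (stepIntegrand P u f' s t ψ n)
      (volume.restrict (Set.uIoc s t)) := fun n => (intervalIntegrable_iff.1 (hstep n).1).aestronglyMeasurable
  have hconv := intervalIntegral.tendsto_integral_filter_of_dominated_convergence
    (F := stepIntegrand P u f' s t ψ) _ (Eventually.of_forall hmeas)
    (Eventually.of_forall hbound) hint hlim
  have hR := (PointwiseConvergenceCLM.tendsto_iff_forall_tendsto.1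
    (H.tendsto_riemannSum hd hl0 h0 h1 hβ hγ hpos hs hst htT)) ψ
  refine ⟨?_, tendsto_nhds_unique hR (hconv.congr fun n => (hstep n).2)⟩
  rw [intervalIntegrable_iff] at hint ⊢
  refine hint.mono' (aestronglyMeasurable_of_tendsto_ae atTop hmeas
    ((ae_restrict_iff' measurableSet_uIoc).2 hlim)) ((ae_restrict_iff' measurableSet_uIoc).2 ?_)
  filter_upwards [hlim, ae_all_iff.2 hbound] with r h1 h2 hr
  exact le_of_tendsto (h1 hr).norm (Eventually.of_forall fun n => h2 n hr)

end LipschitzIntegral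

end HarmonicYoung

end

/-! ### Proof of the proposition -/

theorem propositionB1 (d : ℕ) (hd : 1 ≤ d) (P : DyadicPartition) (T : ℝ) (hT : 0 < T)
    (lam η γ β : ℝ) (hlam₀ : 0 < lam) (hlam₁ : lam < 1) (hη₀ : 0 < η) (hη₁ : η < 1)
    (hγ : lam < γ) (hβ : η < β) :
    -- convergence of the Riemann sums
    (∀ f u : ℝ → 𝓢'(Space d, ℂ), IsHolderPath P (-η) (1 - lam) T f → IsHolderPath P β γ T u →
      ∀ s t : ℝ, 0 ≤ s → s ≤ t → t ≤ T → ∀ μ : ℝ, 0 ≤ μ → μ < 2 - η - 2 * lam →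
        (∀ n, besovNorm P μ (riemannSum P u f s t n) < ⊤) ∧
        besovNorm P μ (mildIntegral P u f s t) < ⊤ ∧
        Tendsto (fun n => besovNorm P μ (riemannSum P u f s t n - mildIntegral P u f s t))
          atTop (𝓝 0)) ∧
    -- bound on the integral
    (∀ μ : ℝ, 0 ≤ μ → μ < 2 - η - 2 * lam → ∃ ε₀ : ℝ, 0 < ε₀ ∧ ∀ ε : ℝ, 0 < ε → ε < ε₀ →
      ∃ C : ℝ≥0, ∀ f u : ℝ → 𝓢'(Space d, ℂ),
        IsHolderPath P (-η) (1 - lam) T f → IsHolderPath P β γ T u →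
        ∀ s t : ℝ, 0 ≤ s → s < t → t ≤ T →
          besovNorm P μ (mildIntegral P u f s t) ≤
            C * ENNReal.ofReal ((t - s) ^ (1 - (μ + η) / 2 - lam - ε)) *
              holderNorm P β γ T u * holderSeminorm P (-η) (1 - lam) T f) ∧
    -- time regularity of the integral
    (∀ f u : ℝ → 𝓢'(Space d, ℂ), IsHolderPath P (-η) (1 - lam) T f → IsHolderPath P β γ T u →
      ∀ μ κ : ℝ, 0 ≤ μ → μ < 2 - η - 2 * lam → 0 ≤ κ → κ < (1 - η / 2 - lam) - μ / 2 →
        IsHolderPath P μ κ T (fun t => mildIntegral P u f 0 t)) ∧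
    -- agreement with the Lebesgue integral for regular paths
    (∀ u : ℝ → 𝓢'(Space d, ℂ), IsHolderPath P β γ T u →
      ∀ (f : ℝ → Lp ℂ ⊤ (volume : Measure (Space d))) (L : ℝ≥0),
        LipschitzOnWith L f (Set.Icc 0 T) →
        (∃ f' : ℝ → 𝓢'(Space d, ℂ), IsTimeDerivative T (fun r => (f r : 𝓢'(Space d, ℂ))) f') ∧
        (∀ s t : ℝ, 0 ≤ s → s < t → t ≤ T →
          Tendsto (riemannSum P u (fun r => (f r : 𝓢'(Space d, ℂ))) s t) atTop
            (𝓝 (mildIntegral P u (fun r => (f r : 𝓢'(Space d, ℂ))) s t))) ∧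
        ∀ f' : ℝ → 𝓢'(Space d, ℂ),
          IsTimeDerivative T (fun r => (f r : 𝓢'(Space d, ℂ))) f' →
          ∀ s t : ℝ, 0 ≤ s → s < t → t ≤ T → ∀ ψ : 𝓢(Space d, ℂ),
            IntervalIntegrable (fun r => heat (t - r) (besovMul P (u r) (f' r)) ψ) volume s t ∧
            mildIntegral P u (fun r => (f r : 𝓢'(Space d, ℂ))) s t ψ =
              ∫ r in s..t, heat (t - r) (besovMul P (u r) (f' r)) ψ) := by
  refine ⟨fun f u hf hu s t hs hst htT μ hμ0 hμ => riemannSum_mem_and_tendsto hd hT hlam₀ hlam₁ hη₀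
      hη₁ hγ hβ hf hu hs hst htT hμ0 hμ,
    fun μ hμ0 hμ => ⟨1, one_pos, fun ε hε _ => exists_besovNorm_mildIntegral_le d hd P hT hlam₀
      hlam₁ hη₀ hη₁ hγ hβ hμ0 hμ hε⟩,
    fun f u hf hu μ κ hμ0 hμ hκ0 hκ => isHolderPath_mildIntegral hd hT hlam₀ hlam₁ hη₀ hη₁ hγ hβ hf
      hu hμ0 hμ hκ0 hκ,
    fun u hu f L hf => ?_⟩
  -- For Lipschitz paths `2 - η - 2 lam` need not be positive. The exponent is lowered to `min lam
  -- (1/2)`, for which this quantity is at least `1 - η > 0`, and which is still less than `γ`.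
  have hl0 : 0 < min lam (1 / 2) := lt_min hlam₀ (by norm_num)
  have hl2 : min lam (1 / 2) ≤ 1 / 2 := min_le_right _ _
  have hlγ : min lam (1 / 2) < γ := (min_le_left _ _).trans_lt hγ
  have hLip := isLipschitzPath_of_lipschitzOnWith hf
  have H := hLip.pathBounds hd (P := P) hl0.le (by linarith) hη₀.le hT (hlam₀.trans hγ)
    L.coe_nonneg hu
  exact ⟨hLip.exists_isTimeDerivative L.coe_nonneg,
    fun s t hs hst htT => H.tendsto_riemannSum hd hl0 hη₀ hη₁ hβ hlγ (by linarith) hs hst htT,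
    fun f' hf' s t hs hst htT ψ => hLip.mildIntegral_eq hd hη₀ hη₁ hβ L.coe_nonneg hl0 hlγ
      (by linarith) hf' H hs hst htT ψ⟩
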